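/- **Conventions.** $\mathbb K$ is a field of characteristic $0$; $\otimes=\otimes_{\mathbb K}$; graded means $\mathbb Z$-graded; signs follow the Koszul rule. *Dir-inv modules.* A dir-inv structure on a $\mathbb K$-module $M$ is a direct system of submodules $F_jM$, indexed by a nonempty directed partially ordered set, with for each $j$ a decreasing sequence of submodules $F_jM\supseteq F^0F_jM\supseteq F^1F_jM\supseteq\cdots$, such that for $j_1\le j_2$ one has $F_{j_1}M\subseteq F_{j_2}M$ and for each $i$ there is $i'$ with $F^{i'}F_{j_1}M\subseteq F^iF_{j_2}M$. A linear map $\phi:M\to N$ is continuous if for each $j$ there is $k$ with $\phi(F_jM)\subseteq F_kN$ and such that for each $i$ there is $i'$ with $\phi(F^{i'}F_jM)\subseteq F^iF_kN$. The tensor product $M\otimes N$ has $F_{(j,k)}=\operatorname{im}(F_jM\otimes F_kN)$ and $F^iF_{(j,k)}=\operatorname{im}(F_jM\otimes F^iF_kN)+\operatorname{im}(F^iF_jM\otimes F_kN)$. A multilinear map is continuous if the induced linear map on the tensor product is; that is, for all $(j_1,\dots,j_r)$ there is $k$ with $\phi(\prod_l F_{j_l}M_l)\subseteq F_kN$ and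 such that for each $i$ there is $i'$ with $\phi(x_1,\dots,x_r)\in F^iF_kN$ whenever all $x_l\in F_{j_l}M_l$ and at least one $x_l\in F^{i'}F_{j_l}M_l$. A graded dir-inv module $M=\bigoplus_p M^p$ has the direct sum dir-inv structure. The completion is $\widehat M=\varinjlim_j\varprojlim_i F_jM/F^iF_jM$ with the induced dir-inv structure, and $M\hat\otimes N$ is the completion of $M\otimes N$. $M$ is complete if, after replacing its dir-inv structure by an isomorphic one (via the identity of $M$), $M=\bigcup_j F_jM$ and each $F_jM\to\varprojlim_iF_jM/F^iF_jM$ is bijective. DG (super-commutative, or Lie) algebras in the category of dir-inv modules are ones whose underlying graded module is a graded dir-inv module and whose differential and product (bracket) are continuous. Continuous (multi)linear maps on $A\otimes\mathfrak g$ are extended to $A\hat\otimes\mathfrak g$ functorially, so that $A\hat\otimes\mathfrak g$ is a DG Lie algebra and an $A$-module when $A$ is complete. *$\mathrm L_\infty$ morphisms.* For a graded module $M$ let $\mathrm S(M[1])$ be the super-symmetric algebra of $M[1]$, $M[1]^p=M^{p+1}$, with the coproduct that is the algebra homomorphism with $\Delta(x)=x\otimes1+1\otimes x$ for $x\in M[1]$,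 and let $\ln$ be the projection to $\mathrm S^1(M[1])=M$. The Taylor coefficients of a linear map $\Psi$ between such coalgebras are $(\partial^j\Psi)(c)=\ln\Psi(c)$, $c\in\mathrm S^j(M[1])$. A DG Lie algebra $\mathfrak g$ is identified with the degree $1$ coderivation $Q$ of $\mathrm S(\mathfrak g[1])$ with $Q(1)=0$, $Q^2=0$, $\partial^1Q=\mathrm d_{\mathfrak g}$, $(\partial^2Q)(x,y)=(-1)^{p-1}[x,y]$ for $x\in\mathfrak g^p$, and $\partial^jQ=0$ for $j\ge3$. An $\mathrm L_\infty$ morphism $\Psi:\mathfrak g\to\mathfrak g'$ is a degree $0$ coalgebra homomorphism $\Psi:\mathrm S(\mathfrak g[1])\to\mathrm S(\mathfrak g'[1])$ with $\Psi(1)=1$ and $\Psi Q=Q'\Psi$. It is continuous if all $\partial^j\Psi$, $j\ge1$, are continuous, and, for DG $A$-module Lie algebras, $A$-multilinear if $(\partial^j\Psi)(a_1x_1,\dots,a_jx_j)=\pm a_1\cdots a_j(\partial^j\Psi)(x_1,\dots,x_j)$ for homogeneous $a_l\in A$ and $x_l$. The Maurer–Cartan (MC) equation is $\mathrm d\omega+\frac12[\omega,\omega]=0$;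 for a solution $\omega$ of degree $1$, $\mathfrak g_\omega$ is $\mathfrak g$ with the same bracket and the differential $\mathrm d+[\omega,-]$. **Theorem.** Let $\mathfrak g$ and $\mathfrak g'$ be DG Lie algebras in the category of dir-inv $\mathbb K$-modules, and let $\Psi:\mathfrak g\to\mathfrak g'$ be a continuous $\mathrm L_\infty$ morphism. Let $A=\bigoplus_{i\ge0}A^i$ be a complete associative unital super-commutative DG algebra in the category of dir-inv $\mathbb K$-modules. Assume that $\mathrm d_{\mathfrak g}=0$ and that $\mathfrak g'$ is bounded below. Then the degree $0$ coalgebra homomorphism $\Psi_A:\mathrm S((A\hat\otimes\mathfrak g)[1])\to\mathrm S((A\hat\otimes\mathfrak g')[1])$ with $\Psi_A(1)=1$, whose Taylor coefficients $\partial^j\Psi_A$ are the continuous $A$-multilinear extensions of the $\partial^j\Psi$, is a continuous $A$-multilinear $\mathrm L_\infty$ morphism $A\hat\otimes\mathfrak g\to A\hat\otimes\mathfrak g'$. Let $\omega\in A^1\hat\otimes\mathfrak g^0$ be a solution of the MC equation in $A\hat\otimes\mathfrak g$ with $(\partial^j\Psi_A)(\omega^j)=0$ for all $j\ge2$, and put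 $\omega'=(\partial^1\Psi_A)(\omega)$. Then: 1. $\omega'\in A^1\hat\otimes\mathfrak g'^0$, and $\omega'$ is a solution of the MC equation in $A\hat\otimes\mathfrak g'$. 2. For every $j\ge0$ and every $c\in\mathrm S^j((A\hat\otimes\mathfrak g)[1])$ there is a natural number $k_0$ such that $(\partial^{j+k}\Psi_A)(\omega^kc)=0$ for all $k>k_0$. 3. There is a degree $0$ coalgebra homomorphism $\Psi_{A,\omega}:\mathrm S((A\hat\otimes\mathfrak g)[1])\to\mathrm S((A\hat\otimes\mathfrak g')[1])$ with $\Psi_{A,\omega}(1)=1$ and with Taylor coefficients $$(\partial^j\Psi_{A,\omega})(c)=\sum_{k\ge0}\frac1{k!}(\partial^{j+k}\Psi_A)(\omega^kc),\qquad j\ge1,\ c\in\mathrm S^j((A\hat\otimes\mathfrak g)[1]),$$ and it is a continuous $A$-multilinear $\mathrm L_\infty$ morphism $(A\hat\otimes\mathfrak g)_\omega\to(A\hat\otimes\mathfrak g')_{\omega'}$. -/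

import Mathlib

open scoped TensorProduct

universe w w' w'' u

/-- A dir-inv structure on a `K`-module `M`: a direct system `F j` of submodules indexed by a
nonempty directed partially ordered set, together with a decreasing sequence `Fi j 0 ≥ Fi j 1 ≥ …`
of submodules of each `F j`, such that all the inclusions `F j₁ ≤ F j₂` are continuous. -/
structure DirInv (K : Type*) (M : Type*) [CommRing K] [AddCommGroup M] [Module K M] where
  J : Type w
  [po : PartialOrder J]
  [ne : Nonempty J]
  directed : ∀ a b : J, ∃ c, a ≤ c ∧ b ≤ c
  F : J → Submodule K M
  Fi : J → ℕ → Submodule K M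
  F_mono : ∀ ⦃j₁ j₂ : J⦄, j₁ ≤ j₂ → F j₁ ≤ F j₂
  Fi_le : ∀ j i, Fi j i ≤ F j
  Fi_anti : ∀ j ⦃i₁ i₂ : ℕ⦄, i₁ ≤ i₂ → Fi j i₂ ≤ Fi j i₁
  compat : ∀ ⦃j₁ j₂ : J⦄, j₁ ≤ j₂ → ∀ i, ∃ i', Fi j₁ i' ≤ Fi j₂ i

namespace DirInv

attribute [instance] DirInv.po DirInv.ne

variable {K : Type*} [CommRing K] {M N P : Type*} [AddCommGroup M] [Module K M]
  [AddCommGroup N] [Module K N] [AddCommGroup P] [Module K P]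

/-- Continuity of a linear map between dir-inv modules. -/
def Cont (D : DirInv.{w} K M) (E : DirInv.{w'} K N) (f : M →ₗ[K] N) : Prop :=
  ∀ j, ∃ k, (∀ x ∈ D.F j, f x ∈ E.F k) ∧ ∀ i, ∃ i', ∀ x ∈ D.Fi j i', f x ∈ E.Fi k i

/-- Continuity of a bilinear map, i.e. continuity of the induced linear map on the tensor product
with its dir-inv structure. -/
def BCont (D : DirInv.{w} K M) (E : DirInv.{w'} K N) (G : DirInv.{w''} K P)
    (φ : M →ₗ[K] N →ₗ[K] P) : Prop :=
  ∀ j k, ∃ l, (∀ x ∈ D.F j, ∀ y ∈ E.F k, φ x y ∈ G.F l) ∧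
    ∀ i, ∃ i', ∀ x ∈ D.F j, ∀ y ∈ E.F k, (x ∈ D.Fi j i' ∨ y ∈ E.Fi k i') → φ x y ∈ G.Fi l i

/-- Continuity of a multilinear map, i.e. continuity of the induced linear map on the tensor power
with its dir-inv structure. -/
def MCont (D : DirInv.{w} K M) (E : DirInv.{w'} K N) {r : ℕ}
    (φ : MultilinearMap K (fun _ : Fin r => M) N) : Prop :=
  ∀ j : Fin r → D.J, ∃ k, (∀ x : Fin r → M, (∀ l, x l ∈ D.F (j l)) → φ x ∈ E.F k) ∧
    ∀ i, ∃ i', ∀ x : Fin r → M, (∀ l, x l ∈ D.F (j l)) → (∃ l, x l ∈ D.Fi (j l) i') →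
      φ x ∈ E.Fi k i

/-- The dir-inv module is complete: the identity of `M` is an isomorphism between `D` and a dir-inv
structure `E` on `M` such that `M` is the union of the `E.F j` and, for every `j`, the canonical
homomorphism from `E.F j` to the inverse limit of the quotients `E.F j / E.Fi j i` is injective
and surjective. -/
def IsComplete (D : DirInv.{w} K M) : Prop :=
  ∃ E : DirInv.{w'} K M, D.Cont E LinearMap.id ∧ E.Cont D LinearMap.id ∧
    (∀ x, ∃ j, x ∈ E.F j) ∧
    (∀ j, ∀ x ∈ E.F j, (∀ i, x ∈ E.Fi j i) → x = 0) ∧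
    (∀ j, ∀ c : ℕ → M, (∀ i, c i ∈ E.F j) → (∀ i, c (i + 1) - c i ∈ E.Fi j i) →
      ∃ x ∈ E.F j, ∀ i, x - c i ∈ E.Fi j i)

/-- The dir-inv structure on the tensor product. -/
def tensor (D : DirInv.{w} K M) (E : DirInv.{w'} K N) : DirInv.{max w w'} K (M ⊗[K] N) where
  J := D.J × E.J
  po := inferInstance
  directed a b := by
    obtain ⟨c, hc⟩ := D.directed a.1 b.1
    obtain ⟨d, hd⟩ := E.directed a.2 b.2
    exact ⟨(c, d), ⟨hc.1, hd.1⟩, ⟨hc.2, hd.2⟩⟩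
  F jk := Submodule.map₂ (TensorProduct.mk K M N) (D.F jk.1) (E.F jk.2)
  Fi jk i := Submodule.map₂ (TensorProduct.mk K M N) (D.F jk.1) (E.Fi jk.2 i) ⊔
    Submodule.map₂ (TensorProduct.mk K M N) (D.Fi jk.1 i) (E.F jk.2)
  F_mono _ _ h := Submodule.map₂_le_map₂ (D.F_mono h.1) (E.F_mono h.2)
  Fi_le jk i := sup_le (Submodule.map₂_le_map₂_right (E.Fi_le _ _))
    (Submodule.map₂_le_map₂_left (D.Fi_le _ _))
  Fi_anti jk _ _ h := sup_le_sup (Submodule.map₂_le_map₂_right (E.Fi_anti _ h))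
    (Submodule.map₂_le_map₂_left (D.Fi_anti _ h))
  compat a b h i := by
    obtain ⟨i₁, h₁⟩ := D.compat h.1 i
    obtain ⟨i₂, h₂⟩ := E.compat h.2 i
    refine ⟨max i₁ i₂, sup_le_sup (Submodule.map₂_le_map₂ (D.F_mono h.1) ?_)
      (Submodule.map₂_le_map₂ ?_ (E.F_mono h.2))⟩
    · exact (E.Fi_anti _ (le_max_right _ _)).trans h₂
    · exact (D.Fi_anti _ (le_max_left _ _)).trans h₁

/-! ### Completion

The completion `lim_j lim_i (F j / Fi j i)` (direct limit over `j` of the inverse limits over `i`)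
is realized as Cauchy sequences modulo null sequences. -/

/-- `c` is a Cauchy sequence in the inv module `F j`. -/
def IsCauchyIn (D : DirInv.{w} K M) (j : D.J) (c : ℕ → M) : Prop :=
  (∀ n, c n ∈ D.F j) ∧ ∀ i, ∃ n₀, ∀ m ≥ n₀, ∀ n ≥ n₀, c m - c n ∈ D.Fi j i

/-- `c` is a sequence in the inv module `F j` which converges to zero. -/
def IsNullIn (D : DirInv.{w} K M) (j : D.J) (c : ℕ → M) : Prop :=
  (∀ n, c n ∈ D.F j) ∧ ∀ i, ∃ n₀, ∀ n ≥ n₀, c n ∈ D.Fi j i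

section
variable {D : DirInv.{w} K M}

lemma IsCauchyIn.mono {j j' : D.J} (h : j ≤ j') {c : ℕ → M} (hc : D.IsCauchyIn j c) :
    D.IsCauchyIn j' c := by
  refine ⟨fun n => D.F_mono h (hc.1 n), fun i => ?_⟩
  obtain ⟨i', hi'⟩ := D.compat h i
  obtain ⟨n₀, h₀⟩ := hc.2 i'
  exact ⟨n₀, fun m hm n hn => hi' (h₀ m hm n hn)⟩

lemma IsNullIn.mono {j j' : D.J} (h : j ≤ j') {c : ℕ → M} (hc : D.IsNullIn j c) :
    D.IsNullIn j' c := by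
  refine ⟨fun n => D.F_mono h (hc.1 n), fun i => ?_⟩
  obtain ⟨i', hi'⟩ := D.compat h i
  obtain ⟨n₀, h₀⟩ := hc.2 i'
  exact ⟨n₀, fun n hn => hi' (h₀ n hn)⟩

lemma IsCauchyIn.add {j : D.J} {c c' : ℕ → M} (hc : D.IsCauchyIn j c) (hc' : D.IsCauchyIn j c') :
    D.IsCauchyIn j (c + c') := by
  refine ⟨fun n => add_mem (hc.1 n) (hc'.1 n), fun i => ?_⟩
  obtain ⟨n₀, h₀⟩ := hc.2 i
  obtain ⟨n₁, h₁⟩ := hc'.2 i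
  refine ⟨max n₀ n₁, fun m hm n hn => ?_⟩
  simp only [ge_iff_le, max_le_iff] at hm hn
  have := add_mem (h₀ m hm.1 n hn.1) (h₁ m hm.2 n hn.2)
  simpa [add_sub_add_comm] using this

lemma IsNullIn.add {j : D.J} {c c' : ℕ → M} (hc : D.IsNullIn j c) (hc' : D.IsNullIn j c') :
    D.IsNullIn j (c + c') := by
  refine ⟨fun n => add_mem (hc.1 n) (hc'.1 n), fun i => ?_⟩
  obtain ⟨n₀, h₀⟩ := hc.2 i
  obtain ⟨n₁, h₁⟩ := hc'.2 i
  refine ⟨max n₀ n₁, fun n hn => ?_⟩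
  simp only [ge_iff_le, max_le_iff] at hn
  exact add_mem (h₀ n hn.1) (h₁ n hn.2)

lemma IsCauchyIn.smul {j : D.J} {c : ℕ → M} (a : K) (hc : D.IsCauchyIn j c) :
    D.IsCauchyIn j (a • c) := by
  refine ⟨fun n => Submodule.smul_mem _ _ (hc.1 n), fun i => ?_⟩
  obtain ⟨n₀, h₀⟩ := hc.2 i
  refine ⟨n₀, fun m hm n hn => ?_⟩
  simpa [smul_sub] using Submodule.smul_mem _ a (h₀ m hm n hn)

lemma IsNullIn.smul {j : D.J} {c : ℕ → M} (a : K) (hc : D.IsNullIn j c) :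
    D.IsNullIn j (a • c) := by
  refine ⟨fun n => Submodule.smul_mem _ _ (hc.1 n), fun i => ?_⟩
  obtain ⟨n₀, h₀⟩ := hc.2 i
  exact ⟨n₀, fun n hn => Submodule.smul_mem _ a (h₀ n hn)⟩

end

/-- The sequences which are Cauchy in some `F j`. -/
def cauchySeq (D : DirInv.{w} K M) : Submodule K (ℕ → M) where
  carrier := {c | ∃ j, D.IsCauchyIn j c}
  add_mem' := by
    rintro c c' ⟨j, hj⟩ ⟨j', hj'⟩
    obtain ⟨k, hk, hk'⟩ := D.directed j j'
    exact ⟨k, (hj.mono hk).add (hj'.mono hk')⟩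
  zero_mem' := ⟨Classical.arbitrary _, fun _ => zero_mem _, fun _ => ⟨0, fun _ _ _ _ => by simp⟩⟩
  smul_mem' := by
    rintro a c ⟨j, hj⟩
    exact ⟨j, hj.smul a⟩

/-- The sequences which converge to zero in some `F j`. -/
def nullSeq (D : DirInv.{w} K M) : Submodule K (ℕ → M) where
  carrier := {c | ∃ j, D.IsNullIn j c}
  add_mem' := by
    rintro c c' ⟨j, hj⟩ ⟨j', hj'⟩
    obtain ⟨k, hk, hk'⟩ := D.directed j j'
    exact ⟨k, (hj.mono hk).add (hj'.mono hk')⟩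
  zero_mem' := ⟨Classical.arbitrary _, fun _ => zero_mem _, fun _ => ⟨0, fun _ _ => by simp⟩⟩
  smul_mem' := by
    rintro a c ⟨j, hj⟩
    exact ⟨j, hj.smul a⟩

/-- The completion of a dir-inv module. -/
def Completion (D : DirInv.{w} K M) : Type _ :=
  D.cauchySeq ⧸ D.nullSeq.comap D.cauchySeq.subtype

noncomputable instance (D : DirInv.{w} K M) : AddCommGroup D.Completion :=
  inferInstanceAs (AddCommGroup (D.cauchySeq ⧸ D.nullSeq.comap D.cauchySeq.subtype))

noncomputable instance (D : DirInv.{w} K M) : Module K D.Completion :=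
  inferInstanceAs (Module K (D.cauchySeq ⧸ D.nullSeq.comap D.cauchySeq.subtype))

/-- The class of a Cauchy sequence in the completion. -/
def mkC (D : DirInv.{w} K M) : D.cauchySeq →ₗ[K] D.Completion :=
  (D.nullSeq.comap D.cauchySeq.subtype).mkQ

lemma mkC_surj (D : DirInv.{w} K M) : Function.Surjective D.mkC := Submodule.mkQ_surjective _

lemma mkC_eq (D : DirInv.{w} K M) {c c' : D.cauchySeq} :
    D.mkC c = D.mkC c' ↔ ∃ j, D.IsNullIn j (c.1 - c'.1) := by
  change Submodule.Quotient.mk _ = Submodule.Quotient.mk _ ↔ _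
  rw [Submodule.Quotient.eq]
  rfl

/-- The dir-inv structure on the completion: `F j` is the image of the completion of the inv module
`F j`, and `Fi j i` is the image of the kernel of the homomorphism from the completion of `F j`
to `F j / Fi j i`. -/
noncomputable def completion (D : DirInv.{w} K M) : DirInv.{w} K D.Completion where
  J := D.J
  directed := D.directed
  F j := Submodule.map D.mkC
    { carrier := {c | D.IsCauchyIn j c.1}
      add_mem' := fun h h' => h.add h'
      zero_mem' := ⟨fun _ => zero_mem _, fun _ => ⟨0, fun _ _ _ _ => by simp⟩⟩
      smul_mem' := fun a _ h => h.smul a }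
  Fi j i := Submodule.map D.mkC
    { carrier := {c | D.IsCauchyIn j c.1 ∧ ∃ n₀, ∀ n ≥ n₀, c.1 n ∈ D.Fi j i}
      add_mem' := by
        rintro c c' ⟨h, n, hn⟩ ⟨h', n', hn'⟩
        refine ⟨h.add h', max n n', fun m hm => ?_⟩
        simp only [ge_iff_le, max_le_iff] at hm
        exact add_mem (hn m hm.1) (hn' m hm.2)
      zero_mem' := ⟨⟨fun _ => zero_mem _, fun _ => ⟨0, fun _ _ _ _ => by simp⟩⟩,
        0, fun _ _ => zero_mem _⟩
      smul_mem' := fun a _ h => ⟨h.1.smul a, h.2.imp fun _ hn m hm =>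
        Submodule.smul_mem _ a (hn m hm)⟩ }
  F_mono j₁ j₂ h := Submodule.map_mono fun c hc => IsCauchyIn.mono h hc
  Fi_le j i := Submodule.map_mono fun c hc => hc.1
  Fi_anti j i₁ i₂ h := Submodule.map_mono fun c hc =>
    ⟨hc.1, hc.2.imp fun _ hn m hm => D.Fi_anti j h (hn m hm)⟩
  compat j₁ j₂ h i := by
    obtain ⟨i', hi'⟩ := D.compat h i
    exact ⟨i', Submodule.map_mono fun c hc =>
      ⟨hc.1.mono h, hc.2.imp fun _ hn m hm => hi' (hn m hm)⟩⟩

/-! ### Completion of continuous (multi)linear maps -/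

lemma Cont.cauchy {D : DirInv.{w} K M} {E : DirInv.{w'} K N} {f : M →ₗ[K] N} (hf : D.Cont E f)
    (c : D.cauchySeq) : (fun n => f (c.1 n)) ∈ E.cauchySeq := by
  obtain ⟨c, j, hc⟩ := c
  obtain ⟨k, h₁, h₂⟩ := hf j
  refine ⟨k, fun n => h₁ _ (hc.1 n), fun i => ?_⟩
  obtain ⟨i', hi'⟩ := h₂ i
  obtain ⟨n₀, h₀⟩ := hc.2 i'
  refine ⟨n₀, fun m hm n hn => ?_⟩
  rw [← map_sub]
  exact hi' _ (h₀ m hm n hn)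

/-- The continuous linear map induced on completions. -/
noncomputable def cmap {D : DirInv.{w} K M} {E : DirInv.{w'} K N} (f : M →ₗ[K] N)
    (hf : D.Cont E f) : D.Completion →ₗ[K] E.Completion :=
  Submodule.mapQ _ _
    { toFun := fun c => (⟨fun n => f (c.1 n), hf.cauchy c⟩ : E.cauchySeq)
      map_add' := fun c c' => by ext n; simp
      map_smul' := fun a c => by ext n; simp }
    (by
      rintro ⟨c, hc'⟩ ⟨j, hc⟩
      obtain ⟨k, h₁, h₂⟩ := hf j
      refine ⟨k, fun n => h₁ _ (hc.1 n), fun i => ?_⟩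
      obtain ⟨i', hi'⟩ := h₂ i
      obtain ⟨n₀, h₀⟩ := hc.2 i'
      exact ⟨n₀, fun n hn => hi' _ (h₀ n hn)⟩)

lemma cmap_mkC {D : DirInv.{w} K M} {E : DirInv.{w'} K N} (f : M →ₗ[K] N)
    (hf : D.Cont E f) (c : D.cauchySeq) :
    cmap f hf (D.mkC c) = E.mkC ⟨fun n => f (c.1 n), hf.cauchy c⟩ := rfl

lemma MCont.sub_mem {D : DirInv.{w} K M} {E : DirInv.{w'} K N} {r : ℕ}
    {φ : MultilinearMap K (fun _ : Fin r => M) N} {j : Fin r → D.J} {k : E.J} {i i' : ℕ}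
    (h : ∀ x : Fin r → M, (∀ l, x l ∈ D.F (j l)) → (∃ l, x l ∈ D.Fi (j l) i') → φ x ∈ E.Fi k i)
    {x y : Fin r → M} (hx : ∀ l, x l ∈ D.F (j l)) (hy : ∀ l, y l ∈ D.F (j l))
    (hxy : ∀ l, x l - y l ∈ D.Fi (j l) i') : φ x - φ y ∈ E.Fi k i := by
  classical
  suffices H : ∀ s : Finset (Fin r), φ (s.piecewise x y) - φ y ∈ E.Fi k i by
    simpa using H Finset.univ
  intro s
  induction s using Finset.induction_on with
  | empty => simp
  | insert l s hl ih =>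
    have e : φ ((insert l s).piecewise x y) =
        φ (Function.update (s.piecewise x y) l (x l - y l)) + φ (s.piecewise x y) := by
      rw [Finset.piecewise_insert, MultilinearMap.map_update_sub]
      have : Function.update (s.piecewise x y) l (y l) = s.piecewise x y := by
        conv_rhs => rw [← Function.update_eq_self l (s.piecewise x y)]
        simp [hl]
      rw [this]; abel
    rw [e, add_sub_assoc]
    refine add_mem (h _ (fun l' => ?_) ⟨l, by simpa using hxy l⟩) ih
    by_cases hl' : l' = l
    · subst hl'; simpa using D.Fi_le _ _ (hxy l')
    · rw [Function.update_of_ne hl']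
      by_cases hs : l' ∈ s <;> simp [hs, hx, hy]

lemma MCont.cauchy {D : DirInv.{w} K M} {E : DirInv.{w'} K N} {r : ℕ}
    {φ : MultilinearMap K (fun _ : Fin r => M) N} (hφ : D.MCont E φ)
    (c : Fin r → D.cauchySeq) : (fun n => φ (fun l => (c l).1 n)) ∈ E.cauchySeq := by
  choose j hj using fun l => (c l).2
  obtain ⟨k, h₁, h₂⟩ := hφ j
  refine ⟨k, fun n => h₁ _ fun l => (hj l).1 n, fun i => ?_⟩
  obtain ⟨i', hi'⟩ := h₂ i
  choose n₀ h₀ using fun l => (hj l).2 i'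
  refine ⟨Finset.univ.sup n₀, fun m hm n hn => ?_⟩
  refine MCont.sub_mem hi' (fun l => (hj l).1 m) (fun l => (hj l).1 n) fun l => ?_
  exact h₀ l m ((Finset.le_sup (Finset.mem_univ l)).trans hm) n
    ((Finset.le_sup (Finset.mem_univ l)).trans hn)

lemma MCont.congr {D : DirInv.{w} K M} {E : DirInv.{w'} K N} {r : ℕ}
    {φ : MultilinearMap K (fun _ : Fin r => M) N} (hφ : D.MCont E φ)
    {c c' : Fin r → D.cauchySeq} (h : ∀ l, D.mkC (c l) = D.mkC (c' l)) :
    E.mkC ⟨_, hφ.cauchy c⟩ = E.mkC ⟨_, hφ.cauchy c'⟩ := by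
  simp only [mkC_eq] at h ⊢
  choose j₁ h₁ using fun l => (c l).2
  choose j₂ h₂ using fun l => (c' l).2
  choose j₃ h₃ using h
  have : ∀ l, ∃ j, j₁ l ≤ j ∧ j₂ l ≤ j ∧ j₃ l ≤ j := fun l => by
    obtain ⟨a, ha, ha'⟩ := D.directed (j₁ l) (j₂ l)
    obtain ⟨b, hb, hb'⟩ := D.directed a (j₃ l)
    exact ⟨b, ha.trans hb, ha'.trans hb, hb'⟩
  choose j hj using this
  replace h₁ := fun l => (h₁ l).mono (hj l).1
  replace h₂ := fun l => (h₂ l).mono (hj l).2.1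
  replace h₃ := fun l => (h₃ l).mono (hj l).2.2
  obtain ⟨k, hk₁, hk₂⟩ := hφ j
  refine ⟨k, fun n => Submodule.sub_mem _ (hk₁ _ fun l => (h₁ l).1 n) (hk₁ _ fun l => (h₂ l).1 n),
    fun i => ?_⟩
  obtain ⟨i', hi'⟩ := hk₂ i
  choose n₀ h₀ using fun l => (h₃ l).2 i'
  refine ⟨Finset.univ.sup n₀, fun n hn => ?_⟩
  exact MCont.sub_mem hi' (fun l => (h₁ l).1 n) (fun l => (h₂ l).1 n)
    fun l => h₀ l n ((Finset.le_sup (Finset.mem_univ l)).trans hn)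

/-- The continuous multilinear map induced on completions: it is computed termwise on Cauchy
sequences, see `cmulti_mkC`. -/
noncomputable def cmulti {D : DirInv.{w} K M} {E : DirInv.{w'} K N} {r : ℕ}
    (φ : MultilinearMap K (fun _ : Fin r => M) N) (hφ : D.MCont E φ) :
    MultilinearMap K (fun _ : Fin r => D.Completion) E.Completion where
  toFun x := E.mkC ⟨_, hφ.cauchy fun l => Function.surjInv D.mkC_surj (x l)⟩
  map_update_add' {inst} x l a b := by
    have hi : inst = instDecidableEqFin r := Subsingleton.elim _ _
    subst hi
    set s := Function.surjInv D.mkC_surj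
    have hs : ∀ x, D.mkC (s x) = x := Function.surjInv_eq D.mkC_surj
    have key : ∀ (z : D.Completion) (d : D.cauchySeq), D.mkC d = z →
        E.mkC ⟨_, hφ.cauchy fun l' => s (Function.update x l z l')⟩ =
        E.mkC ⟨_, hφ.cauchy (Function.update (fun l' => s (x l')) l d)⟩ := by
      intro z d hz
      refine hφ.congr fun l' => ?_
      rw [hs]
      by_cases h : l' = l
      · subst h; simpa using hz.symm
      · simp [h, hs]
    rw [key _ (s a + s b) (by rw [map_add, hs, hs]), key _ (s a) (hs a), key _ (s b) (hs b),
      ← map_add]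
    congr 1
    ext n
    have e : ∀ d : D.cauchySeq, (fun l' => (Function.update (fun l' => s (x l')) l d l').1 n) =
        Function.update (fun l' => (s (x l')).1 n) l (d.1 n) := fun d => by
      ext l'
      by_cases h : l' = l
      · subst h; simp
      · simp [h]
    simp only [e, Submodule.coe_add, Pi.add_apply, MultilinearMap.map_update_add]
  map_update_smul' {inst} x l a b := by
    have hi : inst = instDecidableEqFin r := Subsingleton.elim _ _
    subst hi
    set s := Function.surjInv D.mkC_surj
    have hs : ∀ x, D.mkC (s x) = x := Function.surjInv_eq D.mkC_surj
    have key : ∀ (z : D.Completion) (d : D.cauchySeq), D.mkC d = z →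
        E.mkC ⟨_, hφ.cauchy fun l' => s (Function.update x l z l')⟩ =
        E.mkC ⟨_, hφ.cauchy (Function.update (fun l' => s (x l')) l d)⟩ := by
      intro z d hz
      refine hφ.congr fun l' => ?_
      rw [hs]
      by_cases h : l' = l
      · subst h; simpa using hz.symm
      · simp [h, hs]
    rw [key _ (a • s b) (by rw [map_smul, hs]), key _ (s b) (hs b), ← map_smul]
    congr 1
    ext n
    have e : ∀ d : D.cauchySeq, (fun l' => (Function.update (fun l' => s (x l')) l d l').1 n) =
        Function.update (fun l' => (s (x l')).1 n) l (d.1 n) := fun d => by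
      ext l'
      by_cases h : l' = l
      · subst h; simp
      · simp [h]
    simp only [e, Submodule.coe_smul, Pi.smul_apply, MultilinearMap.map_update_smul]

lemma cmulti_mkC {D : DirInv.{w} K M} {E : DirInv.{w'} K N} {r : ℕ}
    (φ : MultilinearMap K (fun _ : Fin r => M) N) (hφ : D.MCont E φ) (c : Fin r → D.cauchySeq) :
    cmulti φ hφ (fun l => D.mkC (c l)) = E.mkC ⟨_, hφ.cauchy c⟩ :=
  hφ.congr fun _ => Function.surjInv_eq D.mkC_surj _

lemma BCont.cauchy {D : DirInv.{w} K M} {E : DirInv.{w'} K N} {G : DirInv.{w''} K P}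
    {φ : M →ₗ[K] N →ₗ[K] P} (hφ : D.BCont E G φ) (c : D.cauchySeq) (c' : E.cauchySeq) :
    (fun n => φ (c.1 n) (c'.1 n)) ∈ G.cauchySeq := by
  obtain ⟨c, j, hc⟩ := c
  obtain ⟨c', j', hc'⟩ := c'
  obtain ⟨k, h₁, h₂⟩ := hφ j j'
  refine ⟨k, fun n => h₁ _ (hc.1 n) _ (hc'.1 n), fun i => ?_⟩
  obtain ⟨i', hi'⟩ := h₂ i
  obtain ⟨n₀, h₀⟩ := hc.2 i'
  obtain ⟨n₁, h₁'⟩ := hc'.2 i'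
  refine ⟨max n₀ n₁, fun m hm n hn => ?_⟩
  simp only [ge_iff_le, max_le_iff] at hm hn
  have e : φ (c m) (c' m) - φ (c n) (c' n) = φ (c m - c n) (c' m) + φ (c n) (c' m - c' n) := by
    simp
  change φ (c m) (c' m) - φ (c n) (c' n) ∈ _
  rw [e]
  exact add_mem
    (hi' _ (Submodule.sub_mem _ (hc.1 m) (hc.1 n)) _ (hc'.1 m) (Or.inl (h₀ m hm.1 n hn.1)))
    (hi' _ (hc.1 n) _ (Submodule.sub_mem _ (hc'.1 m) (hc'.1 n)) (Or.inr (h₁' m hm.2 n hn.2)))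

lemma BCont.null {D : DirInv.{w} K M} {E : DirInv.{w'} K N} {G : DirInv.{w''} K P}
    {φ : M →ₗ[K] N →ₗ[K] P} (hφ : D.BCont E G φ) (c : D.cauchySeq) (c' : E.cauchySeq)
    (h : (∃ j, D.IsNullIn j c.1) ∨ ∃ j, E.IsNullIn j c'.1) :
    ∃ k, G.IsNullIn k (fun n => φ (c.1 n) (c'.1 n)) := by
  rcases h with ⟨j, h⟩ | ⟨j', h⟩
  · obtain ⟨c', j', hc'⟩ := c'
    obtain ⟨k, h₁, h₂⟩ := hφ j j'
    refine ⟨k, fun n => h₁ _ (h.1 n) _ (hc'.1 n), fun i => ?_⟩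
    obtain ⟨i', hi'⟩ := h₂ i
    obtain ⟨n₀, h₀⟩ := h.2 i'
    exact ⟨n₀, fun n hn => hi' _ (h.1 n) _ (hc'.1 n) (Or.inl (h₀ n hn))⟩
  · obtain ⟨c, j, hc⟩ := c
    obtain ⟨k, h₁, h₂⟩ := hφ j j'
    refine ⟨k, fun n => h₁ _ (hc.1 n) _ (h.1 n), fun i => ?_⟩
    obtain ⟨i', hi'⟩ := h₂ i
    obtain ⟨n₀, h₀⟩ := h.2 i'
    exact ⟨n₀, fun n hn => hi' _ (hc.1 n) _ (h.1 n) (Or.inr (h₀ n hn))⟩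

lemma mkC_eq_zero (D : DirInv.{w} K M) (c : D.cauchySeq) :
    D.mkC c = 0 ↔ ∃ j, D.IsNullIn j c.1 :=
  Submodule.Quotient.mk_eq_zero _

/-- Auxiliary construction for `cbil`. -/
noncomputable def cbilAux {D : DirInv.{w} K M} {E : DirInv.{w'} K N} {G : DirInv.{w''} K P}
    (φ : M →ₗ[K] N →ₗ[K] P) (hφ : D.BCont E G φ) (c : D.cauchySeq) :
    E.Completion →ₗ[K] G.Completion :=
  Submodule.liftQ _
    (G.mkC ∘ₗ
      { toFun := fun c' => (⟨_, hφ.cauchy c c'⟩ : G.cauchySeq)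
        map_add' := fun a b => by ext n; simp
        map_smul' := fun a b => by ext n; simp })
    (fun c' hc' => (G.mkC_eq_zero _).2 (hφ.null c c' (Or.inr hc')))

lemma cbilAux_mkC {D : DirInv.{w} K M} {E : DirInv.{w'} K N} {G : DirInv.{w''} K P}
    (φ : M →ₗ[K] N →ₗ[K] P) (hφ : D.BCont E G φ) (c : D.cauchySeq) (c' : E.cauchySeq) :
    cbilAux φ hφ c (E.mkC c') = G.mkC ⟨_, hφ.cauchy c c'⟩ := rfl

/-- The continuous bilinear map induced on completions: it is computed termwise on Cauchy
sequences, see `cbil_mkC`. -/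
noncomputable def cbil {D : DirInv.{w} K M} {E : DirInv.{w'} K N} {G : DirInv.{w''} K P}
    (φ : M →ₗ[K] N →ₗ[K] P) (hφ : D.BCont E G φ) :
    D.Completion →ₗ[K] E.Completion →ₗ[K] G.Completion :=
  Submodule.liftQ _
    { toFun := cbilAux φ hφ
      map_add' := fun a b => by
        refine LinearMap.ext fun x => ?_
        obtain ⟨c', rfl⟩ := E.mkC_surj x
        rw [LinearMap.add_apply, cbilAux_mkC, cbilAux_mkC, cbilAux_mkC, ← map_add]
        congr 1; ext n; simp
      map_smul' := fun a b => by
        refine LinearMap.ext fun x => ?_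
        obtain ⟨c', rfl⟩ := E.mkC_surj x
        rw [RingHom.id_apply, LinearMap.smul_apply, cbilAux_mkC, cbilAux_mkC, ← map_smul]
        congr 1; ext n; simp }
    (fun c hc => LinearMap.ext fun x => by
      obtain ⟨c', rfl⟩ := E.mkC_surj x
      exact (G.mkC_eq_zero _).2 (hφ.null c c' (Or.inl hc)))

lemma cbil_mkC {D : DirInv.{w} K M} {E : DirInv.{w'} K N} {G : DirInv.{w''} K P}
    (φ : M →ₗ[K] N →ₗ[K] P) (hφ : D.BCont E G φ) (c : D.cauchySeq) (c' : E.cauchySeq) :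
    cbil φ hφ (D.mkC c) (E.mkC c') = G.mkC ⟨_, hφ.cauchy c c'⟩ := rfl

/-! ### General facts on continuity -/

lemma Cont.comp {D : DirInv.{w} K M} {E : DirInv.{w'} K N} {G : DirInv.{w''} K P}
    {g : N →ₗ[K] P} {f : M →ₗ[K] N} (hg : E.Cont G g) (hf : D.Cont E f) : D.Cont G (g ∘ₗ f) := by
  intro j
  obtain ⟨k, h₁, h₂⟩ := hf j
  obtain ⟨l, h₃, h₄⟩ := hg k
  refine ⟨l, fun x hx => h₃ _ (h₁ x hx), fun i => ?_⟩
  obtain ⟨i', hi'⟩ := h₄ i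
  obtain ⟨i'', hi''⟩ := h₂ i'
  exact ⟨i'', fun x hx => hi' _ (hi'' x hx)⟩

lemma Cont.id (D : DirInv.{w} K M) : D.Cont D LinearMap.id := fun j =>
  ⟨j, fun _ h => h, fun i => ⟨i, fun _ h => h⟩⟩

lemma Cont.add {D : DirInv.{w} K M} {E : DirInv.{w'} K N} {f g : M →ₗ[K] N} (hf : D.Cont E f)
    (hg : D.Cont E g) : D.Cont E (f + g) := by
  intro j
  obtain ⟨k, h₁, h₂⟩ := hf j
  obtain ⟨k', h₁', h₂'⟩ := hg j
  obtain ⟨l, hl, hl'⟩ := E.directed k k'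
  refine ⟨l, fun x hx => add_mem (E.F_mono hl (h₁ x hx)) (E.F_mono hl' (h₁' x hx)), fun i => ?_⟩
  obtain ⟨a, ha⟩ := E.compat hl i
  obtain ⟨b, hb⟩ := E.compat hl' i
  obtain ⟨c, hc⟩ := h₂ a
  obtain ⟨d, hd⟩ := h₂' b
  exact ⟨max c d, fun x hx => add_mem (ha (hc x (D.Fi_anti j (le_max_left _ _) hx)))
    (hb (hd x (D.Fi_anti j (le_max_right _ _) hx)))⟩

lemma BCont.add {D : DirInv.{w} K M} {E : DirInv.{w'} K N} {G : DirInv.{w''} K P}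
    {f g : M →ₗ[K] N →ₗ[K] P} (hf : D.BCont E G f) (hg : D.BCont E G g) :
    D.BCont E G (f + g) := by
  intro j j'
  obtain ⟨k, h₁, h₂⟩ := hf j j'
  obtain ⟨k', h₁', h₂'⟩ := hg j j'
  obtain ⟨l, hl, hl'⟩ := G.directed k k'
  refine ⟨l, fun x hx y hy => add_mem (G.F_mono hl (h₁ x hx y hy)) (G.F_mono hl' (h₁' x hx y hy)),
    fun i => ?_⟩
  obtain ⟨a, ha⟩ := G.compat hl i
  obtain ⟨b, hb⟩ := G.compat hl' i
  obtain ⟨c, hc⟩ := h₂ a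
  obtain ⟨d, hd⟩ := h₂' b
  refine ⟨max c d, fun x hx y hy h => add_mem (ha (hc x hx y hy ?_)) (hb (hd x hx y hy ?_))⟩
  · exact h.imp (fun h => D.Fi_anti j (le_max_left _ _) h)
      fun h => E.Fi_anti j' (le_max_left _ _) h
  · exact h.imp (fun h => D.Fi_anti j (le_max_right _ _) h)
      fun h => E.Fi_anti j' (le_max_right _ _) h

/-- Precomposition of a continuous bilinear map with continuous linear maps. -/
lemma BCont.comp {D D' : DirInv.{w} K M} {E E' : DirInv.{w'} K N} {G : DirInv.{w''} K P}
    {φ : M →ₗ[K] N →ₗ[K] P} (hφ : D.BCont E G φ) {f : M →ₗ[K] M} (hf : D'.Cont D f)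
    {g : N →ₗ[K] N} (hg : E'.Cont E g) : D'.BCont E' G (φ.compl₁₂ f g) := by
  intro j k
  obtain ⟨j₁, h₁, h₁'⟩ := hf j
  obtain ⟨k₁, h₂, h₂'⟩ := hg k
  obtain ⟨l, h₃, h₃'⟩ := hφ j₁ k₁
  refine ⟨l, fun x hx y hy => h₃ _ (h₁ x hx) _ (h₂ y hy), fun i => ?_⟩
  obtain ⟨i', hi'⟩ := h₃' i
  obtain ⟨a, ha⟩ := h₁' i'
  obtain ⟨b, hb⟩ := h₂' i'
  refine ⟨max a b, fun x hx y hy h => hi' _ (h₁ x hx) _ (h₂ y hy) ?_⟩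
  exact h.imp (fun h => ha x (D'.Fi_anti j (le_max_left _ _) h))
      fun h => hb y (E'.Fi_anti k (le_max_right _ _) h)

/-- A linear map out of a tensor product is continuous if the bilinear map is. -/
lemma BCont.tensor_lift {D : DirInv.{w} K M} {E : DirInv.{w'} K N} {G : DirInv.{w''} K P}
    {f : M ⊗[K] N →ₗ[K] P} (h : D.BCont E G ((TensorProduct.mk K M N).compr₂ f)) :
    (D.tensor E).Cont G f := by
  rintro ⟨j, k⟩
  obtain ⟨l, h₁, h₂⟩ := h j k
  refine ⟨l, ?_, fun i => ?_⟩
  · change Submodule.map₂ (TensorProduct.mk K M N) (D.F j) (E.F k) ≤ (G.F l).comap f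
    exact Submodule.map₂_le.2 h₁
  · obtain ⟨i', hi'⟩ := h₂ i
    refine ⟨i', ?_⟩
    change Submodule.map₂ (TensorProduct.mk K M N) (D.F j) (E.Fi k i') ⊔
      Submodule.map₂ (TensorProduct.mk K M N) (D.Fi j i') (E.F k) ≤ (G.Fi l i).comap f
    refine sup_le (Submodule.map₂_le.2 fun x hx y hy => ?_)
      (Submodule.map₂_le.2 fun x hx y hy => ?_)
    · exact hi' x hx y (E.Fi_le _ _ hy) (Or.inr hy)
    · exact hi' x (D.Fi_le _ _ hx) y hy (Or.inl hx)

lemma BCont.mk (D : DirInv.{w} K M) (E : DirInv.{w'} K N) :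
    D.BCont E (D.tensor E) (TensorProduct.mk K M N) := fun j k =>
  ⟨(j, k), fun _ hx _ hy => Submodule.apply_mem_map₂ _ hx hy, fun i => ⟨i, fun _ hx _ hy h => by
    rcases h with h | h
    · exact Submodule.mem_sup_right (Submodule.apply_mem_map₂ _ h hy)
    · exact Submodule.mem_sup_left (Submodule.apply_mem_map₂ _ hx h)⟩⟩

lemma Cont.tensor_map {D D' : DirInv.{w} K M} {E E' : DirInv.{w'} K N}
    {f : M →ₗ[K] M} (hf : D.Cont D' f) {g : N →ₗ[K] N} (hg : E.Cont E' g) :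
    (D.tensor E).Cont (D'.tensor E') (TensorProduct.map f g) :=
  BCont.tensor_lift ((BCont.mk D' E').comp hf hg)

/-- The tensor product of two continuous bilinear maps is continuous. -/
lemma BCont.tensor_map₂ {D : DirInv.{w} K M} {E : DirInv.{w'} K N}
    {φ : M →ₗ[K] M →ₗ[K] M} (hφ : D.BCont D D φ) {χ : N →ₗ[K] N →ₗ[K] N} (hχ : E.BCont E E χ) :
    (D.tensor E).BCont (D.tensor E) (D.tensor E) (TensorProduct.map₂ φ χ) := by
  rintro ⟨j, k⟩ ⟨j', k'⟩
  obtain ⟨l, h₁, h₂⟩ := hφ j j'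
  obtain ⟨l', h₁', h₂'⟩ := hχ k k'
  have key : ∀ (p : Submodule K M) (q : Submodule K N) (p' : Submodule K M) (q' : Submodule K N)
      (r : Submodule K (M ⊗[K] N)),
      (∀ x ∈ p, ∀ y ∈ q, ∀ x' ∈ p', ∀ y' ∈ q', φ x x' ⊗ₜ[K] χ y y' ∈ r) →
      ∀ s ∈ Submodule.map₂ (TensorProduct.mk K M N) p q,
      ∀ t ∈ Submodule.map₂ (TensorProduct.mk K M N) p' q', TensorProduct.map₂ φ χ s t ∈ r := by
    intro p q p' q' r h s hs t ht
    have : Submodule.map₂ (TensorProduct.mk K M N) p q ≤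
        r.comap ((TensorProduct.map₂ φ χ).flip t) := by
      refine Submodule.map₂_le.2 fun x hx y hy => ?_
      have : Submodule.map₂ (TensorProduct.mk K M N) p' q' ≤
          r.comap (TensorProduct.map₂ φ χ (x ⊗ₜ y)) :=
        Submodule.map₂_le.2 fun x' hx' y' hy' => h x hx y hy x' hx' y' hy'
      exact this ht
    exact this hs
  refine ⟨(l, l'), key _ _ _ _ _ fun x hx y hy x' hx' y' hy' =>
    Submodule.apply_mem_map₂ _ (h₁ x hx x' hx') (h₁' y hy y' hy'), fun i => ?_⟩
  obtain ⟨a, ha⟩ := h₂ i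
  obtain ⟨b, hb⟩ := h₂' i
  have L : ∀ x ∈ D.F j, ∀ x' ∈ D.F j', (x ∈ D.Fi j (max a b) ∨ x' ∈ D.Fi j' (max a b)) →
      φ x x' ∈ D.Fi l i := fun x hx x' hx' h => ha x hx x' hx'
    (h.imp (fun h => D.Fi_anti _ (le_max_left _ _) h) fun h => D.Fi_anti _ (le_max_left _ _) h)
  have R : ∀ y ∈ E.F k, ∀ y' ∈ E.F k', (y ∈ E.Fi k (max a b) ∨ y' ∈ E.Fi k' (max a b)) →
      χ y y' ∈ E.Fi l' i := fun x hx x' hx' h => hb x hx x' hx'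
    (h.imp (fun h => E.Fi_anti _ (le_max_right _ _) h) fun h => E.Fi_anti _ (le_max_right _ _) h)
  refine ⟨max a b, fun s hs t ht h => ?_⟩
  rcases h with h | h
  · obtain ⟨s₁, hs₁, s₂, hs₂, rfl⟩ := Submodule.mem_sup.1 h
    rw [map_add, LinearMap.add_apply]
    refine add_mem (key _ _ _ _ _ (fun x hx y hy x' hx' y' hy' => ?_) _ hs₁ _ ht)
      (key _ _ _ _ _ (fun x hx y hy x' hx' y' hy' => ?_) _ hs₂ _ ht)
    · exact Submodule.mem_sup_left (Submodule.apply_mem_map₂ _ (h₁ x hx x' hx')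
        (R y (E.Fi_le _ _ hy) y' hy' (Or.inl hy)))
    · exact Submodule.mem_sup_right (Submodule.apply_mem_map₂ _
        (L x (D.Fi_le _ _ hx) x' hx' (Or.inl hx)) (h₁' y hy y' hy'))
  · obtain ⟨s₁, hs₁, s₂, hs₂, rfl⟩ := Submodule.mem_sup.1 h
    rw [map_add]
    refine add_mem (key _ _ _ _ _ (fun x hx y hy x' hx' y' hy' => ?_) _ hs _ hs₁)
      (key _ _ _ _ _ (fun x hx y hy x' hx' y' hy' => ?_) _ hs _ hs₂)
    · exact Submodule.mem_sup_left (Submodule.apply_mem_map₂ _ (h₁ x hx x' hx')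
        (R y hy y' (E.Fi_le _ _ hy') (Or.inr hy')))
    · exact Submodule.mem_sup_right (Submodule.apply_mem_map₂ _
        (L x hx x' (D.Fi_le _ _ hx') (Or.inr hx')) (h₁' y hy y' hy'))

/-! ### Gradings -/

open DirectSum in
/-- For a graded module `M = ⨁ M^p`, the dir-inv structure on `M` is isomorphic to the direct sum
dir-inv structure of the graded pieces `M^p` (with the induced structures): every `F j` meets only
finitely many degrees, and decomposition into homogeneous components is continuous. -/
def IsGraded (D : DirInv.{w} K M) (𝒢 : ℤ → Submodule K M) [Decomposition 𝒢] : Prop :=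
  ∀ j, ∃ j', ∃ S : Finset ℤ,
    (∀ x ∈ D.F j, ∀ p, (decompose 𝒢 x p : M) ∈ D.F j' ∧ (p ∉ S → (decompose 𝒢 x p : M) = 0)) ∧
    ∀ i, ∃ i', ∀ x ∈ D.Fi j i', ∀ p, (decompose 𝒢 x p : M) ∈ D.Fi j' i

end DirInv

section grading

variable {K : Type*} [CommRing K] {M N : Type*} [AddCommGroup M] [Module K M]
  [AddCommGroup N] [Module K N]

open DirectSum

/-- The linear map which multiplies the homogeneous elements of degree `p` by the scalar `s p`. -/
noncomputable def scaleDeg (𝒢 : ℤ → Submodule K M) [Decomposition 𝒢] (s : ℤ → K) : M →ₗ[K] M :=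
  (DirectSum.toModule K ℤ M fun p => s p • (𝒢 p).subtype) ∘ₗ
    (decomposeLinearEquiv 𝒢).toLinearMap

lemma scaleDeg_of_mem {𝒢 : ℤ → Submodule K M} [Decomposition 𝒢] (s : ℤ → K) {p : ℤ} {x : M}
    (hx : x ∈ 𝒢 p) : scaleDeg 𝒢 s x = s p • x := by
  simp only [scaleDeg, LinearMap.comp_apply, LinearEquiv.coe_coe, decomposeLinearEquiv_apply]
  rw [decompose_of_mem _ hx, ← DirectSum.lof_eq_of K, DirectSum.toModule_lof]
  simp

lemma scaleDeg_eq_sum (𝒢 : ℤ → Submodule K M) [Decomposition 𝒢] (s : ℤ → K) (x : M)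
    (S : Finset ℤ) (hS : ∀ p ∉ S, (decompose 𝒢 x p : M) = 0) :
    scaleDeg 𝒢 s x = ∑ p ∈ S, s p • (decompose 𝒢 x p : M) := by
  classical
  have hx : x = ∑ p ∈ S, (decompose 𝒢 x p : M) := by
    conv_lhs => rw [← sum_support_decompose 𝒢 x]
    refine Finset.sum_subset (fun p hp => ?_) fun p _ hp => ?_
    · by_contra h
      have := hS p h
      simp only [DFinsupp.mem_support_iff, ne_eq] at hp
      exact hp (Subtype.ext this)
    · simpa using hp
  conv_lhs => rw [hx, map_sum]
  exact Finset.sum_congr rfl fun p _ => scaleDeg_of_mem s (SetLike.coe_mem _)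

lemma DirInv.IsGraded.cont_scaleDeg {D : DirInv.{w} K M} {𝒢 : ℤ → Submodule K M}
    [Decomposition 𝒢] (h : D.IsGraded 𝒢) (s : ℤ → K) : D.Cont D (scaleDeg 𝒢 s) := by
  intro j
  obtain ⟨j', S, h₁, h₂⟩ := h j
  refine ⟨j', fun x hx => ?_, fun i => ?_⟩
  · rw [scaleDeg_eq_sum 𝒢 s x S fun p hp => (h₁ x hx p).2 hp]
    exact sum_mem fun p _ => Submodule.smul_mem _ _ (h₁ x hx p).1
  · obtain ⟨i', hi'⟩ := h₂ i
    refine ⟨i', fun x hx => ?_⟩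
    rw [scaleDeg_eq_sum 𝒢 s x S fun p hp => (h₁ x (D.Fi_le _ _ hx) p).2 hp]
    exact sum_mem fun p _ => Submodule.smul_mem _ _ (hi' x hx p)

/-- The linear map on `M ⊗ N` which multiplies `x ⊗ y` by the scalar `s p q`, for `x` homogeneous
of degree `p` and `y` homogeneous of degree `q`. -/
noncomputable def tscale (𝒢 : ℤ → Submodule K M) [Decomposition 𝒢] (ℋ : ℤ → Submodule K N)
    [Decomposition ℋ] (s : ℤ → ℤ → K) : M ⊗[K] N →ₗ[K] M ⊗[K] N :=
  TensorProduct.lift ((DirectSum.toModule K ℤ (N →ₗ[K] M ⊗[K] N) fun p =>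
    ((TensorProduct.mk K M N).compl₂ (scaleDeg ℋ (s p))).comp (𝒢 p).subtype) ∘ₗ
      (decomposeLinearEquiv 𝒢).toLinearMap)

lemma tscale_of_mem_left {𝒢 : ℤ → Submodule K M} [Decomposition 𝒢] {ℋ : ℤ → Submodule K N}
    [Decomposition ℋ] (s : ℤ → ℤ → K) {p : ℤ} {x : M} (hx : x ∈ 𝒢 p) (y : N) :
    tscale 𝒢 ℋ s (x ⊗ₜ y) = x ⊗ₜ scaleDeg ℋ (s p) y := by
  simp only [tscale, LinearMap.comp_apply, LinearEquiv.coe_coe, decomposeLinearEquiv_apply,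
    TensorProduct.lift.tmul]
  rw [decompose_of_mem _ hx, ← DirectSum.lof_eq_of K, DirectSum.toModule_lof]
  simp

lemma tscale_of_mem {𝒢 : ℤ → Submodule K M} [Decomposition 𝒢] {ℋ : ℤ → Submodule K N}
    [Decomposition ℋ] (s : ℤ → ℤ → K) {p q : ℤ} {x : M} (hx : x ∈ 𝒢 p) {y : N} (hy : y ∈ ℋ q) :
    tscale 𝒢 ℋ s (x ⊗ₜ y) = s p q • (x ⊗ₜ y) := by
  rw [tscale_of_mem_left s hx, scaleDeg_of_mem _ hy, TensorProduct.tmul_smul]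

lemma linearMap_ext_homogeneous {P : Type*} [AddCommGroup P] [Module K P]
    {𝒢 : ℤ → Submodule K M} [Decomposition 𝒢] {ℋ : ℤ → Submodule K N}
    [Decomposition ℋ] {f g : M ⊗[K] N →ₗ[K] P}
    (h : ∀ p q, ∀ x ∈ 𝒢 p, ∀ y ∈ ℋ q, f (x ⊗ₜ y) = g (x ⊗ₜ y)) : f = g := by
  refine TensorProduct.ext ?_
  refine decompose_lhom_ext 𝒢 fun p => ?_
  ext x : 1
  refine decompose_lhom_ext ℋ fun q => ?_
  ext y
  exact h p q _ x.2 _ y.2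

lemma tscale_comp (𝒢 : ℤ → Submodule K M) [Decomposition 𝒢] (ℋ : ℤ → Submodule K N)
    [Decomposition ℋ] (s t : ℤ → ℤ → K) :
    tscale 𝒢 ℋ s ∘ₗ tscale 𝒢 ℋ t = tscale 𝒢 ℋ (fun p q => t p q * s p q) :=
  linearMap_ext_homogeneous (𝒢 := 𝒢) (ℋ := ℋ) fun p q x hx y hy => by
    simp [tscale_of_mem _ hx hy, mul_smul]

lemma tscale_eq_sum (𝒢 : ℤ → Submodule K M) [Decomposition 𝒢] (ℋ : ℤ → Submodule K N)
    [Decomposition ℋ] (s : ℤ → ℤ → K) (x : M) (y : N)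
    (S : Finset ℤ) (hS : ∀ p ∉ S, (decompose 𝒢 x p : M) = 0) :
    tscale 𝒢 ℋ s (x ⊗ₜ y) = ∑ p ∈ S, (decompose 𝒢 x p : M) ⊗ₜ scaleDeg ℋ (s p) y := by
  have hx : x = ∑ p ∈ S, (decompose 𝒢 x p : M) := by
    have := scaleDeg_eq_sum 𝒢 (fun _ => (1 : K)) x S hS
    simp only [one_smul] at this
    rw [← this]
    have : scaleDeg 𝒢 (fun _ => (1 : K)) = LinearMap.id := by
      refine decompose_lhom_ext 𝒢 fun p => ?_
      ext z
      simp [scaleDeg_of_mem _ z.2]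
    rw [this]; rfl
  conv_lhs => rw [hx, TensorProduct.sum_tmul, map_sum]
  exact Finset.sum_congr rfl fun p _ => tscale_of_mem_left s (SetLike.coe_mem _) y

lemma DirInv.IsGraded.cont_tscale {D : DirInv.{w} K M} {𝒢 : ℤ → Submodule K M}
    [Decomposition 𝒢] (h : D.IsGraded 𝒢) {E : DirInv.{w'} K N} {ℋ : ℤ → Submodule K N}
    [Decomposition ℋ] (h' : E.IsGraded ℋ) (s : ℤ → ℤ → K) :
    (D.tensor E).Cont (D.tensor E) (tscale 𝒢 ℋ s) := by
  refine DirInv.BCont.tensor_lift fun j k => ?_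
  obtain ⟨j', S, h₁, h₂⟩ := h j
  obtain ⟨k', S', h₃, h₄⟩ := h' k
  have e : ∀ x ∈ D.F j, ∀ y, (TensorProduct.mk K M N).compr₂ (tscale 𝒢 ℋ s) x y =
      ∑ p ∈ S, (decompose 𝒢 x p : M) ⊗ₜ scaleDeg ℋ (s p) y := fun x hx y =>
    tscale_eq_sum 𝒢 ℋ s x y S fun p hp => (h₁ x hx p).2 hp
  have m : ∀ p, ∀ y ∈ E.F k, scaleDeg ℋ (s p) y ∈ E.F k' := fun p y hy => by
    rw [scaleDeg_eq_sum ℋ _ y S' fun p hp => (h₃ y hy p).2 hp]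
    exact sum_mem fun q _ => Submodule.smul_mem _ _ (h₃ y hy q).1
  refine ⟨(j', k'), fun x hx y hy => ?_, fun i => ?_⟩
  · rw [e x hx]
    exact sum_mem fun p _ => Submodule.apply_mem_map₂ _ (h₁ x hx p).1 (m p y hy)
  · obtain ⟨a, ha⟩ := h₂ i
    obtain ⟨b, hb⟩ := h₄ i
    refine ⟨max a b, fun x hx y hy hxy => ?_⟩
    rw [e x hx]
    refine sum_mem fun p _ => ?_
    rcases hxy with hx' | hy'
    · exact Submodule.mem_sup_right (Submodule.apply_mem_map₂ _
        (ha x (D.Fi_anti _ (le_max_left _ _) hx') p) (m p y hy))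
    · refine Submodule.mem_sup_left (Submodule.apply_mem_map₂ _ (h₁ x hx p).1 ?_)
      rw [scaleDeg_eq_sum ℋ _ y S' fun p hp => (h₃ y hy p).2 hp]
      exact sum_mem fun q _ => Submodule.smul_mem _ _
        (hb y (E.Fi_anti _ (le_max_right _ _) hy') q)

lemma tscale_eq_zero {D : DirInv.{w} K M} {𝒢 : ℤ → Submodule K M}
    [Decomposition 𝒢] (h : D.IsGraded 𝒢) {E : DirInv.{w'} K N} {ℋ : ℤ → Submodule K N}
    [Decomposition ℋ] (h' : E.IsGraded ℋ) (jk : D.J × E.J) :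
    ∃ S : Finset (ℤ × ℤ), ∀ s : ℤ → ℤ → K, (∀ pq ∈ S, s pq.1 pq.2 = 0) →
      ∀ t ∈ (D.tensor E).F jk, tscale 𝒢 ℋ s t = 0 := by
  obtain ⟨j, k⟩ := jk
  obtain ⟨j', S, h₁, h₂⟩ := h j
  obtain ⟨k', S', h₃, h₄⟩ := h' k
  refine ⟨S ×ˢ S', fun s hs t ht => ?_⟩
  have : (D.tensor E).F (j, k) ≤ LinearMap.ker (tscale 𝒢 ℋ s) := by
    refine Submodule.map₂_le.2 fun x hx y hy => ?_
    change tscale 𝒢 ℋ s (x ⊗ₜ y) = 0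
    rw [tscale_eq_sum 𝒢 ℋ s x y S fun p hp => (h₁ x hx p).2 hp]
    refine Finset.sum_eq_zero fun p hp => ?_
    rw [scaleDeg_eq_sum ℋ _ y S' fun p hp => (h₃ y hy p).2 hp, Finset.sum_eq_zero,
      TensorProduct.tmul_zero]
    intro q hq
    rw [hs (p, q) (Finset.mk_mem_product hp hq), zero_smul]
  exact this ht

/-- The shift `M[1]` of a grading: `M[1]^p = M^(p+1)`. -/
def shift (𝒢 : ℤ → Submodule K M) : ℤ → Submodule K M := fun p => 𝒢 (p + 1)

noncomputable instance (𝒢 : ℤ → Submodule K M) [Decomposition 𝒢] : Decomposition (shift 𝒢) :=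
  IsInternal.chooseDecomposition _ <| by
    have h := Decomposition.isInternal 𝒢
    rw [isInternal_submodule_iff_iSupIndep_and_iSup_eq_top] at h ⊢
    refine ⟨h.1.comp (add_left_injective 1), ?_⟩
    rw [← h.2]
    exact (Equiv.addRight (1 : ℤ)).iSup_comp (g := 𝒢)

end grading

section supersym

lemma units_zpow_smul {K V : Type*} [Field K] [AddCommGroup V] [Module K V] (n : ℤ) (v : V) :
    ((-1 : ℤˣ) ^ n) • v = ((-1 : K) ^ n) • v := by
  rcases Int.even_or_odd n with h | h
  · rw [h.neg_one_zpow, h.neg_one_zpow, one_smul, one_smul]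
  · rw [h.neg_one_zpow, h.neg_one_zpow]; simp [Units.smul_def]

open DirectSum

variable {K : Type*} [Field K] {M : Type*} [AddCommGroup M] [Module K M]

/-- The super-commutativity relations `a b = (-1)^(pq) b a` in the tensor algebra of a graded module,
for `a` of degree `p` and `b` of degree `q`. -/
inductive SuperSym.Rel (𝒢 : ℤ → Submodule K M) : TensorAlgebra K M → TensorAlgebra K M → Prop
  | comm {p q : ℤ} {a b : M} (ha : a ∈ 𝒢 p) (hb : b ∈ 𝒢 q) :
      SuperSym.Rel 𝒢 (TensorAlgebra.ι K a * TensorAlgebra.ι K b)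
        (((-1 : K) ^ (p * q)) • (TensorAlgebra.ι K b * TensorAlgebra.ι K a))

/-- The super-symmetric algebra of a graded module. -/
def SuperSym (𝒢 : ℤ → Submodule K M) : Type _ := RingQuot (SuperSym.Rel 𝒢)

namespace SuperSym

variable (𝒢 : ℤ → Submodule K M)

noncomputable instance : Ring (SuperSym 𝒢) := inferInstanceAs (Ring (RingQuot (SuperSym.Rel 𝒢)))
noncomputable instance : Algebra K (SuperSym 𝒢) :=
  inferInstanceAs (Algebra K (RingQuot (SuperSym.Rel 𝒢)))

/-- The canonical map from `M` to its super-symmetric algebra. -/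
noncomputable def ι : M →ₗ[K] SuperSym 𝒢 :=
  (RingQuot.mkAlgHom K (SuperSym.Rel 𝒢)).toLinearMap ∘ₗ TensorAlgebra.ι K

variable {𝒢}

lemma ι_mul_ι {p q : ℤ} {a b : M} (ha : a ∈ 𝒢 p) (hb : b ∈ 𝒢 q) :
    ι 𝒢 a * ι 𝒢 b = ((-1 : K) ^ (p * q)) • (ι 𝒢 b * ι 𝒢 a) := by
  have h := RingQuot.mkAlgHom_rel K (Rel.comm (𝒢 := 𝒢) ha hb)
  rw [map_mul, map_smul, map_mul] at h
  exact h

/-- The universal property of the super-symmetric algebra. -/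
noncomputable def lift {B : Type*} [Semiring B] [Algebra K B] (f : M →ₗ[K] B)
    (hf : ∀ p q, ∀ a ∈ 𝒢 p, ∀ b ∈ 𝒢 q, f a * f b = ((-1 : K) ^ (p * q)) • (f b * f a)) :
    SuperSym 𝒢 →ₐ[K] B :=
  RingQuot.liftAlgHom K ⟨TensorAlgebra.lift K f, by
    rintro _ _ ⟨ha, hb⟩
    rw [map_mul, map_smul, map_mul]
    simpa using hf _ _ _ ha _ hb⟩

lemma lift_ι {B : Type*} [Semiring B] [Algebra K B] (f : M →ₗ[K] B)
    (hf : ∀ p q, ∀ a ∈ 𝒢 p, ∀ b ∈ 𝒢 q, f a * f b = ((-1 : K) ^ (p * q)) • (f b * f a)) (x : M) :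
    lift f hf (ι 𝒢 x) = f x := by
  change RingQuot.liftAlgHom K _ (RingQuot.mkAlgHom K _ _) = _
  rw [RingQuot.liftAlgHom_mkAlgHom_apply, TensorAlgebra.lift_ι_apply]

lemma algHom_ext {B : Type*} [Semiring B] [Algebra K B] {f g : SuperSym 𝒢 →ₐ[K] B}
    (h : ∀ x, f (ι 𝒢 x) = g (ι 𝒢 x)) : f = g := by
  refine RingQuot.ringQuot_ext' K (s := Rel 𝒢) f g (TensorAlgebra.hom_ext (LinearMap.ext h))

/-- The component of order `j`: it is spanned by the products of `j` elements of `M`. -/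
noncomputable def order (𝒢 : ℤ → Submodule K M) (j : ℕ) : Submodule K (SuperSym 𝒢) :=
  LinearMap.range (ι 𝒢) ^ j

/-- The component of degree `n`: it is spanned by the products of homogeneous elements of `M`
whose degrees have sum `n`. -/
noncomputable def degree (𝒢 : ℤ → Submodule K M) (n : ℤ) : Submodule K (SuperSym 𝒢) :=
  Submodule.span K {x | ∃ l : List (Σ p, 𝒢 p), (l.map fun a => a.1).sum = n ∧
    (l.map fun a => ι 𝒢 (a.2 : M)).prod = x}

instance : SetLike.GradedMonoid (degree 𝒢) where
  one_mem := Submodule.subset_span ⟨[], rfl, rfl⟩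
  mul_mem {i j a b} ha hb := by
    have h := Submodule.mul_mem_mul ha hb
    rw [degree, degree, Submodule.span_mul_span] at h
    refine Submodule.span_mono ?_ h
    rintro _ ⟨_, ⟨l, hl, rfl⟩, _, ⟨l', hl', rfl⟩, rfl⟩
    exact ⟨l ++ l', by simp [hl, hl'], by simp⟩

lemma ι_mem_degree {p : ℤ} {a : M} (ha : a ∈ 𝒢 p) : ι 𝒢 a ∈ degree 𝒢 p :=
  Submodule.subset_span ⟨[⟨p, ⟨a, ha⟩⟩], by simp, by simp⟩

variable [Decomposition 𝒢]

/-- Auxiliary construction for the grading by degree. -/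
noncomputable def decomposeι (𝒢 : ℤ → Submodule K M) [Decomposition 𝒢] :
    M →ₗ[K] ⨁ n, degree 𝒢 n :=
  (DirectSum.toModule K ℤ _ fun p => DirectSum.lof K ℤ (fun n => degree 𝒢 n) p ∘ₗ
    ((ι 𝒢).comp (𝒢 p).subtype).codRestrict (degree 𝒢 p) fun a => ι_mem_degree a.2) ∘ₗ
    (decomposeLinearEquiv 𝒢).toLinearMap

lemma decomposeι_of_mem {p : ℤ} {a : M} (ha : a ∈ 𝒢 p) :
    decomposeι 𝒢 a = DirectSum.of (fun n => degree 𝒢 n) p ⟨ι 𝒢 a, ι_mem_degree ha⟩ := by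
  simp only [decomposeι, LinearMap.comp_apply, LinearEquiv.coe_coe, decomposeLinearEquiv_apply]
  rw [decompose_of_mem _ ha, ← DirectSum.lof_eq_of K, DirectSum.toModule_lof]
  rfl

/-- Auxiliary construction for the grading by degree. -/
noncomputable def decomposeAlgHom (𝒢 : ℤ → Submodule K M) [Decomposition 𝒢] :
    SuperSym 𝒢 →ₐ[K] ⨁ n, degree 𝒢 n :=
  lift (decomposeι 𝒢) fun p q a ha b hb => by
    rw [decomposeι_of_mem ha, decomposeι_of_mem hb, DirectSum.of_mul_of, DirectSum.of_mul_of,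
      ← DirectSum.lof_eq_of K, ← DirectSum.lof_eq_of K, ← map_smul, DirectSum.lof_eq_of,
      DirectSum.lof_eq_of]
    refine DirectSum.of_eq_of_gradedMonoid_eq (Sigma.subtype_ext (add_comm _ _) ?_)
    exact ι_mul_ι ha hb

noncomputable instance : GradedAlgebra (degree 𝒢) :=
  GradedAlgebra.ofAlgHom _ (decomposeAlgHom 𝒢)
    (algHom_ext fun x => by
      induction x using Decomposition.inductionOn 𝒢 with
      | zero => simp
      | homogeneous a =>
        simp only [AlgHom.comp_apply, decomposeAlgHom, lift_ι, decomposeι_of_mem a.2]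
        simp
      | add a b ha hb => simp only [map_add, ha, hb])
    (by
      rintro n ⟨x, hx⟩
      induction hx using Submodule.span_induction with
      | mem x h =>
        obtain ⟨l, rfl, rfl⟩ := h
        induction l with
        | nil => 
          simp only [List.map_nil, List.prod_nil, map_one]
          rfl
        | cons a l ih =>
          simp only [List.map_cons, List.prod_cons, map_mul] at ih ⊢
          rw [ih, decomposeAlgHom, lift_ι, decomposeι_of_mem a.2.2, DirectSum.of_mul_of]
          exact DirectSum.of_eq_of_gradedMonoid_eq (Sigma.subtype_ext rfl rfl)
      | zero =>
        rw [map_zero]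
        exact (map_zero (DirectSum.of (fun n => degree 𝒢 n) n)).symm
      | add x y hx hy ihx ihy =>
        rw [map_add, ihx, ihy, ← map_add]; rfl
      | smul a x hx ih =>
        rw [map_smul, ih, ← DirectSum.lof_eq_of K, ← map_smul]; rfl)

/-- The projection `ln` from the super-symmetric algebra to its component `M` of order `1`. -/
noncomputable def ln (𝒢 : ℤ → Submodule K M) : SuperSym 𝒢 →ₗ[K] M := by
  letI : Module Kᵐᵒᵖ M := Module.compHom _ ((RingHom.id K).fromOpposite mul_comm)
  haveI : IsCentralScalar K M := ⟨fun r m => rfl⟩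
  exact (TrivSqZeroExt.sndHom K M).comp
    (lift (B := TrivSqZeroExt K M) (TrivSqZeroExt.inrHom K M)
      (fun p q a _ b _ => by simp)).toLinearMap

open TensorProduct

/-- The comultiplication `Δ`, as a homomorphism of algebras to the super tensor product: the unique
one with `Δ(γ) = γ ⊗ 1 + 1 ⊗ γ` for `γ ∈ M`. -/
noncomputable def comulAlgHom (𝒢 : ℤ → Submodule K M) [Decomposition 𝒢] :
    SuperSym 𝒢 →ₐ[K] (degree 𝒢) ᵍ⊗[K] (degree 𝒢) :=
  lift ((GradedTensorProduct.includeLeft (degree 𝒢) (degree 𝒢)).toLinearMap ∘ₗ ι 𝒢 +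
      (GradedTensorProduct.includeRight (degree 𝒢) (degree 𝒢)).toLinearMap ∘ₗ ι 𝒢)
    fun p q a ha b hb => by
      have key : ∀ {p q : ℤ} {a b : M} (ha : a ∈ 𝒢 p) (hb : b ∈ 𝒢 q),
          GradedTensorProduct.includeRight (degree 𝒢) (degree 𝒢) (ι 𝒢 a) *
          GradedTensorProduct.includeLeft (degree 𝒢) (degree 𝒢) (ι 𝒢 b) =
          ((-1 : K) ^ (p * q)) • (GradedTensorProduct.includeLeft (degree 𝒢) (degree 𝒢) (ι 𝒢 b) *
          GradedTensorProduct.includeRight (degree 𝒢) (degree 𝒢) (ι 𝒢 a)) := by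
        intro p q a b ha hb
        have h1 := GradedTensorProduct.tmul_coe_mul_coe_tmul (R := K) (degree 𝒢) (degree 𝒢)
          1 ⟨ι 𝒢 a, ι_mem_degree ha⟩ ⟨ι 𝒢 b, ι_mem_degree hb⟩ 1
        have h2 := GradedTensorProduct.tmul_one_mul_one_tmul (R := K) (degree 𝒢) (degree 𝒢)
          (ι 𝒢 b) (ι 𝒢 a)
        simp only [GradedTensorProduct.includeLeft_apply, GradedTensorProduct.includeRight_apply]
        rw [h2]
        rw [one_mul, mul_one] at h1
        exact h1.trans (units_zpow_smul (K := K) _ _)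
      have eL := congrArg (GradedTensorProduct.includeLeft (degree 𝒢) (degree 𝒢)) (ι_mul_ι ha hb)
      have eR := congrArg (GradedTensorProduct.includeRight (degree 𝒢) (degree 𝒢)) (ι_mul_ι ha hb)
      rw [map_mul, map_smul, map_mul] at eL eR
      simp only [LinearMap.add_apply, LinearMap.comp_apply, AlgHom.toLinearMap_apply, add_mul,
        mul_add, smul_add]
      rw [key ha hb, key hb ha, mul_comm q p, smul_smul, ← mul_zpow, neg_one_mul, neg_neg,
        one_zpow, one_smul, eL, eR]
      abel

/-- The comultiplication `Δ`, as a linear map. -/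
noncomputable def comul (𝒢 : ℤ → Submodule K M) [Decomposition 𝒢] :
    SuperSym 𝒢 →ₗ[K] SuperSym 𝒢 ⊗[K] SuperSym 𝒢 :=
  (GradedTensorProduct.of K (degree 𝒢) (degree 𝒢)).symm.toLinearMap ∘ₗ
    (comulAlgHom 𝒢).toLinearMap

/-- The linear map which multiplies elements of degree `n` by `(-1)^n`. -/
noncomputable def sgn (𝒢 : ℤ → Submodule K M) [Decomposition 𝒢] : SuperSym 𝒢 →ₗ[K] SuperSym 𝒢 :=
  scaleDeg (degree 𝒢) fun n => (-1 : K) ^ n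

end SuperSym

end supersym
section structures

open DirectSum

variable {K : Type*} [Field K]

/-- The data and axioms of a DG super-commutative associative unital algebra in the category of
dir-inv `K`-modules, on a graded algebra `A = ⨁ 𝒜 p`. -/
structure DGComAlg (K : Type*) [Field K] {A : Type*} [Ring A] [Algebra K A]
    (𝒜 : ℤ → Submodule K A) [GradedAlgebra 𝒜] where
  top : DirInv.{w} K A
  graded : top.IsGraded 𝒜
  mul_cont : top.BCont top top (LinearMap.mul K A)
  one_mem : ∃ j, (1 : A) ∈ top.F j
  d : A →ₗ[K] A
  d_cont : top.Cont top d
  d_deg : ∀ p, ∀ a ∈ 𝒜 p, d a ∈ 𝒜 (p + 1)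
  d_d : ∀ a, d (d a) = 0
  leibniz : ∀ p, ∀ a ∈ 𝒜 p, ∀ b, d (a * b) = d a * b + (-1 : K) ^ p • (a * d b)
  comm : ∀ p q, ∀ a ∈ 𝒜 p, ∀ b ∈ 𝒜 q, b * a = (-1 : K) ^ (p * q) • (a * b)
  sq_zero : ∀ p, Odd p → ∀ a ∈ 𝒜 p, a * a = 0

/-- The data and axioms of a DG Lie algebra in the category of dir-inv `K`-modules, on a graded
module `L = ⨁ 𝒢 p`. -/
structure DGLieAlg (K : Type*) [Field K] {L : Type*} [AddCommGroup L] [Module K L]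
    (𝒢 : ℤ → Submodule K L) [Decomposition 𝒢] where
  top : DirInv.{w} K L
  graded : top.IsGraded 𝒢
  d : L →ₗ[K] L
  d_cont : top.Cont top d
  d_deg : ∀ p, ∀ x ∈ 𝒢 p, d x ∈ 𝒢 (p + 1)
  d_d : ∀ x, d (d x) = 0
  br : L →ₗ[K] L →ₗ[K] L
  br_cont : top.BCont top top br
  br_deg : ∀ p q, ∀ x ∈ 𝒢 p, ∀ y ∈ 𝒢 q, br x y ∈ 𝒢 (p + q)
  leibniz : ∀ p, ∀ x ∈ 𝒢 p, ∀ y, d (br x y) = br (d x) y + (-1 : K) ^ p • br x (d y)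
  antisymm : ∀ p q, ∀ x ∈ 𝒢 p, ∀ y ∈ 𝒢 q, br x y = -((-1 : K) ^ (p * q) • br y x)
  jacobi : ∀ p q, ∀ x ∈ 𝒢 p, ∀ y ∈ 𝒢 q, ∀ z,
    br x (br y z) = br (br x y) z + (-1 : K) ^ (p * q) • br y (br x z)

end structures

/-! ### `L_∞` morphisms -/

section linfty

open DirectSum SuperSym TensorProduct

variable {K : Type*} [Field K] {M N : Type*} [AddCommGroup M] [Module K M] [AddCommGroup N]
  [Module K N]

/-- The `j`-th Taylor coefficient `(x₁, …, x_j) ↦ ln (Ψ (x₁ ⋯ x_j))` of a linear map between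
super-symmetric algebras. -/
noncomputable def taylor {𝒢 : ℤ → Submodule K M} {ℋ : ℤ → Submodule K N}
    [Decomposition 𝒢] [Decomposition ℋ]
    (Ψ : SuperSym 𝒢 →ₗ[K] SuperSym ℋ) (j : ℕ) : MultilinearMap K (fun _ : Fin j => M) N :=
  (ln ℋ ∘ₗ Ψ).compMultilinearMap
    ((MultilinearMap.mkPiAlgebraFin K j (SuperSym 𝒢)).compLinearMap fun _ => ι 𝒢)

/-- `Ψ` is a homomorphism of coalgebras, homogeneous of degree `0`, with `Ψ(1) = 1`. -/
structure IsCoalgHom {𝒢 : ℤ → Submodule K M} {ℋ : ℤ → Submodule K N} [Decomposition 𝒢]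
    [Decomposition ℋ] (Ψ : SuperSym 𝒢 →ₗ[K] SuperSym ℋ) : Prop where
  comul : comul ℋ ∘ₗ Ψ = TensorProduct.map Ψ Ψ ∘ₗ comul 𝒢
  degree : ∀ n, ∀ x ∈ degree 𝒢 n, Ψ x ∈ degree ℋ n
  one : Ψ 1 = 1

/-- `Q` is an `L_∞` algebra structure on the graded module `M = ⨁ 𝒢 p` (a coderivation of degree
`1` of `S(M[1])` with `Q(1) = 0` and `Q ∘ Q = 0`), namely the one which corresponds to the structure
of DG Lie algebra with differential `d` and bracket `br`: its first Taylor coefficient is `d`, the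
second one is `br` (viewed as a symmetric map of degree `1` on `M[1]`), and the others vanish. -/
structure IsDGLieCoderivation (𝒢 : ℤ → Submodule K M) [Decomposition 𝒢] (d : M →ₗ[K] M)
    (br : M →ₗ[K] M →ₗ[K] M) (Q : SuperSym (shift 𝒢) →ₗ[K] SuperSym (shift 𝒢)) : Prop where
  coderivation : comul (shift 𝒢) ∘ₗ Q =
    (TensorProduct.map Q LinearMap.id + TensorProduct.map (sgn (shift 𝒢)) Q) ∘ₗ comul (shift 𝒢)
  degree : ∀ n, ∀ x ∈ degree (shift 𝒢) n, Q x ∈ SuperSym.degree (shift 𝒢) (n + 1)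
  one : Q 1 = 0
  sq : Q ∘ₗ Q = 0
  taylor_one : ∀ x, ln (shift 𝒢) (Q (ι _ x)) = d x
  taylor_two : ∀ p, ∀ x ∈ 𝒢 p, ∀ y,
    ln (shift 𝒢) (Q (ι _ x * ι _ y)) = (-1 : K) ^ (p - 1) • br x y
  taylor_ge : ∀ j, 3 ≤ j → ∀ c ∈ order (shift 𝒢) j, ln (shift 𝒢) (Q c) = 0

/-- `Ψ : S(M[1]) → S(N[1])` is an `L_∞` morphism from the DG Lie algebra `(M, d, br)` to the
DG Lie algebra `(N, d', br')`. -/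
def IsLInftyMorphism (𝒢 : ℤ → Submodule K M) (ℋ : ℤ → Submodule K N) [Decomposition 𝒢]
    [Decomposition ℋ] (d : M →ₗ[K] M) (br : M →ₗ[K] M →ₗ[K] M) (d' : N →ₗ[K] N)
    (br' : N →ₗ[K] N →ₗ[K] N) (Ψ : SuperSym (shift 𝒢) →ₗ[K] SuperSym (shift ℋ)) : Prop :=
  IsCoalgHom Ψ ∧ ∃ Q Q', IsDGLieCoderivation 𝒢 d br Q ∧ IsDGLieCoderivation ℋ d' br' Q' ∧
    Ψ ∘ₗ Q = Q' ∘ₗ Ψ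

/-- `Ψ` is continuous: all its Taylor coefficients `∂^j Ψ`, `j ≥ 1`, are continuous. -/
def IsContinuousLInfty (D : DirInv.{w} K M) (E : DirInv.{w'} K N) {𝒢 : ℤ → Submodule K M}
    {ℋ : ℤ → Submodule K N} [Decomposition 𝒢] [Decomposition ℋ]
    (Ψ : SuperSym (shift 𝒢) →ₗ[K] SuperSym (shift ℋ)) : Prop :=
  ∀ j, 1 ≤ j → D.MCont E (taylor Ψ j)

/-- The Maurer-Cartan equation `d ω + ½ [ω, ω] = 0`. -/
def IsMC (d : M →ₗ[K] M) (br : M →ₗ[K] M →ₗ[K] M) (ω : M) : Prop :=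
  d ω + (2⁻¹ : K) • br ω ω = 0

end linfty

/-! ### Complete tensor products -/

section ctensor

open DirectSum TensorProduct

variable {K : Type*} [Field K] {A : Type*} [Ring A] [Algebra K A]
  {𝒜 : ℤ → Submodule K A} [GradedAlgebra 𝒜] {L : Type*} [AddCommGroup L] [Module K L]
  {𝒢 : ℤ → Submodule K L} [Decomposition 𝒢] {L' : Type*} [AddCommGroup L'] [Module K L']
  {𝒢' : ℤ → Submodule K L'} [Decomposition 𝒢']

namespace CTensor

variable (R : DGComAlg.{w} K 𝒜) (G : DGLieAlg.{w'} K 𝒢)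

/-- The dir-inv module `A ⊗ 𝔤`. -/
abbrev pre : DirInv.{max w w'} K (A ⊗[K] L) := R.top.tensor G.top

/-- The complete tensor product `A ⊗̂ 𝔤`. -/
abbrev _root_.CTensor : Type _ := (pre R G).Completion

/-- The dir-inv structure on `A ⊗̂ 𝔤`. -/
noncomputable abbrev top : DirInv.{max w w'} K (CTensor R G) := (pre R G).completion

/-- The map on `A ⊗̂ 𝔤` induced by multiplication by the scalar `s p q` on `A^p ⊗ 𝔤^q`. -/
noncomputable def scale (s : ℤ → ℤ → K) : CTensor R G →ₗ[K] CTensor R G :=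
  DirInv.cmap (tscale 𝒜 𝒢 s) (R.graded.cont_tscale G.graded s)

/-- The bigraded component `A^p ⊗̂ 𝔤^q` of `A ⊗̂ 𝔤`: the image of the projection induced by
the projection of `A ⊗ 𝔤` onto `A^p ⊗ 𝔤^q`. -/
noncomputable def bidegree (p q : ℤ) : Submodule K (CTensor R G) :=
  LinearMap.range (scale R G fun p' q' => if p' = p ∧ q' = q then 1 else 0)

/-- The component of degree `n` of `A ⊗̂ 𝔤`: the image of the projection induced by
the projection of `A ⊗ 𝔤` onto `⨁_{p+q=n} A^p ⊗ 𝔤^q`. -/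
noncomputable def degree (n : ℤ) : Submodule K (CTensor R G) :=
  LinearMap.range (scale R G fun p q => if p + q = n then 1 else 0)

variable {R G}

lemma scale_scale (s t : ℤ → ℤ → K) (x : CTensor R G) :
    scale R G s (scale R G t x) = scale R G (fun p q => t p q * s p q) x := by
  obtain ⟨c, rfl⟩ := (pre R G).mkC_surj x
  simp only [scale, DirInv.cmap_mkC]
  congr 2
  ext n
  exact DFunLike.congr_fun (tscale_comp 𝒜 𝒢 s t) (c.1 n)

lemma scale_eq_of_eq_on (x : CTensor R G) : ∃ S : Finset (ℤ × ℤ), ∀ s t : ℤ → ℤ → K,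
    (∀ pq ∈ S, s pq.1 pq.2 = t pq.1 pq.2) → scale R G s x = scale R G t x := by
  obtain ⟨⟨c, jk, hc⟩, rfl⟩ := (pre R G).mkC_surj x
  obtain ⟨S, hS⟩ := tscale_eq_zero R.graded G.graded jk
  refine ⟨S, fun s t h => ?_⟩
  simp only [scale, DirInv.cmap_mkC]
  congr 2
  ext n
  have := hS (fun p q => s p q - t p q) (fun pq hpq => sub_eq_zero.2 (h pq hpq)) _ (hc.1 n)
  have e : tscale 𝒜 𝒢 (fun p q => s p q - t p q) = tscale 𝒜 𝒢 s - tscale 𝒜 𝒢 t :=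
    linearMap_ext_homogeneous (𝒢 := 𝒜) (ℋ := 𝒢) fun p q a ha b hb => by
      rw [LinearMap.sub_apply, tscale_of_mem _ ha hb, tscale_of_mem _ ha hb,
        tscale_of_mem _ ha hb]
      exact sub_smul (s p q) (t p q) (a ⊗ₜ[K] b)
  rw [e, LinearMap.sub_apply, sub_eq_zero] at this
  exact this

lemma scale_one (x : CTensor R G) : scale R G (fun _ _ => 1) x = x := by
  obtain ⟨c, rfl⟩ := (pre R G).mkC_surj x
  simp only [scale, DirInv.cmap_mkC]
  have e : tscale 𝒜 𝒢 (fun _ _ => (1 : K)) = LinearMap.id :=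
    linearMap_ext_homogeneous (𝒢 := 𝒜) (ℋ := 𝒢) fun p q a ha b hb => by
      simp [tscale_of_mem _ ha hb]
  congr 2
  ext n
  rw [e]; rfl

lemma scale_sum {α : Type*} (S : Finset α) (s : α → ℤ → ℤ → K) (x : CTensor R G) :
    scale R G (fun p q => ∑ i ∈ S, s i p q) x = ∑ i ∈ S, scale R G (s i) x := by
  obtain ⟨c, rfl⟩ := (pre R G).mkC_surj x
  simp only [scale, DirInv.cmap_mkC]
  rw [← map_sum]
  have e : tscale 𝒜 𝒢 (fun p q => ∑ i ∈ S, s i p q) = ∑ i ∈ S, tscale 𝒜 𝒢 (s i) :=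
    linearMap_ext_homogeneous (𝒢 := 𝒜) (ℋ := 𝒢) fun p q a ha b hb => by
      simp [tscale_of_mem _ ha hb, Finset.sum_smul]
  congr 1
  ext n
  refine (DFunLike.congr_fun e (c.1 n)).trans ?_
  simp

lemma scale_degree {m n : ℤ} {x : CTensor R G} (hx : x ∈ degree R G n) :
    scale R G (fun p q => if p + q = m then 1 else 0) x = if n = m then x else 0 := by
  obtain ⟨y, rfl⟩ := hx
  rw [scale_scale]
  split_ifs with h
  · subst h
    congr 2
    ext p q
    split_ifs <;> simp
  · have : (fun p q : ℤ => (if p + q = n then (1 : K) else 0) * if p + q = m then 1 else 0) =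
        fun p q => ∑ i ∈ (∅ : Finset ℤ), (0 : K) := by
      ext p q
      split_ifs with h1 h2 <;> simp
      exact h (h1.symm.trans h2)
    rw [this, scale_sum, Finset.sum_empty]

variable (R G) in
lemma isInternal : IsInternal (degree R G) := by
  have key : ∀ (x : ⨁ n, degree R G n) (m : ℤ),
      scale R G (fun p q => if p + q = m then 1 else 0)
        (DirectSum.coeAddMonoidHom (degree R G) x) = x m := by
    intro x m
    induction x using DirectSum.induction_on with
    | zero => simp
    | of n y =>
      rw [DirectSum.coeAddMonoidHom_of, scale_degree y.2]
      split_ifs with h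
      · subst h; rw [DirectSum.of_eq_same]
      · rw [DirectSum.of_eq_of_ne _ _ _ (Ne.symm h)]; rfl
    | add a b ha hb => simp only [map_add, ha, hb, DirectSum.add_apply, Submodule.coe_add]
  constructor
  · rw [injective_iff_map_eq_zero]
    intro x hx
    ext m
    rw [← key x m, hx, map_zero]; rfl
  · intro x
    obtain ⟨S, hS⟩ := scale_eq_of_eq_on x
    refine ⟨∑ n ∈ S.image (fun pq => pq.1 + pq.2),
      DirectSum.of (fun n => degree R G n) n ⟨_, x, rfl⟩, ?_⟩
    rw [map_sum]
    simp only [DirectSum.coeAddMonoidHom_of]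
    rw [← scale_sum]
    conv_rhs => rw [← scale_one x]
    refine hS _ _ fun pq hpq => ?_
    rw [Finset.sum_ite_eq]
    simp only [Finset.mem_image, ite_eq_left_iff]
    exact fun h => absurd ⟨pq, hpq, rfl⟩ h

noncomputable instance : Decomposition (degree R G) := (isInternal R G).chooseDecomposition

variable (R G)

/-- The differential of `A ⊗ 𝔤`: `d(a ⊗ γ) = d a ⊗ γ + (-1)^p a ⊗ d γ` for `a ∈ A^p`. -/
noncomputable def preD : A ⊗[K] L →ₗ[K] A ⊗[K] L :=
  TensorProduct.map R.d LinearMap.id +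
    TensorProduct.map (scaleDeg 𝒜 fun p => (-1 : K) ^ p) G.d

lemma preD_tmul {p : ℤ} {a : A} (ha : a ∈ 𝒜 p) (x : L) :
    preD R G (a ⊗ₜ x) = R.d a ⊗ₜ x + (-1 : K) ^ p • (a ⊗ₜ G.d x) := by
  simp [preD, scaleDeg_of_mem _ ha, TensorProduct.smul_tmul']

lemma preD_cont : (pre R G).Cont (pre R G) (preD R G) :=
  (DirInv.Cont.tensor_map R.d_cont (DirInv.Cont.id _)).add
    (DirInv.Cont.tensor_map (R.graded.cont_scaleDeg _) G.d_cont)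

/-- The bracket of `A ⊗ 𝔤`, see `preBr_tmul`. It is the sum of the terms for the even and for the
odd components of the factor from `𝔤` in the first argument. -/
noncomputable def preBr (𝒜 : ℤ → Submodule K A) [GradedAlgebra 𝒜] (G : DGLieAlg.{w'} K 𝒢) : A ⊗[K] L →ₗ[K] A ⊗[K] L →ₗ[K] A ⊗[K] L :=
  TensorProduct.map₂ (LinearMap.mul K A)
      (G.br.compl₁₂ (scaleDeg 𝒢 fun q => if Even q then 1 else 0) LinearMap.id) +
    TensorProduct.map₂ ((LinearMap.mul K A).compl₁₂ LinearMap.id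
        (scaleDeg 𝒜 fun p => (-1 : K) ^ p))
      (G.br.compl₁₂ (scaleDeg 𝒢 fun q => if Even q then 0 else 1) LinearMap.id)

lemma preBr_tmul (𝒜 : ℤ → Submodule K A) [GradedAlgebra 𝒜] (G : DGLieAlg.{w'} K 𝒢) (a : A) {q : ℤ} {x : L} (hx : x ∈ 𝒢 q) {p : ℤ} {b : A} (hb : b ∈ 𝒜 p) (y : L) :
    preBr 𝒜 G (a ⊗ₜ x) (b ⊗ₜ y) = (-1 : K) ^ (q * p) • ((a * b) ⊗ₜ G.br x y) := by
  have e₁ := scaleDeg_of_mem (fun q : ℤ => if Even q then (1 : K) else 0) hx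
  have e₂ := scaleDeg_of_mem (fun q : ℤ => if Even q then (0 : K) else 1) hx
  have e₃ := scaleDeg_of_mem (fun p : ℤ => (-1 : K) ^ p) hb
  have e : preBr 𝒜 G (a ⊗ₜ x) (b ⊗ₜ y) =
      (a * b) ⊗ₜ G.br (scaleDeg 𝒢 (fun q : ℤ => if Even q then (1 : K) else 0) x) y +
      (a * scaleDeg 𝒜 (fun p : ℤ => (-1 : K) ^ p) b) ⊗ₜ
        G.br (scaleDeg 𝒢 (fun q : ℤ => if Even q then (0 : K) else 1) x) y := rfl
  rw [e, e₁, e₂, e₃, zpow_mul]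
  rcases Int.even_or_odd q with h | h
  · rw [h.neg_one_zpow]
    simp [h]
  · rw [h.neg_one_zpow]
    simp [Int.not_even_iff_odd.2 h, TensorProduct.smul_tmul']

lemma preBr_cont : (pre R G).BCont (pre R G) (pre R G) (preBr 𝒜 G) := by
  exact (DirInv.BCont.tensor_map₂ R.mul_cont
      (G.br_cont.comp (G.graded.cont_scaleDeg _) (DirInv.Cont.id _))).add
    (DirInv.BCont.tensor_map₂ (R.mul_cont.comp (DirInv.Cont.id _) (R.graded.cont_scaleDeg _))
      (G.br_cont.comp (G.graded.cont_scaleDeg _) (DirInv.Cont.id _)))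

/-- The differential of the DG Lie algebra `A ⊗̂ 𝔤`. -/
noncomputable def d : CTensor R G →ₗ[K] CTensor R G := DirInv.cmap (preD R G) (preD_cont R G)

/-- The bracket of the DG Lie algebra `A ⊗̂ 𝔤`. -/
noncomputable def br : CTensor R G →ₗ[K] CTensor R G →ₗ[K] CTensor R G :=
  DirInv.cbil (preBr 𝒜 G) (preBr_cont R G)

/-- The differential `d + ad(ω)` of the twisted DG Lie algebra `(A ⊗̂ 𝔤)_ω`. -/
noncomputable def twistD (ω : CTensor R G) : CTensor R G →ₗ[K] CTensor R G := d R G + br R G ω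

lemma _root_.DirInv.IsComplete.exists_mem {M : Type*} [AddCommGroup M] [Module K M]
    {D : DirInv.{w} K M} (h : DirInv.IsComplete.{w, w'} D) (x : M) : ∃ j, x ∈ D.F j := by
  obtain ⟨E, -, h₂, h₃, -⟩ := h
  obtain ⟨j, hj⟩ := h₃ x
  obtain ⟨k, hk, -⟩ := h₂ j
  exact ⟨k, hk x hj⟩

lemma act_cont {R : DGComAlg.{w} K 𝒜} (hR : DirInv.IsComplete.{w, w''} R.top) (a : A) :
    (pre R G).Cont (pre R G)
      (TensorProduct.map (LinearMap.mulLeft K a) (LinearMap.id : L →ₗ[K] L)) := by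
  refine DirInv.Cont.tensor_map (fun j => ?_) (DirInv.Cont.id _)
  obtain ⟨k, hk⟩ := hR.exists_mem a
  obtain ⟨l, h₁, h₂⟩ := R.mul_cont k j
  refine ⟨l, fun x hx => h₁ a hk x hx, fun i => ?_⟩
  obtain ⟨i', hi'⟩ := h₂ i
  exact ⟨i', fun x hx => hi' a hk x (R.top.Fi_le _ _ hx) (Or.inr hx)⟩

/-- The action of an element `a` of the complete algebra `A` on `A ⊗̂ 𝔤`, induced by
`b ⊗ γ ↦ a b ⊗ γ`. -/
noncomputable def act {R : DGComAlg.{w} K 𝒜} (hR : DirInv.IsComplete.{w, w''} R.top) (a : A) :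
    CTensor R G →ₗ[K] CTensor R G :=
  DirInv.cmap _ (act_cont G hR a)

end CTensor

/-! ### Extension of Taylor coefficients to `A ⊗̂ 𝔤` -/

/-- Let `Ψ : S(𝔤[1]) → S(𝔤'[1])` be linear. This is the `A`-multilinear extension
`(A ⊗ 𝔤)^j → A ⊗ 𝔤'` of the `j`-th Taylor coefficient of `Ψ`: it sends
`(a₁ ⊗ γ₁, …, a_j ⊗ γ_j)` to the image under `id ⊗ (ln ∘ Ψ)` of the product of the elements
`a_l ⊗ γ_l` in the super tensor product of the algebras `A` and `S(𝔤[1])`; that product is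
`± a₁ ⋯ a_j ⊗ γ₁ ⋯ γ_j`, with the sign given by the Koszul rule. -/
noncomputable def preTaylor (𝒜 : ℤ → Submodule K A) [GradedAlgebra 𝒜]
    (Ψ : SuperSym (shift 𝒢) →ₗ[K] SuperSym (shift 𝒢')) (j : ℕ) :
    MultilinearMap K (fun _ : Fin j => A ⊗[K] L) (A ⊗[K] L') :=
  (TensorProduct.map LinearMap.id (SuperSym.ln (shift 𝒢') ∘ₗ Ψ) ∘ₗ
      (GradedTensorProduct.of K 𝒜
        (SuperSym.degree (shift 𝒢))).symm.toLinearMap).compMultilinearMap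
    ((MultilinearMap.mkPiAlgebraFin K j (𝒜 ᵍ⊗[K] SuperSym.degree (shift 𝒢))).compLinearMap
      fun _ => (GradedTensorProduct.of K 𝒜 (SuperSym.degree (shift 𝒢))).toLinearMap ∘ₗ
        TensorProduct.map LinearMap.id (SuperSym.ι (shift 𝒢)))

lemma prod_mem_graded (j : ℕ) (p : Fin j → ℤ) (a : Fin j → A) (ha : ∀ l, a l ∈ 𝒜 (p l)) :
    ∃ n, (List.ofFn a).prod ∈ 𝒜 n := by
  induction j with
  | zero => exact ⟨0, by simpa using SetLike.GradedOne.one_mem⟩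
  | succ j ih =>
    obtain ⟨n, hn⟩ := ih (fun l => p l.succ) (fun l => a l.succ) fun l => ha l.succ
    rw [List.ofFn_succ, List.prod_cons]
    exact ⟨_, SetLike.GradedMul.mul_mem (ha 0) hn⟩

lemma prod_tmul_ι (j : ℕ) (p q : Fin j → ℤ) (a : Fin j → A) (ha : ∀ l, a l ∈ 𝒜 (p l))
    (x : Fin j → L) (hx : ∀ l, x l ∈ shift 𝒢 (q l)) :
    ∃ ε : K, (List.ofFn fun l => GradedTensorProduct.of K 𝒜 (SuperSym.degree (shift 𝒢))
      (a l ⊗ₜ SuperSym.ι (shift 𝒢) (x l))).prod =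
      ε • GradedTensorProduct.of K 𝒜 (SuperSym.degree (shift 𝒢))
        ((List.ofFn a).prod ⊗ₜ (List.ofFn fun l => SuperSym.ι (shift 𝒢) (x l)).prod) := by
  induction j with
  | zero => exact ⟨1, by simp; rfl⟩
  | succ j ih =>
    obtain ⟨ε, hε⟩ := ih (fun l => p l.succ) (fun l => q l.succ) (fun l => a l.succ)
      (fun l => ha l.succ) (fun l => x l.succ) fun l => hx l.succ
    obtain ⟨n, hn⟩ := prod_mem_graded j (fun l => p l.succ) (fun l => a l.succ) fun l => ha l.succ
    refine ⟨ε * (-1 : K) ^ (q 0 * n), ?_⟩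
    rw [List.ofFn_succ, List.prod_cons, hε, mul_smul_comm]
    have := GradedTensorProduct.tmul_coe_mul_coe_tmul (R := K) 𝒜 (SuperSym.degree (shift 𝒢))
      (a 0) ⟨_, SuperSym.ι_mem_degree (hx 0)⟩ ⟨_, hn⟩
      (List.ofFn fun l : Fin j => SuperSym.ι (shift 𝒢) (x l.succ)).prod
    rw [this.trans (units_zpow_smul (K := K) _ _), smul_smul]
    simp [List.ofFn_succ]

lemma preTaylor_tmul (Ψ : SuperSym (shift 𝒢) →ₗ[K] SuperSym (shift 𝒢')) (j : ℕ)
    (p q : Fin j → ℤ) (a : Fin j → A) (ha : ∀ l, a l ∈ 𝒜 (p l))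
    (x : Fin j → L) (hx : ∀ l, x l ∈ shift 𝒢 (q l)) :
    ∃ ε : K, preTaylor 𝒜 Ψ j (fun l => a l ⊗ₜ x l) =
      ε • ((List.ofFn a).prod ⊗ₜ taylor Ψ j x) := by
  obtain ⟨ε, hε⟩ := prod_tmul_ι (𝒜 := 𝒜) (𝒢 := 𝒢) j p q a ha x hx
  refine ⟨ε, ?_⟩
  have : preTaylor 𝒜 Ψ j (fun l => a l ⊗ₜ x l) =
      TensorProduct.map LinearMap.id (SuperSym.ln (shift 𝒢') ∘ₗ Ψ)
        ((GradedTensorProduct.of K 𝒜 (SuperSym.degree (shift 𝒢))).symm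
          (List.ofFn fun l => GradedTensorProduct.of K 𝒜 (SuperSym.degree (shift 𝒢))
            (a l ⊗ₜ SuperSym.ι (shift 𝒢) (x l))).prod) := by
    simp [preTaylor, MultilinearMap.mkPiAlgebraFin_apply]
  rw [this, hε, map_smul, map_smul]
  simp [taylor, MultilinearMap.mkPiAlgebraFin_apply]

lemma multilinear_span_induction {M N : Type*} [AddCommGroup M] [Module K M] [AddCommGroup N]
    [Module K N] {r : ℕ} (φ : MultilinearMap K (fun _ : Fin r => M) N) (W : Submodule K N)
    (s : Fin r → Set M) (h : ∀ x : Fin r → M, (∀ l, x l ∈ s l) → φ x ∈ W)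
    (x : Fin r → M) (hx : ∀ l, x l ∈ Submodule.span K (s l)) : φ x ∈ W := by
  suffices H : ∀ t : Finset (Fin r), ∀ x : Fin r → M, (∀ l ∈ t, x l ∈ Submodule.span K (s l)) →
      (∀ l ∉ t, x l ∈ s l) → φ x ∈ W from
    H Finset.univ x (fun l _ => hx l) fun l hl => absurd (Finset.mem_univ l) hl
  intro t
  induction t using Finset.induction_on with
  | empty => exact fun x _ hx => h x fun l => hx l (Finset.notMem_empty l)
  | insert l t hl ih =>
    intro x hx hx'
    have key : Submodule.span K (s l) ≤ W.comap (φ.toLinearMap x l) := by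
      refine Submodule.span_le.2 fun y hy => ?_
      change φ (Function.update x l y) ∈ W
      refine ih _ (fun l' hl' => ?_) fun l' hl' => ?_
      · have : l' ≠ l := fun e => hl (e ▸ hl')
        rw [Function.update_of_ne this]
        exact hx l' (Finset.mem_insert_of_mem hl')
      · by_cases e : l' = l
        · subst e; simpa using hy
        · rw [Function.update_of_ne e]
          exact hx' l' (by simp [e, hl'])
    have := key (hx l (Finset.mem_insert_self _ _))
    simpa using this

lemma prod_mcont (R : DGComAlg.{w} K 𝒜) (j : ℕ) :
    R.top.MCont R.top (MultilinearMap.mkPiAlgebraFin K j A) := by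
  induction j with
  | zero =>
    intro _
    obtain ⟨k, hk⟩ := R.one_mem
    refine ⟨k, fun x _ => by simpa using hk, fun i => ⟨0, fun x _ h => ?_⟩⟩
    obtain ⟨l, -⟩ := h
    exact l.elim0
  | succ j ih =>
    intro J
    obtain ⟨k, h₁, h₂⟩ := ih fun l => J l.succ
    obtain ⟨m, h₃, h₄⟩ := R.mul_cont (J 0) k
    have e : ∀ x : Fin (j + 1) → A, MultilinearMap.mkPiAlgebraFin K (j + 1) A x =
        x 0 * MultilinearMap.mkPiAlgebraFin K j A (fun l => x l.succ) := fun x => by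
      simp [MultilinearMap.mkPiAlgebraFin_apply, List.ofFn_succ]
    refine ⟨m, fun x hx => ?_, fun i => ?_⟩
    · rw [e]
      exact h₃ _ (hx 0) _ (h₁ _ fun l => hx l.succ)
    · obtain ⟨a, ha⟩ := h₄ i
      obtain ⟨b, hb⟩ := h₂ a
      refine ⟨max a b, fun x hx h => ?_⟩
      rw [e]
      refine ha _ (hx 0) _ (h₁ _ fun l => hx l.succ) ?_
      obtain ⟨l, hl⟩ := h
      induction l using Fin.cases with
      | zero => exact Or.inl (R.top.Fi_anti _ (le_max_left _ _) hl)
      | succ l =>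
        exact Or.inr (hb _ (fun l => hx l.succ) ⟨l, R.top.Fi_anti _ (le_max_right _ _) hl⟩)

/-- The elements of `A ⊗ 𝔤` in a given member of the dir-inv structure are combinations of
homogeneous elementary tensors of the same kind. -/
lemma tensor_le_span (R : DGComAlg.{w} K 𝒜) (G : DGLieAlg.{w'} K 𝒢) (j : R.top.J) (k : G.top.J) :
    ∃ j' k', ((R.top.tensor G.top).F (j, k) ≤ Submodule.span K {t | ∃ p q, ∃ a ∈ 𝒜 p, ∃ x ∈ 𝒢 q,
        a ∈ R.top.F j' ∧ x ∈ G.top.F k' ∧ a ⊗ₜ[K] x = t}) ∧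
      ∀ i, ∃ i', (R.top.tensor G.top).Fi (j, k) i' ≤
        Submodule.span K {t | ∃ p q, ∃ a ∈ 𝒜 p, ∃ x ∈ 𝒢 q,
          a ∈ R.top.F j' ∧ x ∈ G.top.F k' ∧ (a ∈ R.top.Fi j' i ∨ x ∈ G.top.Fi k' i) ∧
          a ⊗ₜ[K] x = t} := by
  classical
  obtain ⟨j', S, h₁, h₂⟩ := R.graded j
  obtain ⟨k', T, h₃, h₄⟩ := G.graded k
  have e : ∀ (a : A) (x : L), a ⊗ₜ[K] x = ∑ p ∈ (decompose 𝒜 a).support,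
      ∑ q ∈ (decompose 𝒢 x).support, (decompose 𝒜 a p : A) ⊗ₜ[K] (decompose 𝒢 x q : L) := by
    intro a x
    conv_lhs => rw [← sum_support_decompose 𝒜 a, ← sum_support_decompose 𝒢 x]
    simp only [TensorProduct.sum_tmul, TensorProduct.tmul_sum]
    rw [Finset.sum_comm]
  refine ⟨j', k', Submodule.map₂_le.2 fun a ha x hx => ?_, fun i => ?_⟩
  · rw [TensorProduct.mk_apply, e]
    exact sum_mem fun p _ => sum_mem fun q _ => Submodule.subset_span
      ⟨p, q, _, SetLike.coe_mem _, _, SetLike.coe_mem _, (h₁ a ha p).1, (h₃ x hx q).1, rfl⟩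
  · obtain ⟨b, hb⟩ := h₂ i
    obtain ⟨c, hc⟩ := h₄ i
    refine ⟨max b c, sup_le (Submodule.map₂_le.2 fun a ha x hx => ?_)
      (Submodule.map₂_le.2 fun a ha x hx => ?_)⟩
    · rw [TensorProduct.mk_apply, e]
      exact sum_mem fun p _ => sum_mem fun q _ => Submodule.subset_span
        ⟨p, q, _, SetLike.coe_mem _, _, SetLike.coe_mem _, (h₁ a ha p).1,
          (h₃ x (G.top.Fi_le _ _ hx) q).1,
          Or.inr (hc x (G.top.Fi_anti _ (le_max_right _ _) hx) q), rfl⟩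
    · rw [TensorProduct.mk_apply, e]
      exact sum_mem fun p _ => sum_mem fun q _ => Submodule.subset_span
        ⟨p, q, _, SetLike.coe_mem _, _, SetLike.coe_mem _, (h₁ a (R.top.Fi_le _ _ ha) p).1,
          (h₃ x hx q).1, Or.inl (hb a (R.top.Fi_anti _ (le_max_left _ _) ha) p), rfl⟩

lemma preTaylor_cont (R : DGComAlg.{w} K 𝒜) (G : DGLieAlg.{w'} K 𝒢) (G' : DGLieAlg.{w''} K 𝒢')
    {Ψ : SuperSym (shift 𝒢) →ₗ[K] SuperSym (shift 𝒢')} {j : ℕ}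
    (hΨ : G.top.MCont G'.top (taylor Ψ j)) :
    (R.top.tensor G.top).MCont (R.top.tensor G'.top) (preTaylor 𝒜 Ψ j) := by
  intro J
  choose j' k' h₁ h₂ using fun l => tensor_le_span R G (J l).1 (J l).2
  obtain ⟨m, h₃, h₄⟩ := prod_mcont R j j'
  obtain ⟨n, h₅, h₆⟩ := hΨ k'
  have hs : ∀ {q : ℤ} {x : L}, x ∈ 𝒢 q → x ∈ shift 𝒢 (q - 1) := fun h => by
    simpa [shift] using h
  refine ⟨(m, n), fun t ht => ?_, fun i => ?_⟩
  · refine multilinear_span_induction _ _ _ (fun x hx => ?_) t fun l => h₁ l (ht l)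
    choose p q a ha g hg haF hgF hx using hx
    obtain rfl : (fun l => a l ⊗ₜ[K] g l) = x := funext hx
    obtain ⟨ε, hε⟩ := preTaylor_tmul Ψ j p (fun l => q l - 1) a ha g fun l => hs (hg l)
    rw [hε]
    refine Submodule.smul_mem _ _ (Submodule.apply_mem_map₂ _ ?_ (h₅ g hgF))
    simpa [MultilinearMap.mkPiAlgebraFin_apply] using h₃ a haF
  · obtain ⟨b, hb⟩ := h₄ i
    obtain ⟨c, hc⟩ := h₆ i
    choose i' hi' using fun l => h₂ l (max b c)
    refine ⟨Finset.univ.sup i', fun t ht h => ?_⟩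
    obtain ⟨l₀, hl₀⟩ := h
    let s : Fin j → Set (A ⊗[K] L) := fun l => {t | ∃ p q, ∃ a ∈ 𝒜 p, ∃ x ∈ 𝒢 q,
      a ∈ R.top.F (j' l) ∧ x ∈ G.top.F (k' l) ∧
      (l = l₀ → (a ∈ R.top.Fi (j' l) (max b c) ∨ x ∈ G.top.Fi (k' l) (max b c))) ∧
      a ⊗ₜ[K] x = t}
    refine multilinear_span_induction _ _ s (fun x hx => ?_) t fun l => ?_
    · choose p q a ha g hg haF hgF hor hx using hx
      obtain rfl : (fun l => a l ⊗ₜ[K] g l) = x := funext hx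
      obtain ⟨ε, hε⟩ := preTaylor_tmul Ψ j p (fun l => q l - 1) a ha g fun l => hs (hg l)
      rw [hε]
      refine Submodule.smul_mem _ _ ?_
      rcases hor l₀ rfl with h | h
      · refine Submodule.mem_sup_right (Submodule.apply_mem_map₂ _ ?_ (h₅ g hgF))
        simpa [MultilinearMap.mkPiAlgebraFin_apply] using
          hb a haF ⟨l₀, R.top.Fi_anti _ (le_max_left _ _) h⟩
      · refine Submodule.mem_sup_left (Submodule.apply_mem_map₂ _ ?_
          (hc g hgF ⟨l₀, G.top.Fi_anti _ (le_max_right _ _) h⟩))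
        simpa [MultilinearMap.mkPiAlgebraFin_apply] using h₃ a haF
    · by_cases hl : l = l₀
      · subst hl
        refine Submodule.span_mono ?_ (hi' l ((R.top.tensor G.top).Fi_anti _
          (Finset.le_sup (Finset.mem_univ l)) hl₀))
        rintro t ⟨p, q, a, ha, x, hx, h, h', h'', rfl⟩
        exact ⟨p, q, a, ha, x, hx, h, h', fun _ => h'', rfl⟩
      · refine Submodule.span_mono ?_ (h₁ l (ht l))
        rintro t ⟨p, q, a, ha, x, hx, h, h', rfl⟩
        exact ⟨p, q, a, ha, x, hx, h, h', fun e => absurd e hl, rfl⟩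

/-- The Taylor coefficient `∂^j Ψ_A : (A ⊗̂ 𝔤)^j → A ⊗̂ 𝔤'`: the continuous extension to the
complete tensor products of the `A`-multilinear extension of the continuous map `∂^j Ψ`. -/
noncomputable def extTaylor (R : DGComAlg.{w} K 𝒜) (G : DGLieAlg.{w'} K 𝒢)
    (G' : DGLieAlg.{w''} K 𝒢') (Ψ : SuperSym (shift 𝒢) →ₗ[K] SuperSym (shift 𝒢')) (j : ℕ)
    (hΨ : G.top.MCont G'.top (taylor Ψ j)) :
    MultilinearMap K (fun _ : Fin j => CTensor R G) (CTensor R G') :=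
  DirInv.cmulti (preTaylor 𝒜 Ψ j) (preTaylor_cont R G G' hΨ)

/-- The graded symmetric coalgebra `S((A ⊗̂ 𝔤)[1])`. -/
abbrev CSym (R : DGComAlg.{w} K 𝒜) (G : DGLieAlg.{w'} K 𝒢) : Type _ :=
  SuperSym (shift (CTensor.degree R G))

/-- `Θ` is the coalgebra homomorphism `Ψ_A : S((A ⊗̂ 𝔤)[1]) → S((A ⊗̂ 𝔤')[1])` induced by the
continuous `L_∞` morphism `Ψ`: it is the one with Taylor coefficients `∂^j Ψ_A`. -/
def IsExtension (R : DGComAlg.{w} K 𝒜) (G : DGLieAlg.{w'} K 𝒢) (G' : DGLieAlg.{w''} K 𝒢')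
    {Ψ : SuperSym (shift 𝒢) →ₗ[K] SuperSym (shift 𝒢')}
    (hΨ : IsContinuousLInfty G.top G'.top Ψ) (Θ : CSym R G →ₗ[K] CSym R G') : Prop :=
  IsCoalgHom Θ ∧ ∀ j (hj : 1 ≤ j), taylor Θ j = extTaylor R G G' Ψ j (hΨ j hj)

/-- `Θ : S((A ⊗̂ 𝔤)[1]) → S((A ⊗̂ 𝔤')[1])` is `A`-multilinear: for homogeneous `a_l` of degree `p_l`
and `x_l` of degree `q_l` (hence of degree `q_l - 1` in the shifted module),
`∂^j Θ (a₁ x₁, …, a_j x_j) = ± a₁ ⋯ a_j ∂^j Θ (x₁, …, x_j)`, with the sign of the Koszul rule. -/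
def IsMultilinearLInfty {R : DGComAlg.{w} K 𝒜} (hR : DirInv.IsComplete.{w, u} R.top)
    (G : DGLieAlg.{w'} K 𝒢) (G' : DGLieAlg.{w''} K 𝒢') (Θ : CSym R G →ₗ[K] CSym R G') : Prop :=
  ∀ j, 1 ≤ j → ∀ (p q : Fin j → ℤ) (a : Fin j → A) (x : Fin j → CTensor R G),
    (∀ l, a l ∈ 𝒜 (p l)) → (∀ l, x l ∈ CTensor.degree R G (q l)) →
    taylor Θ j (fun l => CTensor.act G hR (a l) (x l)) =
      (∏ l, ∏ k ∈ Finset.Iio l, (-1 : K) ^ (p l * (q k - 1))) •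
        CTensor.act G' hR (List.ofFn a).prod (taylor Θ j x)

end ctensor

/-! ### Induction on products, the counit, and Koszul signs in the super-symmetric algebra -/

section supersym

open DirectSum TensorProduct

namespace SuperSym

variable {K : Type*} [Field K] {M : Type*} [AddCommGroup M] [Module K M] {𝒢 : ℤ → Submodule K M}

section induction
variable [Decomposition 𝒢]

/-! Everything is expressed through logarithms. A coalgebra homomorphism Ψ with Ψ(1) = 1 is replaced
by f = ln ∘ Ψ, and it is recovered from f as the convolution exponential of ι ∘ f (`coalgHom`). A
coderivation is recovered from its Taylor coefficients q as the convolution product (ι ∘ q) * id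
(`coder`). The uniqueness statement `eq_zero_of_comul`, which rests on the Euler operator and on
characteristic 0, says that a map obeying a co-Leibniz rule is zero as soon as its composite with ln
is zero. Hence the condition ΨQ = Q'Ψ amounts to a single equation for f, namely f ∘ Q = d' ∘ f +
½[f, f], whose failure is `linfDefect`; see `IsLInftyMorphism.linfDefect_eq_zero` and
`isLInftyMorphism_coalgHom`.

Extension of scalars. The algebra homomorphism from S((A ⊗ 𝔤)[1]) to the super tensor product A ⊗
S(𝔤[1]) (`tensorMap`) respects the comultiplications (`midMap_comul`) and carries Q to d_A ⊗ 1 ± 1 ⊗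
Q (`tensorMap_coder`); hence the A-multilinear extension of f satisfies the same equation
(`linfDefect_preExt`). The completion is reached in two stages. On Cauchy sequences everything is
computed term by term; then one passes to the quotient by null sequences, through which the extended
f factors because the Taylor coefficients are continuous (`mkS_seqExt_eq_zero`, `exists_comp_map`).
The equation is natural along both stages (`linfDefect_map`), which gives `linfDefect_ctExt` for
`ctExt`, the logarithm of Ψ_A.

Twisting. The twisted logarithm is F(c) = f(e^ω c). The sum is finite: ω lies in A^1 ⊗̂ 𝔤^0, so each
factor ω lowers the 𝔤[1]-degree by one, while f preserves that degree and 𝔤' is bounded below. The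
number of terms is bounded uniformly on the members of the dir-inv structure
(`exists_ctExt_pow_mul_prod_eq_zero`), and this also yields continuity. Since e^ω is grouplike
(`exists_map_expMap_comul`) and the Maurer–Cartan equation gives Q e^ω = e^ω Q_ω
(`IsDGLie.expMap_coder`), F satisfies F ∘ Q_ω = d' ∘ F + ½[F, F]. Its value at 1 is the sum of the
f(ω^k)/k!, which the assumption on the higher coefficients reduces to ω'. Write F = g + ε ω' with ε
the counit. At c = 1 the equation becomes the Maurer–Cartan equation for ω' (`isMC_expMap`), and
what remains is the L∞ equation for g with the twisted differentials (`linfDefect_twistMap`); the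
exponential of g is the twisted morphism. The A-multilinearity persists because the powers of ω have
degree 0 and let scalars pass without a sign (`twistMap_prod_act`). -/

theorem mem_of_ι_mul (P : Submodule K (SuperSym 𝒢)) (h1 : 1 ∈ P)
    (h : ∀ p, ∀ x ∈ 𝒢 p, ∀ c ∈ P, ι 𝒢 x * c ∈ P) (c : SuperSym 𝒢) : c ∈ P := by
  induction c using Decomposition.inductionOn (degree 𝒢) with
  | zero => exact zero_mem _
  | @homogeneous n c =>
    obtain ⟨c, hc⟩ := c
    refine (Submodule.span_le (p := P)).2 ?_ hc
    rintro _ ⟨l, -, rfl⟩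
    induction l with
    | nil => simpa using h1
    | cons a l ih =>
      simp only [List.map_cons, List.prod_cons]
      exact h _ _ a.2.2 _ ih
  | add a b ha hb => exact add_mem ha hb

theorem linearMap_ext {N : Type*} [AddCommGroup N] [Module K N] {f g : SuperSym 𝒢 →ₗ[K] N}
    (h1 : f 1 = g 1) (h : ∀ p, ∀ x ∈ 𝒢 p, ∀ c, f c = g c → f (ι 𝒢 x * c) = g (ι 𝒢 x * c)) :
    f = g :=
  LinearMap.ext fun c => mem_of_ι_mul (LinearMap.eqLocus f g) h1 (fun p x hx c hc => h p x hx c hc) c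

end induction

section scale
variable {N : Type*} [AddCommGroup N] [Module K N] {ℋ : ℤ → Submodule K N}

theorem _root_.scaleDeg_comp_of_degree [Decomposition 𝒢] [Decomposition ℋ] (s t : ℤ → K) (e : ℤ)
    (f : M →ₗ[K] N) (hf : ∀ n, ∀ x ∈ 𝒢 n, f x ∈ ℋ (n + e)) (hst : ∀ n, s (n + e) = t n) (x : M) :
    scaleDeg ℋ s (f x) = f (scaleDeg 𝒢 t x) := by
  suffices scaleDeg ℋ s ∘ₗ f = f ∘ₗ scaleDeg 𝒢 t from DFunLike.congr_fun this x
  refine decompose_lhom_ext 𝒢 fun n => ?_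
  ext ⟨x, hx⟩
  simp [scaleDeg_of_mem s (hf n x hx), scaleDeg_of_mem t hx, hst]

end scale

variable (𝒢) in
/-- The counit of the super-symmetric coalgebra. -/
noncomputable def counitHom : SuperSym 𝒢 →ₐ[K] K := lift 0 (by simp)

@[simp] theorem counitHom_ι (x : M) : counitHom 𝒢 (ι 𝒢 x) = 0 := lift_ι _ _ _

section ln

/-- By construction `ln` is the second component of an algebra homomorphism to the square-zero
extension K ⊕ M, and the first component of that homomorphism is the counit. In K ⊕ M a product with
x sees only the scalar part of the other factor. -/
theorem ln_ι_mul (x : M) (c : SuperSym 𝒢) : ln 𝒢 (ι 𝒢 x * c) = counitHom 𝒢 c • x := by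
  -- The right action of K on M has to be the one chosen inside `ln`, so that both speak of the same
  -- square-zero extension.
  let _ : Module Kᵐᵒᵖ M := Module.compHom _ ((RingHom.id K).fromOpposite mul_comm)
  have : IsCentralScalar K M := ⟨fun r m => rfl⟩
  have h : (TrivSqZeroExt.fstHom K K M).comp (lift (𝒢 := 𝒢) (B := TrivSqZeroExt K M)
      (TrivSqZeroExt.inrHom K M) (fun p q a _ b _ => by simp)) = counitHom 𝒢 :=
    algHom_ext fun x => by simp [lift_ι]
  rw [← h]
  simp [ln, lift_ι]

@[simp] theorem ln_one : ln 𝒢 (1 : SuperSym 𝒢) = 0 := by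
  let _ : Module Kᵐᵒᵖ M := Module.compHom _ ((RingHom.id K).fromOpposite mul_comm)
  have : IsCentralScalar K M := ⟨fun r m => rfl⟩
  simp only [ln, LinearMap.comp_apply, AlgHom.toLinearMap_apply]
  rw [map_one]
  rfl

@[simp] theorem ln_ι (x : M) : ln 𝒢 (ι 𝒢 x) = x := by
  simpa using ln_ι_mul x (1 : SuperSym 𝒢)

theorem ln_mem {n : ℤ} {c : SuperSym 𝒢} (hc : c ∈ degree 𝒢 n) : ln 𝒢 c ∈ 𝒢 n := by
  refine (Submodule.span_le (p := (𝒢 n).comap (ln 𝒢))).2 ?_ hc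
  rintro _ ⟨l, rfl, rfl⟩
  rcases l with _ | ⟨a, _ | ⟨b, l⟩⟩
  · simp
  · simp
  · simp [ln_ι_mul]

end ln

section sign
variable [Decomposition 𝒢]

variable (𝒢) in
/-- The sign `(-1)^(pn)` on the component of degree `n`. -/
noncomputable def psgn (p : ℤ) : SuperSym 𝒢 →ₗ[K] SuperSym 𝒢 :=
  scaleDeg (degree 𝒢) fun n => (-1 : K) ^ (p * n)

theorem psgn_of_mem (p : ℤ) {n : ℤ} {c : SuperSym 𝒢} (hc : c ∈ degree 𝒢 n) :
    psgn 𝒢 p c = (-1 : K) ^ (p * n) • c := scaleDeg_of_mem _ hc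

theorem sgn_of_mem {n : ℤ} {c : SuperSym 𝒢} (hc : c ∈ degree 𝒢 n) :
    sgn 𝒢 c = (-1 : K) ^ n • c := scaleDeg_of_mem _ hc

theorem psgn_one_eq : psgn 𝒢 1 = sgn 𝒢 := by simp [psgn, sgn]

omit [Decomposition 𝒢] in
theorem one_mem_degree : (1 : SuperSym 𝒢) ∈ degree 𝒢 0 := SetLike.GradedOne.one_mem

@[simp] theorem psgn_one (p : ℤ) : psgn 𝒢 p 1 = 1 := by simp [psgn_of_mem p one_mem_degree]

theorem psgn_ι_mul (p : ℤ) {q : ℤ} {x : M} (hx : x ∈ 𝒢 q) (c : SuperSym 𝒢) :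
    psgn 𝒢 p (ι 𝒢 x * c) = (-1 : K) ^ (p * q) • (ι 𝒢 x * psgn 𝒢 p c) := by
  suffices psgn 𝒢 p ∘ₗ LinearMap.mulLeft K (ι 𝒢 x) =
      (-1 : K) ^ (p * q) • (LinearMap.mulLeft K (ι 𝒢 x) ∘ₗ psgn 𝒢 p) from
    DFunLike.congr_fun this c
  refine decompose_lhom_ext (degree 𝒢) fun n => ?_
  ext ⟨c, hc⟩
  have := psgn_of_mem p (SetLike.mul_mem_graded (ι_mem_degree hx) hc)
  simp [this, psgn_of_mem p hc, smul_smul, mul_add, zpow_add₀]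

theorem ι_mul_comm {q : ℤ} {x : M} (hx : x ∈ 𝒢 q) (c : SuperSym 𝒢) :
    c * ι 𝒢 x = ι 𝒢 x * psgn 𝒢 q c := by
  suffices LinearMap.mulRight K (ι 𝒢 x) = LinearMap.mulLeft K (ι 𝒢 x) ∘ₗ psgn 𝒢 q from
    DFunLike.congr_fun this c
  refine linearMap_ext (by simp) fun p y hy c hc => ?_
  simp only [LinearMap.mulRight_apply, LinearMap.comp_apply, LinearMap.mulLeft_apply] at hc ⊢
  rw [mul_assoc, hc, psgn_ι_mul q hy, mul_smul_comm, ← mul_assoc, ← mul_assoc, ι_mul_ι hy hx,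
    mul_comm p q, smul_mul_assoc]

/-- Super-commutativity. -/
theorem mul_comm_of_mem {m n : ℤ} {a b : SuperSym 𝒢} (ha : a ∈ degree 𝒢 m) (hb : b ∈ degree 𝒢 n) :
    a * b = (-1 : K) ^ (m * n) • (b * a) := by
  refine (Submodule.span_le (p := LinearMap.eqLocus (LinearMap.mulLeft K a)
    ((-1 : K) ^ (m * n) • LinearMap.mulRight K a))).2 ?_ hb
  rintro _ ⟨l, rfl, rfl⟩
  simp only [SetLike.mem_coe, LinearMap.mem_eqLocus, LinearMap.mulLeft_apply, LinearMap.smul_apply,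
    LinearMap.mulRight_apply]
  clear hb
  induction l with
  | nil => simp
  | cons x l ih =>
    simp only [List.map_cons, List.prod_cons, List.sum_cons]
    rw [← mul_assoc, ι_mul_comm x.2.2, psgn_of_mem _ ha, mul_smul_comm, smul_mul_assoc, mul_assoc,
      ih, mul_smul_comm, smul_smul, mul_add, zpow_add₀ (by simp), mul_assoc, mul_comm m x.1]

end sign

end SuperSym
end supersym

/-! ### The coalgebra structure and its cocommutativity -/

section supersym

open DirectSum TensorProduct

section gradedTensor

variable {K : Type*} [Field K] {A B : Type*} [Ring A] [Algebra K A] [Ring B] [Algebra K B]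
  (𝒜 : ℤ → Submodule K A) (ℬ : ℤ → Submodule K B) [GradedAlgebra 𝒜] [GradedAlgebra ℬ]

theorem GradedTensorProduct.tmul_mul_tmul_of_mem {p q : ℤ} (a : A) {b : B} (hb : b ∈ ℬ q)
    {a' : A} (ha' : a' ∈ 𝒜 p) (b' : B) :
    of K 𝒜 ℬ (a ⊗ₜ b) * of K 𝒜 ℬ (a' ⊗ₜ b') =
      (-1 : K) ^ (q * p) • of K 𝒜 ℬ ((a * a') ⊗ₜ (b * b')) :=
  (tmul_coe_mul_coe_tmul (R := K) 𝒜 ℬ a ⟨b, hb⟩ ⟨a', ha'⟩ b').trans (units_zpow_smul (K := K) _ _)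

end gradedTensor

namespace SuperSym

variable {K : Type*} [Field K] {M : Type*} [AddCommGroup M] [Module K M] {𝒢 : ℤ → Submodule K M}
  [Decomposition 𝒢]

/-- Left multiplication by `x ⊗ 1 + 1 ⊗ x`, for `x` of degree `p`. -/
noncomputable def comulStep (p : ℤ) (x : M) :
    SuperSym 𝒢 ⊗[K] SuperSym 𝒢 →ₗ[K] SuperSym 𝒢 ⊗[K] SuperSym 𝒢 :=
  TensorProduct.map (LinearMap.mulLeft K (ι 𝒢 x)) LinearMap.id +
    TensorProduct.map (psgn 𝒢 p) (LinearMap.mulLeft K (ι 𝒢 x))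

@[simp] theorem comulStep_tmul (p : ℤ) (x : M) (a b : SuperSym 𝒢) :
    comulStep p x (a ⊗ₜ[K] b) = (ι 𝒢 x * a) ⊗ₜ b + psgn 𝒢 p a ⊗ₜ (ι 𝒢 x * b) := rfl

/-- This is multiplicativity of Δ in the super tensor square, rewritten on the plain tensor product:
the Koszul sign of moving x past the left leg becomes `psgn`. It is the recursion by which later
facts on Δ are proved. -/
theorem comul_ι_mul {p : ℤ} {x : M} (hx : x ∈ 𝒢 p) (c : SuperSym 𝒢) :
    comul 𝒢 (ι 𝒢 x * c) = comulStep p x (comul 𝒢 c) := by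
  have h : comulAlgHom 𝒢 (ι 𝒢 x) = GradedTensorProduct.of K (degree 𝒢) (degree 𝒢) (ι 𝒢 x ⊗ₜ 1) +
      GradedTensorProduct.of K (degree 𝒢) (degree 𝒢) (1 ⊗ₜ ι 𝒢 x) := by
    rw [comulAlgHom, lift_ι]; rfl
  have key : ∀ z : SuperSym 𝒢 ⊗[K] SuperSym 𝒢, (GradedTensorProduct.of K (degree 𝒢) (degree 𝒢)).symm
      (comulAlgHom 𝒢 (ι 𝒢 x) * GradedTensorProduct.of K (degree 𝒢) (degree 𝒢) z) =
      comulStep p x z := by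
    intro z
    let F : SuperSym 𝒢 ⊗[K] SuperSym 𝒢 →ₗ[K] SuperSym 𝒢 ⊗[K] SuperSym 𝒢 :=
      (GradedTensorProduct.of K (degree 𝒢) (degree 𝒢)).symm.toLinearMap ∘ₗ
        GradedTensorProduct.mulHom (degree 𝒢) (degree 𝒢) (comulAlgHom 𝒢 (ι 𝒢 x)) ∘ₗ
        (GradedTensorProduct.of K (degree 𝒢) (degree 𝒢)).toLinearMap
    have : F = comulStep p x := by
      refine linearMap_ext_homogeneous (𝒢 := degree 𝒢) (ℋ := degree 𝒢) fun m n a ha b hb => ?_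
      simp only [F, LinearMap.comp_apply, LinearEquiv.coe_coe, h, map_add, LinearMap.add_apply]
      rw [← GradedTensorProduct.mul_def, ← GradedTensorProduct.mul_def,
        GradedTensorProduct.tmul_mul_tmul_of_mem (degree 𝒢) (degree 𝒢) _ one_mem_degree ha,
        GradedTensorProduct.tmul_mul_tmul_of_mem (degree 𝒢) (degree 𝒢) _ (ι_mem_degree hx) ha]
      simp [psgn_of_mem p ha, smul_tmul']
    exact DFunLike.congr_fun this z
  rw [comul, LinearMap.comp_apply, AlgHom.toLinearMap_apply, map_mul]
  exact key ((GradedTensorProduct.of K (degree 𝒢) (degree 𝒢)).symm (comulAlgHom 𝒢 c))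

@[simp] theorem comul_one : comul 𝒢 (1 : SuperSym 𝒢) = 1 ⊗ₜ 1 := by
  simp [comul]; rfl

theorem comul_ι (x : M) : comul 𝒢 (ι 𝒢 x) = ι 𝒢 x ⊗ₜ 1 + 1 ⊗ₜ ι 𝒢 x := by
  induction x using Decomposition.inductionOn 𝒢 with
  | zero => simp
  | homogeneous x => simpa using comul_ι_mul x.2 1
  | add a b ha hb =>
    simp only [map_add, ha, hb, add_tmul, tmul_add]
    abel

theorem psgn_comm (p q : ℤ) (c : SuperSym 𝒢) : psgn 𝒢 p (psgn 𝒢 q c) = psgn 𝒢 q (psgn 𝒢 p c) := by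
  suffices psgn 𝒢 p ∘ₗ psgn 𝒢 q = psgn 𝒢 q ∘ₗ psgn 𝒢 p from DFunLike.congr_fun this c
  refine decompose_lhom_ext (degree 𝒢) fun n => ?_
  ext ⟨c, hc⟩
  simp [psgn_of_mem p hc, psgn_of_mem q hc, smul_smul, mul_comm]

theorem comul_psgn (p : ℤ) (c : SuperSym 𝒢) :
    comul 𝒢 (psgn 𝒢 p c) = TensorProduct.map (psgn 𝒢 p) (psgn 𝒢 p) (comul 𝒢 c) := by
  suffices comul 𝒢 ∘ₗ psgn 𝒢 p = TensorProduct.map (psgn 𝒢 p) (psgn 𝒢 p) ∘ₗ comul 𝒢 from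
    DFunLike.congr_fun this c
  refine linearMap_ext (by simp) fun q x hx c hc => ?_
  simp only [LinearMap.comp_apply] at hc ⊢
  rw [psgn_ι_mul p hx, map_smul, comul_ι_mul hx, comul_ι_mul hx, hc]
  generalize comul 𝒢 c = z
  induction z using TensorProduct.induction_on with
  | zero => simp
  | add a b ha hb => simp only [map_add, smul_add, ha, hb]
  | tmul a b => simp [psgn_ι_mul p hx, smul_tmul', psgn_comm p q]

@[simp] theorem counitHom_psgn (p : ℤ) (c : SuperSym 𝒢) :
    counitHom 𝒢 (psgn 𝒢 p c) = counitHom 𝒢 c := by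
  suffices (counitHom 𝒢).toLinearMap ∘ₗ psgn 𝒢 p = (counitHom 𝒢).toLinearMap from
    DFunLike.congr_fun this c
  refine linearMap_ext (by simp) fun q x hx c hc => ?_
  simp [psgn_ι_mul p hx]

/-- For each axiom, both sides agree at 1 and turn left multiplication by a generator x into one and
the same operator, so they agree on all products. The instance makes linear maps from S to an
algebra a ring under convolution, where the exponentials below live. -/
noncomputable instance : Coalgebra K (SuperSym 𝒢) where
  comul := comul 𝒢
  counit := (counitHom 𝒢).toLinearMap
  coassoc := by
    refine linearMap_ext (by simp) fun p x hx c hc => ?_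
    simp only [LinearMap.comp_apply, LinearEquiv.coe_coe] at hc ⊢
    -- `T` is left multiplication by x ⊗ 1 ⊗ 1 + 1 ⊗ x ⊗ 1 + 1 ⊗ 1 ⊗ x, with the Koszul signs
    -- carried by `psgn`.
    let T : SuperSym 𝒢 ⊗[K] (SuperSym 𝒢 ⊗[K] SuperSym 𝒢) →ₗ[K]
        SuperSym 𝒢 ⊗[K] (SuperSym 𝒢 ⊗[K] SuperSym 𝒢) :=
      TensorProduct.map (LinearMap.mulLeft K (ι 𝒢 x)) LinearMap.id +
        TensorProduct.map (psgn 𝒢 p) (comulStep p x)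
    have h₁ : ∀ z, TensorProduct.assoc K _ _ _ ((comul 𝒢).rTensor _ (comulStep p x z)) =
        T (TensorProduct.assoc K _ _ _ ((comul 𝒢).rTensor _ z)) := by
      intro z
      induction z using TensorProduct.induction_on with
      | zero => simp
      | add a b ha hb => simp only [map_add, ha, hb]
      | tmul a b =>
        simp only [comulStep_tmul, map_add, LinearMap.rTensor_tmul, comul_ι_mul hx, comul_psgn]
        generalize comul 𝒢 a = z
        induction z using TensorProduct.induction_on with
        | zero => simp
        | add a b ha hb =>
          simp only [map_add, add_tmul, ← ha, ← hb]
          abel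
        | tmul a b => simp [T, add_tmul, tmul_add, add_assoc]
    have h₂ : ∀ z, (comul 𝒢).lTensor _ (comulStep p x z) = T ((comul 𝒢).lTensor _ z) := by
      intro z
      induction z using TensorProduct.induction_on with
      | zero => simp
      | add a b ha hb => simp only [map_add, ha, hb]
      | tmul a b => simp [T, comul_ι_mul hx]
    rw [comul_ι_mul hx, h₁, h₂, hc]
  rTensor_counit_comp_comul := by
    refine linearMap_ext (by simp) fun p x hx c hc => ?_
    have h : ∀ z : SuperSym 𝒢 ⊗[K] SuperSym 𝒢, (counitHom 𝒢).toLinearMap.rTensor _ (comulStep p x z) =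
        TensorProduct.map LinearMap.id (LinearMap.mulLeft K (ι 𝒢 x))
          ((counitHom 𝒢).toLinearMap.rTensor _ z) := by
      intro z
      induction z using TensorProduct.induction_on with
      | zero => simp
      | add a b ha hb => simp only [map_add, ha, hb]
      | tmul a b => simp
    simp only [LinearMap.comp_apply] at hc ⊢
    rw [comul_ι_mul hx, h, hc]
    simp
  lTensor_counit_comp_comul := by
    refine linearMap_ext (by simp) fun p x hx c hc => ?_
    have h : ∀ z : SuperSym 𝒢 ⊗[K] SuperSym 𝒢, (counitHom 𝒢).toLinearMap.lTensor _ (comulStep p x z) =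
        TensorProduct.map (LinearMap.mulLeft K (ι 𝒢 x)) LinearMap.id
          ((counitHom 𝒢).toLinearMap.lTensor _ z) := by
      intro z
      induction z using TensorProduct.induction_on with
      | zero => simp
      | add a b ha hb => simp only [map_add, ha, hb]
      | tmul a b => simp
    simp only [LinearMap.comp_apply] at hc ⊢
    rw [comul_ι_mul hx, h, hc]
    simp

theorem counit_eq (c : SuperSym 𝒢) : Coalgebra.counit (R := K) c = counitHom 𝒢 c := rfl

/-- Cocommutativity. The braiding of the super tensor square is an algebra homomorphism that
exchanges x ⊗ 1 and 1 ⊗ x, so its composite with Δ is an algebra homomorphism agreeing with Δ on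
generators. -/
theorem gradedComm_comul (c : SuperSym 𝒢) : GradedTensorProduct.comm (degree 𝒢) (degree 𝒢)
    (GradedTensorProduct.of K (degree 𝒢) (degree 𝒢) (comul 𝒢 c)) =
    GradedTensorProduct.of K (degree 𝒢) (degree 𝒢) (comul 𝒢 c) := by
  have : ((GradedTensorProduct.comm (degree 𝒢) (degree 𝒢)).toAlgHom.comp (comulAlgHom 𝒢)) =
      comulAlgHom 𝒢 := by
    refine algHom_ext fun x => ?_
    induction x using Decomposition.inductionOn 𝒢 with
    | zero => simp
    | homogeneous x =>
      have h₁ := GradedTensorProduct.comm_coe_tmul_coe (R := K) (degree 𝒢) (degree 𝒢)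
        ⟨_, ι_mem_degree x.2⟩ ⟨_, one_mem_degree⟩
      have h₂ := GradedTensorProduct.comm_coe_tmul_coe (R := K) (degree 𝒢) (degree 𝒢)
        ⟨_, one_mem_degree⟩ ⟨_, ι_mem_degree x.2⟩
      simp only [zero_mul, mul_zero, uzpow_zero, one_smul] at h₁ h₂
      simp only [comulAlgHom, AlgHom.comp_apply, lift_ι, LinearMap.add_apply, map_add]
      refine (congrArg₂ (· + ·) h₁ h₂).trans ?_
      exact add_comm _ _
    | add a b ha hb => simp only [map_add, ha, hb]
  exact DFunLike.congr_fun this c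

end SuperSym
end supersym

/-! ### The grading by order and the Euler operator -/

section supersym

open DirectSum TensorProduct

section tensorGrade

variable {K : Type*} [Field K] {A B N : Type*} [AddCommGroup A] [Module K A] [AddCommGroup B]
  [Module K B] [AddCommGroup N] [Module K N] {I : Type*} [Add I]

/-- The span of the tensors `a ⊗ b` with `a ∈ F i`, `b ∈ G j` and `i + j = n`. -/
def tensorGrade (F : I → Submodule K A) (G : I → Submodule K B) (n : I) : Submodule K (A ⊗[K] B) :=
  Submodule.span K {t | ∃ i j, i + j = n ∧ ∃ a ∈ F i, ∃ b ∈ G j, a ⊗ₜ[K] b = t}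

theorem tmul_mem_tensorGrade {F : I → Submodule K A} {G : I → Submodule K B} {i j n : I}
    (h : i + j = n) {a : A} (ha : a ∈ F i) {b : B} (hb : b ∈ G j) :
    a ⊗ₜ[K] b ∈ tensorGrade F G n := Submodule.subset_span ⟨i, j, h, a, ha, b, hb, rfl⟩

theorem tensorGrade_le {F : I → Submodule K A} {G : I → Submodule K B} {n : I}
    {P : Submodule K (A ⊗[K] B)}
    (h : ∀ i j, i + j = n → ∀ a ∈ F i, ∀ b ∈ G j, a ⊗ₜ[K] b ∈ P) : tensorGrade F G n ≤ P := by
  refine Submodule.span_le.2 ?_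
  rintro _ ⟨i, j, hij, a, ha, b, hb, rfl⟩
  exact h i j hij a ha b hb

theorem map_mem_of_mem_tensorGrade {F : I → Submodule K A} {G : I → Submodule K B} {n : I}
    (H : A ⊗[K] B →ₗ[K] N) (P : Submodule K N)
    (h : ∀ i j, i + j = n → ∀ a ∈ F i, ∀ b ∈ G j, H (a ⊗ₜ b) ∈ P) {t : A ⊗[K] B}
    (ht : t ∈ tensorGrade F G n) : H t ∈ P :=
  tensorGrade_le (P := P.comap H) h ht

theorem map_eq_of_mem_tensorGrade {F : I → Submodule K A} {G : I → Submodule K B} {n : I}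
    {H H' : A ⊗[K] B →ₗ[K] N}
    (h : ∀ i j, i + j = n → ∀ a ∈ F i, ∀ b ∈ G j, H (a ⊗ₜ b) = H' (a ⊗ₜ b)) {t : A ⊗[K] B}
    (ht : t ∈ tensorGrade F G n) : H t = H' t :=
  tensorGrade_le (P := LinearMap.eqLocus H H') h ht

end tensorGrade

namespace SuperSym

variable {K : Type*} [Field K] {M : Type*} [AddCommGroup M] [Module K M] {𝒢 : ℤ → Submodule K M}
  {N : Type*} [AddCommGroup N] [Module K N] {ℋ : ℤ → Submodule K N}

section order

theorem order_zero : order 𝒢 0 = 1 := pow_zero _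

theorem mem_order_zero {c : SuperSym 𝒢} : c ∈ order 𝒢 0 ↔ ∃ a : K, a • (1 : SuperSym 𝒢) = c := by
  rw [order_zero, Submodule.mem_one]
  simp [Algebra.algebraMap_eq_smul_one]

theorem one_mem_order : (1 : SuperSym 𝒢) ∈ order 𝒢 0 := mem_order_zero.2 ⟨1, one_smul _ _⟩

theorem ι_mul_mem_order (x : M) {n : ℕ} {c : SuperSym 𝒢} (hc : c ∈ order 𝒢 n) :
    ι 𝒢 x * c ∈ order 𝒢 (n + 1) := by
  rw [order, pow_succ']
  exact Submodule.mul_mem_mul ⟨x, rfl⟩ hc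

theorem ι_mem_order (x : M) : ι 𝒢 x ∈ order 𝒢 1 := by
  simpa using ι_mul_mem_order (𝒢 := 𝒢) x one_mem_order

theorem order_succ_le [Decomposition 𝒢] {n : ℕ} {P : Submodule K (SuperSym 𝒢)}
    (h : ∀ p, ∀ x ∈ 𝒢 p, ∀ c ∈ order 𝒢 n, ι 𝒢 x * c ∈ P) : order 𝒢 (n + 1) ≤ P := by
  rw [order, pow_succ']
  refine Submodule.mul_le.2 ?_
  rintro _ ⟨x, rfl⟩ c hc
  induction x using Decomposition.inductionOn 𝒢 with
  | zero => simp
  | homogeneous x => exact h _ x x.2 c hc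
  | add a b ha hb => rw [map_add, add_mul]; exact add_mem ha hb

theorem order_one_iff {c : SuperSym 𝒢} : c ∈ order 𝒢 1 ↔ ∃ x, ι 𝒢 x = c := by
  simp [order]

theorem ln_of_order {n : ℕ} (hn : n ≠ 1) {c : SuperSym 𝒢} (hc : c ∈ order 𝒢 n) : ln 𝒢 c = 0 := by
  rcases n with _ | _ | n
  · obtain ⟨a, rfl⟩ := mem_order_zero.1 hc
    simp
  · exact absurd rfl hn
  · rw [order, pow_succ'] at hc
    refine (Submodule.mul_le (P := LinearMap.ker (ln 𝒢))).2 ?_ hc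
    rintro _ ⟨x, rfl⟩ c hc
    rw [pow_succ'] at hc
    rw [LinearMap.mem_ker, ln_ι_mul]
    refine smul_eq_zero_of_left ?_ x
    refine (Submodule.mul_le (P := LinearMap.ker (counitHom 𝒢).toLinearMap)).2 ?_ hc
    rintro _ ⟨x, rfl⟩ c hc
    simp

theorem counitHom_of_order {n : ℕ} (hn : n ≠ 0) {c : SuperSym 𝒢} (hc : c ∈ order 𝒢 n) :
    counitHom 𝒢 c = 0 := by
  obtain ⟨n, rfl⟩ := Nat.exists_eq_succ_of_ne_zero hn
  rw [order, pow_succ'] at hc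
  refine (Submodule.mul_le (P := LinearMap.ker (counitHom 𝒢).toLinearMap)).2 ?_ hc
  rintro _ ⟨x, rfl⟩ c hc
  simp

variable [Decomposition 𝒢]

theorem iSup_order : ⨆ n, order 𝒢 n = ⊤ := by
  refine eq_top_iff.2 fun c _ => mem_of_ι_mul _ ?_ (fun p x hx c hc => ?_) c
  · exact Submodule.mem_iSup_of_mem 0 one_mem_order
  · refine (iSup_le (a := (⨆ n, order 𝒢 n).comap (LinearMap.mulLeft K (ι 𝒢 x)))
      fun n c hc => ?_) hc
    exact Submodule.mem_iSup_of_mem (n + 1) (ι_mul_mem_order x hc)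

theorem linearMap_ext_order {f g : SuperSym 𝒢 →ₗ[K] N} (h : ∀ n, ∀ c ∈ order 𝒢 n, f c = g c) :
    f = g := by
  refine LinearMap.ext fun c => ?_
  have : (⊤ : Submodule K (SuperSym 𝒢)) ≤ LinearMap.eqLocus f g := by
    rw [← iSup_order]
    exact iSup_le h
  exact this Submodule.mem_top

theorem psgn_mem_order (p : ℤ) {n : ℕ} {c : SuperSym 𝒢} (hc : c ∈ order 𝒢 n) :
    psgn 𝒢 p c ∈ order 𝒢 n := by
  induction n generalizing c with
  | zero =>
    obtain ⟨a, rfl⟩ := mem_order_zero.1 hc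
    simpa using hc
  | succ n ih =>
    refine order_succ_le (P := (order 𝒢 (n + 1)).comap (psgn 𝒢 p)) (fun q x hx c hc => ?_) hc
    rw [Submodule.mem_comap, psgn_ι_mul p hx]
    exact Submodule.smul_mem _ _ (ι_mul_mem_order x (ih hc))

/-- Splitting the order between the two legs is what permits truncation of series and induction on
the order: no leg of Δ(c) has order larger than c. -/
theorem comul_mem_order {n : ℕ} {c : SuperSym 𝒢} (hc : c ∈ order 𝒢 n) :
    comul 𝒢 c ∈ tensorGrade (order 𝒢) (order 𝒢) n := by
  induction n generalizing c with
  | zero =>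
    obtain ⟨a, rfl⟩ := mem_order_zero.1 hc
    rw [map_smul, comul_one]
    exact Submodule.smul_mem _ _ (tmul_mem_tensorGrade (zero_add 0) one_mem_order one_mem_order)
  | succ n ih =>
    refine order_succ_le (P := (tensorGrade _ _ (n + 1)).comap (comul 𝒢)) (fun q x hx c hc => ?_) hc
    rw [Submodule.mem_comap, comul_ι_mul hx]
    refine map_mem_of_mem_tensorGrade _ _ (fun i j hij a ha b hb => ?_) (ih hc)
    rw [comulStep_tmul]
    exact add_mem (tmul_mem_tensorGrade (by omega) (ι_mul_mem_order x ha) hb)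
      (tmul_mem_tensorGrade (by omega) (psgn_mem_order q ha) (ι_mul_mem_order x hb))

theorem psgn_mem_degree (p : ℤ) {n : ℤ} {c : SuperSym 𝒢} (hc : c ∈ degree 𝒢 n) :
    psgn 𝒢 p c ∈ degree 𝒢 n := by
  rw [psgn_of_mem p hc]; exact Submodule.smul_mem _ _ hc

theorem comul_mem_degree {n : ℤ} {c : SuperSym 𝒢} (hc : c ∈ degree 𝒢 n) :
    comul 𝒢 c ∈ tensorGrade (degree 𝒢) (degree 𝒢) n := by
  refine (Submodule.span_le (p := (tensorGrade _ _ n).comap (comul 𝒢))).2 ?_ hc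
  rintro _ ⟨l, rfl, rfl⟩
  clear hc
  simp only [Submodule.comap_coe, Set.mem_preimage, SetLike.mem_coe]
  induction l with
  | nil =>
    simpa using tmul_mem_tensorGrade (K := K) (zero_add (0 : ℤ)) (one_mem_degree (𝒢 := 𝒢))
      (one_mem_degree (𝒢 := 𝒢))
  | cons x l ih =>
    simp only [List.map_cons, List.prod_cons, List.sum_cons]
    rw [comul_ι_mul x.2.2]
    refine map_mem_of_mem_tensorGrade _ _ (fun i j hij a ha b hb => ?_) ih
    rw [comulStep_tmul]
    exact add_mem
      (tmul_mem_tensorGrade (by rw [← hij, add_assoc]) (SetLike.mul_mem_graded (ι_mem_degree x.2.2) ha) hb)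
      (tmul_mem_tensorGrade (by rw [← hij]; ring) (psgn_mem_degree _ ha)
        (SetLike.mul_mem_graded (ι_mem_degree x.2.2) hb))

/-- The Euler operator, which multiplies a product of `n` elements of `M` by `n`. -/
noncomputable def euler (𝒢 : ℤ → Submodule K M) [Decomposition 𝒢] : SuperSym 𝒢 →ₗ[K] SuperSym 𝒢 :=
  LinearMap.mul' K (SuperSym 𝒢) ∘ₗ TensorProduct.map (ι 𝒢 ∘ₗ ln 𝒢) LinearMap.id ∘ₗ comul 𝒢

/-- The counit axiom with the scalar ε regarded as an element of S, so that it fits expressions in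
which the two legs are multiplied. -/
theorem mul_counitHom_comul (c : SuperSym 𝒢) :
    LinearMap.mul' K (SuperSym 𝒢) (TensorProduct.map
      (Algebra.linearMap K (SuperSym 𝒢) ∘ₗ (counitHom 𝒢).toLinearMap) LinearMap.id
      (comul 𝒢 c)) = c := by
  have h := DFunLike.congr_fun (Coalgebra.rTensor_counit_comp_comul (R := K) (A := SuperSym 𝒢)) c
  have : LinearMap.mul' K (SuperSym 𝒢) ∘ₗ TensorProduct.map
      (Algebra.linearMap K (SuperSym 𝒢) ∘ₗ (counitHom 𝒢).toLinearMap) LinearMap.id =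
      (TensorProduct.lid K (SuperSym 𝒢)).toLinearMap ∘ₗ
        (Coalgebra.counit (R := K) (A := SuperSym 𝒢)).rTensor _ := by
    refine TensorProduct.ext' fun a b => ?_
    simp [counit_eq, Algebra.smul_def]
  refine (DFunLike.congr_fun this _).trans ?_
  rw [LinearMap.comp_apply]
  refine (congrArg _ h).trans ?_
  simp

/-- In Δ(xc) the generator x sits in one of the legs. On the left, `ln` leaves x times the counit of
the rest, which gives xc. On the right, the sign from `psgn` cancels the one from commuting x past
the length-one left factor, which gives x times the Euler operator of c. -/
theorem euler_ι_mul {p : ℤ} {x : M} (hx : x ∈ 𝒢 p) (c : SuperSym 𝒢) :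
    euler 𝒢 (ι 𝒢 x * c) = ι 𝒢 x * (c + euler 𝒢 c) := by
  have h : LinearMap.mul' K (SuperSym 𝒢) ∘ₗ TensorProduct.map (ι 𝒢 ∘ₗ ln 𝒢) LinearMap.id ∘ₗ
      comulStep p x = LinearMap.mulLeft K (ι 𝒢 x) ∘ₗ LinearMap.mul' K (SuperSym 𝒢) ∘ₗ
        (TensorProduct.map (Algebra.linearMap K (SuperSym 𝒢) ∘ₗ (counitHom 𝒢).toLinearMap)
          LinearMap.id + TensorProduct.map (ι 𝒢 ∘ₗ ln 𝒢) LinearMap.id) := by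
    refine linearMap_ext_homogeneous (𝒢 := degree 𝒢) (ℋ := degree 𝒢) fun m n a ha b hb => ?_
    simp only [LinearMap.comp_apply, comulStep_tmul, map_add, TensorProduct.map_tmul, ln_ι_mul,
      psgn_of_mem p ha, map_smul, LinearMap.mul'_apply, LinearMap.id_apply,
      LinearMap.add_apply, LinearMap.mulLeft_apply]
    congr 1
    · simp [Algebra.algebraMap_eq_smul_one]
    · rw [← mul_assoc (ι 𝒢 x), ι_mul_ι hx (ln_mem ha)]
      simp only [smul_mul_assoc, mul_assoc]
  rw [euler, LinearMap.comp_apply, LinearMap.comp_apply, comul_ι_mul hx]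
  refine (DFunLike.congr_fun h _).trans ?_
  simp only [LinearMap.comp_apply, LinearMap.add_apply, map_add, LinearMap.mulLeft_apply,
    mul_counitHom_comul, mul_add]

theorem euler_of_order {n : ℕ} {c : SuperSym 𝒢} (hc : c ∈ order 𝒢 n) :
    euler 𝒢 c = (n : K) • c := by
  induction n generalizing c with
  | zero =>
    obtain ⟨a, rfl⟩ := mem_order_zero.1 hc
    simp [euler]
  | succ n ih =>
    refine order_succ_le (P := LinearMap.eqLocus (euler 𝒢) (((n + 1 : ℕ) : K) • LinearMap.id))
      (fun p x hx c hc => ?_) hc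
    simp [euler_ι_mul hx, ih hc, mul_add, add_smul, add_comm]

variable [CharZero K]

-- The component of order n lies in the eigenspace of the Euler operator for the eigenvalue n. In
-- characteristic 0 these eigenvalues are distinct, so the components are independent.
variable (𝒢) in
theorem isInternal_order : IsInternal (order 𝒢) := by
  refine isInternal_submodule_of_iSupIndep_of_iSup_eq_top ?_ iSup_order
  have h := (Module.End.eigenspaces_iSupIndep (euler 𝒢)).comp (Nat.cast_injective (R := K))
  refine h.mono fun n c hc => ?_
  exact Module.End.mem_eigenspace_iff.2 (euler_of_order hc)

noncomputable instance : Decomposition (order 𝒢) := (isInternal_order 𝒢).chooseDecomposition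

/-- The Euler operator scales each component by its order, and n ≠ 0 in K for n ≥ 1. This is how
characteristic 0 enters the uniqueness statement for coalgebra maps. -/
theorem euler_eq_zero {c : SuperSym 𝒢} (hc : euler 𝒢 c = 0) : c ∈ order 𝒢 0 := by
  classical
  have h : ∀ c n, ((decompose (order 𝒢) (euler 𝒢 c) n : SuperSym 𝒢)) =
      (n : K) • (decompose (order 𝒢) c n : SuperSym 𝒢) := by
    intro c n
    induction c using Decomposition.inductionOn (order 𝒢) with
    | zero => simp
    | @homogeneous m c =>
      rw [euler_of_order c.2, decompose_smul, decompose_coe, DirectSum.smul_apply]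
      by_cases h : m = n
      · subst h; simp
      · simp [DirectSum.of_eq_of_ne _ _ _ (Ne.symm h)]
    | add a b ha hb => simp [ha, hb]
  rw [← sum_support_decompose (order 𝒢) c]
  refine sum_mem fun n hn => ?_
  rcases n with _ | n
  · exact SetLike.coe_mem _
  · have := h c (n + 1)
    simp only [hc, decompose_zero, DirectSum.zero_apply, ZeroMemClass.coe_zero] at this
    rcases smul_eq_zero.1 this.symm with h | h
    · exact absurd h (by exact_mod_cast Nat.succ_ne_zero n)
    · rw [h]; exact zero_mem _

end order

end SuperSym
end supersym

/-! ### The convolution exponential -/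

section supersym

open DirectSum TensorProduct WithConv

namespace SuperSym

variable {K : Type*} [Field K] {M : Type*} [AddCommGroup M] [Module K M] {𝒢 : ℤ → Submodule K M}
  {N : Type*} [AddCommGroup N] [Module K N] {ℋ : ℤ → Submodule K N} [Decomposition 𝒢]

section exponential

variable {B B' : Type*} [Ring B] [Algebra K B] [Ring B'] [Algebra K B']

theorem conv_apply (g h : WithConv (SuperSym 𝒢 →ₗ[K] B)) (c : SuperSym 𝒢) :
    (g * h).ofConv c = LinearMap.mul' K B (TensorProduct.map g.ofConv h.ofConv (comul 𝒢 c)) := rfl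

/-- The linear map `g` vanishes on the components of order `< n`. -/
def VanishesBelow (n : ℕ) (g : WithConv (SuperSym 𝒢 →ₗ[K] B)) : Prop :=
  ∀ m < n, ∀ c ∈ order 𝒢 m, g.ofConv c = 0

theorem VanishesBelow.mul {m n : ℕ} {g h : WithConv (SuperSym 𝒢 →ₗ[K] B)} (hg : VanishesBelow m g)
    (hh : VanishesBelow n h) : VanishesBelow (m + n) (g * h) := by
  intro k hk c hc
  rw [conv_apply]
  refine map_eq_of_mem_tensorGrade
    (H := LinearMap.mul' K B ∘ₗ TensorProduct.map g.ofConv h.ofConv) (H' := 0)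
    (fun i j hij a ha b hb => ?_) (comul_mem_order hc)
  rcases lt_or_ge i m with h' | h'
  · simp [hg i h' a ha]
  · simp [hh j (by omega) b hb]

omit [Decomposition 𝒢] in
theorem vanishesBelow_zero (g : WithConv (SuperSym 𝒢 →ₗ[K] B)) : VanishesBelow 0 g :=
  fun _ h => absurd h (Nat.not_lt_zero _)

omit [Decomposition 𝒢] in
theorem vanishesBelow_one {g : WithConv (SuperSym 𝒢 →ₗ[K] B)} (hg : g.ofConv 1 = 0) :
    VanishesBelow 1 g := by
  intro m hm c hc
  obtain rfl : m = 0 := by omega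
  obtain ⟨a, rfl⟩ := mem_order_zero.1 hc
  rw [map_smul, hg, smul_zero]

theorem VanishesBelow.pow {g : WithConv (SuperSym 𝒢 →ₗ[K] B)} (hg : VanishesBelow 1 g) (n : ℕ) :
    VanishesBelow n (g ^ n) := by
  induction n with
  | zero => exact vanishesBelow_zero _
  | succ n ih => rw [pow_succ]; exact ih.mul hg

variable [CharZero K]

/-- The convolution exponential of a linear map which vanishes at `1`. -/
noncomputable def cexp (g : WithConv (SuperSym 𝒢 →ₗ[K] B)) : WithConv (SuperSym 𝒢 →ₗ[K] B) :=
  toConv (DirectSum.toModule K ℕ B (fun n =>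
    (∑ k ∈ Finset.range (n + 1), (k.factorial : K)⁻¹ • (g ^ k).ofConv) ∘ₗ (order 𝒢 n).subtype) ∘ₗ
    (decomposeLinearEquiv (order 𝒢)).toLinearMap)

/-- A map that vanishes at 1 has k-th convolution power zero on orders below k, so the cutoff n of
the definition may be raised at will. That freedom lets elements of different orders share one
truncation. -/
theorem cexp_apply {g : WithConv (SuperSym 𝒢 →ₗ[K] B)} (hg : g.ofConv 1 = 0) {n m : ℕ} (hnm : n ≤ m)
    {c : SuperSym 𝒢} (hc : c ∈ order 𝒢 n) : (cexp g).ofConv c =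
      ∑ k ∈ Finset.range (m + 1), (k.factorial : K)⁻¹ • (g ^ k).ofConv c := by
  have : (cexp g).ofConv c =
      ∑ k ∈ Finset.range (n + 1), (k.factorial : K)⁻¹ • (g ^ k).ofConv c := by
    simp only [cexp, LinearMap.comp_apply, LinearEquiv.coe_coe, decomposeLinearEquiv_apply]
    rw [decompose_of_mem _ hc, ← DirectSum.lof_eq_of K, DirectSum.toModule_lof]
    simp
  rw [this]
  refine Finset.sum_subset (Finset.range_mono (by omega)) fun k _ hk => ?_
  rw [(vanishesBelow_one hg).pow k n (by simpa using hk) c hc, smul_zero]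

theorem cexp_one {g : WithConv (SuperSym 𝒢 →ₗ[K] B)} (hg : g.ofConv 1 = 0) :
    (cexp g).ofConv 1 = 1 := by
  rw [cexp_apply hg le_rfl one_mem_order]
  simp [LinearMap.convOne_def, counit_eq]

theorem map_cexp (φ : B →ₐ[K] B') {g : WithConv (SuperSym 𝒢 →ₗ[K] B)} (hg : g.ofConv 1 = 0) :
    φ.toLinearMap ∘ₗ (cexp g).ofConv = (cexp (toConv (φ.toLinearMap ∘ₗ g.ofConv))).ofConv := by
  have hp : ∀ k, φ.toLinearMap ∘ₗ (g ^ k).ofConv = (toConv (φ.toLinearMap ∘ₗ g.ofConv) ^ k).ofConv := by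
    intro k
    induction k with
    | zero => ext c; simp [LinearMap.convOne_def]
    | succ k ih => rw [pow_succ, LinearMap.algHom_comp_convMul_distrib, ih, pow_succ]
  refine linearMap_ext_order fun n c hc => ?_
  rw [LinearMap.comp_apply, cexp_apply hg le_rfl hc, cexp_apply (by simp [hg]) le_rfl hc, map_sum]
  refine Finset.sum_congr rfl fun k _ => ?_
  rw [map_smul, ← hp]; rfl

/-- The classical argument made finite. On order n all the series may be cut at exponent n, also
inside the convolution product since Δ splits the order; `E` denotes the cut series. The binomial
theorem then matches coefficients, the sum running over the triangle i + j ≤ n on one side and over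
the square i, j ≤ n on the other. -/
theorem cexp_add {g h : WithConv (SuperSym 𝒢 →ₗ[K] B)} (hg : g.ofConv 1 = 0) (hh : h.ofConv 1 = 0)
    (hgh : Commute g h) : cexp (g + h) = cexp g * cexp h := by
  refine ofConv_injective (linearMap_ext_order fun n c hc => ?_)
  set E : WithConv (SuperSym 𝒢 →ₗ[K] B) → WithConv (SuperSym 𝒢 →ₗ[K] B) := fun g =>
    ∑ k ∈ Finset.range (n + 1), (k.factorial : K)⁻¹ • g ^ k with hE
  have happ : ∀ (s : Finset (ℕ × ℕ)) (G : ℕ × ℕ → WithConv (SuperSym 𝒢 →ₗ[K] B)) (c : SuperSym 𝒢),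
      (∑ k ∈ s, G k).ofConv c = ∑ k ∈ s, (G k).ofConv c := fun s G c => by
    simp
  have hE' : ∀ g : WithConv (SuperSym 𝒢 →ₗ[K] B), g.ofConv 1 = 0 → ∀ m ≤ n, ∀ c ∈ order 𝒢 m,
      (cexp g).ofConv c = (E g).ofConv c := fun g hg m hm c hc => by
    rw [cexp_apply hg hm hc, hE]; simp
  have h₁ : (cexp g * cexp h).ofConv c = (E g * E h).ofConv c := by
    rw [conv_apply, conv_apply]
    refine map_eq_of_mem_tensorGrade
      (H := LinearMap.mul' K B ∘ₗ TensorProduct.map (cexp g).ofConv (cexp h).ofConv)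
      (H' := LinearMap.mul' K B ∘ₗ TensorProduct.map (E g).ofConv (E h).ofConv)
      (fun i j hij a ha b hb => ?_) (comul_mem_order hc)
    simp only [LinearMap.comp_apply, TensorProduct.map_tmul]
    rw [hE' g hg i (by omega) a ha, hE' h hh j (by omega) b hb]
  have h₂ : E g * E h = ∑ ij ∈ Finset.range (n + 1) ×ˢ Finset.range (n + 1),
      ((ij.1.factorial : K)⁻¹ * (ij.2.factorial : K)⁻¹) • (g ^ ij.1 * h ^ ij.2) := by
    rw [hE, Finset.sum_mul_sum, ← Finset.sum_product']
    refine Finset.sum_congr rfl fun ij _ => ?_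
    rw [smul_mul_smul_comm]
  have h₃ : E (g + h) = ∑ ij ∈ (Finset.range (n + 1)).sigma fun k => Finset.HasAntidiagonal.antidiagonal k,
      ((ij.2.1.factorial : K)⁻¹ * (ij.2.2.factorial : K)⁻¹) • (g ^ ij.2.1 * h ^ ij.2.2) := by
    rw [hE, Finset.sum_sigma]
    refine Finset.sum_congr rfl fun k _ => ?_
    rw [hgh.add_pow', Finset.smul_sum]
    refine Finset.sum_congr rfl fun ij hij => ?_
    rw [Finset.HasAntidiagonal.mem_antidiagonal] at hij
    subst hij
    rw [← Nat.cast_smul_eq_nsmul K, smul_smul]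
    congr 1
    have h := Nat.add_choose_mul_factorial_mul_factorial ij.1 ij.2
    rw [← Nat.choose_symm_add] at h
    have h' : (((ij.1 + ij.2).choose ij.1 : ℕ) : K) * (ij.1.factorial : K) * (ij.2.factorial : K) =
        ((ij.1 + ij.2).factorial : K) := by exact_mod_cast h
    have := Nat.cast_ne_zero (R := K).2 (Nat.factorial_ne_zero ij.1)
    have := Nat.cast_ne_zero (R := K).2 (Nat.factorial_ne_zero ij.2)
    have := Nat.cast_ne_zero (R := K).2 (Nat.factorial_ne_zero (ij.1 + ij.2))
    field_simp
    linear_combination h'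
  rw [hE' (g + h) (by simp [hg, hh]) n le_rfl c hc, h₁, h₂, h₃, happ]
  have e : (∑ ij ∈ (Finset.range (n + 1)).sigma fun k => Finset.HasAntidiagonal.antidiagonal k,
      ((ij.2.1.factorial : K)⁻¹ * (ij.2.2.factorial : K)⁻¹) • (g ^ ij.2.1 * h ^ ij.2.2)) =
      ∑ ij ∈ (Finset.range (n + 1) ×ˢ Finset.range (n + 1)).filter (fun ij => ij.1 + ij.2 ≤ n),
      ((ij.1.factorial : K)⁻¹ * (ij.2.factorial : K)⁻¹) • (g ^ ij.1 * h ^ ij.2) := by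
    refine Finset.sum_bij (fun ij _ => ij.2) ?_ ?_ ?_ ?_
    · rintro ⟨k, i, j⟩ h
      simp only [Finset.mem_sigma, Finset.mem_range, Finset.HasAntidiagonal.mem_antidiagonal, Finset.mem_filter,
        Finset.mem_product] at h ⊢
      omega
    · rintro ⟨k, i, j⟩ h ⟨k', i', j'⟩ h' e
      simp only [Finset.mem_sigma, Finset.mem_range, Finset.HasAntidiagonal.mem_antidiagonal, Prod.mk.injEq] at h h' e
      obtain ⟨rfl, rfl⟩ := e
      obtain rfl : k = k' := by omega
      rfl
    · rintro ⟨i, j⟩ h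
      simp only [Finset.mem_filter, Finset.mem_product, Finset.mem_range] at h
      exact ⟨⟨i + j, i, j⟩, by simp; omega, rfl⟩
    · intro _ _; rfl
  rw [e, happ]
  -- The terms of the square outside the triangle have i + j > n, and gⁱ * hʲ vanishes below order i
  -- + j.
  refine Finset.sum_subset (Finset.filter_subset _ _) fun ij h₁ h₂ => ?_
  have := ((vanishesBelow_one hg).pow ij.1).mul ((vanishesBelow_one hh).pow ij.2) n
    (by simp only [Finset.mem_filter, not_and, not_le] at h₂; exact h₂ h₁) c hc
  simp only [ofConv_smul, LinearMap.smul_apply, this, smul_zero]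

end exponential

end SuperSym
end supersym

/-! ### Coalgebra homomorphisms with prescribed Taylor coefficients -/

section supersym

open DirectSum TensorProduct WithConv

namespace SuperSym

variable {K : Type*} [Field K] {M : Type*} [AddCommGroup M] [Module K M] {𝒢 : ℤ → Submodule K M}
  {N : Type*} [AddCommGroup N] [Module K N] {ℋ : ℤ → Submodule K N} [Decomposition 𝒢]
  [Decomposition ℋ]

section inclusions

instance {A B : Type*} [Ring A] [Algebra K A] [Ring B] [Algebra K B] (𝒜 : ℤ → Submodule K A)
    (ℬ : ℤ → Submodule K B) [GradedAlgebra 𝒜] [GradedAlgebra ℬ] :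
    SMulCommClass K (𝒜 ᵍ⊗[K] ℬ) (𝒜 ᵍ⊗[K] ℬ) := by
  exact Algebra.to_smulCommClass

instance {A B : Type*} [Ring A] [Algebra K A] [Ring B] [Algebra K B] (𝒜 : ℤ → Submodule K A)
    (ℬ : ℤ → Submodule K B) [GradedAlgebra 𝒜] [GradedAlgebra ℬ] :
    IsScalarTower K (𝒜 ᵍ⊗[K] ℬ) (𝒜 ᵍ⊗[K] ℬ) := by
  exact IsScalarTower.right

variable (ℋ) in
/-- Composition with the left inclusion into the super tensor square. -/
noncomputable def inl (g : SuperSym 𝒢 →ₗ[K] SuperSym ℋ) :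
    SuperSym 𝒢 →ₗ[K] (degree ℋ) ᵍ⊗[K] (degree ℋ) :=
  (GradedTensorProduct.includeLeft (degree ℋ) (degree ℋ)).toLinearMap ∘ₗ g

variable (ℋ) in
/-- Composition with the right inclusion into the super tensor square. -/
noncomputable def inr (g : SuperSym 𝒢 →ₗ[K] SuperSym ℋ) :
    SuperSym 𝒢 →ₗ[K] (degree ℋ) ᵍ⊗[K] (degree ℋ) :=
  (GradedTensorProduct.includeRight (degree ℋ) (degree ℋ)).toLinearMap ∘ₗ g

theorem inl_conv_inr (g h : SuperSym 𝒢 →ₗ[K] SuperSym ℋ) (c : SuperSym 𝒢) :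
    (toConv (inl ℋ g) * toConv (inr ℋ h)).ofConv c =
      GradedTensorProduct.of K (degree ℋ) (degree ℋ) (TensorProduct.map g h (comul 𝒢 c)) := by
  rw [conv_apply]
  generalize comul 𝒢 c = z
  induction z using TensorProduct.induction_on with
  | zero => simp
  | add a b ha hb => simp only [map_add, ha, hb]
  | tmul a b =>
    exact GradedTensorProduct.tmul_one_mul_one_tmul (R := K) (degree ℋ) (degree ℋ) (g a) (h b)

/-- Cocommutativity of the source exchanges the arguments of g and h, at the cost of (-1)^(mn).
Multiplication in the super tensor square exchanges their values, at the cost of (-1)^((m+e)n). The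
quotient (-1)^(en) is absorbed by `psgn`. The case e = 0 makes the two inclusions commute; e = 1
produces the sign of the coderivation rule. -/
theorem inr_conv_inl (e : ℤ) {g h : SuperSym 𝒢 →ₗ[K] SuperSym ℋ}
    (hg : ∀ n, ∀ c ∈ degree 𝒢 n, g c ∈ degree ℋ (n + e))
    (hh : ∀ n, ∀ c ∈ degree 𝒢 n, h c ∈ degree ℋ n) :
    toConv (inr ℋ g) * toConv (inl ℋ h) =
      toConv (inl ℋ (h ∘ₗ psgn 𝒢 e)) * toConv (inr ℋ g) := by
  refine ofConv_injective (LinearMap.ext fun c => ?_)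
  rw [inl_conv_inr, conv_apply]
  have hc := gradedComm_comul c
  have hc' : (GradedTensorProduct.of K (degree 𝒢) (degree 𝒢)).symm
    (GradedTensorProduct.comm (degree 𝒢) (degree 𝒢)
      (GradedTensorProduct.of K (degree 𝒢) (degree 𝒢) (comul 𝒢 c))) = comul 𝒢 c := by
    rw [hc]; rfl
  conv_rhs => rw [← hc']
  generalize comul 𝒢 c = z
  suffices LinearMap.mul' K _ ∘ₗ TensorProduct.map (inr ℋ g) (inl ℋ h) =
      (GradedTensorProduct.of K (degree ℋ) (degree ℋ)).toLinearMap ∘ₗ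
        TensorProduct.map (h ∘ₗ psgn 𝒢 e) g ∘ₗ
        (GradedTensorProduct.of K (degree 𝒢) (degree 𝒢)).symm.toLinearMap ∘ₗ
        (GradedTensorProduct.comm (degree 𝒢) (degree 𝒢)).toLinearMap ∘ₗ
        (GradedTensorProduct.of K (degree 𝒢) (degree 𝒢)).toLinearMap from
    DFunLike.congr_fun this z
  refine linearMap_ext_homogeneous (𝒢 := degree 𝒢) (ℋ := degree 𝒢) fun m n a ha b hb => ?_
  have h₁ : GradedTensorProduct.comm (degree 𝒢) (degree 𝒢)
      (GradedTensorProduct.of K (degree 𝒢) (degree 𝒢) (a ⊗ₜ b)) =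
      (-1 : K) ^ (n * m) • GradedTensorProduct.of K (degree 𝒢) (degree 𝒢) (b ⊗ₜ a) :=
    (GradedTensorProduct.comm_coe_tmul_coe (R := K) (degree 𝒢) (degree 𝒢) ⟨a, ha⟩ ⟨b, hb⟩).trans
      (units_zpow_smul (K := K) _ _)
  have h₂ : LinearMap.mul' K _ (TensorProduct.map (inr ℋ g) (inl ℋ h) (a ⊗ₜ[K] b)) =
      (-1 : K) ^ ((m + e) * n) • GradedTensorProduct.of K (degree ℋ) (degree ℋ) (h b ⊗ₜ g a) := by
    have := GradedTensorProduct.tmul_mul_tmul_of_mem (degree ℋ) (degree ℋ) 1 (hg m a ha) (hh n b hb) 1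
    rw [one_mul, mul_one] at this
    exact this
  refine h₂.trans ?_
  have h₃ : (GradedTensorProduct.of K (degree ℋ) (degree ℋ)) (TensorProduct.map (h ∘ₗ psgn 𝒢 e) g
      ((GradedTensorProduct.of K (degree 𝒢) (degree 𝒢)).symm
        ((-1 : K) ^ (n * m) • GradedTensorProduct.of K (degree 𝒢) (degree 𝒢) (b ⊗ₜ a)))) =
      (-1 : K) ^ ((m + e) * n) • GradedTensorProduct.of K (degree ℋ) (degree ℋ) (h b ⊗ₜ g a) := by
    rw [map_smul, map_smul, map_smul, GradedTensorProduct.of_symm_of, TensorProduct.map_tmul,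
      LinearMap.comp_apply, psgn_of_mem e hb, map_smul, ← smul_tmul', map_smul, smul_smul,
      ← zpow_add₀ (by simp)]
    congr 2
    ring
  refine h₃.symm.trans ?_
  exact congrArg (fun z => GradedTensorProduct.of K (degree ℋ) (degree ℋ)
    (TensorProduct.map (h ∘ₗ psgn 𝒢 e) g
      ((GradedTensorProduct.of K (degree 𝒢) (degree 𝒢)).symm z))) h₁.symm

theorem psgn_zero : psgn 𝒢 0 = LinearMap.id := by
  refine decompose_lhom_ext (degree 𝒢) fun n => ?_
  ext ⟨c, hc⟩
  simp [psgn_of_mem 0 hc]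

theorem comulAlgHom_ι (x : N) : comulAlgHom ℋ (ι ℋ x) =
    GradedTensorProduct.includeLeft (degree ℋ) (degree ℋ) (ι ℋ x) +
      GradedTensorProduct.includeRight (degree ℋ) (degree ℋ) (ι ℋ x) := by
  rw [comulAlgHom, lift_ι]; rfl

omit [Decomposition 𝒢] in
theorem comulAlgHom_comp_ι (f : SuperSym 𝒢 →ₗ[K] N) :
    (comulAlgHom ℋ).toLinearMap ∘ₗ ι ℋ ∘ₗ f = inl ℋ (ι ℋ ∘ₗ f) + inr ℋ (ι ℋ ∘ₗ f) :=
  LinearMap.ext fun c => comulAlgHom_ι (f c)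

omit [Decomposition 𝒢] in
theorem comulAlgHom_comp_eq {g : SuperSym 𝒢 →ₗ[K] SuperSym ℋ} {z : SuperSym 𝒢 →ₗ[K] _}
    (h : ∀ c, comulAlgHom ℋ (g c) = GradedTensorProduct.of K (degree ℋ) (degree ℋ) (z c)) :
    comul ℋ ∘ₗ g = z := LinearMap.ext fun c => by
  rw [LinearMap.comp_apply, comul, LinearMap.comp_apply, AlgHom.toLinearMap_apply, h]
  rfl

end inclusions

section coalgHom

variable [CharZero K]

theorem exists_cexp_eq_sum {B : Type*} [Ring B] [Algebra K B]
    {g : WithConv (SuperSym 𝒢 →ₗ[K] B)} (hg : g.ofConv 1 = 0) (c : SuperSym 𝒢) :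
    ∃ n, ∀ m ≥ n, (cexp g).ofConv c =
      ∑ k ∈ Finset.range (m + 1), (k.factorial : K)⁻¹ • (g ^ k).ofConv c := by
  induction c using Decomposition.inductionOn (order 𝒢) with
  | zero => exact ⟨0, by simp⟩
  | @homogeneous n c => exact ⟨n, fun m hm => cexp_apply hg hm c.2⟩
  | add a b ha hb =>
    obtain ⟨n, hn⟩ := ha
    obtain ⟨n', hn'⟩ := hb
    refine ⟨max n n', fun m hm => ?_⟩
    rw [map_add, hn m (by omega), hn' m (by omega), ← Finset.sum_add_distrib]
    simp

/-- The homomorphism of coalgebras with Taylor coefficients given by `f`. -/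
noncomputable def coalgHom (ℋ : ℤ → Submodule K N) (f : SuperSym 𝒢 →ₗ[K] N) :
    SuperSym 𝒢 →ₗ[K] SuperSym ℋ := (cexp (toConv (ι ℋ ∘ₗ f))).ofConv

variable {f : SuperSym 𝒢 →ₗ[K] N}

omit [Decomposition ℋ] in
theorem coalgHom_one (h1 : f 1 = 0) : coalgHom ℋ f 1 = 1 := cexp_one (by simp [h1])

-- A k-fold convolution power multiplies k elements of N. Consequently `ln` picks out the term k = 1
-- of the exponential and the counit picks out k = 0.
omit [CharZero K] [Decomposition ℋ] in
theorem pow_ι_comp_mem_order (k : ℕ) (c : SuperSym 𝒢) :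
    (toConv (ι ℋ ∘ₗ f) ^ k).ofConv c ∈ order ℋ k := by
  induction k generalizing c with
  | zero =>
    rw [pow_zero]
    exact mem_order_zero.2 ⟨counitHom 𝒢 c, (Algebra.algebraMap_eq_smul_one _).symm⟩
  | succ k ih =>
    rw [pow_succ', conv_apply]
    generalize comul 𝒢 c = z
    induction z using TensorProduct.induction_on with
    | zero => simp
    | add a b ha hb => simp only [map_add]; exact add_mem ha hb
    | tmul a b => exact ι_mul_mem_order _ (ih b)

theorem ln_coalgHom (h1 : f 1 = 0) : ln ℋ ∘ₗ coalgHom ℋ f = f := by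
  refine linearMap_ext_order fun n c hc => ?_
  -- The cutoff is taken one above the order, so that the term k = 1 is present even when n = 0.
  rw [LinearMap.comp_apply, coalgHom, cexp_apply (by simp [h1]) (Nat.le_succ n) hc, map_sum,
    Finset.sum_eq_single 1]
  · simp
  · intro k _ hk
    rw [map_smul, ln_of_order hk (pow_ι_comp_mem_order k c), smul_zero]
  · intro h
    simp at h

theorem counitHom_coalgHom (h1 : f 1 = 0) (c : SuperSym 𝒢) :
    counitHom ℋ (coalgHom ℋ f c) = counitHom 𝒢 c := by
  suffices (counitHom ℋ).toLinearMap ∘ₗ coalgHom ℋ f = (counitHom 𝒢).toLinearMap from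
    DFunLike.congr_fun this c
  refine linearMap_ext_order fun n c hc => ?_
  rw [LinearMap.comp_apply, coalgHom, cexp_apply (by simp [h1]) (Nat.le_succ n) hc, map_sum,
    Finset.sum_eq_single 0]
  · simp [LinearMap.convOne_def, counit_eq]
  · intro k _ hk
    rw [map_smul]
    refine smul_eq_zero_of_right _ ?_
    exact counitHom_of_order hk (pow_ι_comp_mem_order k c)
  · intro h
    simp at h

omit [CharZero K] [Decomposition ℋ] in
theorem conv_mem_degree {g h : SuperSym 𝒢 →ₗ[K] SuperSym ℋ} (e e' : ℤ)
    (hg : ∀ n, ∀ c ∈ degree 𝒢 n, g c ∈ degree ℋ (n + e))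
    (hh : ∀ n, ∀ c ∈ degree 𝒢 n, h c ∈ degree ℋ (n + e')) (n : ℤ) (c : SuperSym 𝒢)
    (hc : c ∈ degree 𝒢 n) : (toConv g * toConv h).ofConv c ∈ degree ℋ (n + (e + e')) := by
  rw [conv_apply]
  refine map_mem_of_mem_tensorGrade
    (H := LinearMap.mul' K _ ∘ₗ TensorProduct.map g h) (P := degree ℋ (n + (e + e')))
    (fun i j hij a ha b hb => ?_) (comul_mem_degree hc)
  have : n + (e + e') = (i + e) + (j + e') := by rw [← hij]; ring
  rw [this]
  exact SetLike.mul_mem_graded (hg i a ha) (hh j b hb)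

theorem coalgHom_mem_degree (h1 : f 1 = 0) (hf : ∀ n, ∀ c ∈ degree 𝒢 n, f c ∈ ℋ n) (n : ℤ)
    (c : SuperSym 𝒢) (hc : c ∈ degree 𝒢 n) : coalgHom ℋ f c ∈ degree ℋ n := by
  have hp : ∀ k, ∀ n, ∀ c ∈ degree 𝒢 n, (toConv (ι ℋ ∘ₗ f) ^ k).ofConv c ∈ degree ℋ (n + 0) := by
    intro k
    induction k with
    | zero =>
      intro n c hc
      rw [pow_zero]
      change algebraMap K _ (counitHom 𝒢 c) ∈ _
      by_cases hn : n = 0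
      · subst hn
        rw [Algebra.algebraMap_eq_smul_one]
        exact Submodule.smul_mem _ _ one_mem_degree
      · have : counitHom 𝒢 c = 0 := by
          refine (Submodule.span_le (p := LinearMap.ker (counitHom 𝒢).toLinearMap)).2 ?_ hc
          rintro _ ⟨_ | ⟨a, l⟩, rfl, rfl⟩
          · simp at hn
          · simp
        rw [this, map_zero]
        exact zero_mem _
    | succ k ih =>
      intro n c hc
      rw [pow_succ']
      have := conv_mem_degree (g := ι ℋ ∘ₗ f) (h := (toConv (ι ℋ ∘ₗ f) ^ k).ofConv) 0 0
        (fun n c hc => by rw [add_zero]; exact ι_mem_degree (hf n c hc)) ih n c hc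
      rw [add_zero] at this
      exact this
  obtain ⟨m, hm⟩ := exists_cexp_eq_sum (g := toConv (ι ℋ ∘ₗ f)) (by simp [h1]) c
  rw [coalgHom, hm m le_rfl]
  refine sum_mem fun k _ => Submodule.smul_mem _ _ ?_
  have := hp k n c hc
  rwa [add_zero] at this

/-- Δ is an algebra homomorphism and ι has primitive values, so Δ ∘ exp(ι ∘ f) is the exponential of
the sum of the two inclusions of ι ∘ f. As f has degree 0 these commute, and the exponential factors
into the left and right copies of the map, whose convolution product is (Ψ ⊗ Ψ) ∘ Δ. -/
theorem isCoalgHom_coalgHom (h1 : f 1 = 0) (hf : ∀ n, ∀ c ∈ degree 𝒢 n, f c ∈ ℋ n) :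
    IsCoalgHom (coalgHom ℋ f) where
  comul := by
    refine comulAlgHom_comp_eq fun c => ?_
    have h₁ := map_cexp (comulAlgHom ℋ) (g := toConv (ι ℋ ∘ₗ f)) (by simp [h1])
    have h₂ := DFunLike.congr_fun h₁ c
    refine h₂.trans ?_
    rw [ofConv_toConv, comulAlgHom_comp_ι, toConv_add, cexp_add (by simp [inl, h1])
      (by simp [inr, h1])]
    · have hl := map_cexp (GradedTensorProduct.includeLeft (degree ℋ) (degree ℋ))
        (g := toConv (ι ℋ ∘ₗ f)) (by simp [h1])
      have hr := map_cexp (GradedTensorProduct.includeRight (degree ℋ) (degree ℋ))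
        (g := toConv (ι ℋ ∘ₗ f)) (by simp [h1])
      have := inl_conv_inr (coalgHom ℋ f) (coalgHom ℋ f) c
      rw [LinearMap.comp_apply, ← this]
      have el : cexp (toConv (inl ℋ (ι ℋ ∘ₗ f))) = toConv (inl ℋ (coalgHom ℋ f)) :=
        ofConv_injective hl.symm
      have er : cexp (toConv (inr ℋ (ι ℋ ∘ₗ f))) = toConv (inr ℋ (coalgHom ℋ f)) :=
        ofConv_injective hr.symm
      rw [el, er]
    · have hι : ∀ n, ∀ c ∈ degree 𝒢 n, (ι ℋ ∘ₗ f) c ∈ degree ℋ n := fun n c hc =>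
        ι_mem_degree (hf n c hc)
      have := inr_conv_inl (ℋ := ℋ) 0 (g := ι ℋ ∘ₗ f) (h := ι ℋ ∘ₗ f)
        (fun n c hc => by rw [add_zero]; exact hι n c hc) hι
      rw [psgn_zero, LinearMap.comp_id] at this
      exact this.symm
  degree := coalgHom_mem_degree h1 hf
  one := coalgHom_one h1

end coalgHom

end SuperSym
end supersym

/-! ### Coderivations, and uniqueness of maps with given Taylor coefficients -/

section supersym

open DirectSum TensorProduct WithConv

namespace SuperSym

variable {K : Type*} [Field K] {M : Type*} [AddCommGroup M] [Module K M] {𝒢 : ℤ → Submodule K M}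
  {N : Type*} [AddCommGroup N] [Module K N] {ℋ : ℤ → Submodule K N} [Decomposition 𝒢]
  [Decomposition ℋ]

/-- Cocommutativity, evaluated on linear maps. -/
theorem map_comul_swap {P : Type*} [AddCommGroup P] [Module K P]
    {H H' : SuperSym 𝒢 ⊗[K] SuperSym 𝒢 →ₗ[K] P}
    (h : ∀ m n, ∀ a ∈ degree 𝒢 m, ∀ b ∈ degree 𝒢 n, H (a ⊗ₜ b) = (-1 : K) ^ (m * n) • H' (b ⊗ₜ a))
    (c : SuperSym 𝒢) : H (comul 𝒢 c) = H' (comul 𝒢 c) := by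
  have hc' : (GradedTensorProduct.of K (degree 𝒢) (degree 𝒢)).symm
    (GradedTensorProduct.comm (degree 𝒢) (degree 𝒢)
      (GradedTensorProduct.of K (degree 𝒢) (degree 𝒢) (comul 𝒢 c))) = comul 𝒢 c := by
    rw [gradedComm_comul c]; rfl
  conv_rhs => rw [← hc']
  suffices H = H' ∘ₗ (GradedTensorProduct.of K (degree 𝒢) (degree 𝒢)).symm.toLinearMap ∘ₗ
        (GradedTensorProduct.comm (degree 𝒢) (degree 𝒢)).toLinearMap ∘ₗ
        (GradedTensorProduct.of K (degree 𝒢) (degree 𝒢)).toLinearMap from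
    DFunLike.congr_fun this _
  refine linearMap_ext_homogeneous (𝒢 := degree 𝒢) (ℋ := degree 𝒢) fun m n a ha b hb => ?_
  have h₁ : GradedTensorProduct.comm (degree 𝒢) (degree 𝒢)
      (GradedTensorProduct.of K (degree 𝒢) (degree 𝒢) (a ⊗ₜ b)) =
      (-1 : K) ^ (n * m) • GradedTensorProduct.of K (degree 𝒢) (degree 𝒢) (b ⊗ₜ a) :=
    (GradedTensorProduct.comm_coe_tmul_coe (R := K) (degree 𝒢) (degree 𝒢) ⟨a, ha⟩ ⟨b, hb⟩).trans
      (units_zpow_smul (K := K) _ _)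
  rw [h m n a ha b hb, mul_comm, ← map_smul]
  exact congrArg (fun z => H' ((GradedTensorProduct.of K (degree 𝒢) (degree 𝒢)).symm z)) h₁.symm

/-- The coderivation with Taylor coefficients given by `q`. -/
noncomputable def coder (q : SuperSym 𝒢 →ₗ[K] M) : SuperSym 𝒢 →ₗ[K] SuperSym 𝒢 :=
  (toConv (ι 𝒢 ∘ₗ q) * toConv LinearMap.id).ofConv

theorem coder_apply (q : SuperSym 𝒢 →ₗ[K] M) (c : SuperSym 𝒢) : coder q c =
    LinearMap.mul' K _ (TensorProduct.map (ι 𝒢 ∘ₗ q) LinearMap.id (comul 𝒢 c)) := rfl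

theorem coder_one {q : SuperSym 𝒢 →ₗ[K] M} (h1 : q 1 = 0) : coder q 1 = 0 := by
  simp [coder_apply, h1]

theorem counitHom_coder (q : SuperSym 𝒢 →ₗ[K] M) (c : SuperSym 𝒢) :
    counitHom 𝒢 (coder q c) = 0 := by
  rw [coder_apply]
  generalize comul 𝒢 c = z
  induction z using TensorProduct.induction_on with
  | zero => simp
  | add a b ha hb => simp only [map_add, ha, hb, add_zero]
  | tmul a b => simp

/-- In q(a)·b, `ln` keeps only the counit of b, and the right counit axiom collapses the sum. -/
theorem ln_coder (q : SuperSym 𝒢 →ₗ[K] M) : ln 𝒢 ∘ₗ coder q = q := by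
  refine LinearMap.ext fun c => ?_
  rw [LinearMap.comp_apply, coder_apply]
  have h := DFunLike.congr_fun (Coalgebra.lTensor_counit_comp_comul (R := K) (A := SuperSym 𝒢)) c
  have : ln 𝒢 ∘ₗ LinearMap.mul' K _ ∘ₗ TensorProduct.map (ι 𝒢 ∘ₗ q) LinearMap.id =
      (TensorProduct.rid K M).toLinearMap ∘ₗ q.rTensor _ ∘ₗ
        (Coalgebra.counit (R := K) (A := SuperSym 𝒢)).lTensor _ := by
    refine TensorProduct.ext' fun a b => ?_
    simp [counit_eq, ln_ι_mul]
  refine (DFunLike.congr_fun this _).trans ?_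
  rw [LinearMap.comp_apply, LinearMap.comp_apply]
  refine (congrArg (fun z => TensorProduct.rid K M (q.rTensor _ z)) h).trans ?_
  simp

theorem coder_mem_degree {q : SuperSym 𝒢 →ₗ[K] M} {e : ℤ}
    (hq : ∀ n, ∀ c ∈ degree 𝒢 n, q c ∈ 𝒢 (n + e)) (n : ℤ)
    (c : SuperSym 𝒢) (hc : c ∈ degree 𝒢 n) : coder q c ∈ degree 𝒢 (n + e) := by
  have := conv_mem_degree (ℋ := 𝒢) (g := ι 𝒢 ∘ₗ q) (h := LinearMap.id) e 0
    (fun n c hc => ι_mem_degree (hq n c hc)) (fun n c hc => by simpa using hc) n c hc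
  rwa [add_zero] at this

/-- Applying the algebra homomorphism Δ to (ι ∘ q) * id gives (left + right copy of ι ∘ q) * (left *
right copy of id). The left copy is already in place; the right copy of ι ∘ q must be moved past the
left identity, and `inr_conv_inl` with e = 1 yields the factor `sgn`. -/
theorem comul_coder {q : SuperSym 𝒢 →ₗ[K] M}
    (hq : ∀ n, ∀ c ∈ degree 𝒢 n, q c ∈ 𝒢 (n + 1)) : comul 𝒢 ∘ₗ coder q =
      (TensorProduct.map (coder q) LinearMap.id + TensorProduct.map (sgn 𝒢) (coder q)) ∘ₗ
        comul 𝒢 := by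
  refine comulAlgHom_comp_eq fun c => ?_
  have hid : (comulAlgHom 𝒢).toLinearMap ∘ₗ LinearMap.id =
      (toConv (inl 𝒢 LinearMap.id) * toConv (inr 𝒢 LinearMap.id)).ofConv := by
    refine LinearMap.ext fun c => ?_
    rw [inl_conv_inr, TensorProduct.map_id]
    rfl
  have hl : toConv (inl 𝒢 (ι 𝒢 ∘ₗ q)) * toConv (inl 𝒢 LinearMap.id) = toConv (inl 𝒢 (coder q)) :=
    ofConv_injective (LinearMap.algHom_comp_convMul_distrib
      (GradedTensorProduct.includeLeft (degree 𝒢) (degree 𝒢)) (toConv (ι 𝒢 ∘ₗ q))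
      (toConv LinearMap.id)).symm
  have hr : toConv (inr 𝒢 (ι 𝒢 ∘ₗ q)) * toConv (inr 𝒢 LinearMap.id) = toConv (inr 𝒢 (coder q)) :=
    ofConv_injective (LinearMap.algHom_comp_convMul_distrib
      (GradedTensorProduct.includeRight (degree 𝒢) (degree 𝒢)) (toConv (ι 𝒢 ∘ₗ q))
      (toConv LinearMap.id)).symm
  have h₁ := LinearMap.algHom_comp_convMul_distrib (comulAlgHom 𝒢) (toConv (ι 𝒢 ∘ₗ q))
    (toConv LinearMap.id)
  rw [ofConv_toConv, ofConv_toConv, comulAlgHom_comp_ι, hid, toConv_add, toConv_ofConv, add_mul,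
    ← mul_assoc, ← mul_assoc, inr_conv_inl 1 (g := ι 𝒢 ∘ₗ q) (h := LinearMap.id)
      (fun n c hc => ι_mem_degree (hq n c hc)) (fun n c hc => hc), mul_assoc _ (toConv (inr 𝒢 (ι 𝒢 ∘ₗ q))), hl, hr, LinearMap.id_comp,
    psgn_one_eq] at h₁
  refine (DFunLike.congr_fun h₁ c).trans ?_
  rw [ofConv_add, LinearMap.add_apply, inl_conv_inr, inl_conv_inr, LinearMap.comp_apply,
    LinearMap.add_apply, map_add]

section uniqueness
variable [CharZero K]

/-- The uniqueness principle for maps along Δ. Used with E the difference of two coderivations, the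
square of a coderivation, or ΨQ − Q'Ψ, it reduces an identity between such maps to its composite
with `ln`. The Euler operator shows, by induction on the order, that the values of E are scalars,
and the counit shows that these scalars vanish. -/
theorem eq_zero_of_comul {E F F' : SuperSym 𝒢 →ₗ[K] SuperSym ℋ}
    (hE : comul ℋ ∘ₗ E = (TensorProduct.map E F + TensorProduct.map F' E) ∘ₗ comul 𝒢)
    (hln : ln ℋ ∘ₗ E = 0) (hF : ∀ c, counitHom ℋ (F c) = counitHom 𝒢 c)
    (hF' : ∀ c, counitHom ℋ (F' c) = counitHom 𝒢 c) (hF1 : ln ℋ (F' 1) = 0) : E = 0 := by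
  -- Applying ε ⊗ ε to the co-Leibniz rule gives φ = φ + φ for φ = ε ∘ E, since F and F' preserve
  -- the counit.
  have hε : ∀ c, counitHom ℋ (E c) = 0 := by
    let φ : WithConv (SuperSym 𝒢 →ₗ[K] K) := toConv ((counitHom ℋ).toLinearMap ∘ₗ E)
    have h : φ = φ * 1 + 1 * φ := by
      refine ofConv_injective (LinearMap.ext fun c => ?_)
      have h₁ := congrArg (counitHom ℋ) (mul_counitHom_comul (E c))
      have h₂ := DFunLike.congr_fun hE c
      simp only [LinearMap.comp_apply] at h₂
      rw [h₂] at h₁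
      refine h₁.symm.trans ?_
      change _ = LinearMap.mul' K K (TensorProduct.map φ.ofConv
          (1 : WithConv (SuperSym 𝒢 →ₗ[K] K)).ofConv (comul 𝒢 c)) +
        LinearMap.mul' K K (TensorProduct.map
          (1 : WithConv (SuperSym 𝒢 →ₗ[K] K)).ofConv φ.ofConv (comul 𝒢 c))
      rw [LinearMap.add_apply]
      generalize comul 𝒢 c = z
      induction z using TensorProduct.induction_on with
      | zero => simp
      | add a b ha hb =>
        simp only [map_add] at ha hb ⊢
        rw [add_add_add_comm, ha, hb, add_add_add_comm]
      | tmul a b => simp [φ, hF, hF', LinearMap.convOne_def, counit_eq]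
    rw [mul_one, one_mul, left_eq_add] at h
    exact fun c => DFunLike.congr_fun (congrArg WithConv.ofConv h) c
  -- The Euler operator applies `ln` to the left leg, so the summand E ⊗ F drops out because ln ∘ E
  -- = 0.
  have hθ : ∀ c, euler ℋ (E c) = LinearMap.mul' K _
      (TensorProduct.map (ι ℋ ∘ₗ ln ℋ ∘ₗ F') E (comul 𝒢 c)) := by
    intro c
    have h₂ := DFunLike.congr_fun hE c
    simp only [LinearMap.comp_apply] at h₂
    rw [euler, LinearMap.comp_apply, LinearMap.comp_apply, h₂]
    generalize comul 𝒢 c = z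
    induction z using TensorProduct.induction_on with
    | zero => simp
    | add a b ha hb => simp only [map_add] at ha hb ⊢; rw [ha, hb]
    | tmul a b =>
      have : ln ℋ (E a) = 0 := DFunLike.congr_fun hln a
      simp [this]
  refine linearMap_ext_order fun n => ?_
  induction n using Nat.strong_induction_on with
  | _ n ih =>
    intro c hc
    have h : euler ℋ (E c) = 0 := by
      rw [hθ]
      refine map_eq_of_mem_tensorGrade (H := LinearMap.mul' K _ ∘ₗ
        TensorProduct.map (ι ℋ ∘ₗ ln ℋ ∘ₗ F') E) (H' := 0) (fun i j hij a ha b hb => ?_)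
        (comul_mem_order hc)
      -- A left leg of order 0 is killed by ln(F' 1) = 0; otherwise the right leg has smaller order
      -- and the induction hypothesis applies.
      rcases Nat.eq_zero_or_pos i with rfl | hi
      · obtain ⟨k, rfl⟩ := mem_order_zero.1 ha
        simp [hF1]
      · simp [ih j (by omega) b hb]
    obtain ⟨k, hk⟩ := mem_order_zero.1 (euler_eq_zero h)
    have := hε c
    rw [← hk, map_smul, map_one, smul_eq_mul, mul_one] at this
    rw [← hk, this, zero_smul, LinearMap.zero_apply]

end uniqueness

end SuperSym
end supersym

/-! ### DG Lie algebras as coderivations, and the L∞ equation for logarithms -/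

section supersym

open DirectSum TensorProduct WithConv SuperSym

variable {K : Type*} [Field K] {M : Type*} [AddCommGroup M] [Module K M] {𝒢 : ℤ → Submodule K M}
  {N : Type*} [AddCommGroup N] [Module K N] {ℋ : ℤ → Submodule K N} [Decomposition 𝒢]
  [Decomposition ℋ]

/-- The axioms of a DG Lie algebra. -/
structure IsDGLie (𝒢 : ℤ → Submodule K M) (d : M →ₗ[K] M) (br : M →ₗ[K] M →ₗ[K] M) : Prop where
  d_deg : ∀ p, ∀ x ∈ 𝒢 p, d x ∈ 𝒢 (p + 1)
  d_d : ∀ x, d (d x) = 0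
  br_deg : ∀ p q, ∀ x ∈ 𝒢 p, ∀ y ∈ 𝒢 q, br x y ∈ 𝒢 (p + q)
  leibniz : ∀ p, ∀ x ∈ 𝒢 p, ∀ y, d (br x y) = br (d x) y + (-1 : K) ^ p • br x (d y)
  antisymm : ∀ p q, ∀ x ∈ 𝒢 p, ∀ y ∈ 𝒢 q, br x y = -((-1 : K) ^ (p * q) • br y x)
  jacobi : ∀ p q, ∀ x ∈ 𝒢 p, ∀ y ∈ 𝒢 q, ∀ z,
    br x (br y z) = br (br x y) z + (-1 : K) ^ (p * q) • br y (br x z)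

theorem DGLieAlg.isDGLie (G : DGLieAlg.{w} K 𝒢) : IsDGLie 𝒢 G.d G.br :=
  ⟨G.d_deg, G.d_d, G.br_deg, G.leibniz, G.antisymm, G.jacobi⟩

variable (𝒢) in
/-- The bracket as a symmetric bilinear map of degree `1` on the shifted module. -/
noncomputable def symBr (br : M →ₗ[K] M →ₗ[K] M) : M ⊗[K] M →ₗ[K] M :=
  TensorProduct.lift (br ∘ₗ scaleDeg (shift 𝒢) fun n => (-1 : K) ^ n)

theorem symBr_tmul (br : M →ₗ[K] M →ₗ[K] M) {n : ℤ} {x : M} (hx : x ∈ shift 𝒢 n) (y : M) :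
    symBr 𝒢 br (x ⊗ₜ y) = (-1 : K) ^ n • br x y := by
  simp [symBr, scaleDeg_of_mem _ hx]

namespace IsDGLie

variable {d : M →ₗ[K] M} {br : M →ₗ[K] M →ₗ[K] M} (hM : IsDGLie 𝒢 d br)

include hM

theorem d_mem {n : ℤ} {x : M} (hx : x ∈ shift 𝒢 n) : d x ∈ shift 𝒢 (n + 1) := hM.d_deg _ _ hx

theorem br_mem {m n : ℤ} {x y : M} (hx : x ∈ shift 𝒢 m) (hy : y ∈ shift 𝒢 n) :
    br x y ∈ shift 𝒢 (m + n + 1) := by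
  have := hM.br_deg _ _ x hx y hy
  rwa [show m + 1 + (n + 1) = m + n + 1 + 1 by ring] at this

/-- The shift by one and the sign in `symBr` turn antisymmetry into symmetry. Together with the two
next statements these are the Lie axioms in the shape in which they occur as components of Q² = 0;
all signs depend on parities only, so they are settled by cases. -/
theorem symBr_swap {m n : ℤ} {x y : M} (hx : x ∈ shift 𝒢 m) (hy : y ∈ shift 𝒢 n) :
    symBr 𝒢 br (x ⊗ₜ y) = (-1 : K) ^ (m * n) • symBr 𝒢 br (y ⊗ₜ x) := by
  rw [symBr_tmul br hx, symBr_tmul br hy, hM.antisymm _ _ x hx y hy]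
  by_cases hm : Even m <;> by_cases hn : Even n <;>
    simp only [neg_one_zpow_eq_ite, hm, hn, Int.even_add, Int.even_mul, Int.not_even_one,
      or_true, true_or, or_false, false_or, iff_true, true_iff, iff_false, false_iff, not_true,
      not_false_iff, if_true, if_false] <;> module

theorem symBr_leibniz {m n : ℤ} {x y : M} (hx : x ∈ shift 𝒢 m) (hy : y ∈ shift 𝒢 n) :
    d (symBr 𝒢 br (x ⊗ₜ y)) + symBr 𝒢 br (d x ⊗ₜ y) +
      (-1 : K) ^ (m * n) • symBr 𝒢 br (d y ⊗ₜ x) = 0 := by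
  rw [hM.symBr_swap (hM.d_mem hy) hx, symBr_tmul br hx, symBr_tmul br (hM.d_mem hx),
    symBr_tmul br hx, map_smul, hM.leibniz _ x hx y]
  by_cases hm : Even m <;> by_cases hn : Even n <;>
    simp only [neg_one_zpow_eq_ite, hm, hn, Int.even_add, Int.even_mul, Int.not_even_one,
      or_true, true_or, or_false, false_or, iff_true, true_iff, iff_false, false_iff, not_true,
      not_false_iff, if_true, if_false] <;> module

theorem symBr_jacobi {a b c : ℤ} {x y z : M} (hx : x ∈ shift 𝒢 a) (hy : y ∈ shift 𝒢 b)
    (hz : z ∈ shift 𝒢 c) :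
    symBr 𝒢 br (symBr 𝒢 br (x ⊗ₜ y) ⊗ₜ z) +
      (-1 : K) ^ (b * c) • symBr 𝒢 br (symBr 𝒢 br (x ⊗ₜ z) ⊗ₜ y) +
      (-1 : K) ^ (a * b + a * c) • symBr 𝒢 br (symBr 𝒢 br (y ⊗ₜ z) ⊗ₜ x) = 0 := by
  rw [symBr_tmul br hx, symBr_tmul br hx, symBr_tmul br hy, ← smul_tmul', ← smul_tmul',
    ← smul_tmul', map_smul, map_smul, map_smul, symBr_tmul br (hM.br_mem hx hy),
    symBr_tmul br (hM.br_mem hx hz), symBr_tmul br (hM.br_mem hy hz),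
    hM.antisymm _ _ _ (hM.br_mem hy hz) x hx, hM.jacobi _ _ x hx y hy z,
    hM.antisymm _ _ y hy _ (hM.br_mem hx hz)]
  by_cases ha : Even a <;> by_cases hb : Even b <;> by_cases hc : Even c <;>
    simp only [neg_one_zpow_eq_ite, ha, hb, hc, Int.even_add, Int.even_mul, Int.not_even_one,
      or_true, true_or, or_false, false_or, iff_true, true_iff, iff_false, false_iff, not_true,
      not_false_iff, if_true, if_false] <;> module

end IsDGLie

/-- The Taylor coefficients of the coderivation which corresponds to a DG Lie algebra. -/
noncomputable def dgTaylor (𝒢 : ℤ → Submodule K M) [Decomposition 𝒢] (d : M →ₗ[K] M)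
    (br : M →ₗ[K] M →ₗ[K] M) : SuperSym (shift 𝒢) →ₗ[K] M :=
  d ∘ₗ ln (shift 𝒢) + (2⁻¹ : K) • (symBr 𝒢 br ∘ₗ TensorProduct.map (ln (shift 𝒢)) (ln (shift 𝒢)) ∘ₗ
    comul (shift 𝒢))

section
variable (d : M →ₗ[K] M) (br : M →ₗ[K] M →ₗ[K] M)

theorem dgTaylor_apply (c : SuperSym (shift 𝒢)) : dgTaylor 𝒢 d br c = d (ln _ c) +
    (2⁻¹ : K) • symBr 𝒢 br (TensorProduct.map (ln (shift 𝒢)) (ln (shift 𝒢)) (comul _ c)) := rfl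

@[simp] theorem dgTaylor_one : dgTaylor 𝒢 d br 1 = 0 := by simp [dgTaylor_apply]

@[simp] theorem dgTaylor_ι (x : M) : dgTaylor 𝒢 d br (ι _ x) = d x := by
  simp [dgTaylor_apply, comul_ι]

theorem dgTaylor_ge {n : ℕ} (hn : 3 ≤ n) {c : SuperSym (shift 𝒢)} (hc : c ∈ order (shift 𝒢) n) :
    dgTaylor 𝒢 d br c = 0 := by
  have : TensorProduct.map (ln (shift 𝒢)) (ln (shift 𝒢)) (comul _ c) = 0 := by
    refine map_eq_of_mem_tensorGrade (H' := 0) (fun i j hij a ha b hb => ?_) (comul_mem_order hc)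
    by_cases hi : i = 1
    · simp [ln_of_order (show j ≠ 1 by omega) hb]
    · simp [ln_of_order hi ha]
  rw [dgTaylor_apply, this, ln_of_order (by omega) hc]
  simp

theorem comul_ι_mul_ι {m n : ℤ} {x y : M} (hx : x ∈ 𝒢 m) (hy : y ∈ 𝒢 n) :
    comul 𝒢 (ι 𝒢 x * ι 𝒢 y) = (ι 𝒢 x * ι 𝒢 y) ⊗ₜ 1 + (-1 : K) ^ (m * n) • (ι 𝒢 y ⊗ₜ ι 𝒢 x) +
      (ι 𝒢 x ⊗ₜ ι 𝒢 y + 1 ⊗ₜ (ι 𝒢 x * ι 𝒢 y)) := by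
  rw [comul_ι_mul hx, comul_ι, map_add, comulStep_tmul, comulStep_tmul,
    psgn_of_mem m (ι_mem_degree hy), psgn_one, ← smul_tmul']
  simp only [mul_one]

variable {d br} [CharZero K]

/-- Δ(xy) contains both x ⊗ y and ± y ⊗ x, which contribute equally by symmetry; this is the reason
for the factor ½ in `dgTaylor`. -/
theorem IsDGLie.dgTaylor_ι_mul_ι (hM : IsDGLie 𝒢 d br) {m n : ℤ} {x y : M} (hx : x ∈ shift 𝒢 m)
    (hy : y ∈ shift 𝒢 n) : dgTaylor 𝒢 d br (ι _ x * ι _ y) = symBr 𝒢 br (x ⊗ₜ y) := by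
  rw [dgTaylor_apply, comul_ι_mul_ι hx hy]
  simp only [map_add, map_smul, TensorProduct.map_tmul, ln_one, ln_ι, ln_ι_mul, counitHom_ι,
    zero_smul, tmul_zero, zero_tmul, map_zero, zero_add, add_zero]
  rw [← hM.symBr_swap hx hy, ← two_smul K, smul_smul, inv_mul_cancel₀ two_ne_zero, one_smul]

theorem dgTaylor_mem_degree (hM : IsDGLie 𝒢 d br) (n : ℤ) (c : SuperSym (shift 𝒢))
    (hc : c ∈ degree (shift 𝒢) n) : dgTaylor 𝒢 d br c ∈ shift 𝒢 (n + 1) := by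
  rw [dgTaylor_apply]
  refine add_mem (hM.d_mem (ln_mem hc)) (Submodule.smul_mem _ _ ?_)
  refine map_mem_of_mem_tensorGrade (H := symBr 𝒢 br ∘ₗ TensorProduct.map (ln (shift 𝒢))
    (ln (shift 𝒢))) (P := shift 𝒢 (n + 1)) (fun i j hij a ha b hb => ?_) (comul_mem_degree hc)
  rw [LinearMap.comp_apply, TensorProduct.map_tmul, symBr_tmul br (ln_mem ha), ← hij]
  exact Submodule.smul_mem _ _ (hM.br_mem (ln_mem ha) (ln_mem hb))

/-- The Taylor coefficients of a coderivation which corresponds to a DG Lie algebra. -/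
theorem IsDGLieCoderivation.ln_comp (hM : IsDGLie 𝒢 d br)
    {Q : SuperSym (shift 𝒢) →ₗ[K] SuperSym (shift 𝒢)} (hQ : IsDGLieCoderivation 𝒢 d br Q) :
    ln (shift 𝒢) ∘ₗ Q = dgTaylor 𝒢 d br := by
  refine linearMap_ext_order fun n c hc => ?_
  rw [LinearMap.comp_apply]
  rcases n with _ | _ | _ | n
  · obtain ⟨k, rfl⟩ := mem_order_zero.1 hc
    simp [hQ.one]
  · obtain ⟨x, rfl⟩ := order_one_iff.1 hc
    rw [hQ.taylor_one, dgTaylor_ι]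
  · refine order_succ_le (P := LinearMap.eqLocus (ln (shift 𝒢) ∘ₗ Q) (dgTaylor 𝒢 d br))
      (fun p x hx c hc => ?_) hc
    obtain ⟨y, rfl⟩ := order_one_iff.1 hc
    rw [LinearMap.mem_eqLocus, LinearMap.comp_apply]
    induction y using Decomposition.inductionOn (shift 𝒢) with
    | zero => simp
    | homogeneous y =>
      rw [hM.dgTaylor_ι_mul_ι hx y.2, hQ.taylor_two _ x hx, symBr_tmul br hx, add_sub_cancel_right]
    | add a b ha hb =>
      simp only [map_add, mul_add, ha (ι_mem_order a), hb (ι_mem_order b)]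
  · rw [hQ.taylor_ge _ (by omega) c hc, dgTaylor_ge d br (by omega) hc]

/-- The difference of two coderivations obeys the same rule and has zero composite with `ln`. So the
coderivations that are merely asserted to exist in `IsLInftyMorphism` may be replaced by explicit
ones. -/
theorem IsDGLieCoderivation.eq_coder (hM : IsDGLie 𝒢 d br)
    {Q : SuperSym (shift 𝒢) →ₗ[K] SuperSym (shift 𝒢)} (hQ : IsDGLieCoderivation 𝒢 d br Q) :
    Q = coder (dgTaylor 𝒢 d br) := by
  rw [← sub_eq_zero]
  refine eq_zero_of_comul (F := LinearMap.id) (F' := sgn (shift 𝒢)) ?_ ?_ (fun c => rfl)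
    (fun c => ?_) ?_
  · rw [LinearMap.comp_sub, hQ.coderivation, comul_coder (dgTaylor_mem_degree hM),
      ← LinearMap.sub_comp]
    congr 1
    refine TensorProduct.ext' fun a b => ?_
    simp only [LinearMap.sub_apply, LinearMap.add_apply, TensorProduct.map_tmul, sub_tmul, tmul_sub]
    abel
  · rw [LinearMap.comp_sub, hQ.ln_comp hM, ln_coder, sub_self]
  · rw [← psgn_one_eq, counitHom_psgn]
  · rw [← psgn_one_eq, psgn_one, ln_one]

theorem order_two_le {P : Submodule K (SuperSym 𝒢)}
    (h : ∀ m n, ∀ x ∈ 𝒢 m, ∀ y ∈ 𝒢 n, ι 𝒢 x * ι 𝒢 y ∈ P) : order 𝒢 2 ≤ P := by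
  refine order_succ_le fun m x hx c hc => ?_
  refine order_succ_le (n := 0) (P := P.comap (LinearMap.mulLeft K (ι 𝒢 x)))
    (fun n y hy c hc => ?_) hc
  obtain ⟨k, rfl⟩ := mem_order_zero.1 hc
  simpa using P.smul_mem k (h m n x hx y hy)

theorem order_three_le {P : Submodule K (SuperSym 𝒢)}
    (h : ∀ m n l, ∀ x ∈ 𝒢 m, ∀ y ∈ 𝒢 n, ∀ z ∈ 𝒢 l, ι 𝒢 x * (ι 𝒢 y * ι 𝒢 z) ∈ P) :
    order 𝒢 3 ≤ P :=
  order_succ_le fun m x hx _ hc => order_two_le (P := P.comap (LinearMap.mulLeft K (ι 𝒢 x)))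
    (fun n l y hy z hz => h m n l x hx y hy z hz) hc

/-- The rule for Δ ∘ Q produces two quadratic terms, one for each leg on which Q acts.
Cocommutativity and the symmetry of the bracket identify them, which cancels the ½. -/
theorem IsDGLie.dgTaylor_coder (hM : IsDGLie 𝒢 d br) (c : SuperSym (shift 𝒢)) :
    dgTaylor 𝒢 d br (coder (dgTaylor 𝒢 d br) c) = d (dgTaylor 𝒢 d br c) +
      symBr 𝒢 br (TensorProduct.map (dgTaylor 𝒢 d br) (ln (shift 𝒢)) (comul _ c)) := by
  have h := DFunLike.congr_fun (comul_coder (dgTaylor_mem_degree hM)) c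
  have hl := fun c => DFunLike.congr_fun (ln_coder (dgTaylor 𝒢 d br)) c
  simp only [LinearMap.comp_apply] at h hl
  have h₁ : symBr 𝒢 br (TensorProduct.map (ln (shift 𝒢)) (ln (shift 𝒢))
      (TensorProduct.map (sgn (shift 𝒢)) (coder (dgTaylor 𝒢 d br)) (comul _ c))) =
      symBr 𝒢 br (TensorProduct.map (dgTaylor 𝒢 d br) (ln (shift 𝒢)) (comul _ c)) := by
    refine map_comul_swap (H := symBr 𝒢 br ∘ₗ TensorProduct.map (ln (shift 𝒢)) (ln (shift 𝒢)) ∘ₗ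
      TensorProduct.map (sgn (shift 𝒢)) (coder (dgTaylor 𝒢 d br)))
      (H' := symBr 𝒢 br ∘ₗ TensorProduct.map (dgTaylor 𝒢 d br) (ln (shift 𝒢)))
      (fun m n a ha b hb => ?_) c
    simp only [LinearMap.comp_apply, TensorProduct.map_tmul, hl, sgn_of_mem ha, map_smul]
    rw [← smul_tmul', map_smul, hM.symBr_swap (ln_mem ha) (dgTaylor_mem_degree hM n b hb),
      smul_smul, ← zpow_add₀ (by simp)]
    congr 1
    rw [neg_one_zpow_eq_ite, neg_one_zpow_eq_ite]
    congr 1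
    by_cases hm : Even m <;> by_cases hn : Even n <;>
      simp [Int.even_add, Int.even_mul, Int.not_even_one, hm, hn]
  have h₂ : TensorProduct.map (ln (shift 𝒢)) (ln (shift 𝒢))
      (TensorProduct.map (coder (dgTaylor 𝒢 d br)) LinearMap.id (comul _ c)) =
      TensorProduct.map (dgTaylor 𝒢 d br) (ln (shift 𝒢)) (comul _ c) := by
    rw [← LinearMap.comp_apply, ← TensorProduct.map_comp, ln_coder]
    rfl
  rw [dgTaylor_apply d br (coder _ c), hl, h, LinearMap.add_apply, map_add, map_add, h₁, h₂,
    ← two_smul K, smul_smul, inv_mul_cancel₀ two_ne_zero, one_smul]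

/-- The components of ln ∘ Q² by order: d² = 0 in order 1, the Leibniz rule in order 2, the Jacobi
identity in order 3. Order 0 is trivial, and beyond order 3 nothing remains as the Taylor
coefficients stop at two arguments. -/
theorem IsDGLie.dgTaylor_coder_eq_zero (hM : IsDGLie 𝒢 d br) :
    dgTaylor 𝒢 d br ∘ₗ coder (dgTaylor 𝒢 d br) = 0 := by
  refine linearMap_ext_order fun n c hc => ?_
  rw [LinearMap.comp_apply, hM.dgTaylor_coder, LinearMap.zero_apply]
  rcases n with _ | _ | _ | _ | n
  · obtain ⟨k, rfl⟩ := mem_order_zero.1 hc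
    simp
  · obtain ⟨x, rfl⟩ := order_one_iff.1 hc
    simp [comul_ι, hM.d_d]
  · refine order_two_le (P := LinearMap.ker (d ∘ₗ dgTaylor 𝒢 d br + symBr 𝒢 br ∘ₗ
      TensorProduct.map (dgTaylor 𝒢 d br) (ln (shift 𝒢)) ∘ₗ comul _))
      (fun m n x hx y hy => ?_) hc
    rw [LinearMap.mem_ker]
    simp only [LinearMap.add_apply, LinearMap.comp_apply, comul_ι_mul_ι hx hy, map_add, map_smul,
      TensorProduct.map_tmul, ln_one, ln_ι, ln_ι_mul, counitHom_ι, dgTaylor_one, dgTaylor_ι,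
      tmul_zero, zero_tmul, map_zero, zero_add, add_zero, zero_smul, hM.dgTaylor_ι_mul_ι hx hy]
    rw [← hM.symBr_leibniz hx hy]
    abel
  · refine order_three_le (P := LinearMap.ker (d ∘ₗ dgTaylor 𝒢 d br + symBr 𝒢 br ∘ₗ
      TensorProduct.map (dgTaylor 𝒢 d br) (ln (shift 𝒢)) ∘ₗ comul _))
      (fun m n l x hx y hy z hz => ?_) hc
    rw [LinearMap.mem_ker]
    have h3 : dgTaylor 𝒢 d br (ι _ x * (ι _ y * ι _ z)) = 0 :=
      dgTaylor_ge d br le_rfl (ι_mul_mem_order x (ι_mul_mem_order y (ι_mem_order z)))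
    simp only [LinearMap.add_apply, LinearMap.comp_apply, comul_ι_mul hx, comul_ι_mul_ι hy hz,
      map_add, map_smul, comulStep_tmul, psgn_of_mem m (ι_mem_degree hz),
      psgn_of_mem m (ι_mem_degree hy), psgn_ι_mul m hy, psgn_one, h3,
      TensorProduct.map_tmul, ln_one, ln_ι, ln_ι_mul, counitHom_ι, dgTaylor_one, dgTaylor_ι,
      tmul_zero, zero_tmul, map_zero, zero_add, add_zero, zero_smul, hM.dgTaylor_ι_mul_ι hx hy,
      mul_one, map_mul, zero_mul, mul_zero, smul_zero, hM.dgTaylor_ι_mul_ι hx hz,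
      mul_smul_comm, hM.dgTaylor_ι_mul_ι hy hz]
    rw [← hM.symBr_jacobi hx hy hz, zpow_add₀ (by simp)]
    simp only [← smul_tmul', map_smul, smul_smul]
    module
  · have : TensorProduct.map (dgTaylor 𝒢 d br) (ln (shift 𝒢)) (comul _ c) = 0 := by
      refine map_eq_of_mem_tensorGrade (H' := 0) (fun i j hij a ha b hb => ?_) (comul_mem_order hc)
      by_cases hj : j = 1
      · simp [dgTaylor_ge d br (show 3 ≤ i by omega) ha]
      · simp [ln_of_order hj hb]
    rw [dgTaylor_ge d br (by omega) hc, this]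
    simp

theorem sgn_coder {q : SuperSym 𝒢 →ₗ[K] M} (hq : ∀ n, ∀ c ∈ degree 𝒢 n, q c ∈ 𝒢 (n + 1))
    (c : SuperSym 𝒢) : sgn 𝒢 (coder q c) = -coder q (sgn 𝒢 c) := by
  suffices sgn 𝒢 ∘ₗ coder q = -(coder q ∘ₗ sgn 𝒢) from DFunLike.congr_fun this c
  refine decompose_lhom_ext (degree 𝒢) fun n => ?_
  ext ⟨c, hc⟩
  have := coder_mem_degree hq n c hc
  simp [sgn_of_mem hc, sgn_of_mem this, zpow_add₀]

theorem sgn_sgn (c : SuperSym 𝒢) : sgn 𝒢 (sgn 𝒢 c) = c := by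
  suffices sgn 𝒢 ∘ₗ sgn 𝒢 = LinearMap.id from DFunLike.congr_fun this c
  refine decompose_lhom_ext (degree 𝒢) fun n => ?_
  ext ⟨c, hc⟩
  simp [sgn_of_mem hc, smul_smul, ← mul_zpow]

/-- Q anticommutes with `sgn`, so in Δ ∘ Q² the mixed terms cancel and Q² obeys an unsigned
co-Leibniz rule; its composite with `ln` is q ∘ Q, and `eq_zero_of_comul` concludes. -/
theorem coder_coder {q : SuperSym 𝒢 →ₗ[K] M} (hq : ∀ n, ∀ c ∈ degree 𝒢 n, q c ∈ 𝒢 (n + 1))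
    (h : q ∘ₗ coder q = 0) : coder q ∘ₗ coder q = 0 := by
  refine eq_zero_of_comul (F := LinearMap.id) (F' := LinearMap.id) ?_ ?_ (fun c => rfl)
    (fun c => rfl) (by simp)
  · rw [← LinearMap.comp_assoc, comul_coder hq, LinearMap.comp_assoc, comul_coder hq,
      ← LinearMap.comp_assoc]
    congr 1
    refine TensorProduct.ext' fun a b => ?_
    simp only [LinearMap.comp_apply, LinearMap.add_apply, TensorProduct.map_tmul, map_add,
      LinearMap.id_apply, sgn_coder hq, sgn_sgn, neg_tmul]
    abel
  · rw [← LinearMap.comp_assoc, ln_coder, h]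

/-- A DG Lie algebra gives rise to a coderivation. -/
theorem IsDGLie.isDGLieCoderivation (hM : IsDGLie 𝒢 d br) :
    IsDGLieCoderivation 𝒢 d br (coder (dgTaylor 𝒢 d br)) where
  coderivation := comul_coder (dgTaylor_mem_degree hM)
  degree := coder_mem_degree (dgTaylor_mem_degree hM)
  one := coder_one (dgTaylor_one d br)
  sq := coder_coder (dgTaylor_mem_degree hM) hM.dgTaylor_coder_eq_zero
  taylor_one x := (DFunLike.congr_fun (ln_coder _) _).trans (dgTaylor_ι d br x)
  taylor_two p x hx y := by
    refine (DFunLike.congr_fun (ln_coder _) _).trans ?_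
    have hx' : x ∈ shift 𝒢 (p - 1) := by simpa [shift] using hx
    rw [← symBr_tmul br hx' y]
    induction y using Decomposition.inductionOn (shift 𝒢) with
    | zero => simp
    | homogeneous y => exact hM.dgTaylor_ι_mul_ι hx' y.2
    | add a b ha hb => simp only [map_add, mul_add, tmul_add, ha, hb]
  taylor_ge j hj c hc := (DFunLike.congr_fun (ln_coder _) _).trans (dgTaylor_ge d br hj hc)

section morphisms

variable {d' : N →ₗ[K] N} {br' : N →ₗ[K] N →ₗ[K] N}

/-- The obstruction to a linear map being the logarithm of an `L_∞` morphism. -/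
noncomputable def linfDefect (𝒢 : ℤ → Submodule K M) (ℋ : ℤ → Submodule K N) [Decomposition 𝒢]
    [Decomposition ℋ] (d : M →ₗ[K] M) (br : M →ₗ[K] M →ₗ[K] M) (d' : N →ₗ[K] N)
    (br' : N →ₗ[K] N →ₗ[K] N) (f : SuperSym (shift 𝒢) →ₗ[K] N) : SuperSym (shift 𝒢) →ₗ[K] N :=
  f ∘ₗ coder (dgTaylor 𝒢 d br) -
    (d' ∘ₗ f + (2⁻¹ : K) • (symBr ℋ br' ∘ₗ TensorProduct.map f f ∘ₗ comul (shift 𝒢)))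

theorem dgTaylor_comp {Ψ : SuperSym (shift 𝒢) →ₗ[K] SuperSym (shift ℋ)}
    (hΨ : comul _ ∘ₗ Ψ = TensorProduct.map Ψ Ψ ∘ₗ comul _) (d' : N →ₗ[K] N)
    (br' : N →ₗ[K] N →ₗ[K] N) : dgTaylor ℋ d' br' ∘ₗ Ψ = d' ∘ₗ (ln _ ∘ₗ Ψ) + (2⁻¹ : K) •
      (symBr ℋ br' ∘ₗ TensorProduct.map (ln _ ∘ₗ Ψ) (ln _ ∘ₗ Ψ) ∘ₗ comul (shift 𝒢)) := by
  rw [dgTaylor, LinearMap.add_comp, LinearMap.smul_comp, LinearMap.comp_assoc,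
    LinearMap.comp_assoc, LinearMap.comp_assoc, hΨ, ← LinearMap.comp_assoc (comul _),
    ← TensorProduct.map_comp]

/-- The image of ΨQ = Q'Ψ under `ln`, after replacing Q and Q' by their explicit forms;
compatibility of Ψ with Δ expresses the quadratic part through ln ∘ Ψ alone. -/
theorem IsLInftyMorphism.linfDefect_eq_zero (hM : IsDGLie 𝒢 d br) (hN : IsDGLie ℋ d' br')
    {Ψ : SuperSym (shift 𝒢) →ₗ[K] SuperSym (shift ℋ)}
    (hΨ : IsLInftyMorphism 𝒢 ℋ d br d' br' Ψ) :
    linfDefect 𝒢 ℋ d br d' br' (ln _ ∘ₗ Ψ) = 0 := by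
  obtain ⟨h, Q, Q', hQ, hQ', e⟩ := hΨ
  rw [linfDefect, ← dgTaylor_comp h.comul, LinearMap.comp_assoc, ← hQ.eq_coder hM, e,
    ← LinearMap.comp_assoc, hQ'.ln_comp hN, sub_self]

/-- Conversely, E = ΨQ − Q'Ψ satisfies Δ ∘ E = (E ⊗ Ψ + Ψ ∘ sgn ⊗ E) ∘ Δ, and ln ∘ E is exactly the
defect of f. So the vanishing of the defect suffices by `eq_zero_of_comul`. -/
theorem isLInftyMorphism_coalgHom (hM : IsDGLie 𝒢 d br) (hN : IsDGLie ℋ d' br')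
    {f : SuperSym (shift 𝒢) →ₗ[K] N} (h1 : f 1 = 0)
    (hf : ∀ n, ∀ c ∈ degree (shift 𝒢) n, f c ∈ shift ℋ n)
    (h : linfDefect 𝒢 ℋ d br d' br' f = 0) :
    IsLInftyMorphism 𝒢 ℋ d br d' br' (coalgHom (shift ℋ) f) := by
  have hc : IsCoalgHom (coalgHom (shift ℋ) f) := isCoalgHom_coalgHom h1 hf
  have hs : ∀ c, coalgHom (shift ℋ) f (sgn _ c) = sgn _ (coalgHom (shift ℋ) f c) := fun c =>
    (scaleDeg_comp_of_degree (𝒢 := degree (shift 𝒢)) (ℋ := degree (shift ℋ)) _ _ 0 _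
      (by simpa using hc.degree) (by simp) c).symm
  refine ⟨hc, _, _, hM.isDGLieCoderivation, hN.isDGLieCoderivation, ?_⟩
  rw [← sub_eq_zero]
  refine eq_zero_of_comul (F := coalgHom (shift ℋ) f) (F' := coalgHom (shift ℋ) f ∘ₗ sgn _) ?_ ?_
    (counitHom_coalgHom h1) (fun c => ?_) ?_
  · rw [LinearMap.comp_sub, ← LinearMap.comp_assoc, ← LinearMap.comp_assoc, hc.comul,
      comul_coder (dgTaylor_mem_degree hN), LinearMap.comp_assoc, LinearMap.comp_assoc, hc.comul,
      comul_coder (dgTaylor_mem_degree hM), ← LinearMap.comp_assoc, ← LinearMap.comp_assoc,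
      ← LinearMap.sub_comp]
    congr 1
    refine TensorProduct.ext' fun a b => ?_
    simp only [LinearMap.comp_apply, LinearMap.add_apply, LinearMap.sub_apply,
      TensorProduct.map_tmul, map_add, LinearMap.id_apply, hs, sub_tmul, tmul_sub]
    abel
  · rw [LinearMap.comp_sub, ← LinearMap.comp_assoc, ← LinearMap.comp_assoc, ln_coder,
      dgTaylor_comp hc.comul, ln_coalgHom h1]
    exact h
  · rw [LinearMap.comp_apply, counitHom_coalgHom h1, ← psgn_one_eq, counitHom_psgn]
  · rw [LinearMap.comp_apply, ← psgn_one_eq, psgn_one, coalgHom_one h1, ln_one]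

end morphisms

end

end supersym

/-! ### Functoriality in maps of graded modules -/

section supersym

open DirectSum TensorProduct WithConv SuperSym

variable {K : Type*} [Field K]
  {M : Type*} [AddCommGroup M] [Module K M] {𝒢 : ℤ → Submodule K M} [Decomposition 𝒢]
  {N : Type*} [AddCommGroup N] [Module K N] {ℋ : ℤ → Submodule K N} [Decomposition ℋ]

/-- The components of a graded module which is defined by its projections. -/
theorem isInternal_range_of_projections (P : ℤ → M →ₗ[K] M)
    (h : ∀ m n x, P m (P n x) = if n = m then P n x else 0)
    (hS : ∀ x, ∃ S : Finset ℤ, ∑ n ∈ S, P n x = x) :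
    IsInternal fun n => LinearMap.range (P n) := by
  have key : ∀ (x : ⨁ n, LinearMap.range (P n)) (m : ℤ),
      P m (DirectSum.coeAddMonoidHom (fun n => LinearMap.range (P n)) x) = x m := by
    intro x m
    induction x using DirectSum.induction_on with
    | zero => simp
    | of n y =>
      obtain ⟨_, y, rfl⟩ := y
      rw [DirectSum.coeAddMonoidHom_of, h]
      split_ifs with h
      · subst h; rw [DirectSum.of_eq_same]
      · rw [DirectSum.of_eq_of_ne _ _ _ (Ne.symm h)]; rfl
    | add a b ha hb => simp only [map_add, ha, hb, DirectSum.add_apply, Submodule.coe_add]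
  constructor
  · rw [injective_iff_map_eq_zero]
    intro x hx
    ext m
    rw [← key x m, hx, map_zero]; rfl
  · intro x
    obtain ⟨S, hS⟩ := hS x
    refine ⟨∑ n ∈ S, DirectSum.of (fun n => LinearMap.range (P n)) n ⟨_, x, rfl⟩, ?_⟩
    rw [map_sum]
    simpa only [DirectSum.coeAddMonoidHom_of] using hS

namespace SuperSym

section map

variable (φ : M →ₗ[K] N) (hφ : ∀ p, ∀ x ∈ 𝒢 p, φ x ∈ ℋ p)

/-- The homomorphism of super-symmetric algebras induced by a homomorphism of graded modules. -/
noncomputable def map : SuperSym 𝒢 →ₐ[K] SuperSym ℋ :=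
  lift (ι ℋ ∘ₗ φ) fun p q a ha b hb => ι_mul_ι (hφ p a ha) (hφ q b hb)

@[simp] theorem map_ι (x : M) : map φ hφ (ι 𝒢 x) = ι ℋ (φ x) := lift_ι _ _ _

theorem map_mem_degree {n : ℤ} {c : SuperSym 𝒢} (hc : c ∈ degree 𝒢 n) :
    map φ hφ c ∈ degree ℋ n := by
  refine (Submodule.span_le (p := (degree ℋ n).comap (map φ hφ).toLinearMap)).2 ?_ hc
  rintro _ ⟨l, rfl, rfl⟩
  clear hc
  induction l with
  | nil => simpa using one_mem_degree
  | cons a l ih =>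
    simp only [List.map_cons, List.prod_cons, List.sum_cons, SetLike.mem_coe,
      Submodule.mem_comap, AlgHom.toLinearMap_apply, map_mul, map_ι] at ih ⊢
    exact SetLike.GradedMul.mul_mem (ι_mem_degree (hφ _ _ a.2.2)) ih

theorem psgn_map (p : ℤ) (c : SuperSym 𝒢) :
    psgn ℋ p (map φ hφ c) = map φ hφ (psgn 𝒢 p c) :=
  scaleDeg_comp_of_degree (𝒢 := degree 𝒢) (ℋ := degree ℋ) _ _ 0 (map φ hφ).toLinearMap
    (fun n c hc => by simpa using map_mem_degree φ hφ hc) (by simp) c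

theorem comul_map (c : SuperSym 𝒢) : comul ℋ (map φ hφ c) =
    TensorProduct.map (map φ hφ).toLinearMap (map φ hφ).toLinearMap (comul 𝒢 c) := by
  suffices comul ℋ ∘ₗ (map φ hφ).toLinearMap =
    TensorProduct.map (map φ hφ).toLinearMap (map φ hφ).toLinearMap ∘ₗ comul 𝒢 from
    DFunLike.congr_fun this c
  refine linearMap_ext (by simp) fun p x hx c hc => ?_
  simp only [LinearMap.comp_apply, AlgHom.toLinearMap_apply] at hc ⊢
  rw [map_mul, map_ι, comul_ι_mul (hφ p x hx), hc, comul_ι_mul hx]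
  generalize comul 𝒢 c = z
  induction z using TensorProduct.induction_on with
  | zero => simp
  | add a b ha hb => simp only [map_add, ha, hb]
  | tmul a b => simp [psgn_map]

theorem counitHom_map (c : SuperSym 𝒢) : counitHom ℋ (map φ hφ c) = counitHom 𝒢 c := by
  have : (counitHom ℋ).comp (map φ hφ) = counitHom 𝒢 := algHom_ext fun x => by simp
  exact DFunLike.congr_fun this c

theorem ln_map (c : SuperSym 𝒢) : ln ℋ (map φ hφ c) = φ (ln 𝒢 c) := by
  suffices ln ℋ ∘ₗ (map φ hφ).toLinearMap = φ ∘ₗ ln 𝒢 from DFunLike.congr_fun this c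
  refine linearMap_ext (by simp) fun p x hx c _ => ?_
  simp [ln_ι_mul, counitHom_map]

theorem map_surjective (h : Function.Surjective φ) : Function.Surjective (map φ hφ) := by
  rw [← AlgHom.range_eq_top]
  refine eq_top_iff.2 fun c _ => ?_
  refine mem_of_ι_mul (Subalgebra.toSubmodule (map φ hφ).range) (one_mem (map φ hφ).range)
    (fun p x hx c hc => ?_) c
  obtain ⟨y, rfl⟩ := h x
  exact mul_mem (S := Subalgebra K (SuperSym ℋ)) ⟨ι 𝒢 y, map_ι _ _ _⟩ hc

theorem coder_map {q : SuperSym 𝒢 →ₗ[K] M} {q' : SuperSym ℋ →ₗ[K] N}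
    (h : ∀ c, q' (map φ hφ c) = φ (q c)) (c : SuperSym 𝒢) :
    coder q' (map φ hφ c) = map φ hφ (coder q c) := by
  rw [coder_apply, coder_apply, comul_map]
  generalize comul 𝒢 c = z
  induction z using TensorProduct.induction_on with
  | zero => simp
  | add a b ha hb => simp only [map_add, ha, hb]
  | tmul a b => simp [h]

end map

end SuperSym

section naturality

variable {d : M →ₗ[K] M} {br : M →ₗ[K] M →ₗ[K] M} {d' : N →ₗ[K] N} {br' : N →ₗ[K] N →ₗ[K] N}
  {φ : M →ₗ[K] N}

omit [Decomposition 𝒢] [Decomposition ℋ] in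
theorem shift_map (hφ : ∀ p, ∀ x ∈ 𝒢 p, φ x ∈ ℋ p) : ∀ p, ∀ x ∈ shift 𝒢 p, φ x ∈ shift ℋ p :=
  fun p => hφ (p + 1)

theorem symBr_map (hφ : ∀ p, ∀ x ∈ 𝒢 p, φ x ∈ ℋ p) (hbr : ∀ x y, φ (br x y) = br' (φ x) (φ y))
    (t : M ⊗[K] M) : symBr ℋ br' (TensorProduct.map φ φ t) = φ (symBr 𝒢 br t) := by
  suffices symBr ℋ br' ∘ₗ TensorProduct.map φ φ = φ ∘ₗ symBr 𝒢 br from DFunLike.congr_fun this t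
  refine linearMap_ext_homogeneous (𝒢 := shift 𝒢) (ℋ := shift 𝒢) fun p q x hx y hy => ?_
  simp [symBr_tmul br hx, symBr_tmul br' (shift_map hφ p x hx), hbr]

theorem dgTaylor_map (hφ : ∀ p, ∀ x ∈ 𝒢 p, φ x ∈ ℋ p) (hd : ∀ x, φ (d x) = d' (φ x))
    (hbr : ∀ x y, φ (br x y) = br' (φ x) (φ y)) (c : SuperSym (shift 𝒢)) :
    dgTaylor ℋ d' br' (map φ (shift_map hφ) c) = φ (dgTaylor 𝒢 d br c) := by
  rw [dgTaylor_apply, dgTaylor_apply, ln_map, comul_map, map_add, hd, map_smul,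
    ← symBr_map hφ hbr]
  congr 3
  generalize comul (shift 𝒢) c = z
  induction z using TensorProduct.induction_on with
  | zero => simp
  | add a b ha hb => simp only [map_add, ha, hb]
  | tmul a b => simp [ln_map]

variable {M' : Type*} [AddCommGroup M'] [Module K M'] {𝒢' : ℤ → Submodule K M'}
  [Decomposition 𝒢'] {N' : Type*} [AddCommGroup N'] [Module K N'] {ℋ' : ℤ → Submodule K N'}
  [Decomposition ℋ'] {e : M' →ₗ[K] M'} {bs : M' →ₗ[K] M' →ₗ[K] M'}
  {e' : N' →ₗ[K] N'} {bs' : N' →ₗ[K] N' →ₗ[K] N'} {χ : M' →ₗ[K] N'}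

/-- Each ingredient of the defect is natural in maps that respect the grading, the differential and
the bracket. This transports the L∞ equation along the terms of Cauchy sequences and along the
projection to the completion. -/
theorem linfDefect_map (hφ : ∀ p, ∀ x ∈ 𝒢 p, φ x ∈ ℋ p) (hd : ∀ x, φ (d x) = d' (φ x))
    (hbr : ∀ x y, φ (br x y) = br' (φ x) (φ y)) (hχ : ∀ p, ∀ x ∈ 𝒢' p, χ x ∈ ℋ' p)
    (he : ∀ x, χ (e x) = e' (χ x)) (hbs : ∀ x y, χ (bs x y) = bs' (χ x) (χ y))
    {f : SuperSym (shift 𝒢) →ₗ[K] M'} {f' : SuperSym (shift ℋ) →ₗ[K] N'}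
    (hf : ∀ c, f' (map φ (shift_map hφ) c) = χ (f c)) (c : SuperSym (shift 𝒢)) :
    linfDefect ℋ ℋ' d' br' e' bs' f' (map φ (shift_map hφ) c) =
      χ (linfDefect 𝒢 𝒢' d br e bs f c) := by
  simp only [linfDefect, LinearMap.sub_apply, LinearMap.add_apply, LinearMap.smul_apply,
    LinearMap.comp_apply, map_sub, map_add, map_smul, he, ← symBr_map hχ hbs, ← hf,
    coder_map φ _ (dgTaylor_map hφ hd hbr), comul_map]
  congr 4
  generalize comul (shift 𝒢) c = z
  induction z using TensorProduct.induction_on with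
  | zero => simp
  | add a b ha hb => simp only [map_add, ha, hb]
  | tmul a b => simp [hf]

omit [Decomposition 𝒢] [Decomposition ℋ] in
/-- The axioms of a DG Lie algebra are inherited by quotients. -/
theorem IsDGLie.of_surjective (hM : IsDGLie 𝒢 d br) (hs : Function.Surjective φ)
    (hφ : ∀ p, ∀ x ∈ 𝒢 p, φ x ∈ ℋ p) (hφ' : ∀ p, ∀ y ∈ ℋ p, ∃ x ∈ 𝒢 p, φ x = y)
    (hd : ∀ x, φ (d x) = d' (φ x)) (hbr : ∀ x y, φ (br x y) = br' (φ x) (φ y)) :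
    IsDGLie ℋ d' br' where
  d_deg p y hy := by
    obtain ⟨x, hx, rfl⟩ := hφ' p y hy
    exact hd x ▸ hφ _ _ (hM.d_deg p x hx)
  d_d y := by
    obtain ⟨x, rfl⟩ := hs y
    rw [← hd, ← hd, hM.d_d, map_zero]
  br_deg p q y hy z hz := by
    obtain ⟨x, hx, rfl⟩ := hφ' p y hy
    obtain ⟨t, ht, rfl⟩ := hφ' q z hz
    exact hbr x t ▸ hφ _ _ (hM.br_deg p q x hx t ht)
  leibniz p y hy z := by
    obtain ⟨x, hx, rfl⟩ := hφ' p y hy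
    obtain ⟨t, rfl⟩ := hs z
    simp only [← hbr, ← hd, hM.leibniz p x hx, map_add, map_smul]
  antisymm p q y hy z hz := by
    obtain ⟨x, hx, rfl⟩ := hφ' p y hy
    obtain ⟨t, ht, rfl⟩ := hφ' q z hz
    rw [← hbr, hM.antisymm p q x hx t ht, map_neg, map_smul, hbr]
  jacobi p q y hy z hz v := by
    obtain ⟨x, hx, rfl⟩ := hφ' p y hy
    obtain ⟨t, ht, rfl⟩ := hφ' q z hz
    obtain ⟨s, rfl⟩ := hs v
    simp only [← hbr, hM.jacobi p q x hx t ht, map_add, map_smul]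

omit [Decomposition 𝒢] [Decomposition ℋ] in
/-- The axioms of a DG Lie algebra are inherited along a jointly injective family of maps. -/
theorem IsDGLie.of_injective {α : Type*} {φ : α → M →ₗ[K] N} (hN : IsDGLie ℋ d' br')
    (hi : ∀ x y, (∀ i, φ i x = φ i y) → x = y) (hφ : ∀ p x, x ∈ 𝒢 p ↔ ∀ i, φ i x ∈ ℋ p)
    (hd : ∀ i x, φ i (d x) = d' (φ i x)) (hbr : ∀ i x y, φ i (br x y) = br' (φ i x) (φ i y)) :
    IsDGLie 𝒢 d br where
  d_deg p x hx := (hφ _ _).2 fun i => hd i x ▸ hN.d_deg p _ ((hφ p x).1 hx i)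
  d_d x := hi _ _ fun i => by rw [hd, hd, hN.d_d, map_zero]
  br_deg p q x hx y hy := (hφ _ _).2 fun i =>
    hbr i x y ▸ hN.br_deg p q _ ((hφ p x).1 hx i) _ ((hφ q y).1 hy i)
  leibniz p x hx y := hi _ _ fun i => by
    simp only [hbr, hd, map_add, map_smul, hN.leibniz p _ ((hφ p x).1 hx i)]
  antisymm p q x hx y hy := hi _ _ fun i => by
    rw [map_neg, map_smul, hbr, hbr, hN.antisymm p q _ ((hφ p x).1 hx i) _ ((hφ q y).1 hy i)]
  jacobi p q x hx y hy z := hi _ _ fun i => by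
    simp only [hbr, map_add, map_smul, hN.jacobi p q _ ((hφ p x).1 hx i) _ ((hφ q y).1 hy i)]

end naturality

end supersym

/-! ### The total grading of a tensor product of graded modules -/

section tensorgrade

open DirectSum TensorProduct

variable {K : Type*} [Field K] {A : Type*} [AddCommGroup A] [Module K A]
  {𝒜 : ℤ → Submodule K A} [Decomposition 𝒜] {L : Type*} [AddCommGroup L] [Module K L]
  {𝒢 : ℤ → Submodule K L} [Decomposition 𝒢]

-- Scalars are absorbed into the first tensor factor, so that induction over the span needs no
-- separate case for them.
omit [Decomposition 𝒜] [Decomposition 𝒢] in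
theorem tensorGrade_induction {n : ℤ} {P : ∀ t, t ∈ tensorGrade 𝒜 𝒢 n → Prop}
    (zero : P 0 (zero_mem _))
    (add : ∀ s t hs ht, P s hs → P t ht → P (s + t) (add_mem hs ht))
    (tmul : ∀ p q (h : p + q = n) a (ha : a ∈ 𝒜 p) x (hx : x ∈ 𝒢 q),
      P (a ⊗ₜ x) (tmul_mem_tensorGrade h ha hx)) {t : A ⊗[K] L} (ht : t ∈ tensorGrade 𝒜 𝒢 n) :
    P t ht := by
  suffices ∃ h, P t h from this.2
  have hc := ht
  rw [tensorGrade, ← Submodule.mem_toAddSubmonoid, Submodule.span_eq_closure] at hc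
  induction hc using AddSubmonoid.closure_induction with
  | zero => exact ⟨_, zero⟩
  | add x y hx hy ihx ihy =>
    rw [← Submodule.span_eq_closure, Submodule.mem_toAddSubmonoid] at hx hy
    exact ⟨_, add x y _ _ (ihx hx).2 (ihy hy).2⟩
  | mem x hx =>
    obtain ⟨k, -, _, ⟨p, q, h, a, ha, x, hx, rfl⟩, rfl⟩ := hx
    have e : k • (a ⊗ₜ[K] x) = (k • a) ⊗ₜ[K] x := smul_tmul' k a x
    simp only [e]
    exact ⟨tmul_mem_tensorGrade h (Submodule.smul_mem _ k ha) hx,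
      tmul p q h _ (Submodule.smul_mem _ k ha) x hx⟩

variable (𝒜 𝒢) in
theorem homogeneous_tensor_induction {P : A ⊗[K] L → Prop} (t : A ⊗[K] L)
    (zero : P 0) (add : ∀ s t, P s → P t → P (s + t))
    (tmul : ∀ p q, ∀ a ∈ 𝒜 p, ∀ x ∈ 𝒢 q, P (a ⊗ₜ x)) : P t := by
  induction t using TensorProduct.induction_on with
  | zero => exact zero
  | add s t hs ht => exact add s t hs ht
  | tmul a x =>
    induction a using Decomposition.inductionOn 𝒜 with
    | zero => simpa using zero
    | add a b ha hb => rw [add_tmul]; exact add _ _ ha hb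
    | homogeneous a =>
      induction x using Decomposition.inductionOn 𝒢 with
      | zero => simpa using zero
      | add x y hx hy => rw [tmul_add]; exact add _ _ hx hy
      | homogeneous x => exact tmul _ _ _ a.2 _ x.2

theorem tscale_one : tscale 𝒜 𝒢 (fun _ _ => (1 : K)) = LinearMap.id :=
  linearMap_ext_homogeneous (𝒢 := 𝒜) (ℋ := 𝒢) fun p q a ha b hb => by
    simp [tscale_of_mem _ ha hb]

theorem tscale_sum {α : Type*} (S : Finset α) (s : α → ℤ → ℤ → K) :
    tscale 𝒜 𝒢 (fun p q => ∑ i ∈ S, s i p q) = ∑ i ∈ S, tscale 𝒜 𝒢 (s i) :=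
  linearMap_ext_homogeneous (𝒢 := 𝒜) (ℋ := 𝒢) fun p q a ha b hb => by
    simp [tscale_of_mem _ ha hb, Finset.sum_smul]

theorem tscale_sub (s t : ℤ → ℤ → K) :
    tscale 𝒜 𝒢 (fun p q => s p q - t p q) = tscale 𝒜 𝒢 s - tscale 𝒜 𝒢 t :=
  linearMap_ext_homogeneous (𝒢 := 𝒜) (ℋ := 𝒢) fun p q a ha b hb => by
    simp [tscale_of_mem _ ha hb, sub_smul]

variable (𝒜 𝒢) in
/-- The projection of the tensor product to its component of degree `n`. -/
noncomputable def tensorProj (n : ℤ) : A ⊗[K] L →ₗ[K] A ⊗[K] L :=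
  tscale 𝒜 𝒢 fun p q => if p + q = n then 1 else 0

theorem tensorProj_mem (n : ℤ) (t : A ⊗[K] L) : tensorProj 𝒜 𝒢 n t ∈ tensorGrade 𝒜 𝒢 n := by
  induction t using homogeneous_tensor_induction 𝒜 𝒢 with
  | zero => simp
  | add s t hs ht => rw [map_add]; exact add_mem hs ht
  | tmul p q a ha x hx =>
    rw [tensorProj, tscale_of_mem _ ha hx]
    split_ifs with h
    · rw [one_smul]; exact tmul_mem_tensorGrade h ha hx
    · simp

theorem tensorProj_of_mem {n : ℤ} (m : ℤ) {t : A ⊗[K] L} (ht : t ∈ tensorGrade 𝒜 𝒢 n) :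
    tensorProj 𝒜 𝒢 m t = if n = m then t else 0 := by
  induction ht using tensorGrade_induction with
  | zero => simp
  | add s t _ _ hs ht => rw [map_add, hs, ht]; split_ifs <;> simp
  | tmul p q h a ha x hx =>
    rw [tensorProj, tscale_of_mem _ ha hx, h]
    split_ifs <;> simp

theorem range_tensorProj (n : ℤ) :
    LinearMap.range (tensorProj 𝒜 𝒢 n) = tensorGrade 𝒜 𝒢 n := by
  ext t
  refine ⟨?_, fun ht => ⟨t, by rw [tensorProj_of_mem n ht, if_pos rfl]⟩⟩
  rintro ⟨t, rfl⟩
  exact tensorProj_mem n t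

variable (𝒜 𝒢) in
theorem isInternal_tensorGrade : IsInternal (tensorGrade 𝒜 𝒢) := by
  classical
  have := isInternal_range_of_projections (tensorProj 𝒜 𝒢)
    (fun m n t => tensorProj_of_mem m (tensorProj_mem n t)) fun t => by
      have : ∃ S : Finset ℤ, ∀ S', S ⊆ S' → ∑ n ∈ S', tensorProj 𝒜 𝒢 n t = t := by
        induction t using homogeneous_tensor_induction 𝒜 𝒢 with
        | zero => exact ⟨∅, by simp⟩
        | add s t hs ht =>
          obtain ⟨S, hS⟩ := hs
          obtain ⟨T, hT⟩ := ht
          refine ⟨S ∪ T, fun U hU => ?_⟩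
          simp only [map_add, Finset.sum_add_distrib]
          rw [hS U (Finset.union_subset_left hU), hT U (Finset.union_subset_right hU)]
        | tmul p q a ha x hx =>
          refine ⟨{p + q}, fun U hU => ?_⟩
          simp only [tensorProj_of_mem _ (tmul_mem_tensorGrade rfl ha hx)]
          rw [Finset.sum_ite_eq, if_pos (hU (Finset.mem_singleton_self _))]
      obtain ⟨S, hS⟩ := this
      exact ⟨S, hS S subset_rfl⟩
  simpa only [range_tensorProj] using this

noncomputable instance : Decomposition (tensorGrade 𝒜 𝒢) :=
  (isInternal_tensorGrade 𝒜 𝒢).chooseDecomposition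

end tensorgrade

/-! ### The module of Cauchy sequences, intermediate between a module and its completion -/

namespace DirInv

variable {K : Type*} [CommRing K] {M N P : Type*} [AddCommGroup M] [Module K M]
  [AddCommGroup N] [Module K N] [AddCommGroup P] [Module K P]

/-- The module of Cauchy sequences, as a type of its own. -/
def Seq (D : DirInv.{w} K M) : Type _ := D.cauchySeq

instance (D : DirInv.{w} K M) : AddCommGroup D.Seq := inferInstanceAs (AddCommGroup D.cauchySeq)

instance (D : DirInv.{w} K M) : Module K D.Seq := inferInstanceAs (Module K D.cauchySeq)

/-- The terms of Cauchy sequences. -/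
def term (D : DirInv.{w} K M) (k : ℕ) : D.Seq →ₗ[K] M where
  toFun c := c.1 k
  map_add' _ _ := rfl
  map_smul' _ _ := rfl

/-- The class of a Cauchy sequence in the completion. -/
noncomputable def mkS (D : DirInv.{w} K M) : D.Seq →ₗ[K] D.Completion where
  toFun c := D.mkC c
  map_add' := map_add D.mkC
  map_smul' := map_smul D.mkC

theorem mkS_surj (D : DirInv.{w} K M) : Function.Surjective D.mkS := D.mkC_surj

theorem seq_ext {D : DirInv.{w} K M} {c c' : D.Seq}
    (h : ∀ k, D.term k c = D.term k c') : c = c' := Subtype.ext (funext h)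

variable {D : DirInv.{w} K M} {E : DirInv.{w'} K N} {G : DirInv.{w''} K P}

/-- The map induced on Cauchy sequences by a continuous linear map. -/
def seqMap (f : M →ₗ[K] N) (hf : D.Cont E f) : D.Seq →ₗ[K] E.Seq where
  toFun c := ⟨fun n => f (c.1 n), hf.cauchy c⟩
  map_add' c c' := Subtype.ext (funext fun n => map_add f _ _)
  map_smul' a c := Subtype.ext (funext fun n => map_smul f _ _)

@[simp] theorem term_seqMap (f : M →ₗ[K] N) (hf : D.Cont E f) (k : ℕ) (c : D.Seq) :
    E.term k (seqMap f hf c) = f (D.term k c) := rfl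

/-- The map induced on Cauchy sequences by a continuous bilinear map. -/
def seqBil (φ : M →ₗ[K] N →ₗ[K] P) (hφ : D.BCont E G φ) :
    D.Seq →ₗ[K] E.Seq →ₗ[K] G.Seq :=
  LinearMap.mk₂ K (fun c c' => ⟨fun n => φ (c.1 n) (c'.1 n), hφ.cauchy c c'⟩)
    (fun a b c => Subtype.ext (funext fun n => LinearMap.map_add₂ φ _ _ _))
    (fun k a b => Subtype.ext (funext fun n => LinearMap.map_smul₂ φ _ _ _))
    (fun a b c => Subtype.ext (funext fun n => map_add (φ _) _ _))
    (fun k a b => Subtype.ext (funext fun n => map_smul (φ _) _ _))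

end DirInv

/-! ### DG Lie structures on the tensor product, on its Cauchy sequences and on its completion -/

namespace CTensor

open DirectSum TensorProduct

variable {K : Type*} [Field K] {A : Type*} [Ring A] [Algebra K A]
  {𝒜 : ℤ → Submodule K A} [GradedAlgebra 𝒜] {L : Type*} [AddCommGroup L] [Module K L]
  {𝒢 : ℤ → Submodule K L} [Decomposition 𝒢] (R : DGComAlg.{w} K 𝒜) (G : DGLieAlg.{w'} K 𝒢)

/-- By linearity all axioms are checked on homogeneous tensors, where they follow from those of A
and 𝔤 up to signs; these depend only on the parities of the degrees, which are enumerated. -/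
theorem isDGLie_pre : IsDGLie (tensorGrade 𝒜 𝒢) (preD R G) (preBr 𝒜 G) where
  d_deg n t ht := by
    refine map_mem_of_mem_tensorGrade _ _ (fun p q h a ha x hx => ?_) ht
    rw [preD_tmul R G ha]
    exact add_mem (tmul_mem_tensorGrade (by omega) (R.d_deg p a ha) hx)
      (Submodule.smul_mem _ _ (tmul_mem_tensorGrade (by omega) ha (G.d_deg q x hx)))
  d_d t := by
    induction t using homogeneous_tensor_induction 𝒜 𝒢 with
    | zero => simp
    | add s t hs ht => simp only [map_add, hs, ht, add_zero]
    | tmul p q a ha x hx =>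
      rw [preD_tmul R G ha, map_add, map_smul, preD_tmul R G (R.d_deg p a ha), preD_tmul R G ha,
        R.d_d, G.d_d, zpow_add₀ (by simp)]
      simp only [zero_tmul, tmul_zero, smul_zero, zpow_one]
      module
  br_deg m n s hs t ht := by
    induction hs using tensorGrade_induction with
    | zero => simp
    | add s s' _ _ hs hs' => rw [map_add, LinearMap.add_apply]; exact add_mem hs hs'
    | tmul p q h a ha x hx =>
      induction ht using tensorGrade_induction with
      | zero => simp
      | add s s' _ _ hs hs' => rw [map_add]; exact add_mem hs hs'
      | tmul p' q' h' b hb y hy =>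
        rw [preBr_tmul 𝒜 G a hx hb]
        exact Submodule.smul_mem _ _ (tmul_mem_tensorGrade (by omega)
          (SetLike.GradedMul.mul_mem ha hb) (G.br_deg q q' x hx y hy))
  leibniz n s hs t := by
    induction hs using tensorGrade_induction with
    | zero => simp
    | add s s' _ _ hs hs' =>
      simp only [map_add, LinearMap.add_apply, hs, hs', smul_add]
      abel
    | tmul p q h a ha x hx =>
      induction t using homogeneous_tensor_induction 𝒜 𝒢 with
      | zero => simp
      | add s s' hs hs' =>
        simp only [map_add, hs, hs', smul_add]
        abel
      | tmul p' q' b hb y hy =>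
        subst h
        rw [preBr_tmul 𝒜 G a hx hb, map_smul, preD_tmul R G (SetLike.GradedMul.mul_mem ha hb),
          preD_tmul R G ha, preD_tmul R G hb, map_add, map_add, LinearMap.add_apply, map_smul,
          map_smul, LinearMap.smul_apply, preBr_tmul 𝒜 G _ hx hb, preBr_tmul 𝒜 G _ hx hb,
          preBr_tmul 𝒜 G _ (G.d_deg q x hx) hb, preBr_tmul 𝒜 G _ hx (R.d_deg _ b hb),
          R.leibniz p a ha, G.leibniz q x hx]
        simp only [add_tmul, tmul_add, tmul_smul, ← smul_tmul']
        by_cases hp : Even p <;> by_cases hq : Even q <;> by_cases hr : Even p' <;>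
          simp only [neg_one_zpow_eq_ite, hp, hq, hr, Int.even_add, Int.even_mul, Int.not_even_one,
            or_true, true_or, or_false, false_or, iff_true, true_iff, iff_false, false_iff,
            not_true, not_false_iff, if_true, if_false] <;> module
  antisymm m n s hs t ht := by
    induction hs using tensorGrade_induction with
    | zero => simp
    | add s s' _ _ hs hs' =>
      simp only [map_add, LinearMap.add_apply, hs, hs', smul_add]
      abel
    | tmul p q h a ha x hx =>
      induction ht using tensorGrade_induction with
      | zero => simp
      | add s s' _ _ hs hs' =>
        simp only [map_add, LinearMap.add_apply, hs, hs', smul_add]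
        abel
      | tmul p' q' h' b hb y hy =>
        subst h h'
        rw [preBr_tmul 𝒜 G a hx hb, preBr_tmul 𝒜 G b hy ha, R.comm p p' a ha b hb,
          G.antisymm q q' x hx y hy]
        simp only [tmul_neg, tmul_smul, ← smul_tmul']
        by_cases hp : Even p <;> by_cases hq : Even q <;> by_cases hr : Even p' <;>
          by_cases hs : Even q' <;>
          simp only [neg_one_zpow_eq_ite, hp, hq, hr, hs, Int.even_add, Int.even_mul,
            or_true, true_or, or_false, false_or, iff_true, true_iff, iff_false, false_iff,
            not_true, not_false_iff, if_true, if_false] <;> module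
  jacobi m n s hs t ht u := by
    induction hs using tensorGrade_induction with
    | zero => simp
    | add s s' _ _ hs hs' =>
      simp only [map_add, LinearMap.add_apply, hs, hs', smul_add]
      abel
    | tmul p q h a ha x hx =>
      induction ht using tensorGrade_induction with
      | zero => simp
      | add s s' _ _ hs hs' =>
        simp only [map_add, LinearMap.add_apply, hs, hs', smul_add]
        abel
      | tmul p' q' h' b hb y hy =>
        induction u using homogeneous_tensor_induction 𝒜 𝒢 with
        | zero => simp
        | add s s' hs hs' =>
          simp only [map_add, hs, hs', smul_add]
          abel
        | tmul p'' q'' c hc z hz =>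
          subst h h'
          rw [preBr_tmul 𝒜 G b hy hc, map_smul, preBr_tmul 𝒜 G a hx
            (SetLike.GradedMul.mul_mem hb hc), preBr_tmul 𝒜 G a hx hb, map_smul,
            LinearMap.smul_apply, preBr_tmul 𝒜 G _ (G.br_deg q q' x hx y hy) hc,
            preBr_tmul 𝒜 G a hx hc, map_smul, preBr_tmul 𝒜 G b hy
            (SetLike.GradedMul.mul_mem ha hc), ← mul_assoc, ← mul_assoc, R.comm p p' a ha b hb,
            G.jacobi q q' x hx y hy]
          simp only [tmul_add, tmul_smul, smul_mul_assoc, ← smul_tmul']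
          by_cases hp : Even p <;> by_cases hq : Even q <;> by_cases hr : Even p' <;>
            by_cases hs : Even q' <;> by_cases ht : Even p'' <;>
            simp only [neg_one_zpow_eq_ite, hp, hq, hr, hs, ht, Int.even_add, Int.even_mul,
              or_true, true_or, or_false, false_or, iff_true, true_iff, iff_false, false_iff,
              not_true, not_false_iff, if_true, if_false] <;> module

/-- The projection of the module of Cauchy sequences in `A ⊗ 𝔤` to its component of degree `n`. -/
noncomputable def seqProj (n : ℤ) : (pre R G).Seq →ₗ[K] (pre R G).Seq :=
  DirInv.seqMap (tensorProj 𝒜 𝒢 n) (R.graded.cont_tscale G.graded _)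

/-- The Cauchy sequences in `A ⊗ 𝔤` of degree `n`. -/
noncomputable def seqDegree (n : ℤ) : Submodule K (pre R G).Seq :=
  LinearMap.range (seqProj R G n)

variable {R G}

theorem mem_seqDegree {n : ℤ} {c : (pre R G).Seq} :
    c ∈ seqDegree R G n ↔ ∀ k, (pre R G).term k c ∈ tensorGrade 𝒜 𝒢 n := by
  constructor
  · rintro ⟨c, rfl⟩ k
    exact tensorProj_mem n _
  · refine fun h => ⟨c, DirInv.seq_ext fun k => ?_⟩
    exact (tensorProj_of_mem n (h k)).trans (if_pos rfl)

variable (R G)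

/-- A Cauchy sequence lies in a single member of the dir-inv structure, which meets only finitely
many bidegrees. Hence one finite set of degrees serves all its terms at once. -/
theorem isInternal_seqDegree : IsInternal (seqDegree R G) := by
  have h₁ : ∀ m n c, seqProj R G m (seqProj R G n c) = if n = m then seqProj R G n c else 0 := by
    intro m n c
    refine DirInv.seq_ext fun k => ?_
    have h := tensorProj_of_mem m (tensorProj_mem (𝒜 := 𝒜) (𝒢 := 𝒢) n (c.1 k))
    split_ifs at h ⊢
    · exact h
    · exact h
  have h₂ : ∀ c, ∃ S : Finset ℤ, ∑ n ∈ S, seqProj R G n c = c := by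
    rintro ⟨c, jk, hc⟩
    obtain ⟨S, hS⟩ := tscale_eq_zero R.graded G.graded jk
    refine ⟨S.image fun pq => pq.1 + pq.2, DirInv.seq_ext fun k => ?_⟩
    have := hS (fun p q => ∑ n ∈ S.image (fun pq => pq.1 + pq.2),
        (if p + q = n then (1 : K) else 0) - 1) (fun pq hpq => ?_) _ (hc.1 k)
    · rw [tscale_sub (fun p q => ∑ n ∈ S.image (fun pq => pq.1 + pq.2),
        (if p + q = n then (1 : K) else 0)), tscale_sum, tscale_one, LinearMap.sub_apply,
        sub_eq_zero, LinearMap.sum_apply] at this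
      rw [map_sum]
      exact this
    · rw [Finset.sum_ite_eq, if_pos (Finset.mem_image_of_mem _ hpq), sub_self]
  have h := isInternal_range_of_projections (seqProj R G) h₁ h₂
  have e : seqDegree R G = fun n => LinearMap.range (seqProj R G n) := rfl
  rw [e]
  exact h

noncomputable instance : Decomposition (seqDegree R G) :=
  (isInternal_seqDegree R G).chooseDecomposition

/-- The differential on Cauchy sequences in `A ⊗ 𝔤`. -/
noncomputable def seqD : (pre R G).Seq →ₗ[K] (pre R G).Seq :=
  DirInv.seqMap (preD R G) (preD_cont R G)

/-- The bracket on Cauchy sequences in `A ⊗ 𝔤`. -/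
noncomputable def seqBr :
    (pre R G).Seq →ₗ[K] (pre R G).Seq →ₗ[K] (pre R G).Seq :=
  DirInv.seqBil (preBr 𝒜 G) (preBr_cont R G)

theorem isDGLie_seq : IsDGLie (seqDegree R G) (seqD R G) (seqBr R G) :=
  (isDGLie_pre R G).of_injective (φ := (pre R G).term) (fun _ _ => DirInv.seq_ext)
    (fun _ _ => mem_seqDegree) (fun _ _ => rfl) fun _ _ _ => rfl

variable {R G}

theorem term_mem (k : ℕ) (n : ℤ) (c : (pre R G).Seq) (hc : c ∈ seqDegree R G n) :
    (pre R G).term k c ∈ tensorGrade 𝒜 𝒢 n := mem_seqDegree.1 hc k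

theorem mkS_mem (n : ℤ) (c : (pre R G).Seq) (hc : c ∈ seqDegree R G n) :
    (pre R G).mkS c ∈ degree R G n := by
  obtain ⟨c, rfl⟩ := hc
  exact ⟨(pre R G).mkS c, rfl⟩

theorem exists_mkS_eq (n : ℤ) (x : CTensor R G) (hx : x ∈ degree R G n) :
    ∃ c ∈ seqDegree R G n, (pre R G).mkS c = x := by
  obtain ⟨x, rfl⟩ := hx
  obtain ⟨c, rfl⟩ := (pre R G).mkS_surj x
  exact ⟨_, ⟨c, rfl⟩, rfl⟩

variable (R G)

/-- The axioms pass from A ⊗ 𝔤 to Cauchy sequences because the terms are jointly injective, and on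
to the completion because it is a quotient in which homogeneous classes have homogeneous
representatives. -/
theorem isDGLie : IsDGLie (degree R G) (d R G) (br R G) :=
  (isDGLie_seq R G).of_surjective (pre R G).mkS_surj mkS_mem exists_mkS_eq (fun _ => rfl)
    fun _ _ => rfl

end CTensor

/-! ### From S((A ⊗ 𝔤)[1]) to the super tensor product of A and S(𝔤[1]) -/

section gradedtensor

open DirectSum TensorProduct

variable {K : Type*} [Field K] {A : Type*} [Ring A] [Algebra K A]
  {𝒜 : ℤ → Submodule K A} [GradedAlgebra 𝒜]

section gmap
variable {B : Type*} [AddCommGroup B] [Module K B] {ℬ : ℤ → Submodule K B} [Decomposition ℬ]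
  {C : Type*} [AddCommGroup C] [Module K C] {P : Type*} [AddCommGroup P] [Module K P]

variable (𝒜 ℬ) in
/-- The extension of a bilinear map to `A`, with the sign of the Koszul rule. -/
noncomputable def gmap₂ (χ : B →ₗ[K] C →ₗ[K] P) : A ⊗[K] B →ₗ[K] A ⊗[K] C →ₗ[K] A ⊗[K] P :=
  TensorProduct.map₂ (LinearMap.mul K A)
      (χ.compl₁₂ (scaleDeg ℬ fun q => if Even q then 1 else 0) LinearMap.id) +
    TensorProduct.map₂ ((LinearMap.mul K A).compl₁₂ LinearMap.id
        (scaleDeg 𝒜 fun p => (-1 : K) ^ p))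
      (χ.compl₁₂ (scaleDeg ℬ fun q => if Even q then 0 else 1) LinearMap.id)

theorem gmap₂_tmul (χ : B →ₗ[K] C →ₗ[K] P) (a : A) {q : ℤ} {x : B} (hx : x ∈ ℬ q) {p : ℤ} {b : A}
    (hb : b ∈ 𝒜 p) (y : C) :
    gmap₂ 𝒜 ℬ χ (a ⊗ₜ x) (b ⊗ₜ y) = (-1 : K) ^ (q * p) • ((a * b) ⊗ₜ χ x y) := by
  have e₁ := scaleDeg_of_mem (fun q : ℤ => if Even q then (1 : K) else 0) hx
  have e₂ := scaleDeg_of_mem (fun q : ℤ => if Even q then (0 : K) else 1) hx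
  have e₃ := scaleDeg_of_mem (fun p : ℤ => (-1 : K) ^ p) hb
  have e : gmap₂ 𝒜 ℬ χ (a ⊗ₜ x) (b ⊗ₜ y) =
      (a * b) ⊗ₜ χ (scaleDeg ℬ (fun q : ℤ => if Even q then (1 : K) else 0) x) y +
      (a * scaleDeg 𝒜 (fun p : ℤ => (-1 : K) ^ p) b) ⊗ₜ
        χ (scaleDeg ℬ (fun q : ℤ => if Even q then (0 : K) else 1) x) y := rfl
  rw [e, e₁, e₂, e₃, zpow_mul]
  rcases Int.even_or_odd q with h | h
  · rw [h.neg_one_zpow]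
    simp [h]
  · rw [h.neg_one_zpow]
    simp [Int.not_even_iff_odd.2 h, TensorProduct.smul_tmul']

end gmap

variable (𝒜) in
/-- The sign `(-1)^p` on the component of degree `p`. -/
noncomputable abbrev altSign : A →ₗ[K] A := scaleDeg 𝒜 fun p => (-1 : K) ^ p

section gmul
variable {B : Type*} [Ring B] [Algebra K B] {ℬ : ℤ → Submodule K B} [GradedAlgebra ℬ]

theorem gtensor_mul (s t : A ⊗[K] B) : GradedTensorProduct.of K 𝒜 ℬ s *
    GradedTensorProduct.of K 𝒜 ℬ t =
      GradedTensorProduct.of K 𝒜 ℬ (gmap₂ 𝒜 ℬ (LinearMap.mul K B) s t) := by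
  induction s using homogeneous_tensor_induction 𝒜 ℬ with
  | zero => simp
  | add s s' hs hs' => simp only [map_add, add_mul, LinearMap.add_apply, hs, hs']
  | tmul p q a ha x hx =>
    induction t using homogeneous_tensor_induction 𝒜 ℬ with
    | zero => simp
    | add s s' hs hs' => simp only [map_add, mul_add, hs, hs']
    | tmul p' q' b hb y hy =>
      rw [GradedTensorProduct.tmul_mul_tmul_of_mem 𝒜 ℬ a hx hb y, gmap₂_tmul _ a hx hb y, map_smul]
      rfl

theorem gmul_assoc (r s t : A ⊗[K] B) :
    gmap₂ 𝒜 ℬ (LinearMap.mul K B) (gmap₂ 𝒜 ℬ (LinearMap.mul K B) r s) t =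
      gmap₂ 𝒜 ℬ (LinearMap.mul K B) r (gmap₂ 𝒜 ℬ (LinearMap.mul K B) s t) := by
  apply (GradedTensorProduct.of K 𝒜 ℬ).injective
  rw [← gtensor_mul, ← gtensor_mul, ← gtensor_mul, ← gtensor_mul, mul_assoc]

theorem gmul_mem {m n : ℤ} {s t : A ⊗[K] B} (hs : s ∈ tensorGrade 𝒜 ℬ m)
    (ht : t ∈ tensorGrade 𝒜 ℬ n) :
    gmap₂ 𝒜 ℬ (LinearMap.mul K B) s t ∈ tensorGrade 𝒜 ℬ (m + n) := by
  induction hs using tensorGrade_induction with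
  | zero => simp
  | add s s' _ _ hs hs' => rw [map_add, LinearMap.add_apply]; exact add_mem hs hs'
  | tmul p q h a ha x hx =>
    induction ht using tensorGrade_induction with
    | zero => simp
    | add s s' _ _ hs hs' => rw [map_add]; exact add_mem hs hs'
    | tmul p' q' h' b hb y hy =>
      rw [gmap₂_tmul _ a hx hb]
      exact Submodule.smul_mem _ _ (tmul_mem_tensorGrade (by omega)
        (SetLike.GradedMul.mul_mem ha hb) (SetLike.GradedMul.mul_mem hx hy))

end gmul

variable {L : Type*} [AddCommGroup L] [Module K L] {𝒢 : ℤ → Submodule K L} [Decomposition 𝒢]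
  (R : DGComAlg.{w} K 𝒜)

namespace SuperSym

variable (A 𝒢) in
/-- The inclusion of `A ⊗ 𝔤` into `A ⊗ S(𝔤[1])`. -/
noncomputable abbrev tι : A ⊗[K] L →ₗ[K] A ⊗[K] SuperSym (shift 𝒢) :=
  TensorProduct.map LinearMap.id (ι (shift 𝒢))

variable (𝒜 𝒢) in
/-- The multiplication of the super tensor product of `A` and `S(𝔤[1])`. -/
noncomputable abbrev tmulS : A ⊗[K] SuperSym (shift 𝒢) →ₗ[K] A ⊗[K] SuperSym (shift 𝒢) →ₗ[K]
    A ⊗[K] SuperSym (shift 𝒢) :=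
  gmap₂ 𝒜 (degree (shift 𝒢)) (LinearMap.mul K (SuperSym (shift 𝒢)))

theorem mem_shift_of_mem {q : ℤ} {x : L} (hx : x ∈ 𝒢 q) : x ∈ shift 𝒢 (q - 1) := by
  simpa [shift] using hx

-- Super-commutativity of A and of S(𝔤[1]) combine to super-commutativity for the total degree. This
-- is the relation which the universal property demands for `tensorHom`.
include R in
theorem tmulS_comm {m n : ℤ} {s t : A ⊗[K] L} (hs : s ∈ shift (tensorGrade 𝒜 𝒢) m)
    (ht : t ∈ shift (tensorGrade 𝒜 𝒢) n) :
    tmulS 𝒜 𝒢 (tι A 𝒢 s) (tι A 𝒢 t) =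
      (-1 : K) ^ (m * n) • tmulS 𝒜 𝒢 (tι A 𝒢 t) (tι A 𝒢 s) := by
  unfold shift at hs ht
  induction hs using tensorGrade_induction with
  | zero => simp
  | add s s' _ _ hs hs' => simp only [map_add, LinearMap.add_apply, hs, hs', smul_add]
  | tmul p q h a ha x hx =>
    induction ht using tensorGrade_induction with
    | zero => simp
    | add s s' _ _ hs hs' => simp only [map_add, LinearMap.add_apply, hs, hs', smul_add]
    | tmul p' q' h' b hb y hy =>
      obtain rfl : m = p + (q - 1) := by omega
      obtain rfl : n = p' + (q' - 1) := by omega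
      have hx' := mem_shift_of_mem hx
      have hy' := mem_shift_of_mem hy
      simp only [tι, TensorProduct.map_tmul, LinearMap.id_apply, tmulS]
      rw [gmap₂_tmul _ a (ι_mem_degree hx') hb, gmap₂_tmul _ b (ι_mem_degree hy') ha,
        LinearMap.mul_apply', LinearMap.mul_apply', ι_mul_ι hx' hy', R.comm p p' a ha b hb]
      simp only [tmul_smul, ← smul_tmul']
      by_cases hp : Even p <;> by_cases hq : Even q <;> by_cases hr : Even p' <;>
        by_cases hs : Even q' <;>
        simp only [neg_one_zpow_eq_ite, hp, hq, hr, hs, Int.even_add, Int.even_sub, Int.even_mul,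
          Int.not_even_one, or_true, true_or, or_false, false_or, iff_true, true_iff, iff_false,
          false_iff, not_true, not_false_iff, if_true, if_false] <;> module

variable (𝒢) in
/-- The homomorphism of algebras from the super-symmetric algebra of `A ⊗ 𝔤` to the super tensor
product of `A` and the one of `𝔤`. -/
noncomputable def tensorHom : SuperSym (shift (tensorGrade 𝒜 𝒢)) →ₐ[K]
    𝒜 ᵍ⊗[K] (degree (shift 𝒢)) :=
  lift ((GradedTensorProduct.of K 𝒜 (degree (shift 𝒢))).toLinearMap ∘ₗ tι A 𝒢)
    fun p q s hs t ht => by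
      have h := congrArg (GradedTensorProduct.of K 𝒜 (degree (shift 𝒢))) (tmulS_comm R hs ht)
      rw [map_smul, ← gtensor_mul, ← gtensor_mul] at h
      exact h

variable (𝒢) in
/-- The homomorphism `tensorHom` as a linear map to the tensor product. -/
noncomputable def tensorMap : SuperSym (shift (tensorGrade 𝒜 𝒢)) →ₗ[K]
    A ⊗[K] SuperSym (shift 𝒢) where
  toFun c := (GradedTensorProduct.of K 𝒜 (degree (shift 𝒢))).symm (tensorHom 𝒢 R c)
  map_add' a b := by rw [map_add, map_add]
  map_smul' a b := by rw [map_smul]; exact map_smul _ _ _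

theorem of_tensorMap (c : SuperSym (shift (tensorGrade 𝒜 𝒢))) :
    GradedTensorProduct.of K 𝒜 (degree (shift 𝒢)) (tensorMap 𝒢 R c) = tensorHom 𝒢 R c :=
  LinearEquiv.apply_symm_apply _ _

variable {R}

theorem tensorMap_one : tensorMap 𝒢 R (1 : SuperSym (shift (tensorGrade 𝒜 𝒢))) = 1 ⊗ₜ 1 := by
  apply (GradedTensorProduct.of K 𝒜 (degree (shift 𝒢))).injective
  rw [of_tensorMap, map_one]
  rfl

theorem tensorMap_ι_mul (v : A ⊗[K] L) (c : SuperSym (shift (tensorGrade 𝒜 𝒢))) :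
    tensorMap 𝒢 R (ι _ v * c) = tmulS 𝒜 𝒢 (tι A 𝒢 v) (tensorMap 𝒢 R c) := by
  apply (GradedTensorProduct.of K 𝒜 (degree (shift 𝒢))).injective
  rw [← gtensor_mul, of_tensorMap, of_tensorMap, map_mul, tensorHom, lift_ι]
  rfl

theorem tmulS_one (s : A ⊗[K] SuperSym (shift 𝒢)) : tmulS 𝒜 𝒢 s (1 ⊗ₜ 1) = s := by
  apply (GradedTensorProduct.of K 𝒜 (degree (shift 𝒢))).injective
  rw [← gtensor_mul]
  exact mul_one _

theorem tensorMap_ι (v : A ⊗[K] L) : tensorMap 𝒢 R (ι (shift (tensorGrade 𝒜 𝒢)) v) = tι A 𝒢 v := by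
  rw [← mul_one (ι _ v), tensorMap_ι_mul, tensorMap_one, tmulS_one]

theorem linearMap_ext_tensor {N : Type*} [AddCommGroup N] [Module K N]
    {f g : SuperSym (shift (tensorGrade 𝒜 𝒢)) →ₗ[K] N} (h1 : f 1 = g 1)
    (h : ∀ p q, ∀ a ∈ 𝒜 p, ∀ x ∈ shift 𝒢 q, ∀ c, f c = g c →
      f (ι _ (a ⊗ₜ x) * c) = g (ι _ (a ⊗ₜ x) * c)) : f = g := by
  refine linearMap_ext h1 fun m v hv c hc => ?_
  unfold shift at hv
  induction hv using tensorGrade_induction with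
  | zero => simp
  | add s s' _ _ hs hs' => simp only [map_add, add_mul, hs, hs']
  | tmul p q _ a ha x hx => exact h p (q - 1) a ha x (mem_shift_of_mem hx) c hc

theorem tmul_mem_shift {p q : ℤ} {a : A} (ha : a ∈ 𝒜 p) {x : L} (hx : x ∈ shift 𝒢 q) :
    a ⊗ₜ[K] x ∈ shift (tensorGrade 𝒜 𝒢) (p + q) :=
  tmul_mem_tensorGrade (by omega) ha hx

theorem tι_mem {n : ℤ} {v : A ⊗[K] L} (hv : v ∈ shift (tensorGrade 𝒜 𝒢) n) :
    tι A 𝒢 v ∈ tensorGrade 𝒜 (degree (shift 𝒢)) n := by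
  unfold shift at hv
  induction hv using tensorGrade_induction with
  | zero => simp
  | add s s' _ _ hs hs' => rw [map_add]; exact add_mem hs hs'
  | tmul p q h a ha x hx =>
    exact tmul_mem_tensorGrade (by omega) ha (ι_mem_degree (mem_shift_of_mem hx))

theorem tensorMap_mem {n : ℤ} {c : SuperSym (shift (tensorGrade 𝒜 𝒢))}
    (hc : c ∈ degree (shift (tensorGrade 𝒜 𝒢)) n) :
    tensorMap 𝒢 R c ∈ tensorGrade 𝒜 (degree (shift 𝒢)) n := by
  refine (Submodule.span_le (p := (tensorGrade _ _ n).comap (tensorMap 𝒢 R))).2 ?_ hc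
  rintro _ ⟨l, rfl, rfl⟩
  clear hc
  induction l with
  | nil =>
    simp only [List.map_nil, List.prod_nil, SetLike.mem_coe, Submodule.mem_comap, tensorMap_one]
    exact tmul_mem_tensorGrade (by simp) SetLike.GradedOne.one_mem one_mem_degree
  | cons a l ih =>
    simp only [List.map_cons, List.prod_cons, List.sum_cons, SetLike.mem_coe,
      Submodule.mem_comap, tensorMap_ι_mul] at ih ⊢
    exact gmul_mem (tι_mem a.2.2) ih

/-- The map `(a ⊗ s) ⊗ (b ⊗ t) ↦ ± a b ⊗ (s ⊗ t)`. -/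
noncomputable abbrev midMul (𝒜 : ℤ → Submodule K A) [GradedAlgebra 𝒜] (𝒢 : ℤ → Submodule K L)
    [Decomposition 𝒢] : A ⊗[K] SuperSym (shift 𝒢) →ₗ[K] A ⊗[K] SuperSym (shift 𝒢) →ₗ[K]
      A ⊗[K] (SuperSym (shift 𝒢) ⊗[K] SuperSym (shift 𝒢)) :=
  gmap₂ 𝒜 (degree (shift 𝒢)) (TensorProduct.mk K _ _)

variable (R) in
/-- The bilinear map `midMul`, composed with `tensorMap`, as a linear map. -/
noncomputable def midMap (𝒢 : ℤ → Submodule K L) [Decomposition 𝒢] :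
    SuperSym (shift (tensorGrade 𝒜 𝒢)) ⊗[K] SuperSym (shift (tensorGrade 𝒜 𝒢)) →ₗ[K]
      A ⊗[K] (SuperSym (shift 𝒢) ⊗[K] SuperSym (shift 𝒢)) :=
  TensorProduct.lift ((midMul 𝒜 𝒢).compl₁₂ (tensorMap 𝒢 R) (tensorMap 𝒢 R))

@[simp] theorem midMap_tmul (c c' : SuperSym (shift (tensorGrade 𝒜 𝒢))) :
    midMap R 𝒢 (c ⊗ₜ c') = midMul 𝒜 𝒢 (tensorMap 𝒢 R c) (tensorMap 𝒢 R c') := rfl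

-- The inductive step of `midMap_comul`: the two places where a new generator a ⊗ x can enter under
-- Δ assemble into one operator on A ⊗ (S ⊗ S), which multiplies by a and applies `comulStep`, with
-- the sign of moving x past the coefficient in A.
include R in
theorem midMul_step {p q : ℤ} {a : A} (ha : a ∈ 𝒜 p) {x : L} (hx : x ∈ shift 𝒢 q) {n : ℤ}
    {s : A ⊗[K] SuperSym (shift 𝒢)} (hs : s ∈ tensorGrade 𝒜 (degree (shift 𝒢)) n)
    (t : A ⊗[K] SuperSym (shift 𝒢)) :
    midMul 𝒜 𝒢 (tmulS 𝒜 𝒢 (a ⊗ₜ ι _ x) s) t +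
      (-1 : K) ^ ((p + q) * n) • midMul 𝒜 𝒢 s (tmulS 𝒜 𝒢 (a ⊗ₜ ι _ x) t) =
    TensorProduct.map (LinearMap.mulLeft K a ∘ₗ scaleDeg 𝒜 fun r => (-1 : K) ^ (q * r))
      (comulStep q x) (midMul 𝒜 𝒢 s t) := by
  have hx' := ι_mem_degree hx
  induction hs using tensorGrade_induction with
  | zero => simp
  | add s s' _ _ hs hs' =>
    simp only [map_add, LinearMap.add_apply, smul_add, ← hs, ← hs']
    abel
  | tmul p' q' h b hb y hy =>
    subst h
    induction t using homogeneous_tensor_induction 𝒜 (degree (shift 𝒢)) with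
    | zero => simp
    | add s s' hs hs' =>
      simp only [map_add, smul_add, ← hs, ← hs']
      abel
    | tmul p'' q'' c hc z hz =>
      rw [tmulS, gmap₂_tmul _ a hx' hb, gmap₂_tmul _ a hx' hc, midMul, LinearMap.mul_apply', LinearMap.mul_apply', map_smul, map_smul,
        LinearMap.smul_apply, gmap₂_tmul _ _ (SetLike.GradedMul.mul_mem hx' hy) hc,
        gmap₂_tmul _ _ hy (SetLike.GradedMul.mul_mem ha hc), gmap₂_tmul _ _ hy hc, map_smul,
        TensorProduct.map_tmul, LinearMap.comp_apply,
        scaleDeg_of_mem _ (SetLike.GradedMul.mul_mem hb hc), ← mul_assoc b, R.comm p p' a ha b hb]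
      simp only [TensorProduct.mk_apply, comulStep_tmul, psgn_of_mem q hy, LinearMap.mul_apply',
        map_smul, LinearMap.mulLeft_apply, tmul_add, ← smul_tmul', tmul_smul, mul_assoc,
        smul_mul_assoc]
      by_cases hp : Even p <;> by_cases hq : Even q <;> by_cases hr : Even p' <;>
        by_cases hs : Even q' <;> by_cases ht : Even p'' <;>
        simp only [neg_one_zpow_eq_ite, hp, hq, hr, hs, ht, Int.even_add, Int.even_mul,
          or_true, true_or, or_false, false_or, iff_true, true_iff, iff_false,
          false_iff, not_true, not_false_iff, if_true, if_false] <;> module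

/-- The map to `A ⊗ S(𝔤[1])` is compatible with the comultiplications. -/
theorem midMap_comul (c : SuperSym (shift (tensorGrade 𝒜 𝒢))) : midMap R 𝒢 (comul _ c) =
    TensorProduct.map LinearMap.id (comul (shift 𝒢)) (tensorMap 𝒢 R c) := by
  suffices midMap R 𝒢 ∘ₗ comul _ =
    TensorProduct.map LinearMap.id (comul (shift 𝒢)) ∘ₗ tensorMap 𝒢 R from DFunLike.congr_fun this c
  refine linearMap_ext_tensor ?_ fun p q a ha x hx c hc => ?_
  · simp only [LinearMap.comp_apply, comul_one, midMap_tmul, tensorMap_one, TensorProduct.map_tmul]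
    rw [midMul, gmap₂_tmul (ℬ := degree (shift 𝒢)) _ (1 : A) one_mem_degree (p := 0)
      SetLike.GradedOne.one_mem]
    simp
  · simp only [LinearMap.comp_apply] at hc ⊢
    rw [comul_ι_mul (tmul_mem_shift ha hx), tensorMap_ι_mul]
    have h₁ : ∀ s, TensorProduct.map LinearMap.id (comul (shift 𝒢))
        (tmulS 𝒜 𝒢 (a ⊗ₜ ι _ x) s) =
        TensorProduct.map (LinearMap.mulLeft K a ∘ₗ scaleDeg 𝒜 fun r => (-1 : K) ^ (q * r))
          (comulStep q x) (TensorProduct.map LinearMap.id (comul (shift 𝒢)) s) := by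
      intro s
      induction s using homogeneous_tensor_induction 𝒜 (degree (shift 𝒢)) with
      | zero => simp
      | add s s' hs hs' => simp only [map_add, hs, hs']
      | tmul p' q' b hb y hy =>
        rw [tmulS, gmap₂_tmul _ a (ι_mem_degree hx) hb]
        simp only [map_smul, TensorProduct.map_tmul, LinearMap.mul_apply', comul_ι_mul hx,
          LinearMap.comp_apply, scaleDeg_of_mem _ hb, LinearMap.mulLeft_apply, LinearMap.id_apply,
          ← smul_tmul', mul_smul_comm]
    refine Eq.trans ?_ (h₁ _).symm
    rw [← hc]
    generalize comul (shift (tensorGrade 𝒜 𝒢)) c = z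
    induction z using homogeneous_tensor_induction (degree (shift (tensorGrade 𝒜 𝒢)))
      (degree (shift (tensorGrade 𝒜 𝒢))) with
    | zero => simp
    | add s s' hs hs' => simp only [map_add, hs, hs']
    | tmul m n b hb c hc =>
      rw [comulStep_tmul, map_add, midMap_tmul, midMap_tmul, midMap_tmul, tensorMap_ι_mul,
        tensorMap_ι_mul, psgn_of_mem _ hb, map_smul, map_smul, LinearMap.smul_apply]
      exact midMul_step (R := R) ha hx (tensorMap_mem hb) _

end SuperSym

end gradedtensor

/-! ### The L∞ equation for the A-multilinear extension -/

section prelinf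

open DirectSum TensorProduct SuperSym CTensor

variable {K : Type*} [Field K] {A : Type*} [Ring A] [Algebra K A]
  {𝒜 : ℤ → Submodule K A} [GradedAlgebra 𝒜]
  {L : Type*} [AddCommGroup L] [Module K L] {𝒢 : ℤ → Submodule K L} [Decomposition 𝒢]
  {L' : Type*} [AddCommGroup L'] [Module K L'] {𝒢' : ℤ → Submodule K L'} [Decomposition 𝒢']
  {R : DGComAlg.{w} K 𝒜} (G : DGLieAlg.{w'} K 𝒢) (G' : DGLieAlg.{w''} K 𝒢')

variable (R) in
/-- The `A`-multilinear extension of a linear map on `S(𝔤[1])`. -/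
noncomputable def preExt (f : SuperSym (shift 𝒢) →ₗ[K] L') :
    SuperSym (shift (tensorGrade 𝒜 𝒢)) →ₗ[K] A ⊗[K] L' :=
  TensorProduct.map LinearMap.id f ∘ₗ tensorMap 𝒢 R

theorem preExt_apply (f : SuperSym (shift 𝒢) →ₗ[K] L') (c : SuperSym (shift (tensorGrade 𝒜 𝒢))) :
    preExt R f c = TensorProduct.map LinearMap.id f (tensorMap 𝒢 R c) := rfl

theorem symBr_tensor {f : SuperSym (shift 𝒢) →ₗ[K] L'}
    (hf : ∀ n, ∀ c ∈ SuperSym.degree (shift 𝒢) n, f c ∈ shift 𝒢' n) {n : ℤ}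
    {s : A ⊗[K] SuperSym (shift 𝒢)} (hs : s ∈ tensorGrade 𝒜 (SuperSym.degree (shift 𝒢)) n)
    (t : A ⊗[K] SuperSym (shift 𝒢)) :
    symBr (tensorGrade 𝒜 𝒢') (preBr 𝒜 G')
      (TensorProduct.map LinearMap.id f s ⊗ₜ TensorProduct.map LinearMap.id f t) =
    TensorProduct.map (altSign 𝒜) (symBr 𝒢' G'.br ∘ₗ TensorProduct.map f f) (midMul 𝒜 𝒢 s t) := by
  induction hs using tensorGrade_induction with
  | zero => simp
  | add s s' _ _ hs hs' => simp only [map_add, LinearMap.add_apply, add_tmul, hs, hs']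
  | tmul p q h b hb y hy =>
    induction t using homogeneous_tensor_induction 𝒜 (SuperSym.degree (shift 𝒢)) with
    | zero => simp
    | add s s' hs hs' => simp only [map_add, tmul_add, hs, hs']
    | tmul p' q' c hc z hz =>
      have hfy := hf q y hy
      have hfy' : f y ∈ 𝒢' (q + 1) := hfy
      rw [TensorProduct.map_tmul, TensorProduct.map_tmul, LinearMap.id_apply, LinearMap.id_apply,
        symBr_tmul _ (tmul_mem_shift hb hfy), preBr_tmul 𝒜 G' b hfy' hc, midMul,
        gmap₂_tmul _ b hy hc, map_smul, TensorProduct.map_tmul, LinearMap.comp_apply, mk_apply,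
        TensorProduct.map_tmul, symBr_tmul _ hfy, altSign,
        scaleDeg_of_mem _ (SetLike.GradedMul.mul_mem hb hc)]
      simp only [tmul_smul, ← smul_tmul']
      by_cases hp : Even p <;> by_cases hq : Even q <;> by_cases hr : Even p' <;>
        simp only [neg_one_zpow_eq_ite, hp, hq, hr, Int.even_add, Int.even_mul,
          Int.not_even_one, or_true, true_or, or_false, false_or, iff_true, true_iff, iff_false,
          false_iff, not_true, not_false_iff, if_true, if_false] <;> module

/-- By `midMap_comul` the comultiplication may be carried out in S(𝔤[1]) instead. The factor
`altSign` is the price of moving the bracket, of degree 1 on the shifted module, past the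
coefficients in A. -/
theorem symBr_preExt {f : SuperSym (shift 𝒢) →ₗ[K] L'}
    (hf : ∀ n, ∀ c ∈ SuperSym.degree (shift 𝒢) n, f c ∈ shift 𝒢' n)
    (c : SuperSym (shift (tensorGrade 𝒜 𝒢))) :
    symBr (tensorGrade 𝒜 𝒢') (preBr 𝒜 G')
      (TensorProduct.map (preExt R f) (preExt R f) (comul _ c)) =
    TensorProduct.map (altSign 𝒜) (symBr 𝒢' G'.br ∘ₗ TensorProduct.map f f ∘ₗ comul (shift 𝒢))
      (tensorMap 𝒢 R c) := by
  have h : ∀ z, symBr (tensorGrade 𝒜 𝒢') (preBr 𝒜 G')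
      (TensorProduct.map (preExt R f) (preExt R f) z) =
      TensorProduct.map (altSign 𝒜) (symBr 𝒢' G'.br ∘ₗ TensorProduct.map f f)
        (midMap R 𝒢 z) := by
    intro z
    induction z using homogeneous_tensor_induction (SuperSym.degree (shift (tensorGrade 𝒜 𝒢)))
      (SuperSym.degree (shift (tensorGrade 𝒜 𝒢))) with
    | zero => simp
    | add s s' hs hs' => simp only [map_add, hs, hs']
    | tmul m n b hb c hc => exact symBr_tensor G' hf (tensorMap_mem hb) _
  rw [h, midMap_comul, ← LinearMap.comp_apply, ← TensorProduct.map_comp, LinearMap.comp_id,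
    LinearMap.comp_assoc]

theorem counit_tensorMap (c : SuperSym (shift (tensorGrade 𝒜 𝒢))) :
    TensorProduct.map LinearMap.id (counitHom (shift 𝒢)).toLinearMap (tensorMap 𝒢 R c) =
      counitHom _ c • ((1 : A) ⊗ₜ[K] (1 : K)) := by
  suffices TensorProduct.map LinearMap.id (counitHom (shift 𝒢)).toLinearMap ∘ₗ tensorMap 𝒢 R =
    (counitHom _).toLinearMap.smulRight ((1 : A) ⊗ₜ[K] (1 : K)) from DFunLike.congr_fun this c
  refine linearMap_ext_tensor ?_ fun p q a ha x hx c _ => ?_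
  · simp [tensorMap_one]
  · simp only [LinearMap.comp_apply, tensorMap_ι_mul, LinearMap.smulRight_apply,
      AlgHom.toLinearMap_apply, map_mul, counitHom_ι, zero_mul, zero_smul]
    generalize tensorMap 𝒢 R c = s
    induction s using homogeneous_tensor_induction 𝒜 (SuperSym.degree (shift 𝒢)) with
    | zero => simp
    | add s s' hs hs' => simp only [map_add, hs, hs', add_zero]
    | tmul p' q' b hb y hy =>
      rw [tι, TensorProduct.map_tmul, LinearMap.id_apply, tmulS,
        gmap₂_tmul _ a (ι_mem_degree hx) hb]
      simp

/-- Multiplying by a ⊗ x, `ln` retains only the counit of the other factor, and `counit_tensorMap`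
computes that. Recognizing `ln` as an extension lets `symBr_preExt` compute the Taylor coefficients
of the structure on A ⊗ 𝔤. -/
theorem preExt_ln : preExt R (ln (shift 𝒢)) = ln (shift (tensorGrade 𝒜 𝒢)) := by
  refine linearMap_ext_tensor ?_ fun p q a ha x hx c _ => ?_
  · simp [preExt_apply, tensorMap_one]
  · rw [preExt_apply, tensorMap_ι_mul, ln_ι_mul]
    have h : ∀ s, TensorProduct.map LinearMap.id (ln (shift 𝒢))
        (tmulS 𝒜 𝒢 (tι A 𝒢 (a ⊗ₜ x)) s) =
        TensorProduct.map (LinearMap.mulLeft K a ∘ₗ scaleDeg 𝒜 fun r => (-1 : K) ^ (q * r))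
          (LinearMap.toSpanSingleton K L x)
          (TensorProduct.map LinearMap.id (counitHom (shift 𝒢)).toLinearMap s) := by
      intro s
      induction s using homogeneous_tensor_induction 𝒜 (SuperSym.degree (shift 𝒢)) with
      | zero => simp
      | add s s' hs hs' => simp only [map_add, hs, hs']
      | tmul p' q' b hb y hy =>
        rw [tι, TensorProduct.map_tmul, LinearMap.id_apply, tmulS,
          gmap₂_tmul _ a (ι_mem_degree hx) hb]
        simp [ln_ι_mul, scaleDeg_of_mem _ hb, ← smul_tmul']
        exact smul_comm _ _ _
    rw [h, counit_tensorMap, map_smul, TensorProduct.map_tmul, LinearMap.comp_apply,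
      scaleDeg_of_mem _ (SetLike.GradedOne.one_mem : (1 : A) ∈ 𝒜 0)]
    simp

theorem preD_preExt (f : SuperSym (shift 𝒢) →ₗ[K] L') (c : SuperSym (shift (tensorGrade 𝒜 𝒢))) :
    preD R G' (preExt R f c) = TensorProduct.map R.d f (tensorMap 𝒢 R c) +
      TensorProduct.map (altSign 𝒜) (G'.d ∘ₗ f) (tensorMap 𝒢 R c) := by
  rw [preExt_apply]
  generalize tensorMap 𝒢 R c = s
  induction s using TensorProduct.induction_on with
  | zero => simp
  | add s s' hs hs' =>
    simp only [map_add, hs, hs']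
    abel
  | tmul a s => rfl

/-- The differential of A contributes only to the first Taylor coefficient; all the rest is the
signed A-extension of the coefficients of 𝔤. -/
theorem dgTaylor_pre (c : SuperSym (shift (tensorGrade 𝒜 𝒢))) :
    dgTaylor (tensorGrade 𝒜 𝒢) (preD R G) (preBr 𝒜 G) c =
      TensorProduct.map R.d LinearMap.id (ln _ c) +
      TensorProduct.map (altSign 𝒜) (dgTaylor 𝒢 G.d G.br) (tensorMap 𝒢 R c) := by
  have h : TensorProduct.map R.d (ln (shift 𝒢)) (tensorMap 𝒢 R c) =
      TensorProduct.map R.d LinearMap.id (ln (shift (tensorGrade 𝒜 𝒢)) c) := by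
    rw [← preExt_ln (R := R), preExt_apply,
      ← LinearMap.comp_apply (TensorProduct.map R.d LinearMap.id), ← TensorProduct.map_comp]
    rfl
  rw [dgTaylor_apply, ← h, ← preExt_ln (R := R), symBr_preExt G (fun n c hc => ln_mem hc),
    preD_preExt, dgTaylor, TensorProduct.map_add_right, TensorProduct.map_smul_right, add_assoc]
  rfl

theorem DGComAlg.d_one (R : DGComAlg.{w} K 𝒜) : R.d 1 = 0 := by
  have := R.leibniz 0 1 SetLike.GradedOne.one_mem 1
  simpa using this

theorem derivation_tmulS {p q : ℤ} {a : A} (ha : a ∈ 𝒜 p) {s : SuperSym (shift 𝒢)}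
    (hs : s ∈ SuperSym.degree (shift 𝒢) q) (t : A ⊗[K] SuperSym (shift 𝒢)) :
    TensorProduct.map R.d LinearMap.id (tmulS 𝒜 𝒢 (a ⊗ₜ s) t) = tmulS 𝒜 𝒢 (R.d a ⊗ₜ s) t +
      (-1 : K) ^ (p + q) • tmulS 𝒜 𝒢 (a ⊗ₜ s) (TensorProduct.map R.d LinearMap.id t) := by
  induction t using homogeneous_tensor_induction 𝒜 (SuperSym.degree (shift 𝒢)) with
  | zero => simp
  | add s s' hs hs' =>
    simp only [map_add, hs, hs', smul_add]
    abel
  | tmul p' q' b hb y hy =>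
    rw [tmulS, gmap₂_tmul _ a hs hb, gmap₂_tmul _ _ hs hb, TensorProduct.map_tmul,
      gmap₂_tmul _ a hs (R.d_deg p' b hb), map_smul, TensorProduct.map_tmul, R.leibniz p a ha]
    simp only [LinearMap.id_apply, add_tmul, ← smul_tmul']
    by_cases hp : Even p <;> by_cases hq : Even q <;> by_cases hr : Even p' <;>
      simp only [neg_one_zpow_eq_ite, hp, hq, hr, Int.even_add, Int.even_mul,
        Int.not_even_one, or_true, true_or, or_false, false_or, iff_true, true_iff, iff_false,
        false_iff, not_true, not_false_iff, if_true, if_false] <;> module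

theorem map_d_mem {n : ℤ} {v : A ⊗[K] L} (hv : v ∈ shift (tensorGrade 𝒜 𝒢) n) :
    TensorProduct.map R.d LinearMap.id v ∈ shift (tensorGrade 𝒜 𝒢) (n + 1) := by
  unfold shift at hv ⊢
  induction hv using tensorGrade_induction with
  | zero => simp
  | add s s' _ _ hs hs' => rw [map_add]; exact add_mem hs hs'
  | tmul p q h a ha x hx => exact tmul_mem_tensorGrade (by omega) (R.d_deg p a ha) hx

variable (R) in
/-- The convolution of the differential of `A` with `tensorMap`. -/
noncomputable def dConv (𝒢 : ℤ → Submodule K L) [Decomposition 𝒢] :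
    SuperSym (shift (tensorGrade 𝒜 𝒢)) ⊗[K] SuperSym (shift (tensorGrade 𝒜 𝒢)) →ₗ[K]
      A ⊗[K] SuperSym (shift 𝒢) :=
  TensorProduct.lift ((tmulS 𝒜 𝒢).compl₁₂
    (tι A 𝒢 ∘ₗ TensorProduct.map R.d LinearMap.id ∘ₗ ln (shift (tensorGrade 𝒜 𝒢)))
    (tensorMap 𝒢 R))

theorem dConv_tmul (c c' : SuperSym (shift (tensorGrade 𝒜 𝒢))) : dConv R 𝒢 (c ⊗ₜ c') =
    tmulS 𝒜 𝒢 (tι A 𝒢 (TensorProduct.map R.d LinearMap.id (ln _ c))) (tensorMap 𝒢 R c') := rfl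

theorem dConv_step {m : ℤ} {v : A ⊗[K] L} (hv : v ∈ shift (tensorGrade 𝒜 𝒢) m)
    (z : SuperSym (shift (tensorGrade 𝒜 𝒢)) ⊗[K] SuperSym (shift (tensorGrade 𝒜 𝒢))) :
    dConv R 𝒢 (comulStep m v z) =
      tmulS 𝒜 𝒢 (tι A 𝒢 (TensorProduct.map R.d LinearMap.id v))
        (tensorMap 𝒢 R (LinearMap.mul' K _ (TensorProduct.map
          (Algebra.linearMap K _ ∘ₗ (counitHom _).toLinearMap) LinearMap.id z))) +
      (-1 : K) ^ m • tmulS 𝒜 𝒢 (tι A 𝒢 v) (dConv R 𝒢 z) := by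
  induction z using homogeneous_tensor_induction (SuperSym.degree (shift (tensorGrade 𝒜 𝒢)))
    (SuperSym.degree (shift (tensorGrade 𝒜 𝒢))) with
  | zero => simp
  | add s s' hs hs' =>
    simp only [map_add, hs, hs', smul_add]
    abel
  | tmul n n' b hb c hc =>
    rw [comulStep_tmul, map_add, dConv_tmul, dConv_tmul, dConv_tmul, ln_ι_mul, psgn_of_mem _ hb,
      tensorMap_ι_mul]
    simp only [map_smul, LinearMap.smul_apply]
    rw [← gmul_assoc, tmulS_comm R (map_d_mem (ln_mem hb)) hv, map_smul, LinearMap.smul_apply, gmul_assoc,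
      smul_smul]
    congr 1
    · simp [← Algebra.smul_def]
    · congr 1
      by_cases hm : Even m <;> by_cases hn : Even n <;>
        simp [neg_one_zpow_eq_ite, Int.even_add, Int.even_mul, Int.not_even_one, hm, hn]

/-- The operator d_A ⊗ 1 is a derivation of the super tensor product, hence determined by its effect
on generators; the convolution on the left is the coderivation-style formula for the same operator.
The recursion `dConv_step` moves the generator of odd degree shift into front position, where the
signs cancel. -/
theorem dConv_comul (c : SuperSym (shift (tensorGrade 𝒜 𝒢))) :
    dConv R 𝒢 (comul _ c) = TensorProduct.map R.d LinearMap.id (tensorMap 𝒢 R c) := by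
  suffices dConv R 𝒢 ∘ₗ comul _ = TensorProduct.map R.d LinearMap.id ∘ₗ tensorMap 𝒢 R from
    DFunLike.congr_fun this c
  refine linearMap_ext_tensor ?_ fun p q a ha x hx c hc => ?_
  · simp [tensorMap_one, dConv_tmul, R.d_one]
  · simp only [LinearMap.comp_apply] at hc ⊢
    rw [comul_ι_mul (tmul_mem_shift ha hx), dConv_step (tmul_mem_shift ha hx),
      mul_counitHom_comul, hc, tensorMap_ι_mul]
    exact (derivation_tmulS ha (ι_mem_degree hx) _).symm

theorem tmulS_map {q : SuperSym (shift 𝒢) →ₗ[K] L}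
    (hq : ∀ n, ∀ c ∈ SuperSym.degree (shift 𝒢) n, q c ∈ shift 𝒢 (n + 1))
    (s t : A ⊗[K] SuperSym (shift 𝒢)) :
    tmulS 𝒜 𝒢 (tι A 𝒢 (TensorProduct.map (altSign 𝒜) q s)) t =
      TensorProduct.map (altSign 𝒜) (LinearMap.mul' K _ ∘ₗ
        TensorProduct.map (ι (shift 𝒢) ∘ₗ q) LinearMap.id) (midMul 𝒜 𝒢 s t) := by
  induction s using homogeneous_tensor_induction 𝒜 (SuperSym.degree (shift 𝒢)) with
  | zero => simp
  | add s s' hs hs' => simp only [map_add, LinearMap.add_apply, hs, hs']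
  | tmul p q b hb y hy =>
    induction t using homogeneous_tensor_induction 𝒜 (SuperSym.degree (shift 𝒢)) with
    | zero => simp
    | add s s' hs hs' => simp only [map_add, hs, hs']
    | tmul p' q' c hc z hz =>
      rw [TensorProduct.map_tmul, tι, TensorProduct.map_tmul, LinearMap.id_apply, tmulS,
        gmap₂_tmul _ _ (ι_mem_degree (hq _ y hy)) hc, midMul, gmap₂_tmul _ b hy hc, map_smul,
        TensorProduct.map_tmul, altSign, scaleDeg_of_mem _ hb,
        scaleDeg_of_mem _ (SetLike.GradedMul.mul_mem hb hc)]
      simp only [smul_mul_assoc, ← smul_tmul', LinearMap.comp_apply, mk_apply,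
        TensorProduct.map_tmul, LinearMap.mul'_apply, LinearMap.mul_apply', LinearMap.id_apply]
      by_cases hp : Even p <;> by_cases hq : Even q <;> by_cases hr : Even p' <;>
        simp only [neg_one_zpow_eq_ite, hp, hq, hr, Int.even_add, Int.even_mul,
          Int.not_even_one, or_true, true_or, or_false, false_or, iff_true, true_iff, iff_false,
          false_iff, not_true, not_false_iff, if_true, if_false] <;> module

/-- The coderivation of A ⊗ 𝔤 becomes d_A ⊗ 1 plus the signed 1 ⊗ Q. The first summand comes from
`dConv_comul`, the second from compatibility with Δ. -/
theorem tensorMap_coder [CharZero K] (c : SuperSym (shift (tensorGrade 𝒜 𝒢))) :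
    tensorMap 𝒢 R (coder (dgTaylor (tensorGrade 𝒜 𝒢) (preD R G) (preBr 𝒜 G)) c) =
      TensorProduct.map R.d LinearMap.id (tensorMap 𝒢 R c) +
      TensorProduct.map (altSign 𝒜) (coder (dgTaylor 𝒢 G.d G.br)) (tensorMap 𝒢 R c) := by
  have h : ∀ z, tensorMap 𝒢 R (LinearMap.mul' K _ (TensorProduct.map (ι _ ∘ₗ
      dgTaylor (tensorGrade 𝒜 𝒢) (preD R G) (preBr 𝒜 G)) LinearMap.id z)) = dConv R 𝒢 z +
      TensorProduct.map (altSign 𝒜) (LinearMap.mul' K _ ∘ₗ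
        TensorProduct.map (ι (shift 𝒢) ∘ₗ dgTaylor 𝒢 G.d G.br) LinearMap.id) (midMap R 𝒢 z) := by
    intro z
    induction z using TensorProduct.induction_on with
    | zero => simp
    | add s s' hs hs' =>
      simp only [map_add, hs, hs']
      abel
    | tmul b c =>
      rw [TensorProduct.map_tmul, LinearMap.mul'_apply, LinearMap.comp_apply, LinearMap.id_apply,
        tensorMap_ι_mul, dgTaylor_pre, map_add, map_add, LinearMap.add_apply, dConv_tmul,
        tmulS_map (dgTaylor_mem_degree G.isDGLie), midMap_tmul]
  rw [coder_apply, h, dConv_comul, midMap_comul, ← LinearMap.comp_apply (TensorProduct.map _ _)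
    (TensorProduct.map _ _), ← TensorProduct.map_comp]
  rfl

/-- The operator d_A ⊗ 1 commutes with 1 ⊗ f, so its contributions on the two sides cancel. What is
left is the signed A-extension of the equation for f. -/
theorem linfDefect_preExt [CharZero K] {f : SuperSym (shift 𝒢) →ₗ[K] L'}
    (hf : ∀ n, ∀ c ∈ SuperSym.degree (shift 𝒢) n, f c ∈ shift 𝒢' n)
    (h : linfDefect 𝒢 𝒢' G.d G.br G'.d G'.br f = 0) :
    linfDefect (tensorGrade 𝒜 𝒢) (tensorGrade 𝒜 𝒢') (preD R G) (preBr 𝒜 G) (preD R G')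
      (preBr 𝒜 G') (preExt R f) = 0 := by
  rw [linfDefect, sub_eq_zero] at h
  refine LinearMap.ext fun c => ?_
  simp only [linfDefect, LinearMap.sub_apply, LinearMap.comp_apply, LinearMap.add_apply,
    LinearMap.smul_apply, LinearMap.zero_apply]
  rw [sub_eq_zero, preD_preExt, symBr_preExt G' hf, preExt_apply, tensorMap_coder, map_add,
    ← LinearMap.comp_apply (TensorProduct.map LinearMap.id f)
      (TensorProduct.map R.d LinearMap.id), ← TensorProduct.map_comp,
    ← LinearMap.comp_apply (TensorProduct.map LinearMap.id f)
      (TensorProduct.map (altSign 𝒜) _), ← TensorProduct.map_comp, h, LinearMap.id_comp, LinearMap.id_comp, LinearMap.comp_id,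
    TensorProduct.map_add_right, TensorProduct.map_smul_right, LinearMap.add_apply,
    LinearMap.smul_apply, add_assoc]

end prelinf

/-! ### Descent of linear maps along a surjection of symmetric algebras -/

section descent

open DirectSum TensorProduct SuperSym

variable {K : Type*} [Field K]
  {M : Type*} [AddCommGroup M] [Module K M] {𝒢 : ℤ → Submodule K M} [Decomposition 𝒢]
  {N : Type*} [AddCommGroup N] [Module K N] {ℋ : ℤ → Submodule K N} [Decomposition ℋ]
  {P : Type*} [AddCommGroup P] [Module K P]

namespace SuperSym

theorem mem_of_list_prod (S : Submodule K (SuperSym 𝒢))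
    (h : ∀ l : List M, (l.map (ι 𝒢)).prod ∈ S) (c : SuperSym 𝒢) : c ∈ S := by
  have key : c ∈ Submodule.span K (Set.range fun l : List M => (l.map (ι 𝒢)).prod) := by
    refine mem_of_ι_mul _ (Submodule.subset_span (Set.mem_range.2 ⟨[], rfl⟩)) (fun p x _ c hc => ?_) c
    refine (Submodule.span_le (p := (Submodule.span K (Set.range fun l : List M =>
      (l.map (ι 𝒢)).prod)).comap (LinearMap.mulLeft K (ι 𝒢 x)))).2 ?_ hc
    rintro _ ⟨l, rfl⟩
    exact Submodule.subset_span (Set.mem_range.2 ⟨x :: l, rfl⟩)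
  refine Submodule.span_le.2 ?_ key
  rintro _ ⟨l, rfl⟩
  exact h l

theorem mem_of_prod (S : Submodule K (SuperSym 𝒢))
    (h : ∀ (j : ℕ) (x : Fin j → M), (List.ofFn fun l => ι 𝒢 (x l)).prod ∈ S) (c : SuperSym 𝒢) :
    c ∈ S := by
  refine mem_of_list_prod S (fun l => ?_) c
  have := h l.length l.get
  rwa [← List.ofFn_get l, List.map_ofFn]

variable (φ : M →ₗ[K] N) (hφ : ∀ p, ∀ x ∈ 𝒢 p, φ x ∈ ℋ p)

theorem map_prod_ι {j : ℕ} (x : Fin j → M) : map φ hφ (List.ofFn fun l => ι 𝒢 (x l)).prod =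
    (List.ofFn fun l => ι ℋ (φ (x l))).prod := by
  rw [map_list_prod, List.map_ofFn]
  simp [Function.comp_def]

/-- The kernel of the homomorphism of super-symmetric algebras induced by a surjection is the ideal
which is generated by the kernel of the surjection. -/
theorem exists_comp_map (hs : Function.Surjective φ)
    (hφ' : ∀ p, ∀ y ∈ ℋ p, ∃ x ∈ 𝒢 p, φ x = y) (g : SuperSym 𝒢 →ₗ[K] P)
    (hg : ∀ x, φ x = 0 → ∀ a b, g (a * ι 𝒢 x * b) = 0) :
    ∃ g' : SuperSym ℋ →ₗ[K] P, ∀ c, g' (map φ hφ c) = g c := by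
  -- Two elements are congruent when g cannot distinguish them in any context a · _ · b. This is a
  -- ring congruence through which g factors, and the hypothesis says that it identifies elements of
  -- M with equal image in N.
  let r : RingCon (SuperSym 𝒢) :=
    { r := fun s t => ∀ a b, g (a * s * b) = g (a * t * b)
      iseqv := ⟨fun _ _ _ => rfl, fun h a b => (h a b).symm, fun h h' a b =>
        (h a b).trans (h' a b)⟩
      mul' := fun {s t s' t'} h h' a b => by
        have h₁ := h a (s' * b)
        have h₂ := h' (a * t) b
        simp only [mul_assoc] at h₁ h₂ ⊢
        rw [h₁, h₂]
      add' := fun {s t s' t'} h h' a b => by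
        simp only [mul_add, add_mul, map_add, h a b, h' a b] }
  let m : SuperSym 𝒢 →ₐ[K] r.Quotient := RingCon.mkₐ K r
  have hm : ∀ {s t}, m s = m t ↔ ∀ a b, g (a * s * b) = g (a * t * b) := fun {s t} =>
    RingCon.eq r
  have hm' : ∀ {x y}, φ x = φ y → m (ι 𝒢 x) = m (ι 𝒢 y) := fun {x y} h => hm.2 fun a b => by
    have := hg (x - y) (by rw [map_sub, h, sub_self]) a b
    rwa [map_sub, mul_sub, sub_mul, map_sub, sub_eq_zero] at this
  let s := Function.surjInv hs
  have hs' : ∀ y, φ (s y) = y := Function.surjInv_eq hs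
  let f : N →ₗ[K] r.Quotient :=
    { toFun := fun y => m (ι 𝒢 (s y))
      map_add' := fun y z => by
        rw [← map_add, ← map_add]
        exact hm' (by rw [map_add, hs', hs', hs'])
      map_smul' := fun a y => by
        rw [RingHom.id_apply, ← map_smul, ← map_smul]
        exact hm' (by rw [map_smul, hs', hs']) }
  have hf : ∀ x, f (φ x) = m (ι 𝒢 x) := fun x => hm' (hs' _)
  let F : SuperSym ℋ →ₐ[K] r.Quotient := lift f fun p q a ha b hb => by
    obtain ⟨a, ha', rfl⟩ := hφ' p a ha
    obtain ⟨b, hb', rfl⟩ := hφ' q b hb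
    rw [hf, hf, ← map_mul m, ← map_mul m, ← map_smul m, ← ι_mul_ι ha' hb']
  have hF : F.comp (map φ hφ) = m := algHom_ext fun x => by
    rw [AlgHom.comp_apply, map_ι, lift_ι, hf]
  -- Over a field the surjection has a linear section. Composing g with it gives the required map:
  -- σ(map c) and c are congruent, and the context a = b = 1 compares their values under g.
  obtain ⟨σ, hσ⟩ := LinearMap.exists_rightInverse_of_surjective (map φ hφ).toLinearMap
    (LinearMap.range_eq_top.2 (map_surjective φ hφ hs))
  refine ⟨g ∘ₗ σ, fun c => ?_⟩
  have h₁ : map φ hφ (σ (map φ hφ c)) = map φ hφ c := DFunLike.congr_fun hσ _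
  have h₂ : m (σ (map φ hφ c)) = m c := by
    rw [← hF, AlgHom.comp_apply, h₁, AlgHom.comp_apply]
  simpa using hm.1 h₂ 1 1

theorem exists_map_eq_of_mem_degree (hφ' : ∀ p, ∀ y ∈ ℋ p, ∃ x ∈ 𝒢 p, φ x = y) {n : ℤ}
    {c : SuperSym ℋ} (hc : c ∈ degree ℋ n) : ∃ b ∈ degree 𝒢 n, map φ hφ b = c := by
  refine (Submodule.span_le (p := (degree 𝒢 n).map (map φ hφ).toLinearMap)).2 ?_ hc
  rintro _ ⟨l, rfl, rfl⟩
  clear hc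
  induction l with
  | nil => exact ⟨1, one_mem_degree, map_one (map φ hφ)⟩
  | cons y l ih =>
    obtain ⟨b, hb, e⟩ := ih
    obtain ⟨x, hx, ex⟩ := hφ' _ _ y.2.2
    refine ⟨ι 𝒢 x * b, SetLike.GradedMul.mul_mem (ι_mem_degree hx) hb, ?_⟩
    simp only [List.map_cons, List.prod_cons] at e ⊢
    rw [← e, ← ex]
    simp

end SuperSym

end descent

/-! ### Extension to Cauchy sequences and to the completed tensor product -/

section extension

open DirectSum TensorProduct SuperSym CTensor

variable {K : Type*} [Field K] {A : Type*} [Ring A] [Algebra K A]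
  {𝒜 : ℤ → Submodule K A} [GradedAlgebra 𝒜]
  {L : Type*} [AddCommGroup L] [Module K L] {𝒢 : ℤ → Submodule K L} [Decomposition 𝒢]
  {L' : Type*} [AddCommGroup L'] [Module K L'] {𝒢' : ℤ → Submodule K L'} [Decomposition 𝒢']
  (R : DGComAlg.{w} K 𝒜) (G : DGLieAlg.{w'} K 𝒢) (G' : DGLieAlg.{w''} K 𝒢')

theorem preExt_prod (Ψ : SuperSym (shift 𝒢) →ₗ[K] SuperSym (shift 𝒢')) {j : ℕ}
    (t : Fin j → A ⊗[K] L) : preExt R (ln _ ∘ₗ Ψ) (List.ofFn fun l => ι _ (t l)).prod =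
      preTaylor 𝒜 Ψ j t := by
  have : GradedTensorProduct.of K 𝒜 (degree (shift 𝒢))
      (tensorMap 𝒢 R (List.ofFn fun l => ι _ (t l)).prod) = (List.ofFn fun l =>
        GradedTensorProduct.of K 𝒜 (degree (shift 𝒢)) (tι A 𝒢 (t l))).prod := by
    rw [of_tensorMap, map_list_prod, List.map_ofFn]
    congr 2
    funext l
    rw [Function.comp_apply, ← of_tensorMap, tensorMap_ι]
  rw [← LinearEquiv.eq_symm_apply] at this
  rw [preExt_apply, this]
  rfl

theorem preExt_mem {f : SuperSym (shift 𝒢) →ₗ[K] L'}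
    (hf : ∀ n, ∀ c ∈ SuperSym.degree (shift 𝒢) n, f c ∈ shift 𝒢' n) {n : ℤ}
    {c : SuperSym (shift (tensorGrade 𝒜 𝒢))} (hc : c ∈ degree (shift (tensorGrade 𝒜 𝒢)) n) :
    preExt R f c ∈ shift (tensorGrade 𝒜 𝒢') n := by
  have h := tensorMap_mem (R := R) hc
  rw [preExt_apply]
  generalize tensorMap 𝒢 R c = s at h
  induction h using tensorGrade_induction with
  | zero => simp
  | add s s' _ _ hs hs' => rw [map_add]; exact add_mem hs hs'
  | tmul p q h a ha x hx =>
    subst h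
    exact tmul_mem_shift ha (hf q x hx)

variable {Ψ : SuperSym (shift 𝒢) →ₗ[K] SuperSym (shift 𝒢')}

theorem preExt_ln_one (h1 : Ψ 1 = 1) :
    preExt R (ln _ ∘ₗ Ψ) (1 : SuperSym (shift (tensorGrade 𝒜 𝒢))) = 0 := by
  simp [preExt_apply, tensorMap_one, h1]

variable (hΨ : IsContinuousLInfty G.top G'.top Ψ) (h1 : Ψ 1 = 1)

section

/-- The shifted grading on Cauchy sequences in `A ⊗ 𝔤`. -/
noncomputable abbrev seqShift : ℤ → Submodule K (pre R G).Seq :=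
  shift (seqDegree R G)

/-- The graded symmetric coalgebra of the shifted module of Cauchy sequences in `A ⊗ 𝔤`. -/
abbrev SeqSym : Type _ := SuperSym (seqShift R G)

variable {G} in
/-- The homomorphism of super-symmetric algebras induced by the `k`-th term of Cauchy sequences. -/
noncomputable def mapTerm (k : ℕ) :
    SeqSym R G →ₐ[K] SuperSym (shift (tensorGrade 𝒜 𝒢)) :=
  SuperSym.map ((pre R G).term k) (shift_map (term_mem k))

/-- The homomorphism of super-symmetric algebras induced by the projection to the completion. -/
noncomputable def mapMk : SeqSym R G →ₐ[K] CSym R G :=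
  SuperSym.map (pre R G).mkS (shift_map mkS_mem)

end

-- It suffices to treat products of j sequences. For j ≥ 1 continuity of the j-th Taylor coefficient
-- gives the Cauchy property; for j = 0 the value is zero since Ψ(1) = 1.
include hΨ h1 in
theorem preExt_mapTerm_mem (c : SeqSym R G) :
    (fun k => preExt R (ln _ ∘ₗ Ψ) (mapTerm R k c)) ∈ (pre R G').cauchySeq := by
  let g : SeqSym R G →ₗ[K] (ℕ → A ⊗[K] L') :=
    LinearMap.pi fun k => preExt R (ln _ ∘ₗ Ψ) ∘ₗ (mapTerm R k).toLinearMap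
  refine mem_of_prod ((pre R G').cauchySeq.comap g) (fun j x => ?_) c
  have hg : g (List.ofFn fun l => ι _ (x l)).prod =
      fun k => preTaylor 𝒜 Ψ j fun l => (x l).1 k := by
    funext k
    exact (congrArg _ (map_prod_ι _ _ _)).trans (preExt_prod R Ψ _)
  rw [Submodule.mem_comap, hg]
  rcases Nat.eq_zero_or_pos j with rfl | hj
  · have : (fun k => preTaylor 𝒜 Ψ 0 fun l => (x l).1 k) = 0 := by
      funext k
      rw [← preExt_prod R]
      simpa using preExt_ln_one R h1
    rw [this]
    exact zero_mem _
  · exact (preTaylor_cont R G G' (hΨ j hj)).cauchy x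

/-- The extension of `ln ∘ Ψ` to Cauchy sequences in `A ⊗ 𝔤`. -/
noncomputable def seqExt : SeqSym R G →ₗ[K] (pre R G').Seq where
  toFun c := ⟨_, preExt_mapTerm_mem R G G' hΨ h1 c⟩
  map_add' c c' := DirInv.seq_ext fun k =>
    (congrArg (preExt R _) (map_add (mapTerm R k) c c')).trans (map_add (preExt R _) _ _)
  map_smul' a c := DirInv.seq_ext fun k =>
    (congrArg (preExt R _) (map_smul (mapTerm R k) a c)).trans (map_smul (preExt R _) _ _)

theorem term_seqExt (k : ℕ) (c : SeqSym R G) :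
    (pre R G').term k (seqExt R G G' hΨ h1 c) = preExt R (ln _ ∘ₗ Ψ) (mapTerm R k c) := rfl

theorem mkS_seqExt_prod {j : ℕ} (hj : 1 ≤ j) (x : Fin j → (pre R G).Seq) :
    (pre R G').mkS (seqExt R G G' hΨ h1 (List.ofFn fun l => ι _ (x l)).prod) =
      extTaylor R G G' Ψ j (hΨ j hj) fun l => (pre R G).mkS (x l) := by
  refine (congrArg (pre R G').mkS (?_ : _ = (⟨_, (preTaylor_cont R G G' (hΨ j hj)).cauchy x⟩ :
    (pre R G').cauchySeq))).trans (DirInv.cmulti_mkC _ _ x).symm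
  refine DirInv.seq_ext fun k => ?_
  exact (congrArg _ (map_prod_ι _ _ _)).trans (preExt_prod R Ψ _)

/-- On products of sequences the class of the value is `extTaylor` of the classes, which vanishes
when one argument does. This is the hypothesis under which `exists_comp_map` lets the map descend to
the completion. -/
theorem mkS_seqExt_eq_zero (x : (pre R G).Seq) (hx : (pre R G).mkS x = 0)
    (a b : SeqSym R G) :
    (pre R G').mkS (seqExt R G G' hΨ h1 (a * ι _ x * b)) = 0 := by
  let g := (pre R G').mkS ∘ₗ seqExt R G G' hΨ h1
  refine mem_of_list_prod (LinearMap.ker (g ∘ₗ LinearMap.mulRight K (ι _ x * b)))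
    (fun l => ?_) a |> fun h => by simpa [g, mul_assoc] using h
  refine mem_of_list_prod (LinearMap.ker (g ∘ₗ LinearMap.mulLeft K ((l.map (ι _)).prod * ι _ x)))
    (fun l' => ?_) b |> fun h => by simpa [g, mul_assoc] using h
  rw [LinearMap.mem_ker, LinearMap.comp_apply, LinearMap.mulLeft_apply]
  have e : (l.map (ι (seqShift R G))).prod * ι _ x * (l'.map (ι _)).prod =
      (List.ofFn fun i => ι (seqShift R G) ((l ++ x :: l').get i)).prod := by
    have := List.map_ofFn (f := (l ++ x :: l').get) (g := ι (seqShift R G))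
    rw [List.ofFn_get] at this
    refine Eq.trans ?_ (congrArg List.prod this)
    simp [mul_assoc]
  rw [e]
  have hl : 1 ≤ (l ++ x :: l').length := by simp; omega
  refine (mkS_seqExt_prod R G G' hΨ h1 hl _).trans ?_
  obtain ⟨i, hi⟩ := List.mem_iff_get.1 (show x ∈ l ++ x :: l' by simp)
  exact MultilinearMap.map_coord_zero _ i (by rw [hi, hx])

theorem exists_ctExt : ∃ f : CSym R G →ₗ[K] CTensor R G',
    ∀ c, f (mapMk R G c) = (pre R G').mkS (seqExt R G G' hΨ h1 c) :=
  exists_comp_map (𝒢 := seqShift R G)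
    (ℋ := shift (CTensor.degree R G)) (pre R G).mkS (shift_map mkS_mem) (pre R G).mkS_surj (fun p => exists_mkS_eq (p + 1))
    ((pre R G').mkS ∘ₗ seqExt R G G' hΨ h1) (mkS_seqExt_eq_zero R G G' hΨ h1)

/-- The map `ln ∘ Ψ_A` on `S((A ⊗̂ 𝔤)[1])`. -/
noncomputable def ctExt : CSym R G →ₗ[K] CTensor R G' := (exists_ctExt R G G' hΨ h1).choose

theorem ctExt_mapMk (c : SeqSym R G) :
    ctExt R G G' hΨ h1 (mapMk R G c) = (pre R G').mkS (seqExt R G G' hΨ h1 c) :=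
  (exists_ctExt R G G' hΨ h1).choose_spec c

theorem mapMk_surjective : Function.Surjective (mapMk R G) :=
  SuperSym.map_surjective _ _ (pre R G).mkS_surj

theorem ctExt_one : ctExt R G G' hΨ h1 1 = 0 := by
  rw [← map_one (mapMk R G), ctExt_mapMk,
    show seqExt R G G' hΨ h1 1 = 0 from DirInv.seq_ext fun k => ?_, map_zero]
  rw [term_seqExt, map_one, preExt_ln_one R h1, map_zero]

theorem ctExt_prod {j : ℕ} (hj : 1 ≤ j) (x : Fin j → CTensor R G) :
    ctExt R G G' hΨ h1 (List.ofFn fun l => ι _ (x l)).prod = extTaylor R G G' Ψ j (hΨ j hj) x := by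
  choose c hc using fun l => (pre R G).mkS_surj (x l)
  obtain rfl : (fun l => (pre R G).mkS (c l)) = x := funext hc
  rw [← mkS_seqExt_prod R G G' hΨ h1 hj, ← ctExt_mapMk]
  exact congrArg _ (map_prod_ι (𝒢 := seqShift R G)
    (pre R G).mkS (shift_map mkS_mem) c).symm

theorem ln_comp_mem (hΨ' : IsCoalgHom Ψ) (n : ℤ) (c : SuperSym (shift 𝒢))
    (hc : c ∈ SuperSym.degree (shift 𝒢) n) : (ln _ ∘ₗ Ψ) c ∈ shift 𝒢' n :=
  ln_mem (hΨ'.degree n c hc)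

theorem seqExt_mem (hΨ' : IsCoalgHom Ψ) {n : ℤ} {c : SeqSym R G}
    (hc : c ∈ SuperSym.degree (seqShift R G) n) :
    seqExt R G G' hΨ h1 c ∈ seqShift R G' n := by
  refine mem_seqDegree.2 fun k => ?_
  rw [term_seqExt]
  exact preExt_mem R (ln_comp_mem hΨ') (map_mem_degree
    (𝒢 := seqShift R G) _ _ hc)

theorem ctExt_mem (hΨ' : IsCoalgHom Ψ) (n : ℤ) (c : CSym R G)
    (hc : c ∈ SuperSym.degree (shift (CTensor.degree R G)) n) :
    ctExt R G G' hΨ h1 c ∈ shift (CTensor.degree R G') n := by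
  obtain ⟨b, hb, rfl⟩ := exists_map_eq_of_mem_degree
    (𝒢 := seqShift R G) (pre R G).mkS (shift_map mkS_mem) (fun p => exists_mkS_eq (p + 1)) hc
  have := ctExt_mapMk R G G' hΨ h1 b
  rw [mapMk] at this
  rw [this]
  exact mkS_mem _ _ (seqExt_mem R G G' hΨ h1 hΨ' hb)

/-- Two applications of naturality: the defect on Cauchy sequences vanishes since each of its terms
is a defect on A ⊗ 𝔤, and the defect on the completion is its image under a surjection. -/
theorem linfDefect_ctExt [CharZero K] (hΨ' : IsLInftyMorphism 𝒢 𝒢' G.d G.br G'.d G'.br Ψ) :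
    linfDefect (CTensor.degree R G) (CTensor.degree R G') (CTensor.d R G) (CTensor.br R G)
      (CTensor.d R G') (CTensor.br R G') (ctExt R G G' hΨ h1) = 0 := by
  have h := linfDefect_preExt (R := R) G G' (ln_comp_mem hΨ'.1)
    (hΨ'.linfDefect_eq_zero G.isDGLie G'.isDGLie)
  have hC : ∀ c, linfDefect (seqDegree R G) (seqDegree R G') (seqD R G) (seqBr R G) (seqD R G')
      (seqBr R G') (seqExt R G G' hΨ h1) c = 0 := fun c => DirInv.seq_ext fun k => by
    rw [← linfDefect_map (φ := (pre R G).term k) (χ := (pre R G').term k)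
      (d := seqD R G) (e := seqD R G') (d' := preD R G) (e' := preD R G')
      (br := seqBr R G) (bs := seqBr R G') (br' := preBr 𝒜 G) (bs' := preBr 𝒜 G') (term_mem k)
      (fun _ => rfl) (fun _ _ => rfl) (term_mem k) (fun _ => rfl) (fun _ _ => rfl)
      (fun c => (term_seqExt R G G' hΨ h1 k c).symm), h, LinearMap.zero_apply, map_zero]
  refine LinearMap.ext fun c => ?_
  obtain ⟨c, rfl⟩ := mapMk_surjective R G c
  refine (linfDefect_map (φ := (pre R G).mkS) (χ := (pre R G').mkS)
    (d := seqD R G) (e := seqD R G') (d' := CTensor.d R G) (e' := CTensor.d R G')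
    (br := seqBr R G) (bs := seqBr R G') (br' := CTensor.br R G) (bs' := CTensor.br R G') mkS_mem
    (fun _ => rfl) (fun _ _ => rfl) mkS_mem (fun _ => rfl) (fun _ _ => rfl)
    (ctExt_mapMk R G G' hΨ h1) c).trans ?_
  rw [hC, map_zero, LinearMap.zero_apply]

theorem taylor_coalgHom {M : Type*} [AddCommGroup M] [Module K M] {ℰ : ℤ → Submodule K M}
    [Decomposition ℰ] {N : Type*} [AddCommGroup N] [Module K N] {ℋ : ℤ → Submodule K N}
    [Decomposition ℋ] [CharZero K] {f : SuperSym ℰ →ₗ[K] N} (h1 : f 1 = 0) {j : ℕ}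
    (x : Fin j → M) : taylor (coalgHom ℋ f) j x = f (List.ofFn fun l => ι ℰ (x l)).prod := by
  have := DFunLike.congr_fun (ln_coalgHom (ℋ := ℋ) h1) (List.ofFn fun l => ι ℰ (x l)).prod
  simpa [taylor, MultilinearMap.mkPiAlgebraFin_apply] using this

end extension

/-! ### Finite exponential sums over the powers of ω -/

section expsum

open DirectSum TensorProduct SuperSym

variable {K : Type*} [Field K]
  {M : Type*} [AddCommGroup M] [Module K M] {𝒢 : ℤ → Submodule K M} [Decomposition 𝒢]
  {V : Type*} [AddCommGroup V] [Module K V] {W : Type*} [AddCommGroup W] [Module K W]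
  {ω : M}

namespace SuperSym

theorem pow_ι_mem_degree (hω : ω ∈ 𝒢 0) (k : ℕ) : ι 𝒢 ω ^ k ∈ degree 𝒢 0 := by
  induction k with
  | zero => simpa using one_mem_degree
  | succ k ih =>
    rw [pow_succ]
    simpa using SetLike.GradedMul.mul_mem ih (ι_mem_degree hω)

theorem mul_comm_of_mem_zero {a : SuperSym 𝒢} (ha : a ∈ degree 𝒢 0) (c : SuperSym 𝒢) :
    a * c = c * a := by
  suffices LinearMap.mulLeft K a = LinearMap.mulRight K a from DFunLike.congr_fun this c
  refine decompose_lhom_ext (degree 𝒢) fun n => ?_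
  ext ⟨c, hc⟩
  simp [mul_comm_of_mem ha hc]

theorem comul_ι_mul_of_mem_zero (hω : ω ∈ 𝒢 0) (c : SuperSym 𝒢) : comul 𝒢 (ι 𝒢 ω * c) =
    TensorProduct.map (LinearMap.mulLeft K (ι 𝒢 ω)) LinearMap.id (comul 𝒢 c) +
    TensorProduct.map LinearMap.id (LinearMap.mulLeft K (ι 𝒢 ω)) (comul 𝒢 c) := by
  rw [comul_ι_mul hω, comulStep, LinearMap.add_apply]
  congr 3
  exact psgn_zero

/-- As ω has degree 0 in the shifted module, multiplication by ω in the left leg and in the right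
leg commute without signs, and the binomial theorem applies to their sum. -/
theorem comul_pow_ι_mul (hω : ω ∈ 𝒢 0) (k : ℕ) (c : SuperSym 𝒢) : comul 𝒢 (ι 𝒢 ω ^ k * c) =
    ∑ m ∈ Finset.HasAntidiagonal.antidiagonal k, (k.choose m.1 : K) •
      TensorProduct.map (LinearMap.mulLeft K (ι 𝒢 ω ^ m.1)) (LinearMap.mulLeft K (ι 𝒢 ω ^ m.2))
        (comul 𝒢 c) := by
  let X : Module.End K (SuperSym 𝒢 ⊗[K] SuperSym 𝒢) :=
    TensorProduct.map (LinearMap.mulLeft K (ι 𝒢 ω)) LinearMap.id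
  let Y : Module.End K (SuperSym 𝒢 ⊗[K] SuperSym 𝒢) :=
    TensorProduct.map LinearMap.id (LinearMap.mulLeft K (ι 𝒢 ω))
  have hXY : Commute X Y := TensorProduct.ext' fun a b => rfl
  have h : ∀ k, comul 𝒢 (ι 𝒢 ω ^ k * c) = ((X + Y) ^ k) (comul 𝒢 c) := by
    intro k
    induction k with
    | zero => simp
    | succ k ih =>
      rw [pow_succ', mul_assoc, comul_ι_mul_of_mem_zero hω, ih, pow_succ', Module.End.mul_apply]
      rfl
  rw [h, hXY.add_pow', LinearMap.sum_apply]
  refine Finset.sum_congr rfl fun m _ => ?_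
  rw [LinearMap.smul_apply, Nat.cast_smul_eq_nsmul]
  congr 1
  have hX : X ^ m.1 = TensorProduct.map (LinearMap.mulLeft K (ι 𝒢 ω ^ m.1)) LinearMap.id := by
    rw [TensorProduct.map_pow, LinearMap.pow_mulLeft, ← Module.End.one_eq_id, one_pow]
  have hY : Y ^ m.2 = TensorProduct.map LinearMap.id (LinearMap.mulLeft K (ι 𝒢 ω ^ m.2)) := by
    rw [TensorProduct.map_pow, LinearMap.pow_mulLeft, ← Module.End.one_eq_id, one_pow]
  rw [hX, hY, Module.End.mul_apply, ← LinearMap.comp_apply, ← TensorProduct.map_comp]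
  rfl

variable (ω) in
/-- The linear map `h` on the symmetric algebra vanishes on the products of a given element with
high powers of `ω`. -/
def PowFinite (h : SuperSym 𝒢 →ₗ[K] V) : Prop := ∀ c, ∃ N, ∀ k, N ≤ k → h (ι 𝒢 ω ^ k * c) = 0

variable (ω) in
/-- The sum `∑ h(ω^k c) / k!`. -/
noncomputable def expSum (h : SuperSym 𝒢 →ₗ[K] V) (c : SuperSym 𝒢) : V :=
  ∑ᶠ k : ℕ, (k.factorial : K)⁻¹ • h (ι 𝒢 ω ^ k * c)

theorem expSum_eq_sum {h : SuperSym 𝒢 →ₗ[K] V} {c : SuperSym 𝒢} {N : ℕ}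
    (hN : ∀ k, N ≤ k → h (ι 𝒢 ω ^ k * c) = 0) :
    expSum ω h c = ∑ k ∈ Finset.range N, (k.factorial : K)⁻¹ • h (ι 𝒢 ω ^ k * c) := by
  refine finsum_eq_sum_of_support_subset _ fun k hk => ?_
  by_contra hk'
  simp only [Finset.coe_range, Set.mem_Iio, not_lt] at hk'
  exact hk (by simp [hN k hk'])

variable {h : SuperSym 𝒢 →ₗ[K] V} (hh : PowFinite ω h)

/-- The map `c ↦ ∑ h(ω^k c) / k!`. -/
noncomputable def expMap (hh : PowFinite ω h) : SuperSym 𝒢 →ₗ[K] V where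
  toFun := expSum ω h
  map_add' c c' := by
    obtain ⟨N, hN⟩ := hh c
    obtain ⟨N', hN'⟩ := hh c'
    have h₁ : ∀ k, max N N' ≤ k → h (ι 𝒢 ω ^ k * c) = 0 := fun k hk =>
      hN k ((le_max_left _ _).trans hk)
    have h₂ : ∀ k, max N N' ≤ k → h (ι 𝒢 ω ^ k * c') = 0 := fun k hk =>
      hN' k ((le_max_right _ _).trans hk)
    rw [expSum_eq_sum h₁, expSum_eq_sum h₂, expSum_eq_sum (N := max N N') fun k hk => by
      rw [mul_add, map_add, h₁ k hk, h₂ k hk, add_zero], ← Finset.sum_add_distrib]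
    simp [mul_add]
  map_smul' a c := by
    obtain ⟨N, hN⟩ := hh c
    rw [expSum_eq_sum hN, expSum_eq_sum (N := N) fun k hk => by
      rw [mul_smul_comm, map_smul, hN k hk, smul_zero], RingHom.id_apply, Finset.smul_sum]
    refine Finset.sum_congr rfl fun k _ => ?_
    rw [mul_smul_comm, map_smul, smul_comm]

theorem expMap_apply (c : SuperSym 𝒢) : expMap hh c = expSum ω h c := rfl

include hh in
theorem exists_expMap_eq_sum (c : SuperSym 𝒢) : ∃ N₀, ∀ N, N₀ ≤ N → expMap hh c =
    ∑ k ∈ Finset.range N, (k.factorial : K)⁻¹ • h (ι 𝒢 ω ^ k * c) := by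
  obtain ⟨N₀, hN₀⟩ := hh c
  exact ⟨N₀, fun N hN => expSum_eq_sum fun k hk => hN₀ k (hN.trans hk)⟩

theorem map_expMap_eq_sum {g : SuperSym 𝒢 →ₗ[K] W} (hg : PowFinite ω g)
    (z : SuperSym 𝒢 ⊗[K] SuperSym 𝒢) : ∃ N₀, ∀ N, N₀ ≤ N →
    TensorProduct.map (expMap hh) (expMap hg) z = ∑ k ∈ Finset.range N,
      ∑ m ∈ Finset.HasAntidiagonal.antidiagonal k,
        ((m.1.factorial : K)⁻¹ * (m.2.factorial : K)⁻¹) • TensorProduct.map h g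
          (TensorProduct.map (LinearMap.mulLeft K (ι 𝒢 ω ^ m.1))
            (LinearMap.mulLeft K (ι 𝒢 ω ^ m.2)) z) := by
  induction z using TensorProduct.induction_on with
  | zero => exact ⟨0, fun N _ => by simp⟩
  | add z z' hz hz' =>
    obtain ⟨N, hN⟩ := hz
    obtain ⟨N', hN'⟩ := hz'
    refine ⟨max N N', fun n hn => ?_⟩
    rw [map_add, hN n ((le_max_left _ _).trans hn), hN' n ((le_max_right _ _).trans hn),
      ← Finset.sum_add_distrib]
    refine Finset.sum_congr rfl fun k _ => ?_
    rw [← Finset.sum_add_distrib]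
    exact Finset.sum_congr rfl fun m _ => by simp only [map_add, smul_add]
  | tmul a b =>
    obtain ⟨N, hN⟩ := hh a
    obtain ⟨N', hN'⟩ := hg b
    -- Pairs with m.1 < N and m.2 < N' have sum below N + N', so every term that can be nonzero lies
    -- on an antidiagonal in range.
    refine ⟨N + N', fun n hn => ?_⟩
    rw [TensorProduct.map_tmul, expMap_apply, expMap_apply, expSum_eq_sum hN, expSum_eq_sum hN',
      TensorProduct.sum_tmul]
    simp only [TensorProduct.tmul_sum, TensorProduct.map_tmul, LinearMap.mulLeft_apply]
    rw [← Finset.sum_product', ← Finset.sum_fiberwise_of_maps_to (t := Finset.range n)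
      (g := fun m : ℕ × ℕ => m.1 + m.2) (fun m hm => by
        simp only [Finset.mem_product, Finset.mem_range] at hm ⊢; omega)]
    refine Finset.sum_congr rfl fun k _ => ?_
    refine (Finset.sum_congr rfl fun m _ => ?_).trans
      (Finset.sum_subset (s₁ := (Finset.range N ×ˢ Finset.range N').filter
        fun m => m.1 + m.2 = k) (fun m hm =>
          Finset.HasAntidiagonal.mem_antidiagonal.2 (Finset.mem_filter.1 hm).2)
        fun m hm hm' => ?_)
    · rw [TensorProduct.smul_tmul_smul]
    · rw [Finset.HasAntidiagonal.mem_antidiagonal] at hm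
      simp only [Finset.mem_filter, Finset.mem_product, Finset.mem_range, not_and, not_lt] at hm'
      rcases lt_or_ge m.1 N with h₁ | h₁
      · rcases lt_or_ge m.2 N' with h₂ | h₂
        · exact absurd hm (hm' ⟨h₁, h₂⟩)
        · rw [hN' _ h₂]; simp
      · rw [hN _ h₁]; simp

/-- The statement that e^ω is grouplike, in truncated form: the binomial coefficients of Δ(ω^k c),
divided by k!, become the products of inverse factorials of a Cauchy product. -/
theorem exists_map_expMap_comul [CharZero K] (hω : ω ∈ 𝒢 0) {g : SuperSym 𝒢 →ₗ[K] W}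
    (hg : PowFinite ω g) (c : SuperSym 𝒢) : ∃ N₀, ∀ N, N₀ ≤ N →
    TensorProduct.map (expMap hh) (expMap hg) (comul 𝒢 c) = ∑ k ∈ Finset.range N,
      (k.factorial : K)⁻¹ • TensorProduct.map h g (comul 𝒢 (ι 𝒢 ω ^ k * c)) := by
  obtain ⟨N₀, hN₀⟩ := map_expMap_eq_sum hh hg (comul 𝒢 c)
  refine ⟨N₀, fun N hN => (hN₀ N hN).trans (Finset.sum_congr rfl fun k _ => ?_)⟩
  rw [comul_pow_ι_mul hω, map_sum, Finset.smul_sum]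
  refine Finset.sum_congr rfl fun m hm => ?_
  rw [map_smul, smul_smul]
  congr 1
  obtain rfl := Finset.HasAntidiagonal.mem_antidiagonal.1 hm
  have h₁ : (m.1.factorial : K) ≠ 0 := by exact_mod_cast m.1.factorial_ne_zero
  have h₂ : (m.2.factorial : K) ≠ 0 := by exact_mod_cast m.2.factorial_ne_zero
  have h₃ : ((m.1 + m.2).factorial : K) ≠ 0 := by exact_mod_cast (m.1 + m.2).factorial_ne_zero
  have := Nat.add_choose_mul_factorial_mul_factorial m.1 m.2
  rw [← Nat.choose_symm_add] at this
  have : ((m.1 + m.2).choose m.1 : K) * m.1.factorial * m.2.factorial = (m.1 + m.2).factorial := by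
    exact_mod_cast this
  field_simp
  linear_combination -this

/-- The commutator of a coderivation with multiplication by ω is again of the form `coder`, with ω
inserted into its Taylor coefficients; iterating this gives the expansion of Q e^ω. -/
theorem coder_ι_mul (hω : ω ∈ 𝒢 0) (q : SuperSym 𝒢 →ₗ[K] M) (c : SuperSym 𝒢) :
    coder q (ι 𝒢 ω * c) = ι 𝒢 ω * coder q c + coder (q ∘ₗ LinearMap.mulLeft K (ι 𝒢 ω)) c := by
  rw [coder_apply, comul_ι_mul_of_mem_zero hω, coder_apply, coder_apply]
  generalize comul 𝒢 c = z
  induction z using TensorProduct.induction_on with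
  | zero => simp
  | add z z' hz hz' =>
    simp only [map_add, mul_add] at hz hz' ⊢
    rw [add_add_add_comm, hz, hz']
    abel
  | tmul a b =>
    simp only [TensorProduct.map_tmul, LinearMap.comp_apply, LinearMap.mulLeft_apply, map_add,
      LinearMap.id_apply, LinearMap.mul'_apply]
    rw [← mul_assoc, ← mul_assoc, ← mul_comm_of_mem_zero (ι_mem_degree hω) (ι 𝒢 (q a)), add_comm]

theorem coder_add (q q' : SuperSym 𝒢 →ₗ[K] M) (c : SuperSym 𝒢) :
    coder (q + q') c = coder q c + coder q' c := by
  rw [coder_apply, coder_apply, coder_apply, LinearMap.comp_add, TensorProduct.map_add_left,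
    LinearMap.add_apply, map_add]

/-- Taylor coefficients concentrated in order 0 give multiplication by their value. Such terms arise
once the arguments of d or of the bracket have been filled by ω. -/
theorem coder_counitHom (x : M) (c : SuperSym 𝒢) :
    coder ((counitHom 𝒢).toLinearMap.smulRight x) c = ι 𝒢 x * c := by
  conv_rhs => rw [← mul_counitHom_comul c]
  rw [coder_apply]
  generalize comul 𝒢 c = z
  induction z using TensorProduct.induction_on with
  | zero => simp
  | add z z' hz hz' => simp only [map_add, mul_add, hz, hz']
  | tmul a b => simp [Algebra.smul_def, mul_assoc, Algebra.left_comm]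

/-- The commutation rule of an operator of second order with powers of `ω`, summed up. -/
theorem sum_range_apply_pow_mul [CharZero K] {w : SuperSym 𝒢}
    {Q Q₁ Q₂ : SuperSym 𝒢 →ₗ[K] SuperSym 𝒢}
    (h : ∀ c, Q (w * c) = w * Q c + Q₁ c) (h₁ : ∀ c, Q₁ (w * c) = w * Q₁ c + Q₂ c)
    (h₂ : ∀ c, Q₂ (w * c) = w * Q₂ c) (c : SuperSym 𝒢) (N : ℕ) :
    ∑ k ∈ Finset.range (N + 2), (k.factorial : K)⁻¹ • Q (w ^ k * c) =
      ∑ k ∈ Finset.range (N + 2), (k.factorial : K)⁻¹ • (w ^ k * Q c) +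
      ∑ k ∈ Finset.range (N + 1), (k.factorial : K)⁻¹ • (w ^ k * Q₁ c) +
      ∑ k ∈ Finset.range N, (k.factorial : K)⁻¹ • (w ^ k * ((2⁻¹ : K) • Q₂ c)) := by
  have e₂ : ∀ k, Q₂ (w ^ k * c) = w ^ k * Q₂ c := fun k => by
    induction k with
    | zero => simp
    | succ k ih => rw [pow_succ', mul_assoc, h₂, ih, mul_assoc]
  have e₁ : ∀ k : ℕ, Q₁ (w ^ (k + 1) * c) = w ^ (k + 1) * Q₁ c +
      ((k : K) + 1) • (w ^ k * Q₂ c) := fun k => by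
    induction k with
    | zero => simp [h₁]
    | succ k ih =>
      rw [pow_succ' w (k + 1), mul_assoc, h₁, ih, e₂, mul_add, mul_smul_comm, ← mul_assoc,
        ← mul_assoc, ← pow_succ', ← pow_succ']
      push_cast
      module
  -- The commutation rule for w^k has coefficients k for Q₁ and k(k−1)/2 for Q₂. Division by k!
  -- shifts the summation index by one and by two, hence the ranges N + 2, N + 1 and N.
  have e : ∀ k : ℕ, Q (w ^ (k + 2) * c) = w ^ (k + 2) * Q c + ((k : K) + 2) • (w ^ (k + 1) * Q₁ c) +
      (((k : K) + 2) * ((k : K) + 1) * 2⁻¹) • (w ^ k * Q₂ c) := fun k => by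
    induction k with
    | zero =>
      rw [zero_add, pow_succ', mul_assoc, h, pow_one, h, h₁, mul_add, ← mul_assoc]
      simp only [pow_zero, one_mul, Nat.cast_zero, zero_add, mul_one]
      module
    | succ k ih =>
      rw [pow_succ' w (k + 2), mul_assoc, h, ih, e₁, mul_add, mul_add, mul_smul_comm,
        mul_smul_comm, ← mul_assoc, ← mul_assoc, ← mul_assoc, ← pow_succ', ← pow_succ',
        ← pow_succ']
      push_cast
      module
  induction N with
  | zero =>
    simp only [zero_add, Finset.sum_range_succ, Finset.sum_range_zero, pow_zero, one_mul, pow_one,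
      Nat.factorial_zero, Nat.factorial_one, Nat.cast_one, inv_one, one_smul, h]
    abel
  | succ N ih =>
    have s₀ := Finset.sum_range_succ (fun k => (k.factorial : K)⁻¹ • (w ^ k * Q c)) (N + 2)
    have s₁ := Finset.sum_range_succ (fun k => (k.factorial : K)⁻¹ • (w ^ k * Q₁ c)) (N + 1)
    have s₂ := Finset.sum_range_succ
      (fun k => (k.factorial : K)⁻¹ • (w ^ k * ((2⁻¹ : K) • Q₂ c))) N
    rw [Finset.sum_range_succ, ih, e]
    refine Eq.trans ?_ (congrArg₂ (· + ·) (congrArg₂ (· + ·) s₀ s₁) s₂).symm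
    have f : (N.factorial : K) ≠ 0 := by exact_mod_cast N.factorial_ne_zero
    have f₁ : (N : K) + 1 ≠ 0 := by exact_mod_cast N.succ_ne_zero
    have f₂ : (N : K) + 2 ≠ 0 := by exact_mod_cast (N + 1).succ_ne_zero
    have g₁ : (((N + 2).factorial : ℕ) : K)⁻¹ * ((N : K) + 2) = ((N + 1).factorial : K)⁻¹ := by
      rw [Nat.factorial_succ (N + 1)]
      push_cast
      have : ((N + 1).factorial : K) ≠ 0 := by exact_mod_cast (N + 1).factorial_ne_zero
      rw [show (N : K) + 1 + 1 = N + 2 by ring, mul_inv, mul_right_comm, inv_mul_cancel₀ f₂,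
        one_mul]
    have g₂ : ((N + 1).factorial : K)⁻¹ * ((N : K) + 1) = (N.factorial : K)⁻¹ := by
      rw [Nat.factorial_succ]
      push_cast
      field_simp
    simp only [mul_smul_comm, smul_add, smul_smul, ← mul_assoc, g₁, g₂]
    abel

end SuperSym

end expsum

/-! ### Twisting DG Lie algebras and L∞ equations by a Maurer–Cartan element -/

section twist

open DirectSum TensorProduct SuperSym

variable {K : Type*} [Field K]
  {M : Type*} [AddCommGroup M] [Module K M] {𝒢 : ℤ → Submodule K M} [Decomposition 𝒢]
  {N : Type*} [AddCommGroup N] [Module K N] {ℋ : ℤ → Submodule K N} [Decomposition ℋ]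
  {d : M →ₗ[K] M} {br : M →ₗ[K] M →ₗ[K] M} {d' : N →ₗ[K] N} {br' : N →ₗ[K] N →ₗ[K] N}
  {ω : M} {ω' : N}

omit [Decomposition 𝒢] in
theorem IsDGLie.br_br_self [CharZero K] (hM : IsDGLie 𝒢 d br) (hω : ω ∈ 𝒢 1) (x : M) :
    br ω (br ω x) = (2⁻¹ : K) • br (br ω ω) x := by
  have h := hM.jacobi 1 1 ω hω ω hω x
  simp only [mul_one, zpow_one, neg_smul, one_smul, ← sub_eq_add_neg] at h
  rw [eq_sub_iff_add_eq, ← two_smul K] at h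
  rw [← h, smul_smul, inv_mul_cancel₀ two_ne_zero, one_smul]

omit [Decomposition 𝒢] in
/-- The DG Lie algebra which is obtained by twisting with a solution of the Maurer–Cartan
equation. -/
theorem IsDGLie.twist [CharZero K] (hM : IsDGLie 𝒢 d br) (hω : ω ∈ 𝒢 1) (hmc : IsMC d br ω) :
    IsDGLie 𝒢 (d + br ω) br where
  d_deg p x hx := add_mem (hM.d_deg p x hx) (add_comm 1 p ▸ hM.br_deg 1 p ω hω x hx)
  d_d x := by
    have h : br (d ω + (2⁻¹ : K) • br ω ω) x = 0 := by
      have h : d ω + (2⁻¹ : K) • br ω ω = 0 := hmc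
      rw [h, map_zero, LinearMap.zero_apply]
    simp only [LinearMap.add_apply, map_add, hM.d_d, hM.leibniz 1 ω hω, hM.br_br_self hω,
      LinearMap.smul_apply, map_smul] at h ⊢
    refine Eq.trans ?_ h
    simp only [zpow_one]
    module
  br_deg := hM.br_deg
  leibniz p x hx y := by
    simp only [LinearMap.add_apply, hM.leibniz p x hx, hM.jacobi 1 p ω hω x hx, map_add, one_mul]
    module
  antisymm := hM.antisymm
  jacobi := hM.jacobi

section coder

variable [CharZero K]

/-- Only the parts of order 0 and 1 of c matter, because the Taylor coefficients stop at two
arguments. Inserting ω a second time leaves just the counit times [ω, ω], so the expansion of Q e^ω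
stops at second order. -/
theorem IsDGLie.dgTaylor_ι_mul (hM : IsDGLie 𝒢 d br) (hω : ω ∈ shift 𝒢 0)
    (c : SuperSym (shift 𝒢)) :
    dgTaylor 𝒢 d br (ι _ ω * c) = counitHom _ c • d ω + br ω (ln _ c) := by
  suffices dgTaylor 𝒢 d br ∘ₗ LinearMap.mulLeft K (ι _ ω) =
    (counitHom (shift 𝒢)).toLinearMap.smulRight (d ω) + br ω ∘ₗ ln (shift 𝒢) from
    DFunLike.congr_fun this c
  refine linearMap_ext_order fun n c hc => ?_
  simp only [LinearMap.comp_apply, LinearMap.mulLeft_apply, LinearMap.add_apply,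
    LinearMap.smulRight_apply, AlgHom.toLinearMap_apply]
  rcases n with _ | _ | n
  · obtain ⟨a, rfl⟩ := mem_order_zero.1 hc
    rw [mul_smul_comm, mul_one, map_smul, dgTaylor_ι, map_smul, map_one, map_smul, ln_one]
    simp
  · obtain ⟨x, rfl⟩ := order_one_iff.1 hc
    rw [counitHom_ι, zero_smul, zero_add, ln_ι]
    induction x using Decomposition.inductionOn (shift 𝒢) with
    | zero => simp
    | homogeneous x => rw [hM.dgTaylor_ι_mul_ι hω x.2, symBr_tmul br hω, zpow_zero, one_smul]
    | add a b ha hb =>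
      rw [map_add, mul_add, map_add, ha ((order_one_iff).2 ⟨a, rfl⟩),
        hb ((order_one_iff).2 ⟨b, rfl⟩), map_add]
  · rw [dgTaylor_ge d br (by omega) (ι_mul_mem_order _ hc), ln_of_order (by omega) hc,
      counitHom_of_order (by omega) hc]
    simp

omit [CharZero K] in
theorem dgTaylor_add (c : SuperSym (shift 𝒢)) :
    dgTaylor 𝒢 (d + br ω) br c = dgTaylor 𝒢 d br c + br ω (ln _ c) := by
  rw [dgTaylor_apply, dgTaylor_apply, LinearMap.add_apply, add_right_comm]

/-- This is Q e^ω = e^ω Q_ω, seen through f. The expansion of Q e^ω gives e^ω (Q + Q₁ + ½Q₂), where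
Q₁ and Q₂ arise by inserting ω once and twice. Multiplication by d ω + ½[ω, ω] is what separates
this sum from Q_ω. -/
theorem IsDGLie.expMap_coder (hM : IsDGLie 𝒢 d br) (hω : ω ∈ 𝒢 1) (hmc : IsMC d br ω)
    {f : SuperSym (shift 𝒢) →ₗ[K] N} (hf : PowFinite ω f) (c : SuperSym (shift 𝒢)) :
    ∃ N₀, ∀ n, N₀ ≤ n → expMap hf (coder (dgTaylor 𝒢 (d + br ω) br) c) =
      ∑ k ∈ Finset.range n, (k.factorial : K)⁻¹ •
        f (coder (dgTaylor 𝒢 d br) (ι _ ω ^ k * c)) := by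
  have hω : ω ∈ shift 𝒢 0 := by simpa [shift] using hω
  let q := dgTaylor 𝒢 d br
  let μ := LinearMap.mulLeft K (ι (shift 𝒢) ω)
  have h₁ : q ∘ₗ μ = (counitHom (shift 𝒢)).toLinearMap.smulRight (d ω) + br ω ∘ₗ ln (shift 𝒢) :=
    LinearMap.ext fun c => hM.dgTaylor_ι_mul hω c
  have h₂ : (q ∘ₗ μ) ∘ₗ μ = (counitHom (shift 𝒢)).toLinearMap.smulRight (br ω ω) := by
    rw [h₁]
    refine LinearMap.ext fun c => ?_
    simp [μ, ln_ι_mul]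
  have e : coder (dgTaylor 𝒢 (d + br ω) br) c = coder q c + coder (q ∘ₗ μ) c +
      (2⁻¹ : K) • coder ((q ∘ₗ μ) ∘ₗ μ) c := by
    have : dgTaylor 𝒢 (d + br ω) br = q + br ω ∘ₗ ln (shift 𝒢) := LinearMap.ext dgTaylor_add
    -- The Maurer–Cartan equation enters here: the multiplication terms from d ω and ½[ω, ω]
    -- together vanish.
    have h : ι (shift 𝒢) (d ω + (2⁻¹ : K) • br ω ω) * c = 0 := by
      have h : d ω + (2⁻¹ : K) • br ω ω = 0 := hmc
      rw [h, map_zero, zero_mul]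
    rw [map_add, add_mul, map_smul, smul_mul_assoc] at h
    rw [this, h₂, h₁, coder_add, coder_add, coder_counitHom, coder_counitHom]
    have h := congrArg (· + (coder q c + coder (br ω ∘ₗ ln (shift 𝒢)) c)) h
    simp only [zero_add] at h
    rw [← h]
    abel
  obtain ⟨n₀, h₀⟩ := exists_expMap_eq_sum hf (coder q c)
  obtain ⟨n₁, h₁'⟩ := exists_expMap_eq_sum hf (coder (q ∘ₗ μ) c)
  obtain ⟨n₂, h₂'⟩ := exists_expMap_eq_sum hf ((2⁻¹ : K) • coder ((q ∘ₗ μ) ∘ₗ μ) c)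
  refine ⟨max n₀ (max n₁ n₂) + 2, fun n hn => ?_⟩
  obtain ⟨n, rfl⟩ : ∃ m, n = m + 2 := ⟨n - 2, by omega⟩
  have hs := congrArg f (sum_range_apply_pow_mul (w := ι (shift 𝒢) ω) (coder_ι_mul hω q)
    (coder_ι_mul hω (q ∘ₗ μ)) (Q₂ := coder ((q ∘ₗ μ) ∘ₗ μ)) (fun c => by
      rw [h₂, coder_counitHom, coder_counitHom, ← mul_assoc, ← mul_assoc,
        mul_comm_of_mem_zero (ι_mem_degree hω)]) c n)
  rw [e, map_add, map_add, h₀ (n + 2) (by omega), h₁' (n + 1) (by omega), h₂' n (by omega)]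
  simpa only [map_add, map_sum, map_smul] using hs.symm

end coder

theorem counitHom_of_degree {n : ℤ} (hn : n ≠ 0) {c : SuperSym 𝒢} (hc : c ∈ degree 𝒢 n) :
    counitHom 𝒢 c = 0 := by
  refine (Submodule.span_le (p := LinearMap.ker (counitHom 𝒢).toLinearMap)).2 ?_ hc
  rintro _ ⟨l, rfl, rfl⟩
  cases l with
  | nil => exact absurd rfl hn
  | cons a l => simp

theorem map_comul_smulRight (g : SuperSym 𝒢 →ₗ[K] N) (v : N) (c : SuperSym 𝒢) :
    TensorProduct.map g ((counitHom 𝒢).toLinearMap.smulRight v) (comul 𝒢 c) = g c ⊗ₜ v := by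
  have h := DFunLike.congr_fun (Coalgebra.lTensor_counit_comp_comul (R := K) (A := SuperSym 𝒢)) c
  have : TensorProduct.map g ((counitHom 𝒢).toLinearMap.smulRight v) =
      TensorProduct.map g (LinearMap.toSpanSingleton K N v) ∘ₗ
        (Coalgebra.counit (R := K) (A := SuperSym 𝒢)).lTensor _ :=
    TensorProduct.ext' fun a b => by simp [counit_eq]
  rw [this]
  refine (congrArg (TensorProduct.map g (LinearMap.toSpanSingleton K N v)) h).trans ?_
  simp

theorem map_smulRight_comul (g : SuperSym 𝒢 →ₗ[K] N) (v : N) (c : SuperSym 𝒢) :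
    TensorProduct.map ((counitHom 𝒢).toLinearMap.smulRight v) g (comul 𝒢 c) = v ⊗ₜ g c := by
  have h := DFunLike.congr_fun (Coalgebra.rTensor_counit_comp_comul (R := K) (A := SuperSym 𝒢)) c
  have : TensorProduct.map ((counitHom 𝒢).toLinearMap.smulRight v) g =
      TensorProduct.map (LinearMap.toSpanSingleton K N v) g ∘ₗ
        (Coalgebra.counit (R := K) (A := SuperSym 𝒢)).rTensor _ :=
    TensorProduct.ext' fun a b => by simp [counit_eq]
  rw [this]
  refine (congrArg (TensorProduct.map (LinearMap.toSpanSingleton K N v) g) h).trans ?_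
  simp

/-- In the shifted module ω' has degree 0, so no sign appears in either position. -/
theorem IsDGLie.symBr_tmul_comm (hN : IsDGLie ℋ d' br') (hω' : ω' ∈ ℋ 1) (y : N) :
    symBr ℋ br' (y ⊗ₜ ω') = br' ω' y ∧ symBr ℋ br' (ω' ⊗ₜ y) = br' ω' y := by
  have hω' : ω' ∈ shift ℋ 0 := by simpa [shift] using hω'
  have h : ∀ y, symBr ℋ br' (ω' ⊗ₜ y) = br' ω' y := fun y => by
    rw [symBr_tmul br' hω', zpow_zero, one_smul]
  refine ⟨?_, h y⟩
  induction y using Decomposition.inductionOn (shift ℋ) with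
  | zero => simp
  | homogeneous y => rw [hN.symBr_swap y.2 hω', h, mul_zero, zpow_zero, one_smul]
  | add a b ha hb => rw [add_tmul, map_add, ha, hb, map_add]

variable [CharZero K] {f : SuperSym (shift 𝒢) →ₗ[K] N}

/-- The logarithm of the twist of an `L_∞` morphism. -/
noncomputable def twistMap (hf : PowFinite ω f) : SuperSym (shift 𝒢) →ₗ[K] N :=
  expMap hf - (counitHom (shift 𝒢)).toLinearMap.smulRight (expMap hf 1)

theorem twistMap_one (hf : PowFinite ω f) : twistMap hf 1 = 0 := by
  simp [twistMap]

theorem twistMap_of_order (hf : PowFinite ω f) {j : ℕ} (hj : 1 ≤ j) {c : SuperSym (shift 𝒢)}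
    (hc : c ∈ order (shift 𝒢) j) : twistMap hf c = expMap hf c := by
  simp [twistMap, counitHom_of_order (by omega) hc]

/-- The twisted `L_∞` morphism equation, up to the Maurer–Cartan equation in the target. -/
theorem linfDefect_twistMap_apply (hM : IsDGLie 𝒢 d br) (hN : IsDGLie ℋ d' br')
    (hω : ω ∈ 𝒢 1) (hmc : IsMC d br ω) (hf : PowFinite ω f)
    (h : linfDefect 𝒢 ℋ d br d' br' f = 0) (hω' : ω' ∈ ℋ 1) (e' : expMap hf 1 = ω')
    (c : SuperSym (shift 𝒢)) :
    linfDefect 𝒢 ℋ (d + br ω) br (d' + br' ω') br' (twistMap hf) c =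
      counitHom _ c • (d' ω' + (2⁻¹ : K) • br' ω' ω') := by
  -- F = f(e^ω ·) satisfies the L∞ equation with the twisted coderivation on the source and the
  -- untwisted structure on the target; the truncations of the three sums are given a common bound.
  have hE : expMap hf (coder (dgTaylor 𝒢 (d + br ω) br) c) = d' (expMap hf c) +
      (2⁻¹ : K) • symBr ℋ br' (TensorProduct.map (expMap hf) (expMap hf) (comul _ c)) := by
    obtain ⟨n₀, h₀⟩ := hM.expMap_coder hω hmc hf c
    obtain ⟨n₁, h₁⟩ := exists_expMap_eq_sum hf c
    obtain ⟨n₂, h₂⟩ := exists_map_expMap_comul hf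
      (show ω ∈ shift 𝒢 0 by simpa [shift] using hω) hf c
    have hn := fun k => DFunLike.congr_fun h (ι _ ω ^ k * c)
    simp only [linfDefect, LinearMap.sub_apply, LinearMap.add_apply, LinearMap.smul_apply,
      LinearMap.comp_apply, LinearMap.zero_apply, sub_eq_zero] at hn
    rw [h₀ (n₀ + n₁ + n₂) (by omega), h₁ (n₀ + n₁ + n₂) (by omega),
      h₂ (n₀ + n₁ + n₂) (by omega)]
    simp only [hn, map_sum, map_smul, smul_add, Finset.sum_add_distrib, Finset.smul_sum]
    congr 1
    exact Finset.sum_congr rfl fun k _ => smul_comm _ _ _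
  have ht : expMap hf = twistMap hf + (counitHom (shift 𝒢)).toLinearMap.smulRight ω' := by
    rw [twistMap, e', sub_add_cancel]
  have hc : expMap hf (coder (dgTaylor 𝒢 (d + br ω) br) c) =
      twistMap hf (coder (dgTaylor 𝒢 (d + br ω) br) c) := by
    rw [ht]
    simp [counitHom_coder]
  -- Substituting F = g + ε ω' into ½[F, F] gives ½[g, g], then twice ½[ω', g], which turns d' into
  -- the twisted differential, and finally ε · ½[ω', ω'].
  rw [hc, ht, TensorProduct.map_add_left, TensorProduct.map_add_right, TensorProduct.map_add_right]
    at hE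
  simp only [linfDefect, LinearMap.sub_apply, LinearMap.add_apply, LinearMap.smul_apply,
    LinearMap.comp_apply]
  rw [hE]
  simp only [LinearMap.add_apply, map_add, map_comul_smulRight, map_smulRight_comul,
    (hN.symBr_tmul_comm hω' _).1, (hN.symBr_tmul_comm hω' _).2, LinearMap.smulRight_apply,
    AlgHom.toLinearMap_apply, map_smul, smul_add]
  have h2 : (2⁻¹ : K) • br' ω' (twistMap hf c) + (2⁻¹ : K) • br' ω' (twistMap hf c) =
      br' ω' (twistMap hf c) := by
    rw [← add_smul, ← two_mul, mul_inv_cancel₀ two_ne_zero, one_smul]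
  conv_rhs => rw [← add_zero (_ + _), ← sub_self (br' ω' (twistMap hf c))]
  conv_rhs => enter [2, 1]; rw [← h2]
  rw [smul_comm (2⁻¹ : K)]
  abel

/-- Evaluation of `linfDefect_twistMap_apply` at 1: the defect is trivially zero there, as the
coderivation and `twistMap` vanish at 1, so the Maurer–Cartan expression of ω' must be zero. -/
theorem isMC_expMap (hM : IsDGLie 𝒢 d br) (hN : IsDGLie ℋ d' br')
    (hω : ω ∈ 𝒢 1) (hmc : IsMC d br ω) (hf : PowFinite ω f)
    (h : linfDefect 𝒢 ℋ d br d' br' f = 0) (hω' : ω' ∈ ℋ 1) (e' : expMap hf 1 = ω') :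
    IsMC d' br' ω' := by
  have := linfDefect_twistMap_apply hM hN hω hmc hf h hω' e' 1
  rw [map_one (counitHom (shift 𝒢)), one_smul] at this
  rw [IsMC, ← this]
  simp [linfDefect, coder_one (dgTaylor_one _ _), twistMap_one]

theorem linfDefect_twistMap (hM : IsDGLie 𝒢 d br) (hN : IsDGLie ℋ d' br')
    (hω : ω ∈ 𝒢 1) (hmc : IsMC d br ω) (hf : PowFinite ω f)
    (h : linfDefect 𝒢 ℋ d br d' br' f = 0) (hω' : ω' ∈ ℋ 1) (e' : expMap hf 1 = ω') :
    linfDefect 𝒢 ℋ (d + br ω) br (d' + br' ω') br' (twistMap hf) = 0 := by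
  refine LinearMap.ext fun c => ?_
  have h' : d' ω' + (2⁻¹ : K) • br' ω' ω' = 0 := isMC_expMap hM hN hω hmc hf h hω' e'
  rw [linfDefect_twistMap_apply hM hN hω hmc hf h hω' e', h', smul_zero, LinearMap.zero_apply]

theorem twistMap_mem (hω : ω ∈ 𝒢 1) (hf : PowFinite ω f)
    (hd : ∀ n, ∀ c ∈ degree (shift 𝒢) n, f c ∈ shift ℋ n) (n : ℤ) (c : SuperSym (shift 𝒢))
    (hc : c ∈ degree (shift 𝒢) n) : twistMap hf c ∈ shift ℋ n := by
  have hω : ω ∈ shift 𝒢 0 := by simpa [shift] using hω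
  have hE : ∀ n, ∀ c ∈ degree (shift 𝒢) n, expMap hf c ∈ shift ℋ n := fun n c hc => by
    obtain ⟨N₀, hN₀⟩ := exists_expMap_eq_sum hf c
    rw [hN₀ N₀ le_rfl]
    refine sum_mem fun k _ => Submodule.smul_mem _ _ (hd n _ ?_)
    simpa using SetLike.GradedMul.mul_mem (pow_ι_mem_degree hω k) hc
  refine sub_mem (hE n c hc) ?_
  rw [LinearMap.smulRight_apply, AlgHom.toLinearMap_apply]
  by_cases hn : n = 0
  · subst hn
    exact Submodule.smul_mem _ _ (hE 0 1 one_mem_degree)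
  · rw [counitHom_of_degree hn hc, zero_smul]
    exact zero_mem _

end twist

/-! ### A-multilinearity, also in the presence of a factor of degree 0 -/

section multilinear

open DirectSum TensorProduct SuperSym CTensor

variable {K : Type*} [Field K] {A : Type*} [Ring A] [Algebra K A]
  {𝒜 : ℤ → Submodule K A} [GradedAlgebra 𝒜]
  {L : Type*} [AddCommGroup L] [Module K L] {𝒢 : ℤ → Submodule K L} [Decomposition 𝒢]
  {L' : Type*} [AddCommGroup L'] [Module K L'] {𝒢' : ℤ → Submodule K L'} [Decomposition 𝒢']
  (R : DGComAlg.{w} K 𝒜) (G : DGLieAlg.{w'} K 𝒢) (G' : DGLieAlg.{w''} K 𝒢')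

/-- The action of `A` on `A ⊗ V`. -/
noncomputable def lmulT (V : Type*) [AddCommGroup V] [Module K V] (a : A) :
    A ⊗[K] V →ₗ[K] A ⊗[K] V :=
  TensorProduct.map (LinearMap.mulLeft K a) LinearMap.id

variable (𝒢) in
theorem tensorMap_mul (c c' : SuperSym (shift (tensorGrade 𝒜 𝒢))) :
    tensorMap 𝒢 R (c * c') = tmulS 𝒜 𝒢 (tensorMap 𝒢 R c) (tensorMap 𝒢 R c') := by
  apply (GradedTensorProduct.of K 𝒜 (degree (shift 𝒢))).injective
  rw [← gtensor_mul, of_tensorMap, of_tensorMap, of_tensorMap, map_mul]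

theorem tmulS_lmulT_left (a : A) (s t : A ⊗[K] SuperSym (shift 𝒢)) :
    tmulS 𝒜 𝒢 (lmulT _ a s) t = lmulT _ a (tmulS 𝒜 𝒢 s t) := by
  induction s using homogeneous_tensor_induction 𝒜 (degree (shift 𝒢)) with
  | zero => simp
  | add s s' hs hs' => simp only [map_add, LinearMap.add_apply, hs, hs']
  | tmul p q b _ y hy =>
    induction t using homogeneous_tensor_induction 𝒜 (degree (shift 𝒢)) with
    | zero => simp
    | add s s' hs hs' => simp only [map_add, hs, hs']
    | tmul p' q' c hc z _ =>
      rw [lmulT, TensorProduct.map_tmul, tmulS, gmap₂_tmul _ _ hy hc,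
        LinearMap.id_apply, gmap₂_tmul _ _ hy hc, map_smul, TensorProduct.map_tmul,
        LinearMap.mulLeft_apply, LinearMap.mulLeft_apply, mul_assoc, LinearMap.id_apply]

include R in
theorem tmulS_lmulT_right {p n : ℤ} {a : A} (ha : a ∈ 𝒜 p) {s : A ⊗[K] SuperSym (shift 𝒢)}
    (hs : s ∈ tensorGrade 𝒜 (degree (shift 𝒢)) n) (t : A ⊗[K] SuperSym (shift 𝒢)) :
    tmulS 𝒜 𝒢 s (lmulT _ a t) = (-1 : K) ^ (p * n) • lmulT _ a (tmulS 𝒜 𝒢 s t) := by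
  induction hs using tensorGrade_induction with
  | zero => simp
  | add s s' _ _ hs hs' => simp only [map_add, LinearMap.add_apply, hs, hs', smul_add]
  | tmul r q h b hb y hy =>
    subst h
    induction t using homogeneous_tensor_induction 𝒜 (degree (shift 𝒢)) with
    | zero => simp
    | add s s' hs hs' => simp only [map_add, hs, hs', smul_add]
    | tmul p' q' c hc z _ =>
      rw [lmulT, TensorProduct.map_tmul, LinearMap.mulLeft_apply, tmulS,
        gmap₂_tmul _ _ hy (SetLike.GradedMul.mul_mem ha hc), LinearMap.id_apply,
        gmap₂_tmul _ _ hy hc, map_smul, TensorProduct.map_tmul, LinearMap.mulLeft_apply,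
        ← mul_assoc, R.comm p r a ha b hb]
      simp only [smul_mul_assoc, ← smul_tmul', mul_assoc, LinearMap.id_apply]
      by_cases hp : Even p <;> by_cases hq : Even q <;> by_cases hr : Even p' <;>
        by_cases hs : Even r <;>
        simp only [neg_one_zpow_eq_ite, hp, hq, hr, hs, Int.even_add, Int.even_mul,
          or_true, true_or, or_false, false_or, iff_true, true_iff, iff_false, false_iff,
          not_true, not_false_iff, if_true, if_false] <;> module

theorem lmulT_lmulT (V : Type*) [AddCommGroup V] [Module K V] (a b : A) (t : A ⊗[K] V) :
    lmulT V a (lmulT V b t) = lmulT V (a * b) t := by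
  induction t using TensorProduct.induction_on with
  | zero => simp
  | add s s' hs hs' => simp only [map_add, hs, hs']
  | tmul c v => simp [lmulT, mul_assoc]

theorem tι_lmulT (a : A) (t : A ⊗[K] L) : tι A 𝒢 (lmulT L a t) = lmulT _ a (tι A 𝒢 t) := by
  induction t using TensorProduct.induction_on with
  | zero => simp
  | add s s' hs hs' => simp only [map_add, hs, hs']
  | tmul c v => rfl

theorem prod_list_mem_graded {j : ℕ} {p : Fin j → ℤ} {a : Fin j → A} (ha : ∀ l, a l ∈ 𝒜 (p l)) :
    (List.ofFn a).prod ∈ 𝒜 (∑ l, p l) := by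
  have := SetLike.list_prod_ofFn_mem_graded p a ha
  rwa [List.sum_ofFn] at this

variable (K) in
/-- The Koszul sign for moving scalars of degrees `p` in front of elements of degrees `q - 1`. -/
def koszulSign {j : ℕ} (p q : Fin j → ℤ) : K :=
  ∏ l, ∏ k ∈ Finset.Iio l, (-1 : K) ^ (p l * (q k - 1))

theorem koszulSign_succ {j : ℕ} (p q : Fin (j + 1) → ℤ) : koszulSign K p q =
    (-1 : K) ^ ((∑ l : Fin j, p l.succ) * (q 0 - 1)) *
      koszulSign K (fun l => p l.succ) fun l => q l.succ := by
  have h : ∀ {j : ℕ} (p q : Fin j → ℤ), koszulSign K p q =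
      ∏ l, ∏ k, if k < l then (-1 : K) ^ (p l * (q k - 1)) else 1 := fun p q => by
    refine Finset.prod_congr rfl fun l _ => ?_
    rw [← Finset.prod_filter]
    congr 1
    ext k
    simp
  rw [h, h, Fin.prod_univ_succ]
  simp only [Fin.prod_univ_succ, Fin.not_lt_zero, if_false, Finset.prod_const_one, mul_one,
    Fin.succ_pos, if_true, Fin.succ_lt_succ_iff, one_mul, Finset.prod_mul_distrib]
  congr 1
  rw [Finset.sum_mul]
  induction (Finset.univ : Finset (Fin j)) using Finset.induction_on with
  | empty => simp
  | insert l s hl ih => rw [Finset.prod_insert hl, Finset.sum_insert hl, zpow_add₀ (by simp), ih]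

/-- In the super tensor product scalars of A are pulled to the front one factor at a time; a scalar
crossing a factor of degree q in A ⊗ 𝔤 meets shifted degree q − 1, which is the exponent in
`koszulSign`. -/
theorem tensorMap_prod_lmulT {j : ℕ} (p q : Fin j → ℤ) (a : Fin j → A)
    (t : Fin j → A ⊗[K] L) (ha : ∀ l, a l ∈ 𝒜 (p l)) (ht : ∀ l, t l ∈ tensorGrade 𝒜 𝒢 (q l)) :
    tensorMap 𝒢 R (List.ofFn fun l => ι _ (lmulT L (a l) (t l))).prod =
      koszulSign K p q • lmulT _ (List.ofFn a).prod
        (tensorMap 𝒢 R (List.ofFn fun l => ι _ (t l)).prod) := by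
  induction j with
  | zero => simp [koszulSign, lmulT]
  | succ j ih =>
    rw [List.ofFn_succ, List.prod_cons, tensorMap_ι_mul, tι_lmulT, tmulS_lmulT_left,
      ih (fun l => p l.succ) (fun l => q l.succ) _ _ (fun l => ha l.succ) (fun l => ht l.succ),
      map_smul, tmulS_lmulT_right R (prod_list_mem_graded fun l => ha l.succ)
        (tι_mem (n := q 0 - 1) (by simpa [shift] using ht 0)), koszulSign_succ,
      map_smul, map_smul, lmulT_lmulT, smul_smul, List.ofFn_succ (f := a), List.prod_cons,
      List.ofFn_succ (f := fun l => ι _ (t l)), List.prod_cons, tensorMap_ι_mul, mul_comm]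

theorem map_id_lmulT (f : SuperSym (shift 𝒢) →ₗ[K] L') (a : A) (s : A ⊗[K] SuperSym (shift 𝒢)) :
    TensorProduct.map LinearMap.id f (lmulT _ a s) =
      lmulT L' a (TensorProduct.map LinearMap.id f s) := by
  induction s using TensorProduct.induction_on with
  | zero => simp
  | add s s' hs hs' => simp only [map_add, hs, hs']
  | tmul c v => rfl

/-- Scalars cross the extra factor c without a sign because it has degree 0. It will be a power of ω
for the twisted morphism, and 1 for Ψ_A itself. -/
theorem preExt_mul_prod_lmulT {f : SuperSym (shift 𝒢) →ₗ[K] L'} {j : ℕ} (p q : Fin j → ℤ)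
    (a : Fin j → A) (t : Fin j → A ⊗[K] L) (ha : ∀ l, a l ∈ 𝒜 (p l))
    (ht : ∀ l, t l ∈ tensorGrade 𝒜 𝒢 (q l)) {c : SuperSym (shift (tensorGrade 𝒜 𝒢))}
    (hc : c ∈ degree (shift (tensorGrade 𝒜 𝒢)) 0) :
    preExt R f (c * (List.ofFn fun l => ι _ (lmulT L (a l) (t l))).prod) =
      koszulSign K p q • lmulT _ (List.ofFn a).prod
        (preExt R f (c * (List.ofFn fun l => ι _ (t l)).prod)) := by
  rw [preExt_apply, preExt_apply, tensorMap_mul, tensorMap_mul, tensorMap_prod_lmulT R p q a t ha ht,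
    map_smul, tmulS_lmulT_right R (prod_list_mem_graded ha) (tensorMap_mem hc), mul_zero, zpow_zero,
    one_smul, map_smul, map_id_lmulT]

variable {Ψ : SuperSym (shift 𝒢) →ₗ[K] SuperSym (shift 𝒢')}
  (hΨ : IsContinuousLInfty G.top G'.top Ψ) (h1 : Ψ 1 = 1)

variable {R} in
/-- The action of `A` on Cauchy sequences in `A ⊗ 𝔤`. -/
noncomputable def seqAct (hR : DirInv.IsComplete.{w, u} R.top) (a : A) :
    (pre R G).Seq →ₗ[K] (pre R G).Seq :=
  DirInv.seqMap _ (act_cont G hR a)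

theorem mapTerm_prod (k : ℕ) {j : ℕ} (t : Fin j → (pre R G).Seq) :
    mapTerm R k (List.ofFn fun l => ι (seqShift R G) (t l)).prod =
      (List.ofFn fun l => ι _ ((pre R G).term k (t l))).prod :=
  map_prod_ι (𝒢 := seqShift R G) _ _ t

theorem mapMk_prod {j : ℕ} (t : Fin j → (pre R G).Seq) :
    mapMk R G (List.ofFn fun l => ι (seqShift R G) (t l)).prod =
      (List.ofFn fun l => ι _ ((pre R G).mkS (t l))).prod :=
  map_prod_ι (𝒢 := seqShift R G) _ _ t

theorem mapTerm_mem (k : ℕ) {n : ℤ} {c : SeqSym R G} (hc : c ∈ SuperSym.degree (seqShift R G) n) :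
    mapTerm R k c ∈ SuperSym.degree (shift (tensorGrade 𝒜 𝒢)) n :=
  map_mem_degree (𝒢 := seqShift R G) _ _ hc

variable {R} in
theorem act_mkS (hR : DirInv.IsComplete.{w, u} R.top) (a : A) (c : (pre R G).Seq) :
    act G hR a ((pre R G).mkS c) = (pre R G).mkS (seqAct G hR a c) := rfl

variable {R} in
theorem term_seqAct (hR : DirInv.IsComplete.{w, u} R.top) (a : A) (k : ℕ) (c : (pre R G).Seq) :
    (pre R G).term k (seqAct G hR a c) = lmulT L a ((pre R G).term k c) := rfl

variable {R} in
theorem seqExt_mul_prod_seqAct (hR : DirInv.IsComplete.{w, u} R.top) {j : ℕ} (p q : Fin j → ℤ)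
    (a : Fin j → A) (t : Fin j → (pre R G).Seq) (ha : ∀ l, a l ∈ 𝒜 (p l))
    (ht : ∀ l, t l ∈ seqDegree R G (q l)) {c : SeqSym R G}
    (hc : c ∈ SuperSym.degree (seqShift R G) 0) :
    seqExt R G G' hΨ h1 (c * (List.ofFn fun l => ι _ (seqAct G hR (a l) (t l))).prod) =
      koszulSign K p q • seqAct G' hR (List.ofFn a).prod
        (seqExt R G G' hΨ h1 (c * (List.ofFn fun l => ι _ (t l)).prod)) := by
  refine DirInv.seq_ext fun k => ?_
  rw [map_smul, term_seqAct, term_seqExt, term_seqExt, map_mul (mapTerm R k), mapTerm_prod,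
    map_mul (mapTerm R k),
    mapTerm_prod]
  simp only [term_seqAct]
  exact preExt_mul_prod_lmulT R p q a _ ha (fun l => term_mem k _ _ (ht l)) (mapTerm_mem R G k hc)

-- Both c and the arguments are lifted to homogeneous Cauchy sequences, where the identity holds
-- term by term.
variable {R} in
theorem ctExt_mul_prod_act (hR : DirInv.IsComplete.{w, u} R.top) {j : ℕ} (p q : Fin j → ℤ)
    (a : Fin j → A) (x : Fin j → CTensor R G) (ha : ∀ l, a l ∈ 𝒜 (p l))
    (hx : ∀ l, x l ∈ CTensor.degree R G (q l)) {c : CSym R G}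
    (hc : c ∈ SuperSym.degree (shift (CTensor.degree R G)) 0) :
    ctExt R G G' hΨ h1 (c * (List.ofFn fun l => ι _ (act G hR (a l) (x l))).prod) =
      koszulSign K p q • act G' hR (List.ofFn a).prod
        (ctExt R G G' hΨ h1 (c * (List.ofFn fun l => ι _ (x l)).prod)) := by
  obtain ⟨c, hc', rfl⟩ := exists_map_eq_of_mem_degree (𝒢 := seqShift R G) (pre R G).mkS
    (shift_map mkS_mem) (fun p => exists_mkS_eq (p + 1)) hc
  choose t ht e using fun l => exists_mkS_eq (q l) (x l) (hx l)
  obtain rfl : (fun l => (pre R G).mkS (t l)) = x := funext e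
  have h₁ := ctExt_mapMk R G G' hΨ h1 (c * (List.ofFn fun l => ι _ (seqAct G hR (a l) (t l))).prod)
  have h₂ := ctExt_mapMk R G G' hΨ h1 (c * (List.ofFn fun l => ι _ (t l)).prod)
  rw [map_mul, mapMk_prod] at h₁ h₂
  rw [seqExt_mul_prod_seqAct G G' hΨ h1 hR p q a t ha ht hc', map_smul, ← act_mkS, ← h₂] at h₁
  exact h₁

end multilinear

/-! ### Finiteness of the twisting sums, from the lower bound on the degrees of 𝔤' -/

section finiteness

open DirectSum TensorProduct SuperSym CTensor

variable {K : Type*} [Field K] {A : Type*} [Ring A] [Algebra K A]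
  {𝒜 : ℤ → Submodule K A} [GradedAlgebra 𝒜]
  {L : Type*} [AddCommGroup L] [Module K L] {𝒢 : ℤ → Submodule K L} [Decomposition 𝒢]
  {L' : Type*} [AddCommGroup L'] [Module K L'] {𝒢' : ℤ → Submodule K L'} [Decomposition 𝒢']
  (R : DGComAlg.{w} K 𝒜) (G : DGLieAlg.{w'} K 𝒢) (G' : DGLieAlg.{w''} K 𝒢')

/-- The part of a tensor product with a graded module where the degree of the second factor is at
most `m`. -/
def lowSpan {B : Type*} [AddCommGroup B] [Module K B] (𝒜 : ℤ → Submodule K A)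
    (ℬ : ℤ → Submodule K B) (m : ℤ) : Submodule K (A ⊗[K] B) :=
  Submodule.span K {t | ∃ p, ∃ a ∈ 𝒜 p, ∃ q, q ≤ m ∧ ∃ x ∈ ℬ q, a ⊗ₜ[K] x = t}

omit [GradedAlgebra 𝒜] in
theorem tmul_mem_lowSpan {B : Type*} [AddCommGroup B] [Module K B] {ℬ : ℤ → Submodule K B}
    {m p q : ℤ} {a : A} (ha : a ∈ 𝒜 p) (hq : q ≤ m) {x : B} (hx : x ∈ ℬ q) :
    a ⊗ₜ[K] x ∈ lowSpan 𝒜 ℬ m := Submodule.subset_span ⟨p, a, ha, q, hq, x, hx, rfl⟩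

omit [GradedAlgebra 𝒜] in
theorem lowSpan_le {B V : Type*} [AddCommGroup B] [Module K B] [AddCommGroup V] [Module K V]
    {ℬ : ℤ → Submodule K B} {m : ℤ} (F : A ⊗[K] B →ₗ[K] V) (P : Submodule K V)
    (h : ∀ p, ∀ a ∈ 𝒜 p, ∀ q ≤ m, ∀ x ∈ ℬ q, F (a ⊗ₜ x) ∈ P) {t : A ⊗[K] B}
    (ht : t ∈ lowSpan 𝒜 ℬ m) : F t ∈ P := by
  refine (Submodule.span_le (p := P.comap F)).2 ?_ ht
  rintro _ ⟨p, a, ha, q, hq, x, hx, rfl⟩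
  exact h p a ha q hq x hx

theorem tι_mem_lowSpan {m : ℤ} {t : A ⊗[K] L} (ht : t ∈ lowSpan 𝒜 (shift 𝒢) m) :
    tι A 𝒢 t ∈ lowSpan 𝒜 (degree (shift 𝒢)) m :=
  lowSpan_le _ _ (fun _ _ ha _ hq _ hx => tmul_mem_lowSpan ha hq (ι_mem_degree hx)) ht

theorem tmulS_mem_lowSpan {m n : ℤ} {s t : A ⊗[K] SuperSym (shift 𝒢)}
    (hs : s ∈ lowSpan 𝒜 (degree (shift 𝒢)) m) (ht : t ∈ lowSpan 𝒜 (degree (shift 𝒢)) n) :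
    tmulS 𝒜 𝒢 s t ∈ lowSpan 𝒜 (degree (shift 𝒢)) (m + n) := by
  refine lowSpan_le ((tmulS 𝒜 𝒢).flip t) _ (fun p a ha q hq x hx => ?_) hs
  refine lowSpan_le (tmulS 𝒜 𝒢 (a ⊗ₜ x)) _ (fun p' b hb q' hq' y hy => ?_) ht
  rw [tmulS, gmap₂_tmul _ a hx hb]
  exact Submodule.smul_mem _ _ (tmul_mem_lowSpan (SetLike.GradedMul.mul_mem ha hb)
    (add_le_add hq hq') (SetLike.GradedMul.mul_mem hx hy))

theorem tensorMap_prod_mem_lowSpan {j : ℕ} (B : Fin j → ℤ) (t : Fin j → A ⊗[K] L)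
    (ht : ∀ l, t l ∈ lowSpan 𝒜 (shift 𝒢) (B l)) :
    tensorMap 𝒢 R (List.ofFn fun l => ι _ (t l)).prod ∈
      lowSpan 𝒜 (degree (shift 𝒢)) (∑ l, B l) := by
  induction j with
  | zero =>
    simp only [List.ofFn_zero, List.prod_nil, tensorMap_one, Finset.univ_eq_empty, Finset.sum_empty]
    exact tmul_mem_lowSpan SetLike.GradedOne.one_mem le_rfl one_mem_degree
  | succ j ih =>
    rw [List.ofFn_succ, List.prod_cons, tensorMap_ι_mul, Fin.sum_univ_succ]
    exact tmulS_mem_lowSpan (tι_mem_lowSpan (ht 0)) (ih _ _ fun l => ht l.succ)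

theorem tensorMap_pow_mem_lowSpan {t : A ⊗[K] L} (ht : t ∈ lowSpan 𝒜 (shift 𝒢) (-1)) (k : ℕ) :
    tensorMap 𝒢 R (ι _ t ^ k) ∈ lowSpan 𝒜 (degree (shift 𝒢)) (-k) := by
  have := tensorMap_prod_mem_lowSpan R (fun _ : Fin k => -1) (fun _ => t) fun _ => ht
  simpa using this

/-- Degree q in S(𝔤[1]) is sent by f to degree q + 1 of 𝔤', which is zero below r₀. -/
theorem preExt_eq_zero_of_low {r₀ : ℤ} (hr : ∀ r < r₀, 𝒢' r = ⊥)
    {f : SuperSym (shift 𝒢) →ₗ[K] L'} (hf : ∀ n, ∀ c ∈ degree (shift 𝒢) n, f c ∈ shift 𝒢' n)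
    {m : ℤ} (hm : m + 1 < r₀) {c : SuperSym (shift (tensorGrade 𝒜 𝒢))}
    (hc : tensorMap 𝒢 R c ∈ lowSpan 𝒜 (degree (shift 𝒢)) m) : preExt R f c = 0 := by
  rw [preExt_apply, ← Submodule.mem_bot K]
  refine lowSpan_le _ _ (fun p a _ q hq x hx => ?_) hc
  have h : f x ∈ 𝒢' (q + 1) := hf q x hx
  rw [hr (q + 1) (by omega), Submodule.mem_bot] at h
  rw [TensorProduct.map_tmul, h, tmul_zero]
  exact zero_mem _

theorem tscale_mem_lowSpan (s : ℤ → ℤ → K) {m : ℤ} (hs : ∀ p q, m < q → s p (q + 1) = 0)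
    (t : A ⊗[K] L) : tscale 𝒜 𝒢 s t ∈ lowSpan 𝒜 (shift 𝒢) m := by
  induction t using homogeneous_tensor_induction 𝒜 𝒢 with
  | zero => simp
  | add s t hs ht => rw [map_add]; exact add_mem hs ht
  | tmul p q a ha x hx =>
    rw [tscale_of_mem s ha hx]
    rcases lt_or_ge m (q - 1) with h | h
    · have := hs p (q - 1) h
      rw [sub_add_cancel] at this
      rw [this, zero_smul]
      exact zero_mem _
    · exact Submodule.smul_mem _ _ (tmul_mem_lowSpan ha h (by simpa [shift] using hx))

/-- A member of the dir-inv structure meets only finitely many bidegrees, so the 𝔤-degrees occurring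
in it are bounded above. This makes the later bounds uniform in the arguments. -/
theorem exists_F_le_lowSpan (j : (pre R G).J) : ∃ m, (pre R G).F j ≤ lowSpan 𝒜 (shift 𝒢) m := by
  obtain ⟨S, hS⟩ := tscale_eq_zero R.graded G.graded j
  obtain ⟨m, hm⟩ := (S.image Prod.snd).exists_le
  refine ⟨m, fun t ht => ?_⟩
  have h := hS (fun p q => 1 - if q ≤ m then 1 else 0) (fun pq hpq => by
    rw [if_pos (hm _ (Finset.mem_image_of_mem _ hpq)), sub_self]) t ht
  rw [tscale_sub (fun _ _ => 1), tscale_one, LinearMap.sub_apply, LinearMap.id_apply,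
    sub_eq_zero] at h
  rw [h]
  exact tscale_mem_lowSpan _ (fun p q hq => if_neg (by omega)) t

variable {Ψ : SuperSym (shift 𝒢) →ₗ[K] SuperSym (shift 𝒢')}
  (hΨ : IsContinuousLInfty G.top G'.top Ψ) (h1 : Ψ 1 = 1)

/-- Products with high powers of an element of `A^1 ⊗̂ 𝔤^0` are annihilated, uniformly on the members
of the dir-inv structure. -/
theorem exists_ctExt_pow_mul_prod_eq_zero (hΨ' : IsCoalgHom Ψ) {r₀ : ℤ}
    (hr : ∀ r < r₀, 𝒢' r = ⊥) {ω : CTensor R G} (hω : ω ∈ bidegree R G 1 0) {j : ℕ}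
    (J : Fin j → (CTensor.top R G).J) : ∃ N : ℕ, ∀ x : Fin j → CTensor R G,
      (∀ l, x l ∈ (CTensor.top R G).F (J l)) → ∀ k, N ≤ k →
      ctExt R G G' hΨ h1 (ι _ ω ^ k * (List.ofFn fun l => ι _ (x l)).prod) = 0 := by
  obtain ⟨y, rfl⟩ := hω
  obtain ⟨y, rfl⟩ := (pre R G).mkS_surj y
  choose B hB using fun l => exists_F_le_lowSpan R G (J l)
  -- With arguments of shifted 𝔤-degree at most B l and each ω contributing −1, the product has
  -- degree at most −k + ∑ B l. The target degree is one more, and it is below r₀ once k ≥ ∑ B l + 2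
  -- − r₀.
  refine ⟨(∑ l, B l + 2 - r₀).toNat, fun x hx k hk => ?_⟩
  have hx' : ∀ l, ∃ c : (pre R G).Seq, (pre R G).IsCauchyIn (J l) c.1 ∧ (pre R G).mkS c = x l := hx
  choose t ht e using hx'
  let w : (pre R G).Seq := DirInv.seqMap (tscale 𝒜 𝒢 fun p' q' => if p' = 1 ∧ q' = 0 then 1 else 0)
    (R.graded.cont_tscale G.graded _) y
  obtain rfl : (fun l => (pre R G).mkS (t l)) = x := funext e
  have h : ctExt R G G' hΨ h1 (mapMk R G (ι _ w ^ k *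
      (List.ofFn fun l => ι (seqShift R G) (t l)).prod)) = 0 := by
    rw [ctExt_mapMk, show seqExt R G G' hΨ h1 _ = 0 from DirInv.seq_ext fun i => ?_, map_zero]
    rw [term_seqExt, map_zero]
    refine preExt_eq_zero_of_low R hr (ln_comp_mem hΨ') (m := -k + ∑ l, B l) (by omega) ?_
    rw [map_mul, map_pow, mapTerm_prod, mapTerm, map_ι, tensorMap_mul]
    refine tmulS_mem_lowSpan (tensorMap_pow_mem_lowSpan R ?_ k)
      (tensorMap_prod_mem_lowSpan R B _ fun l => hB l ((ht l).1 i))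
    exact tscale_mem_lowSpan _ (fun p q hq => if_neg (by omega)) _
  rw [map_mul, map_pow, mapMk_prod, mapMk, map_ι] at h
  exact h

theorem exists_mem_top_F (x : CTensor R G) : ∃ j, x ∈ (CTensor.top R G).F j := by
  obtain ⟨⟨c, j, hc⟩, rfl⟩ := (pre R G).mkC_surj x
  exact ⟨j, ⟨c, j, hc⟩, hc, rfl⟩

theorem powFinite_ctExt (hΨ' : IsCoalgHom Ψ) {r₀ : ℤ} (hr : ∀ r < r₀, 𝒢' r = ⊥)
    {ω : CTensor R G} (hω : ω ∈ bidegree R G 1 0) : PowFinite ω (ctExt R G G' hΨ h1) := by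
  let f := ctExt R G G' hΨ h1
  let S : Submodule K (CSym R G) :=
    { carrier := {c | ∃ N, ∀ k, N ≤ k → f (ι _ ω ^ k * c) = 0}
      add_mem' := by
        rintro c c' ⟨N, hN⟩ ⟨N', hN'⟩
        exact ⟨max N N', fun k hk => by
          rw [mul_add, map_add, hN k ((le_max_left _ _).trans hk),
            hN' k ((le_max_right _ _).trans hk), add_zero]⟩
      zero_mem' := ⟨0, fun k _ => by rw [mul_zero, map_zero]⟩
      smul_mem' := by
        rintro a c ⟨N, hN⟩
        exact ⟨N, fun k hk => by rw [mul_smul_comm, map_smul, hN k hk, smul_zero]⟩ }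
  intro c
  refine mem_of_prod S (fun j x => ?_) c
  choose J hJ using fun l => exists_mem_top_F R G (x l)
  obtain ⟨N, hN⟩ := exists_ctExt_pow_mul_prod_eq_zero R G G' hΨ h1 hΨ' hr hω J
  exact ⟨N, hN x hJ⟩

/-- On single elements the extension is the identity on A tensored with a map that preserves the
degree of 𝔤, so it commutes with the projection to bidegree (1, 0). -/
theorem ctExt_ι_mem_bidegree (hΨ' : IsCoalgHom Ψ) {ω : CTensor R G} (hω : ω ∈ bidegree R G 1 0) :
    ctExt R G G' hΨ h1 (ι _ ω) ∈ bidegree R G' 1 0 := by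
  obtain ⟨y, rfl⟩ := hω
  obtain ⟨y, rfl⟩ := (pre R G).mkS_surj y
  let w : (pre R G).Seq := DirInv.seqMap (tscale 𝒜 𝒢 fun p' q' => if p' = 1 ∧ q' = 0 then 1 else 0)
    (R.graded.cont_tscale G.graded _) y
  have h := ctExt_mapMk R G G' hΨ h1 (ι _ w)
  rw [mapMk, map_ι] at h
  refine ⟨(pre R G').mkS (seqExt R G G' hΨ h1 (ι _ w)), Eq.trans ?_ h.symm⟩
  refine congrArg (pre R G').mkS (DirInv.seq_ext (c := DirInv.seqMap _
    (R.graded.cont_tscale G'.graded _) _) fun k => ?_)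
  rw [DirInv.term_seqMap, term_seqExt, mapTerm, map_ι, preExt_apply, tensorMap_ι]
  change tscale 𝒜 𝒢' _ (TensorProduct.map _ _ (tι A 𝒢 (tscale 𝒜 𝒢 _ ((pre R G).term k y)))) =
    TensorProduct.map _ _ (tι A 𝒢 (tscale 𝒜 𝒢 _ ((pre R G).term k y)))
  generalize (pre R G).term k y = t
  induction t using homogeneous_tensor_induction 𝒜 𝒢 with
  | zero => simp
  | add s t hs ht => simp only [map_add, hs, ht]
  | tmul p q a ha x hx =>
    rw [tscale_of_mem _ ha hx]
    split_ifs with h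
    · obtain ⟨rfl, rfl⟩ := h
      rw [one_smul]
      change tscale 𝒜 𝒢' _ (a ⊗ₜ (ln _ ∘ₗ Ψ) (ι _ x)) = _
      have hx' : x ∈ shift 𝒢 (-1) := by simpa [shift] using hx
      have := ln_comp_mem hΨ' (-1) _ (ι_mem_degree hx')
      rw [tscale_of_mem _ ha (show (ln _ ∘ₗ Ψ) (ι _ x) ∈ 𝒢' 0 by simpa [shift] using this)]
      simp
    · simp

end finiteness

/-! ### Closure properties of continuity for multilinear maps -/

namespace DirInv

variable {K : Type*} [CommRing K] {M N : Type*} [AddCommGroup M] [Module K M]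
  [AddCommGroup N] [Module K N] {D : DirInv.{w} K M} {E : DirInv.{w'} K N} {r : ℕ}

theorem MCont.zero : D.MCont E (0 : MultilinearMap K (fun _ : Fin r => M) N) := fun _ =>
  ⟨Classical.arbitrary _, fun _ _ => zero_mem _, fun _ => ⟨0, fun _ _ _ => zero_mem _⟩⟩

theorem MCont.smul {φ : MultilinearMap K (fun _ : Fin r => M) N} (hφ : D.MCont E φ) (a : K) :
    D.MCont E (a • φ) := fun J => by
  obtain ⟨k, h₁, h₂⟩ := hφ J
  exact ⟨k, fun x hx => Submodule.smul_mem _ a (h₁ x hx), fun i => (h₂ i).imp fun i' h x hx hl =>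
    Submodule.smul_mem _ a (h x hx hl)⟩

theorem MCont.add {φ ψ : MultilinearMap K (fun _ : Fin r => M) N} (hφ : D.MCont E φ)
    (hψ : D.MCont E ψ) : D.MCont E (φ + ψ) := fun J => by
  obtain ⟨k, h₁, h₂⟩ := hφ J
  obtain ⟨k', h₁', h₂'⟩ := hψ J
  obtain ⟨l, hl, hl'⟩ := E.directed k k'
  refine ⟨l, fun x hx => add_mem (E.F_mono hl (h₁ x hx)) (E.F_mono hl' (h₁' x hx)), fun i => ?_⟩
  obtain ⟨a, ha⟩ := E.compat hl i
  obtain ⟨a', ha'⟩ := E.compat hl' i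
  obtain ⟨b, hb⟩ := h₂ a
  obtain ⟨b', hb'⟩ := h₂' a'
  refine ⟨max b b', fun x hx ⟨m, hm⟩ => add_mem (ha (hb x hx ⟨m, ?_⟩)) (ha' (hb' x hx ⟨m, ?_⟩))⟩
  · exact D.Fi_anti _ (le_max_left _ _) hm
  · exact D.Fi_anti _ (le_max_right _ _) hm

theorem MCont.sum {α : Type*} (S : Finset α) {φ : α → MultilinearMap K (fun _ : Fin r => M) N}
    (hφ : ∀ k, D.MCont E (φ k)) : D.MCont E (∑ k ∈ S, φ k) :=
  Finset.sum_induction _ _ (fun _ _ => MCont.add) MCont.zero fun k _ => hφ k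

/-- Continuity is a condition on each choice of members F (J l) separately. A sum whose number of
terms depends on that choice is therefore still continuous. -/
theorem MCont.of_eq_on {φ : MultilinearMap K (fun _ : Fin r => M) N}
    (h : ∀ J : Fin r → D.J, ∃ ψ : MultilinearMap K (fun _ : Fin r => M) N, D.MCont E ψ ∧
      ∀ x : Fin r → M, (∀ l, x l ∈ D.F (J l)) → φ x = ψ x) : D.MCont E φ := fun J => by
  obtain ⟨ψ, hψ, e⟩ := h J
  obtain ⟨k, h₁, h₂⟩ := hψ J
  exact ⟨k, fun x hx => e x hx ▸ h₁ x hx, fun i => (h₂ i).imp fun i' h x hx hl =>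
    e x hx ▸ h x hx hl⟩

theorem MCont.cmulti {φ : MultilinearMap K (fun _ : Fin r => M) N} (hφ : D.MCont E φ) :
    D.completion.MCont E.completion (cmulti φ hφ) := fun J => by
  obtain ⟨k, h₁, h₂⟩ := hφ J
  have hC : ∀ c : Fin r → D.cauchySeq, (∀ l, D.IsCauchyIn (J l) (c l).1) →
      E.IsCauchyIn k fun n => φ fun l => (c l).1 n := fun c hc => by
    refine ⟨fun n => h₁ _ fun l => (hc l).1 n, fun i => ?_⟩
    obtain ⟨i', hi'⟩ := h₂ i
    choose n₀ h₀ using fun l => (hc l).2 i'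
    exact ⟨Finset.univ.sup n₀, fun m hm n hn => MCont.sub_mem hi' (fun l => (hc l).1 m)
      (fun l => (hc l).1 n) fun l => h₀ l m ((Finset.le_sup (Finset.mem_univ l)).trans hm) n
        ((Finset.le_sup (Finset.mem_univ l)).trans hn)⟩
  refine ⟨k, fun x hx => ?_, fun i => ?_⟩
  · choose c hc e using hx
    obtain rfl : (fun l => D.mkC (c l)) = x := funext e
    rw [cmulti_mkC]
    exact ⟨_, hC c hc, rfl⟩
  · obtain ⟨i', hi'⟩ := h₂ i
    refine ⟨i', fun x hx ⟨m, hm⟩ => ?_⟩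
    -- The representative of the m-th argument must be both Cauchy and eventually in the smaller
    -- submodule, so it is chosen separately from the others.
    have : ∀ l, ∃ c : D.cauchySeq, D.IsCauchyIn (J l) c.1 ∧ D.mkC c = x l ∧
        (l = m → ∃ n₀, ∀ n ≥ n₀, c.1 n ∈ D.Fi (J l) i') := fun l => by
      by_cases hl : l = m
      · subst hl
        obtain ⟨c, ⟨hc, hc'⟩, e⟩ := hm
        exact ⟨c, hc, e, fun _ => hc'⟩
      · obtain ⟨c, hc, e⟩ := hx l
        exact ⟨c, hc, e, fun h => absurd h hl⟩
    choose c hc e hm' using this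
    obtain rfl : (fun l => D.mkC (c l)) = x := funext e
    obtain ⟨n₀, h₀⟩ := hm' m rfl
    rw [cmulti_mkC]
    exact ⟨_, ⟨hC c hc, n₀, fun n hn => hi' _ (fun l => (hc l).1 n) ⟨m, h₀ n hn⟩⟩, rfl⟩

end DirInv

/-! ### Taylor coefficients with some arguments fixed at ω -/

section twistcont

open DirectSum SuperSym CTensor

variable {K : Type*} [Field K] {M N : Type*} [AddCommGroup M] [Module K M] [AddCommGroup N]
  [Module K N] {ℰ : ℤ → Submodule K M} [Decomposition ℰ]

/-- The restriction of a linear map on a super-symmetric algebra to products of `j` elements. -/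
noncomputable def prodMap (f : SuperSym ℰ →ₗ[K] N) (j : ℕ) :
    MultilinearMap K (fun _ : Fin j => M) N :=
  f.compMultilinearMap ((MultilinearMap.mkPiAlgebraFin K j (SuperSym ℰ)).compLinearMap fun _ => ι ℰ)

theorem prodMap_apply (f : SuperSym ℰ →ₗ[K] N) {j : ℕ} (x : Fin j → M) :
    prodMap f j x = f (List.ofFn fun l => ι ℰ (x l)).prod := by
  simp [prodMap, MultilinearMap.mkPiAlgebraFin_apply]

theorem prodMap_mulLeft_pow (f : SuperSym ℰ →ₗ[K] N) (ω : M) (k : ℕ) {j : ℕ} (x : Fin j → M) :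
    prodMap (f ∘ₗ LinearMap.mulLeft K (ι ℰ ω ^ k)) j x =
      prodMap f (k + j) (Fin.append (fun _ => ω) x) := by
  rw [prodMap_apply, prodMap_apply, LinearMap.comp_apply, LinearMap.mulLeft_apply]
  have : (fun l => ι ℰ (Fin.append (fun _ : Fin k => ω) x l)) =
      Fin.append (fun _ : Fin k => ι ℰ ω) fun l => ι ℰ (x l) := by
    funext l
    refine Fin.addCases (fun l => ?_) (fun l => ?_) l <;> simp
  rw [this, List.ofFn_fin_append, List.prod_append, List.ofFn_const, List.prod_replicate]

/-- Multiplying by ω^k amounts to filling the first k arguments of a coefficient of higher arity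
with ω. Some member of the dir-inv structure contains ω, so continuity in the remaining arguments is
inherited. -/
theorem mcont_prodMap_mulLeft_pow {D : DirInv.{w} K M} {E : DirInv.{w'} K N}
    {f : SuperSym ℰ →ₗ[K] N} {ω : M} {j₀ : D.J} (hω : ω ∈ D.F j₀) (k : ℕ) {j : ℕ}
    (hf : D.MCont E (prodMap f (k + j))) :
    D.MCont E (prodMap (f ∘ₗ LinearMap.mulLeft K (ι ℰ ω ^ k)) j) := fun J => by
  obtain ⟨l, h₁, h₂⟩ := hf (Fin.append (fun _ => j₀) J)
  have hF : ∀ x : Fin j → M, (∀ l, x l ∈ D.F (J l)) → ∀ l, Fin.append (fun _ : Fin k => ω) x l ∈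
      D.F (Fin.append (fun _ => j₀) J l) := fun x hx l => by
    refine Fin.addCases (fun l => ?_) (fun l => ?_) l
    · simpa using hω
    · simpa using hx l
  refine ⟨l, fun x hx => ?_, fun i => ?_⟩
  · rw [prodMap_mulLeft_pow]
    exact h₁ _ (hF x hx)
  · obtain ⟨i', hi'⟩ := h₂ i
    refine ⟨i', fun x hx ⟨m, hm⟩ => ?_⟩
    rw [prodMap_mulLeft_pow]
    exact hi' _ (hF x hx) ⟨Fin.natAdd k m, by simpa using hm⟩

theorem prod_mem_order {j : ℕ} (x : Fin j → M) :
    (List.ofFn fun l => ι ℰ (x l)).prod ∈ order ℰ j := by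
  induction j with
  | zero => simpa using one_mem_order
  | succ j ih =>
    rw [List.ofFn_succ, List.prod_cons]
    exact ι_mul_mem_order _ (ih _)

end twistcont

/-! ### Continuity and A-multilinearity of the extended and of the twisted morphism -/

section extcont

open DirectSum SuperSym CTensor

variable {K : Type*} [Field K] [CharZero K] {A : Type*} [Ring A] [Algebra K A]
  {𝒜 : ℤ → Submodule K A} [GradedAlgebra 𝒜]
  {L : Type*} [AddCommGroup L] [Module K L] {𝒢 : ℤ → Submodule K L} [Decomposition 𝒢]
  {L' : Type*} [AddCommGroup L'] [Module K L'] {𝒢' : ℤ → Submodule K L'} [Decomposition 𝒢']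
  (R : DGComAlg.{w} K 𝒜) (G : DGLieAlg.{w'} K 𝒢) (G' : DGLieAlg.{w''} K 𝒢')
  {Ψ : SuperSym (shift 𝒢) →ₗ[K] SuperSym (shift 𝒢')}
  (hΨ : IsContinuousLInfty G.top G'.top Ψ) (h1 : Ψ 1 = 1)

theorem taylor_coalgHom_eq {M : Type*} [AddCommGroup M] [Module K M] {ℰ : ℤ → Submodule K M}
    [Decomposition ℰ] {N : Type*} [AddCommGroup N] [Module K N] {ℋ : ℤ → Submodule K N}
    [Decomposition ℋ] {f : SuperSym ℰ →ₗ[K] N} (h1 : f 1 = 0) (j : ℕ) :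
    taylor (coalgHom ℋ f) j = prodMap f j :=
  MultilinearMap.ext fun x => (taylor_coalgHom h1 x).trans (prodMap_apply f x).symm

omit [CharZero K] in
theorem prodMap_ctExt {j : ℕ} (hj : 1 ≤ j) :
    prodMap (ctExt R G G' hΨ h1) j = extTaylor R G G' Ψ j (hΨ j hj) :=
  MultilinearMap.ext fun x => (prodMap_apply _ x).trans (ctExt_prod R G G' hΨ h1 hj x)

omit [CharZero K] in
theorem mcont_prodMap_ctExt {j : ℕ} (hj : 1 ≤ j) :
    (CTensor.top R G).MCont (CTensor.top R G') (prodMap (ctExt R G G' hΨ h1) j) := by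
  rw [prodMap_ctExt R G G' hΨ h1 hj]
  exact (preTaylor_cont R G G' (hΨ j hj)).cmulti

/-- On fixed members F (J l) the exponential sum has a length N that does not depend on the
arguments, so there the twisted coefficient equals one finite sum of continuous maps. -/
theorem mcont_prodMap_twistMap (hΨ' : IsCoalgHom Ψ) {r₀ : ℤ} (hr : ∀ r < r₀, 𝒢' r = ⊥)
    {ω : CTensor R G} (hω : ω ∈ bidegree R G 1 0) {j : ℕ} (hj : 1 ≤ j) :
    (CTensor.top R G).MCont (CTensor.top R G')
      (prodMap (twistMap (powFinite_ctExt R G G' hΨ h1 hΨ' hr hω)) j) := by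
  refine DirInv.MCont.of_eq_on fun J => ?_
  obtain ⟨N, hN⟩ := exists_ctExt_pow_mul_prod_eq_zero R G G' hΨ h1 hΨ' hr hω J
  obtain ⟨j₀, h₀⟩ := exists_mem_top_F R G ω
  refine ⟨∑ k ∈ Finset.range N, (k.factorial : K)⁻¹ •
    prodMap (ctExt R G G' hΨ h1 ∘ₗ LinearMap.mulLeft K (ι _ ω ^ k)) j,
    DirInv.MCont.sum _ fun k => (mcont_prodMap_mulLeft_pow h₀ k
      (mcont_prodMap_ctExt R G G' hΨ h1 (by omega))).smul _, fun x hx => ?_⟩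
  rw [prodMap_apply, twistMap_of_order _ hj (prod_mem_order x), expMap_apply,
    expSum_eq_sum (hN x hx), MultilinearMap.sum_apply]
  simp only [MultilinearMap.smul_apply, prodMap_apply, LinearMap.comp_apply,
    LinearMap.mulLeft_apply]

-- The two exponential sums are cut at a common length and compared term by term, with ω^k as the
-- factor of degree 0.
variable {R} in
theorem twistMap_prod_act (hR : DirInv.IsComplete.{w, u} R.top) (hΨ' : IsCoalgHom Ψ) {r₀ : ℤ}
    (hr : ∀ r < r₀, 𝒢' r = ⊥) {ω : CTensor R G} (hω : ω ∈ bidegree R G 1 0)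
    (hω' : ω ∈ CTensor.degree R G 1) {j : ℕ} (hj : 1 ≤ j) (p q : Fin j → ℤ)
    (a : Fin j → A) (x : Fin j → CTensor R G) (ha : ∀ l, a l ∈ 𝒜 (p l))
    (hx : ∀ l, x l ∈ CTensor.degree R G (q l)) :
    twistMap (powFinite_ctExt R G G' hΨ h1 hΨ' hr hω)
        (List.ofFn fun l => ι _ (act G hR (a l) (x l))).prod =
      koszulSign K p q • act G' hR (List.ofFn a).prod
        (twistMap (powFinite_ctExt R G G' hΨ h1 hΨ' hr hω)
          (List.ofFn fun l => ι _ (x l)).prod) := by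
  rw [twistMap_of_order _ hj (prod_mem_order _), twistMap_of_order _ hj (prod_mem_order _)]
  obtain ⟨N, hN⟩ := exists_expMap_eq_sum (powFinite_ctExt R G G' hΨ h1 hΨ' hr hω)
    (List.ofFn fun l => ι _ (act G hR (a l) (x l))).prod
  obtain ⟨N', hN'⟩ := exists_expMap_eq_sum (powFinite_ctExt R G G' hΨ h1 hΨ' hr hω)
    (List.ofFn fun l => ι _ (x l)).prod
  rw [hN _ (le_max_left N N'), hN' _ (le_max_right N N'), map_sum, Finset.smul_sum]
  refine Finset.sum_congr rfl fun k _ => ?_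
  have hk : ι _ ω ^ k ∈ SuperSym.degree (shift (CTensor.degree R G)) 0 :=
    pow_ι_mem_degree (by simpa [shift] using hω') k
  rw [ctExt_mul_prod_act G G' hΨ h1 hR p q a x ha hx hk, map_smul, smul_comm]

end extcont

/-! ### The value of the twist at 1, and the main theorem -/

theorem CTensor.bidegree_le_degree {K : Type*} [Field K] {A : Type*} [Ring A] [Algebra K A]
    {𝒜 : ℤ → Submodule K A} [GradedAlgebra 𝒜] {L : Type*} [AddCommGroup L] [Module K L]
    {𝒢 : ℤ → Submodule K L} [DirectSum.Decomposition 𝒢] (R : DGComAlg.{w} K 𝒜)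
    (G : DGLieAlg.{w'} K 𝒢) {p q n : ℤ} (h : p + q = n) :
    CTensor.bidegree R G p q ≤ CTensor.degree R G n := by
  rintro _ ⟨x, rfl⟩
  refine ⟨CTensor.scale R G (fun p' q' => if p' = p ∧ q' = q then 1 else 0) x, ?_⟩
  rw [CTensor.scale_scale]
  congr 2
  funext p' q'
  split_ifs with h₁ h₂
  · simp
  · exact absurd (by rw [h₁.1, h₁.2, h]) h₂
  all_goals simp

/-- The terms k ≥ 2 vanish by hypothesis and the term k = 0 is f(1) = 0. This identifies the
constant term of the twisted logarithm with ω'. -/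
theorem SuperSym.expMap_one_eq {K : Type*} [Field K] {M N : Type*} [AddCommGroup M] [Module K M]
    [AddCommGroup N] [Module K N] {𝒢 : ℤ → Submodule K M} [DirectSum.Decomposition 𝒢] {ω : M}
    {f : SuperSym 𝒢 →ₗ[K] N} (hf : PowFinite ω f) (h1 : f 1 = 0)
    (h : ∀ j, 2 ≤ j → f (SuperSym.ι 𝒢 ω ^ j) = 0) : expMap hf 1 = f (SuperSym.ι 𝒢 ω) := by
  rw [expMap_apply, expSum_eq_sum (N := 2) fun k hk => by rw [mul_one, h k hk]]
  simp [Finset.sum_range_succ, h1]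

theorem theorem3 {K : Type*} [Field K] [CharZero K]
    {L : Type*} [AddCommGroup L] [Module K L] (𝒢 : ℤ → Submodule K L) [DirectSum.Decomposition 𝒢]
    {L' : Type*} [AddCommGroup L'] [Module K L'] (𝒢' : ℤ → Submodule K L') [DirectSum.Decomposition 𝒢']
    {A : Type*} [Ring A] [Algebra K A] (𝒜 : ℤ → Submodule K A) [GradedAlgebra 𝒜]
    (G : DGLieAlg.{w'} K 𝒢) (G' : DGLieAlg.{w''} K 𝒢') (R : DGComAlg.{w} K 𝒜)
    (hR : DirInv.IsComplete.{w, u} R.top) (h𝒜 : ∀ p < 0, 𝒜 p = ⊥)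
    (Ψ : SuperSym (shift 𝒢) →ₗ[K] SuperSym (shift 𝒢'))
    (hΨ : IsLInftyMorphism 𝒢 𝒢' G.d G.br G'.d G'.br Ψ)
    (hΨc : IsContinuousLInfty G.top G'.top Ψ)
    (hd : G.d = 0) (hG' : ∃ r₀ : ℤ, ∀ r < r₀, 𝒢' r = ⊥) :
    ∃ ΨA : CSym R G →ₗ[K] CSym R G',
      IsExtension R G G' hΨc ΨA ∧
      IsLInftyMorphism (CTensor.degree R G) (CTensor.degree R G') (CTensor.d R G) (CTensor.br R G)
        (CTensor.d R G') (CTensor.br R G') ΨA ∧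
      IsContinuousLInfty (CTensor.top R G) (CTensor.top R G') ΨA ∧
      IsMultilinearLInfty hR G G' ΨA ∧
      ∀ ω ∈ CTensor.bidegree R G 1 0, IsMC (CTensor.d R G) (CTensor.br R G) ω →
        (∀ j, 2 ≤ j → taylor ΨA j (fun _ => ω) = 0) →
        ∀ ω', ω' = taylor ΨA 1 (fun _ => ω) →
          (ω' ∈ CTensor.bidegree R G' 1 0 ∧ IsMC (CTensor.d R G') (CTensor.br R G') ω') ∧
          (∀ j, ∀ c ∈ SuperSym.order (shift (CTensor.degree R G)) j, ∃ k₀ : ℕ, ∀ k > k₀,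
            SuperSym.ln _ (ΨA (SuperSym.ι _ ω ^ k * c)) = 0) ∧
          ∃ Θ : CSym R G →ₗ[K] CSym R G',
            IsCoalgHom Θ ∧
            (∀ j, 1 ≤ j → ∀ c ∈ SuperSym.order (shift (CTensor.degree R G)) j,
              SuperSym.ln _ (Θ c) =
                ∑ᶠ k : ℕ, (k.factorial : K)⁻¹ • SuperSym.ln _ (ΨA (SuperSym.ι _ ω ^ k * c))) ∧
            IsLInftyMorphism (CTensor.degree R G) (CTensor.degree R G')
              (CTensor.twistD R G ω) (CTensor.br R G) (CTensor.twistD R G' ω') (CTensor.br R G')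
              Θ ∧
            IsContinuousLInfty (CTensor.top R G) (CTensor.top R G') Θ ∧
            IsMultilinearLInfty hR G G' Θ := by
  have h1 : Ψ 1 = 1 := hΨ.1.one
  obtain ⟨r₀, hr⟩ := hG'
  let f := ctExt R G G' hΨc h1
  have hf1 : f 1 = 0 := ctExt_one R G G' hΨc h1
  have hfd : ∀ n, ∀ c ∈ SuperSym.degree (shift (CTensor.degree R G)) n,
      f c ∈ shift (CTensor.degree R G') n := ctExt_mem R G G' hΨc h1 hΨ.1
  have hfl : linfDefect (CTensor.degree R G) (CTensor.degree R G') (CTensor.d R G)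
      (CTensor.br R G) (CTensor.d R G') (CTensor.br R G') f = 0 :=
    linfDefect_ctExt R G G' hΨc h1 hΨ
  have hM := CTensor.isDGLie R G
  have hN := CTensor.isDGLie R G'
  refine ⟨SuperSym.coalgHom (shift (CTensor.degree R G')) f, ⟨SuperSym.isCoalgHom_coalgHom hf1 hfd, fun j hj =>
    (taylor_coalgHom_eq hf1 j).trans (prodMap_ctExt R G G' hΨc h1 hj)⟩,
    isLInftyMorphism_coalgHom hM hN hf1 hfd hfl, fun j hj => ?_, fun j hj p q a x ha hx => ?_, ?_⟩
  · rw [taylor_coalgHom_eq hf1]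
    exact mcont_prodMap_ctExt R G G' hΨc h1 hj
  · rw [taylor_coalgHom hf1, taylor_coalgHom hf1]
    have := ctExt_mul_prod_act G G' hΨc h1 hR p q a x ha hx SuperSym.one_mem_degree
    rw [one_mul, one_mul] at this
    exact this
  rintro ω hω hmc hωj ω' rfl
  have hω₁ : ω ∈ CTensor.degree R G 1 := CTensor.bidegree_le_degree R G (by norm_num) hω
  have hp : SuperSym.PowFinite ω f := powFinite_ctExt R G G' hΨc h1 hΨ.1 hr hω
  have hln : ∀ c, SuperSym.ln _ (SuperSym.coalgHom (shift (CTensor.degree R G')) f c) = f c :=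
    DFunLike.congr_fun (SuperSym.ln_coalgHom hf1)
  have hω' : taylor (SuperSym.coalgHom (shift (CTensor.degree R G')) f) 1 (fun _ => ω) =
      f (SuperSym.ι _ ω) := by
    rw [taylor_coalgHom hf1]
    simp
  rw [hω']
  -- The assumption on the higher Taylor coefficients at ω is used only here, to see that the
  -- constant term of f(e^ω ·) is ω' itself.
  have he : SuperSym.expMap hp 1 = f (SuperSym.ι _ ω) := SuperSym.expMap_one_eq hp hf1 fun j hj => by
    have := hωj j hj
    rw [taylor_coalgHom hf1, List.ofFn_const, List.prod_replicate] at this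
    exact this
  have hb : f (SuperSym.ι _ ω) ∈ CTensor.bidegree R G' 1 0 :=
    ctExt_ι_mem_bidegree R G G' hΨc h1 hΨ.1 hω
  have hb₁ := CTensor.bidegree_le_degree R G' (n := 1) (by norm_num) hb
  have hmc' := isMC_expMap hM hN hω₁ hmc hp hfl hb₁ he
  refine ⟨⟨hb, hmc'⟩, fun j c _ => ?_, SuperSym.coalgHom (shift (CTensor.degree R G')) (twistMap hp),
    SuperSym.isCoalgHom_coalgHom (twistMap_one hp) (twistMap_mem hω₁ hp hfd), fun j hj c hc => ?_,
    isLInftyMorphism_coalgHom (hM.twist hω₁ hmc) (hN.twist hb₁ hmc') (twistMap_one hp)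
      (twistMap_mem hω₁ hp hfd) (linfDefect_twistMap hM hN hω₁ hmc hp hfl hb₁ he),
    fun j hj => ?_, fun j hj p q a x ha hx => ?_⟩
  · obtain ⟨N, h⟩ := hp c
    exact ⟨N, fun k hk => (hln _).trans (h k hk.le)⟩
  · simp only [hln]
    refine (DFunLike.congr_fun (SuperSym.ln_coalgHom (twistMap_one hp)) c).trans ?_
    exact twistMap_of_order hp hj hc
  · rw [taylor_coalgHom_eq (twistMap_one hp)]
    exact mcont_prodMap_twistMap R G G' hΨc h1 hΨ.1 hr hω hj
  · rw [taylor_coalgHom (twistMap_one hp), taylor_coalgHom (twistMap_one hp)]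
    exact twistMap_prod_act G G' hΨc h1 hR hΨ.1 hr hω hω₁ hj p q a x ha hx
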